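/- **Setting.** Let $\mathfrak q\ge 4$ be even, $a>0$, $L>1$ odd, $n\ge 0$, and let $L_{tp}=L^{2n+2+s}$, $L_{sp}=L^{n+1+t}$ with $s,t\ge 0$. With $\varepsilon_j=L^{-j}$, let $$\mathcal X_j^{(m)}=(\varepsilon_j^2\mathbb Z/\varepsilon_{m+j}^2L_{tp}\mathbb Z)\times(\varepsilon_j\mathbb Z^3/\varepsilon_{m+j}L_{sp}\mathbb Z^3),$$ $\mathcal H_j^{(m)}$ the space of complex functions on $\mathcal X_j^{(m)}$, with $\int du=\varepsilon_j^5\sum_u$ and bilinear inner product $\int\alpha\beta\,du$ (adjoints $*$ are taken with respect to it), and $\mathbb L(u_0,\mathbf u)=(L^2u_0,L\mathbf u)$, $\mathbb L_*\alpha(\mathbb Lu)=\alpha(u)$. Let $q$ be the $\mathfrak q$-fold convolution of $L^{-5}$ times the characteristic function of $[-\frac{L^2-1}2,\frac{L^2-1}2]\times[-\frac{L-1}2,\frac{L-1}2]^3$ on $\mathbb Z\times\mathbb Z^3$, and let $Q:\mathcal H_0^{(m)}\to\mathcal H_{-1}^{(m+1)}$, $(Q\psi)(y)=\sum_{x}q(x)\psi(y+[x])$.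 Put $Q_j=(\mathbb L_*^{-1}Q)^j\mathbb L_*^j$ and $$\mathfrak Q_n=a\Big(1+\sum_{j=1}^{n-1}L^{-2j}Q_jQ_j^*\Big)^{-1}.$$ Let $\mathbf h_0$ be a translation invariant operator on $L^2(\mathbb Z^3)$ whose Fourier transform $\hat{\mathbf h}_0(\mathbf p)$ is entire, even in each $\mathbf p_\nu$, nonnegative for real $\mathbf p$, strictly positive on $\mathbb R^3\setminus2\pi\mathbb Z^3$, and satisfies $\hat{\mathbf h}_0(0)=0$, $\nabla\hat{\mathbf h}_0(0)=0$, with positive definite Hessian at $0$. Let $h_0$ be its periodization, $\partial_0$ the forward time derivative, and $$D_n=L^{2n}\mathbb L_*^{-n}(1-e^{-h_0}-e^{-h_0}\partial_0)\mathbb L_*^n .$$ Set $\Delta^{(0)}=D_0$ and, for $n\ge1$, $\Delta^{(n)}=(1+\mathfrak Q_nQ_nD_n^{-1}Q_n^*)^{-1}\mathfrak Q_n$ on $\mathcal H_0^{(n)}$. Since $D_n$ annihilates constants, the last formula means $\lim_{\mu\downarrow0}(1+\mathfrak Q_nQ_n(D_n+\mu)^{-1}Q_n^*)^{-1}\mathfrak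 Q_n$. Its Fourier symbol is $\hat\Delta^{(n)}(k)=\hat{\mathfrak Q}_n(k)\big(1+\hat{\mathfrak Q}_n(k)\sum_{\ell}u_n(k+\ell)^{2\mathfrak q}\hat D_n(k+\ell)^{-1}\big)^{-1}$ with removable singularities removed ($\hat\Delta^{(0)}=\hat D_0$), where $\ell\in\hat{\mathcal B}_n=(2\pi\mathbb Z/2\pi L^{2n}\mathbb Z)\times(2\pi\mathbb Z^3/2\pi L^n\mathbb Z^3)$, $u_n(p)=L^{-5n}\sigma(p)/\sigma(\mathbb L^{-n}p)$, $\sigma(k)=\prod_{\nu=0}^3\sin\frac{k_\nu}2$, and $$\hat{\mathfrak Q}_n(k)=a\Big[1+\sum_{j=1}^{n-1}\sum_{\ell\in\hat{\mathcal B}_j}L^{-2j}u_j(k+\ell)^{2\mathfrak q}\Big]^{-1},\qquad \hat D_n(p)=L^{2n}\big(1-e^{-\hat{\mathbf h}_0(\varepsilon_n\mathbf p)+i\varepsilon_n^2p_0}\big).$$ Let $$A=\big(\tfrac a{L^2}Q^*Q+\Delta^{(n)}\big)^{(s)}=\mathbb L_*^{-1}\big(\tfrac a{L^2}Q^*Q+\Delta^{(n)}\big)\mathbb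 L_*\quad\text{on }\mathcal H_1^{(n)} .$$ For an operator $B$ on $\mathcal H_1^{(n)}$ with kernel $B(u,u')$ put $$\|B\|_m=\max\Big\{\sup_u\int du'\,e^{m|u-u'|}|B(u,u')|,\ \sup_{u'}\int du\,e^{m|u-u'|}|B(u,u')|\Big\}$$ with $|\cdot|$ the (Euclidean) distance on the torus. The scaled Floquet matrices are, for $k\in\mathbb C\times\mathbb C^3$ and $\ell,\ell'\in\hat{\mathcal B}_1$, $$d^{(s)}_{n,k}(\ell,\ell')=\tfrac a{L^2}u_+(\mathbb L^{-1}(k+\ell))^{\mathfrak q}u_+(\mathbb L^{-1}(k+\ell'))^{\mathfrak q}+\delta_{\ell,\ell'}\hat\Delta^{(n)}(\mathbb L^{-1}(k+\ell)),\qquad u_+(k)=\frac{\sigma(\mathbb Lk)}{L^5\sigma(k)} .$$ Given $\Gamma_2$, call $(m_2,\lambda_0,\Gamma_8)$, all positive, *admissible* if, for all odd $L>\max\{1,\Gamma_2\}$ and all $n\ge0$, the matrix $d^{(s)}_{n,k}$ is analytic in $k$ on $|\mathrm{Im}\,k|<3m_2$ and there $\|d^{(s)}_{n,k}\|\le\Gamma_8$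 and, whenever $\lambda\in\mathbb C$ is within distance $\lambda_0/L^2$ of the negative real axis $\mathbb R_-$, $\lambda-d^{(s)}_{n,k}$ is invertible with $\|(\lambda-d^{(s)}_{n,k})^{-1}\|\le\Gamma_8L^2$ (matrix $\ell^1$–$\ell^\infty$ norms, which dominate the $\ell^2$ operator norm). **Statement.** For every even $\mathfrak q\ge4$ there is a constant $\Gamma_2$ such that, for all $a>0$ and all $\mathbf h_0$ as above: 1. An admissible triple $(m_2,\lambda_0,\Gamma_8)$ exists. 2. For every admissible triple there is a constant $\Gamma_9$ such that, for all odd $L>\max\{1,\Gamma_2\}$, all $n\ge0$ and all $s,t\ge 0$, the following holds. Set $$\mathcal O_C=\{z:\mathrm{dist}(z,\mathbb R_-)>\tfrac{\lambda_0}{2L^2},\ |z|<\Gamma_8+1\},\quad \mathcal O=\{z:\mathrm{dist}(z,\mathbb R_-)>\tfrac{\lambda_0}{3L^2},\ |z|<\Gamma_8+2\},$$ and let $C=\partial\mathcal O_C$, oriented counterclockwise. Then $\Delta^{(n)}$ is well defined (the above limit exists if $n\ge1$), the spectrum of $A$ is contained in $\mathcal O_C$, so that $$f(A)=\frac1{2\pi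 i}\oint_Cf(\zeta)(\zeta-A)^{-1}d\zeta$$ exists for every analytic $f:\mathcal O\to\mathbb C$, and $$\|f(A)\|_{m_2}\le\Gamma_9\,L^7\,\sup_{\zeta\in C}|f(\zeta)| .$$ In particular $\Gamma_9$ does not depend on $L$, on $n$, on the volume ($s$, $t$) or on $f$. -/

import Mathlib

open Filter Topology

namespace BlockSpin

noncomputable section

/-! ### Lattices

All lattices are discrete tori `(ε² ℤ / ε² L ^ s ℤ) × (ε ℤ³ / ε L ^ t ℤ³)` with spacing `ε² = L⁻²ʲ` in
the time direction and `ε = L⁻ʲ` in the three space directions. A site `(ε² i₀, ε i)` is recorded by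
its integer coordinates `(i₀, i)`, so that one type of sites serves for all `j`. In these
coordinates the scaling map `𝕃 (u₀, u) = (L² u₀, L u)`, from the lattice with spacing index `j` onto
the one with index `j - 1`, is the identity, and conjugation of an operator by `𝕃_*` does not change
its matrix; what changes with `j` are the distances and the cell volume `L⁻⁵ʲ`. -/

/-- The sites of a torus with `L ^ s` points in the time direction and `L ^ t` points in each of the
three space directions. -/
abbrev Torus (L s t : ℕ) : Type := ZMod (L ^ s) × (Fin 3 → ZMod (L ^ t))

/-- The torus distance `|u - u'|` (quotient of the Euclidean distance on `ℝ × ℝ³`) of two sites of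
the torus with spacing `L⁻²ʲ` in time and `L⁻ʲ` in space. -/
def torusDist (L s t j : ℕ) (x y : Torus L s t) : ℝ :=
  Real.sqrt ((((x.1 - y.1).valMinAbs : ℝ) / (L : ℝ) ^ (2 * j)) ^ 2
    + ∑ ν : Fin 3, (((x.2 ν - y.2 ν).valMinAbs : ℝ) / (L : ℝ) ^ j) ^ 2)

/-- The volume `εⱼ⁵ = L⁻⁵ʲ` of a cell. -/
def cellVolume (L j : ℕ) : ℝ := ((L : ℝ) ^ (5 * j))⁻¹

/-- The weighted norm `‖A‖_m` of an operator on the functions on the torus of spacing index `j`. Here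
`M` is the matrix of `A`; its kernel with respect to `∫ du = εⱼ⁵ ∑ᵤ` is `A(u,u') = εⱼ⁻⁵ M u u'`. -/
def weightedNorm (L s t j : ℕ) [NeZero L] (m : ℝ) (M : Matrix (Torus L s t) (Torus L s t) ℂ) : ℝ :=
  max
    (⨆ u, cellVolume L j * ∑ u', Real.exp (m * torusDist L s t j u u')
      * ‖((cellVolume L j)⁻¹ : ℂ) * M u u'‖)
    (⨆ u', cellVolume L j * ∑ u, Real.exp (m * torusDist L s t j u u')
      * ‖((cellVolume L j)⁻¹ : ℂ) * M u u'‖)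

/-! ### Block spin averaging operators -/

/-- The lattice points `ℤ × ℤ³` of the rectangle
`[-(L²-1)/2, (L²-1)/2] × [-(L-1)/2, (L-1)/2]³` (for odd `L`). -/
def block (L : ℕ) : Finset (ℤ × (Fin 3 → ℤ)) :=
  Finset.Icc (-(((L : ℤ) ^ 2 - 1) / 2)) (((L : ℤ) ^ 2 - 1) / 2) ×ˢ
    Fintype.piFinset fun _ : Fin 3 => Finset.Icc (-(((L : ℤ) - 1) / 2)) (((L : ℤ) - 1) / 2)

/-- The averaging profile: the `𝔮`-fold convolution of `L⁻⁵` times the characteristic function of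
the block, on `ℤ × ℤ³` (for `𝔮 = 0` the unit of convolution). -/
def profile (L : ℕ) : ℕ → ℤ × (Fin 3 → ℤ) → ℝ
  | 0 => fun x => if x = 0 then 1 else 0
  | r + 1 => fun x => ((L : ℝ) ^ 5)⁻¹ * ∑ y ∈ block L, profile L r (x - y)

/-- The inclusion of the coarse sublattice (`L²` times coarser in time, `L` times in space). -/
def coarseToFine (L s t : ℕ) (y : Torus L s t) : Torus L (s + 2) (t + 1) :=
  (((L ^ 2 * y.1.val : ℕ) : ZMod (L ^ (s + 2))), fun ν => ((L * (y.2 ν).val : ℕ) : ZMod (L ^ (t + 1))))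

/-- The class in the torus of a point of `ℤ × ℤ³`. -/
def toTorus (L s t : ℕ) (x : ℤ × (Fin 3 → ℤ)) : Torus L s t :=
  ((x.1 : ZMod (L ^ s)), fun ν => (x.2 ν : ZMod (L ^ t)))

open Classical in
/-- The matrix of the averaging operator `(Q ψ)(y) = ∑_{x ∈ ℤ × ℤ³} q(x) ψ(y + [x])`. -/
def avg (L 𝔮 s t : ℕ) : Matrix (Torus L s t) (Torus L (s + 2) (t + 1)) ℂ :=
  Matrix.of fun y x' =>
    ∑ᶠ z : ℤ × (Fin 3 → ℤ),
      if coarseToFine L s t y + toTorus L (s + 2) (t + 1) z = x' then (profile L 𝔮 z : ℂ) else 0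

/-- The iterated averaging operator `Q_j`, a product of `j` (scaled) averaging operators; its domain
consists of the functions on a lattice `j` levels finer. -/
def avgIter (L 𝔮 s t : ℕ) [NeZero L] :
    (j : ℕ) → Matrix (Torus L s t) (Torus L (s + 2 * j) (t + j)) ℂ
  | 0 => (1 : Matrix (Torus L s t) (Torus L s t) ℂ)
  | j + 1 => avgIter L 𝔮 s t j * avg L 𝔮 (s + 2 * j) (t + j)

/-- The adjoint `Q*` with respect to the real inner products `⟨α, β⟩ = ∫ α β`; the quotient of the
cell volumes of the two lattices is `L⁵`. -/
def avgAdj (L 𝔮 s t : ℕ) : Matrix (Torus L (s + 2) (t + 1)) (Torus L s t) ℂ :=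
  ((L : ℂ) ^ 5) • (avg L 𝔮 s t).transpose

/-- The adjoint `Q_j*`; the quotient of the cell volumes of the two lattices is `L⁵ʲ`. -/
def avgIterAdj (L 𝔮 s t : ℕ) [NeZero L] (j : ℕ) :
    Matrix (Torus L (s + 2 * j) (t + j)) (Torus L s t) ℂ :=
  ((L : ℂ) ^ (5 * j)) • (avgIter L 𝔮 s t j).transpose

/-- `𝔔_n = a (1 + ∑_{j=1}^{n-1} L⁻²ʲ Q_j Q_j*)⁻¹`. -/
def frakQ (L 𝔮 : ℕ) (a : ℝ) (n s t : ℕ) [NeZero L] : Matrix (Torus L s t) (Torus L s t) ℂ :=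
  (a : ℂ) • (1 + ∑ j ∈ Finset.Icc 1 (n - 1),
    ((L : ℂ) ^ (2 * j))⁻¹ • (avgIter L 𝔮 s t j * avgIterAdj L 𝔮 s t j))⁻¹

/-! ### The single particle operator and the differential operators -/

/-- The Fourier transform `∑_z h(z) e^{-i p·z}` of the translation invariant operator on `L²(ℤ³)`
with kernel `h(x - x')`. -/
def hatH (h : (Fin 3 → ℤ) → ℂ) (p : Fin 3 → ℂ) : ℂ :=
  ∑' z : Fin 3 → ℤ, h z * Complex.exp (-Complex.I * ∑ ν, p ν * (z ν : ℂ))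

/-- The matrix of second derivatives of the Fourier transform at the origin. -/
def hessH (h : (Fin 3 → ℤ) → ℂ) : Matrix (Fin 3) (Fin 3) ℝ :=
  Matrix.of fun μ ν =>
    (iteratedFDeriv ℂ 2 (hatH h) 0 ![Pi.single μ 1, Pi.single ν 1]).re

/-- The assumptions on the translation invariant operator on `L²(ℤ³)` with kernel `h(x - x')`. -/
structure IsHamiltonian (h : (Fin 3 → ℤ) → ℂ) : Prop where
  summable : ∀ p : Fin 3 → ℂ,
    Summable fun z : Fin 3 → ℤ => h z * Complex.exp (-Complex.I * ∑ ν, p ν * (z ν : ℂ))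
  entire : AnalyticOnNhd ℂ (hatH h) Set.univ
  even : ∀ (p : Fin 3 → ℂ) (ν : Fin 3), hatH h (Function.update p ν (-p ν)) = hatH h p
  real : ∀ p : Fin 3 → ℝ, (hatH h fun ν => (p ν : ℂ)).im = 0
  nonneg : ∀ p : Fin 3 → ℝ, 0 ≤ (hatH h fun ν => (p ν : ℂ)).re
  pos : ∀ p : Fin 3 → ℝ, (¬ ∃ z : Fin 3 → ℤ, ∀ ν, p ν = 2 * Real.pi * (z ν : ℝ)) →
    0 < (hatH h fun ν => (p ν : ℂ)).re
  map_zero : hatH h 0 = 0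
  fderiv_zero : fderiv ℂ (hatH h) 0 = 0
  hess_posDef : (hessH h).PosDef

open Classical in
/-- The periodization `h₀` of the operator with kernel `h(x - x')`, acting in the space variables. -/
def hOp (L : ℕ) (h : (Fin 3 → ℤ) → ℂ) (s t : ℕ) : Matrix (Torus L s t) (Torus L s t) ℂ :=
  Matrix.of fun x x' =>
    if x.1 = x'.1 then
      ∑' z : Fin 3 → ℤ, if (fun ν => (z ν : ZMod (L ^ t))) = x.2 - x'.2 then h z else 0
    else 0

/-- The forward time derivative `(∂₀ α)(x) = α(x + e₀) - α(x)` of the unit lattice. -/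
def timeDeriv (L s t : ℕ) : Matrix (Torus L s t) (Torus L s t) ℂ :=
  Matrix.of fun x x' => (if x' = x + (1, 0) then 1 else 0) - (if x' = x then 1 else 0)

/-- `D_n = L²ⁿ 𝕃_*⁻ⁿ (1 - e^{-h₀} - e^{-h₀} ∂₀) 𝕃_*ⁿ`. -/
def diffOp (L : ℕ) (h : (Fin 3 → ℤ) → ℂ) (n s t : ℕ) [NeZero L] :
    Matrix (Torus L s t) (Torus L s t) ℂ :=
  ((L : ℂ) ^ (2 * n)) •
    (1 - NormedSpace.exp (-(hOp L h s t)) - NormedSpace.exp (-(hOp L h s t)) * timeDeriv L s t)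

/-- `(1 + 𝔔_n Q_n (D_n + μ)⁻¹ Q_n*)⁻¹ 𝔔_n`. -/
def deltaReg (L 𝔮 : ℕ) (a : ℝ) (h : (Fin 3 → ℤ) → ℂ) (n s t : ℕ) [NeZero L] (μ : ℝ) :
    Matrix (Torus L s t) (Torus L s t) ℂ :=
  (1 + frakQ L 𝔮 a n s t * avgIter L 𝔮 s t n
      * (diffOp L h n (s + 2 * n) (t + n) + (μ : ℂ) • 1)⁻¹ * avgIterAdj L 𝔮 s t n)⁻¹
    * frakQ L 𝔮 a n s t

/-- `Δ⁽ⁿ⁾ = (1 + 𝔔_n Q_n D_n⁻¹ Q_n*)⁻¹ 𝔔_n` for `n ≥ 1` and `Δ⁽⁰⁾ = D₀`. On a finite torus the constant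
functions are in the kernel of `D_n`, and `D_n⁻¹` is read as `(D_n + μ)⁻¹` in the limit `μ ↓ 0`; this
is the operator whose symbol is `deltaHat`, in which the singularity at momentum zero is removed. -/
def delta (L 𝔮 : ℕ) (a : ℝ) (h : (Fin 3 → ℤ) → ℂ) (n s t : ℕ) [NeZero L] :
    Matrix (Torus L s t) (Torus L s t) ℂ :=
  if n = 0 then diffOp L h 0 s t
  else limUnder (𝓝[>] (0 : ℝ)) fun μ => deltaReg L 𝔮 a h n s t μ

/-- The operator `((a/L²) Q* Q + Δ⁽ⁿ⁾)⁽ˢ⁾ = 𝕃_*⁻¹ ((a/L²) Q* Q + Δ⁽ⁿ⁾) 𝕃_*`, on functions on the torus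
of spacing index `1` with `L ^ (s + 2)` points in time and `L ^ (t + 1)` in each space direction. -/
def scaledOp (L 𝔮 : ℕ) (a : ℝ) (h : (Fin 3 → ℤ) → ℂ) (n s t : ℕ) [NeZero L] :
    Matrix (Torus L (s + 2) (t + 1)) (Torus L (s + 2) (t + 1)) ℂ :=
  ((a : ℂ) / (L : ℂ) ^ 2) • (avgAdj L 𝔮 s t * avg L 𝔮 s t) + delta L 𝔮 a h n (s + 2) (t + 1)

/-! ### Fourier symbols and Floquet matrices -/

/-- `L₀ = L²` and `L_ν = L` for `ν = 1, 2, 3`. -/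
def scaleFactor (L : ℕ) (ν : Fin 4) : ℕ := if ν = 0 then L ^ 2 else L

/-- The entire function `x ↦ sin (N x / 2) / (N sin (x / 2))`, for odd `N`, as a trigonometric
polynomial. -/
def dirichletRatio (N : ℕ) (x : ℂ) : ℂ :=
  (N : ℂ)⁻¹ * ∑ j ∈ Finset.Icc (-(((N : ℤ) - 1) / 2)) (((N : ℤ) - 1) / 2),
    Complex.exp (-Complex.I * (j : ℂ) * x)

/-- `u_+(k) = σ(𝕃k) / (L⁵ σ(k))`, where `σ(k) = ∏_ν sin (k_ν / 2)`. -/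
def uPlus (L : ℕ) (k : Fin 4 → ℂ) : ℂ := ∏ ν, dirichletRatio (scaleFactor L ν) (k ν)

/-- `u_n(p) = L⁻⁵ⁿ σ(p) / σ(𝕃⁻ⁿ p)`. -/
def uN (L n : ℕ) (p : Fin 4 → ℂ) : ℂ :=
  ∏ ν, dirichletRatio (scaleFactor L ν ^ n) (p ν / (scaleFactor L ν : ℂ) ^ n)

/-- `𝓑̂_j = (2πℤ / 2πL²ʲℤ) × (2πℤ³ / 2πLʲℤ³)`; an element is recorded by the integer vector
`ℓ / 2π`, with components in `{0, …, L_νʲ - 1}`. -/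
abbrev DualCell (L j : ℕ) : Type := (ν : Fin 4) → Fin (scaleFactor L ν ^ j)

/-- The momentum `ℓ` itself. -/
def DualCell.momentum {L j : ℕ} (l : DualCell L j) (ν : Fin 4) : ℂ :=
  2 * (Real.pi : ℂ) * ((l ν : ℕ) : ℂ)

/-- The symbol of `𝔔_n`. -/
def frakQHat (L 𝔮 : ℕ) (a : ℝ) (n : ℕ) (k : Fin 4 → ℂ) : ℂ :=
  (a : ℂ) * (1 + ∑ j ∈ Finset.Icc 1 (n - 1), ∑ l : DualCell L j,
    ((L : ℂ) ^ (2 * j))⁻¹ * uN L j (k + l.momentum) ^ (2 * 𝔮))⁻¹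

/-- The symbol of `D_n`. -/
def diffHat (L : ℕ) (h : (Fin 3 → ℤ) → ℂ) (n : ℕ) (p : Fin 4 → ℂ) : ℂ :=
  (L : ℂ) ^ (2 * n) *
    (1 - Complex.exp (-(hatH h fun ν => p ν.succ / (L : ℂ) ^ n))
      - Complex.exp (-(hatH h fun ν => p ν.succ / (L : ℂ) ^ n))
        * (Complex.exp (Complex.I * (p 0 / (L : ℂ) ^ (2 * n))) - 1))

/-- The symbol of `Δ⁽ⁿ⁾`: for `n = 0` that of `D₀`, and for `n ≥ 1` the meromorphic function
`𝔔̂_n(k) (1 + 𝔔̂_n(k) ∑_ℓ u_n(k+ℓ)^{2𝔮} / D̂_n(k+ℓ))⁻¹`, with numerator and denominator multiplied by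
`∏_ℓ D̂_n(k+ℓ)` to remove the singularities at the zeroes of the `D̂_n(k+ℓ)`. -/
def deltaHat (L 𝔮 : ℕ) (a : ℝ) (h : (Fin 3 → ℤ) → ℂ) (n : ℕ) (k : Fin 4 → ℂ) : ℂ :=
  if n = 0 then diffHat L h 0 k
  else
    frakQHat L 𝔮 a n k * (∏ l : DualCell L n, diffHat L h n (k + l.momentum)) /
      ((∏ l : DualCell L n, diffHat L h n (k + l.momentum)) +
        frakQHat L 𝔮 a n k * ∑ l : DualCell L n, uN L n (k + l.momentum) ^ (2 * 𝔮) *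
          ∏ l' ∈ Finset.univ.erase l, diffHat L h n (k + l'.momentum))

/-- `𝕃⁻¹ k`. -/
def unscale (L : ℕ) (k : Fin 4 → ℂ) : Fin 4 → ℂ := fun ν => k ν / (scaleFactor L ν : ℂ)

/-- The scaled Floquet matrix `d⁽ˢ⁾_{n,k}(ℓ, ℓ')`, `ℓ, ℓ' ∈ 𝓑̂₁`. -/
def floquet (L 𝔮 : ℕ) (a : ℝ) (h : (Fin 3 → ℤ) → ℂ) (n : ℕ) (k : Fin 4 → ℂ) :
    Matrix (DualCell L 1) (DualCell L 1) ℂ :=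
  Matrix.of fun l l' =>
    (a : ℂ) / (L : ℂ) ^ 2 * uPlus L (unscale L (k + l.momentum)) ^ 𝔮
        * uPlus L (unscale L (k + l'.momentum)) ^ 𝔮
      + if l = l' then deltaHat L 𝔮 a h n (unscale L (k + l.momentum)) else 0

/-- The `ℓ¹`–`ℓ^∞` norm of a matrix. (It dominates the operator norm on `ℓ²`.) -/
def matNorm {ι : Type} [Fintype ι] (M : Matrix ι ι ℂ) : ℝ :=
  max (⨆ i, ∑ j, ‖M i j‖) (⨆ j, ∑ i, ‖M i j‖)

/-- The complex strip `|Im k| < m` in `ℂ × ℂ³`, with the Euclidean norm. -/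
def strip (m : ℝ) : Set (Fin 4 → ℂ) := {k | Real.sqrt (∑ ν, (k ν).im ^ 2) < m}

/-- The negative real axis. -/
def negAxis : Set ℂ := {z | z.im = 0 ∧ z.re ≤ 0}

/-- `(m₂, lam₀, Γ₈)` are constants for the Floquet matrices on block sizes `L > Γ₂`: uniformly in `L`
and `n`, the matrices are analytic and bounded by `Γ₈` on the strip `|Im k| < 3 m₂`, and their
resolvents exist and are bounded by `Γ₈ L²` within distance `lam₀ / L²` of the negative real axis. -/
structure FloquetConstants (𝔮 : ℕ) (a : ℝ) (h : (Fin 3 → ℤ) → ℂ) (Γ₂ m₂ lam₀ Γ₈ : ℝ) : Prop where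
  m₂_pos : 0 < m₂
  lam₀_pos : 0 < lam₀
  Γ₈_pos : 0 < Γ₈
  analytic : ∀ L : ℕ, Odd L → 1 < L → Γ₂ < L → ∀ (n : ℕ) (l l' : DualCell L 1),
    AnalyticOnNhd ℂ (fun k => floquet L 𝔮 a h n k l l') (strip (3 * m₂))
  bound : ∀ L : ℕ, Odd L → 1 < L → Γ₂ < L → ∀ (n : ℕ), ∀ k ∈ strip (3 * m₂),
    matNorm (floquet L 𝔮 a h n k) ≤ Γ₈
  resolvent : ∀ L : ℕ, Odd L → 1 < L → Γ₂ < L → ∀ (n : ℕ), ∀ k ∈ strip (3 * m₂),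
    ∀ z : ℂ, Metric.infDist z negAxis ≤ lam₀ / (L : ℝ) ^ 2 →
      IsUnit (z • 1 - floquet L 𝔮 a h n k) ∧
      matNorm (z • 1 - floquet L 𝔮 a h n k)⁻¹ ≤ Γ₈ * (L : ℝ) ^ 2

/-! ### Functions of the operator -/

/-- The slit disc `{z | dist(z, ℝ₋) > δ, |z| < R}`. -/
def slitDisc (δ R : ℝ) : Set ℂ := {z | δ < Metric.infDist z negAxis ∧ ‖z‖ < R}

/-- The integral of `g` over the boundary of `slitDisc δ R` (`0 < δ < R`), counterclockwise: the outer
arc, from just below to just above the slit; the segment above the slit, rightwards; the half circle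
of radius `δ` about the origin, from `iδ` to `-iδ`; the segment below the slit, leftwards. -/
def slitDiscIntegral (δ R : ℝ) (g : ℂ → ℂ) : ℂ :=
  (∫ θ in (-(Real.pi - Real.arcsin (δ / R)))..(Real.pi - Real.arcsin (δ / R)),
      g (R * Complex.exp (θ * Complex.I)) * (Complex.I * (R * Complex.exp (θ * Complex.I))))
  + (∫ x in (-Real.sqrt (R ^ 2 - δ ^ 2))..0, g (x + δ * Complex.I))
  + (∫ θ in (Real.pi / 2)..(-(Real.pi / 2)),
      g (δ * Complex.exp (θ * Complex.I)) * (Complex.I * (δ * Complex.exp (θ * Complex.I))))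
  + (∫ x in (0 : ℝ)..(-Real.sqrt (R ^ 2 - δ ^ 2)), g (x - δ * Complex.I))

/-- `f(A) = (2πi)⁻¹ ∮ f(ζ) (ζ - A)⁻¹ dζ` over the boundary of `slitDisc δ R`. -/
def funCalc {ι : Type} [Fintype ι] [DecidableEq ι] (δ R : ℝ) (f : ℂ → ℂ) (A : Matrix ι ι ℂ) :
    Matrix ι ι ℂ :=
  Matrix.of fun u u' =>
    (2 * (Real.pi : ℂ) * Complex.I)⁻¹ * slitDiscIntegral δ R fun ζ => f ζ * (ζ • 1 - A)⁻¹ u u'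

end

end BlockSpin

namespace BlockSpin

/-! ### The Dirichlet ratio -/

/-! Everything is reduced to one estimate, the exponential decay of the kernel of (ζ - A)⁻¹ for ζ on
C, which is read off from the Floquet matrices in a complex strip of momenta.

Admissible constants. Put ε = L⁻². The Floquet matrix is a rank one matrix aε v vᵀ, v(ℓ) =
u₁(k+ℓ)^𝔮, plus a diagonal matrix with entries δ(ℓ) = Δ̂(𝕃⁻¹(k+ℓ)). At real k the δ(ℓ) have
nonnegative real part, and on the fundamental cell |Δ̂(p)| is comparable to |p₀| + |𝐩|². So only
δ(0) can drop below order ε, and there the rank one term fills the gap, since v(0)² is bounded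
below. Eliminating the components ℓ ≠ 0 leaves a scalar Schur complement of size at least of order ε
(`exists_rankOne_resolvent_bound`). For complex k and for z near the negative axis this persists by
perturbation, provided that the strip is narrow (`IsHamiltonian.exists_floquetConstants`).

Uniformity in n and L has three sources. First, u_n(p+ℓ) decays in ℓ at a rate independent of the
size of the cell (`norm_dirichletRatio_cell_le`), so sums of its powers over ℓ are bounded; this
also keeps 𝔔̂_n comparable to a once L > Γ₂. Second, D̂_n satisfies upper, lower and perturbation
bounds in the parabolic variables that do not see n, because the prefactor L²ⁿ is exactly undone by
the scaling of momenta. Third, Δ̂ = D̂/(D̂ R + u^{2𝔮}), where R collects 1/𝔔̂ and the terms ℓ ≠ 0.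
At real momenta Re D̂ ≥ 0 and Re R ≥ 1/a, so the denominator cannot vanish (`le_norm_mul_add`), and
Δ̂ is D̂ times a function bounded above and below (`IsHamiltonian.exists_deltaHat_factor`).

From the Floquet matrices to A. The averaging operators map a character to its reduction to the
coarse lattice, and their adjoints map it to the combination of all its aliases. Hence A preserves
the span of the L⁵ characters with momenta 𝕃⁻¹(k+ℓ) and acts there by the Floquet matrix
(`hasFloquet_scaledOp`). The kernel of (ζ - A)⁻¹ is therefore L⁻⁵ times the average, over the
momenta k of a finite torus, of a 2π-periodic function analytic in the strip
(`FloquetConstants.stripDecay`). Such an average is a sum of Fourier coefficients over the windings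
of the torus. Shifting the contour makes each of them decay, and the sum over windings is bounded
independently of the volume (`norm_average_le`).

Powers of L. Off the slit disc the matrix resolvent is bounded by Γ₈L² + 1. The L⁵ rows ℓ cancel the
factor L⁻⁵, and summing the decaying kernel costs L⁵, the number of sites in a unit volume. This
gives L⁷. The contour has length bounded in terms of Γ₈ alone.

Decay rates. The Euclidean strip of width 3m₂ contains the box of half-width 3m₂/2. The kernel
decays at rate 5m₂/4, the difference paying for the windings, and the weight e^{m₂|u-u'|} still
leaves m₂/4 for the sum over sites. -/

theorem sum_Icc_neg_eq (m : ℕ) (f : ℤ → ℂ) :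
    ∑ j ∈ Finset.Icc (-(m : ℤ)) m, f j
      = f 0 + ∑ j ∈ Finset.range m, (f (j + 1) + f (-((j : ℤ) + 1))) := by
  induction m with
  | zero => simp
  | succ m ih =>
    have h : Finset.Icc (-((m + 1 : ℕ) : ℤ)) ((m + 1 : ℕ) : ℤ)
        = insert ((m : ℤ) + 1) (insert (-((m : ℤ) + 1)) (Finset.Icc (-(m : ℤ)) m)) := by
      ext x
      simp only [Finset.mem_Icc, Finset.mem_insert]
      push_cast
      omega
    rw [h, Finset.sum_insert, Finset.sum_insert, ih, Finset.sum_range_succ]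
    · ring
    · simp
    · simp only [Finset.mem_insert, Finset.mem_Icc]; omega

/-- Pairing j with -j. Reality on the real axis and evenness are read off from this form. -/
theorem dirichletRatio_eq_cos (m : ℕ) (x : ℂ) :
    dirichletRatio (2 * m + 1) x
      = ((2 * m + 1 : ℕ) : ℂ)⁻¹ * (1 + 2 * ∑ j ∈ Finset.range m, Complex.cos ((j + 1 : ℂ) * x)) := by
  have h : (((2 * m + 1 : ℕ) : ℤ) - 1) / 2 = m := by push_cast; omega
  rw [dirichletRatio, h, sum_Icc_neg_eq, Finset.mul_sum]
  congr 2
  · simp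
  · refine Finset.sum_congr rfl fun j _ => ?_
    rw [Complex.two_cos, add_comm]
    push_cast
    congr 2 <;> ring

theorem sin_mul_cos_sum (m : ℕ) (x : ℂ) :
    Complex.sin (x / 2) * (1 + 2 * ∑ j ∈ Finset.range m, Complex.cos ((j + 1 : ℂ) * x))
      = Complex.sin (((2 * m + 1 : ℕ) : ℂ) * x / 2) := by
  induction m with
  | zero => simp
  | succ m ih =>
    rw [Finset.sum_range_succ]
    have e1 : ((2 * m + 1 : ℕ) : ℂ) * x / 2 = ((m : ℂ) + 1) * x - x / 2 := by push_cast; ring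
    have e2 : ((2 * (m + 1) + 1 : ℕ) : ℂ) * x / 2 = ((m : ℂ) + 1) * x + x / 2 := by
      push_cast; ring
    rw [e1, Complex.sin_sub] at ih
    rw [e2, Complex.sin_add]
    have e3 : Complex.sin (((m : ℂ) + 1) * x) * Complex.cos (x / 2)
        = Complex.sin (x / 2) * (1 + 2 * ∑ j ∈ Finset.range m, Complex.cos ((j + 1 : ℂ) * x))
          + Complex.cos (((m : ℂ) + 1) * x) * Complex.sin (x / 2) := by rw [ih]; ring
    rw [e3]
    ring

/-- The Dirichlet kernel identity in division-free form, so that it also holds at the zeros of sin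
(x/2). -/
theorem dirichletRatio_mul_sin {N : ℕ} (hN : Odd N) (x : ℂ) :
    (N : ℂ) * (Complex.sin (x / 2) * dirichletRatio N x) = Complex.sin (N * x / 2) := by
  obtain ⟨m, rfl⟩ := hN
  rw [dirichletRatio_eq_cos, ← sin_mul_cos_sum]
  have : ((2 * m + 1 : ℕ) : ℂ) ≠ 0 := by exact_mod_cast Nat.succ_ne_zero (2 * m)
  field_simp

theorem dirichletRatio_add_two_pi (N : ℕ) (x : ℂ) (r : ℤ) :
    dirichletRatio N (x + 2 * Real.pi * r) = dirichletRatio N x := by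
  unfold dirichletRatio
  congr 1
  refine Finset.sum_congr rfl fun j _ => ?_
  rw [Complex.exp_eq_exp_iff_exists_int]
  exact ⟨-(j * r), by push_cast; ring⟩

theorem dirichletRatio_zero {N : ℕ} (hN : Odd N) : dirichletRatio N 0 = 1 := by
  obtain ⟨m, rfl⟩ := hN
  rw [dirichletRatio_eq_cos]
  have : ((2 * m + 1 : ℕ) : ℂ) ≠ 0 := by exact_mod_cast Nat.succ_ne_zero (2 * m)
  rw [inv_mul_eq_iff_eq_mul₀ this]
  simp
  ring

theorem dirichletRatio_two_pi {N : ℕ} (hN : Odd N) (r : ℤ) :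
    dirichletRatio N (2 * Real.pi * r) = 1 := by
  simpa [dirichletRatio_zero hN] using dirichletRatio_add_two_pi N 0 r

/-- Where sin (x/2) ≠ 0 this is cancellation of sin (Nx/2); at the zeros x ∈ 2πℤ all three ratios
equal 1. It is the reason why composing averaging operators multiplies their symbols into a single
u_n. -/
theorem dirichletRatio_mul {N M : ℕ} (hN : Odd N) (hM : Odd M) (x : ℂ) :
    dirichletRatio (N * M) x = dirichletRatio N x * dirichletRatio M (N * x) := by
  by_cases h : Complex.sin (x / 2) = 0
  · obtain ⟨k, hk⟩ := Complex.sin_eq_zero_iff.mp h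
    have hx : x = 2 * Real.pi * k := by linear_combination 2 * hk
    have h2 : (N : ℂ) * x = 2 * Real.pi * ((N * k : ℤ) : ℂ) := by rw [hx]; push_cast; ring
    rw [h2, hx, dirichletRatio_two_pi hN, dirichletRatio_two_pi hM,
      dirichletRatio_two_pi (hN.mul hM), one_mul]
  · have hN0 : (N : ℂ) ≠ 0 := by exact_mod_cast hN.pos.ne'
    have hM0 : (M : ℂ) ≠ 0 := by exact_mod_cast hM.pos.ne'
    have h1 := dirichletRatio_mul_sin (hN.mul hM) x
    have h2 := dirichletRatio_mul_sin hM (N * x)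
    have h3 := dirichletRatio_mul_sin hN x
    have e : (M : ℂ) * (N * x) / 2 = ((N * M : ℕ) : ℂ) * x / 2 := by push_cast; ring
    rw [e, ← h1, ← h3] at h2
    have h4 : ((N : ℂ) * M * Complex.sin (x / 2))
        * (dirichletRatio N x * dirichletRatio M (N * x) - dirichletRatio (N * M) x) = 0 := by
      push_cast at h2
      linear_combination h2
    have h5 := (mul_eq_zero.mp h4).resolve_left (mul_ne_zero (mul_ne_zero hN0 hM0) h)
    exact (sub_eq_zero.mp h5).symm

theorem differentiable_dirichletRatio (N : ℕ) : Differentiable ℂ (dirichletRatio N) := by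
  unfold dirichletRatio
  fun_prop

theorem dirichletRatio_ofReal_im {N : ℕ} (hN : Odd N) (x : ℝ) : (dirichletRatio N x).im = 0 := by
  obtain ⟨m, rfl⟩ := hN
  rw [dirichletRatio_eq_cos]
  have : (((2 * m + 1 : ℕ) : ℂ)⁻¹ * (1 + 2 * ∑ j ∈ Finset.range m, Complex.cos ((j + 1 : ℂ) * x)))
      = (((2 * m + 1 : ℕ) : ℝ)⁻¹ * (1 + 2 * ∑ j ∈ Finset.range m, Real.cos ((j + 1 : ℝ) * x)) : ℝ) := by
    push_cast; rfl
  rw [this, Complex.ofReal_im]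

theorem norm_dirichletRatio_le {N : ℕ} (hN : Odd N) (x : ℂ) :
    ‖dirichletRatio N x‖ ≤ Real.exp (N * |x.im| / 2) := by
  have hN0 : (0 : ℝ) < N := by exact_mod_cast hN.pos
  obtain ⟨m, hm⟩ := hN
  have h : ((N : ℤ) - 1) / 2 = m := by rw [hm]; push_cast; omega
  rw [dirichletRatio, h, norm_mul, norm_inv, Complex.norm_natCast]
  rw [inv_mul_le_iff₀ hN0]
  refine (norm_sum_le _ _).trans ?_
  have hc : ((Finset.Icc (-(m : ℤ)) m).card : ℝ) = N := by
    rw [Int.card_Icc, hm]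
    have : ((m : ℤ) + 1 - -(m : ℤ)).toNat = 2 * m + 1 := by omega
    rw [this]
  rw [← hc, ← nsmul_eq_mul]
  refine Finset.sum_le_card_nsmul _ _ _ fun j hj => ?_
  rw [Complex.norm_exp, hc]
  refine Real.exp_le_exp.mpr ?_
  have e : (-Complex.I * (j : ℂ) * x).re = j * x.im := by simp
  rw [e]
  have hj' : |(j : ℝ)| ≤ N / 2 := by
    rw [Finset.mem_Icc] at hj
    rw [hm, abs_le]
    have h1 : (-(m : ℝ)) ≤ j := by exact_mod_cast hj.1
    have h2 : (j : ℝ) ≤ m := by exact_mod_cast hj.2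
    push_cast
    constructor <;> linarith
  calc (j : ℝ) * x.im ≤ |(j : ℝ) * x.im| := le_abs_self _
    _ = |(j : ℝ)| * |x.im| := abs_mul _ _
    _ ≤ N / 2 * |x.im| := by gcongr
    _ = _ := by ring

/-- |sin z|² = sin² (Re z) + sinh² (Im z), so an imaginary part can only help denominators. -/
theorem abs_sin_re_le_norm_sin (z : ℂ) : |Real.sin z.re| ≤ ‖Complex.sin z‖ := by
  rw [Complex.sin_eq, Complex.norm_eq_sqrt_sq_add_sq, ← Real.sqrt_sq_eq_abs]
  apply Real.sqrt_le_sqrt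
  have e1 : (Complex.sin z.re * Complex.cosh z.im + Complex.cos z.re * Complex.sinh z.im * Complex.I)
      = ((Real.sin z.re * Real.cosh z.im : ℝ) : ℂ) + ((Real.cos z.re * Real.sinh z.im : ℝ) : ℂ)
        * Complex.I := by push_cast; rfl
  rw [e1]
  simp only [Complex.add_re, Complex.add_im, Complex.ofReal_re, Complex.ofReal_im, Complex.mul_re,
    Complex.mul_im, Complex.I_re, Complex.I_im]
  nlinarith [sq_nonneg (Real.sinh z.im), Real.cosh_sq z.im, Real.sin_sq_add_cos_sq z.re,
    mul_nonneg (sq_nonneg (Real.sin z.re)) (sq_nonneg (Real.sinh z.im)),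
    mul_nonneg (sq_nonneg (Real.cos z.re)) (sq_nonneg (Real.sinh z.im))]

theorem norm_sin_le_exp (z : ℂ) : ‖Complex.sin z‖ ≤ Real.exp |z.im| := by
  have h : ‖(Complex.exp (-z * Complex.I) - Complex.exp (z * Complex.I)) * Complex.I / 2‖
      ≤ Real.exp |z.im| := by
    rw [norm_div, norm_mul, Complex.norm_I, mul_one]
    have h1 := norm_sub_le (Complex.exp (-z * Complex.I)) (Complex.exp (z * Complex.I))
    rw [Complex.norm_exp, Complex.norm_exp] at h1
    have e1 : (-z * Complex.I).re = z.im := by simp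
    have e2 : (z * Complex.I).re = -z.im := by simp
    rw [e1, e2] at h1
    have h3 := Real.exp_le_exp.mpr (le_abs_self z.im)
    have h4 := Real.exp_le_exp.mpr (neg_le_abs z.im)
    simp only [RCLike.norm_ofNat]
    linarith
  exact h

/-! ### Decay on the dual cell -/

/-- The decay weight `1 / (1 + min j (N - j))` at the `j`-th of `N` sites on a circle. -/
noncomputable def circWeight (N j : ℕ) : ℝ := (1 + ((min j (N - j) : ℕ) : ℝ))⁻¹

theorem circWeight_pos (N j : ℕ) : 0 < circWeight N j := by unfold circWeight; positivity

theorem circWeight_le_one (N j : ℕ) : circWeight N j ≤ 1 := by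
  unfold circWeight
  apply inv_le_one_of_one_le₀
  have : (0 : ℝ) ≤ ((min j (N - j) : ℕ) : ℝ) := by positivity
  linarith

theorem min_le_abs_sub_mul {N j : ℕ} (hj : j < N) (r : ℤ) :
    ((min j (N - j) : ℕ) : ℝ) ≤ |(j : ℝ) - r * N| := by
  have h : ((min j (N - j) : ℕ) : ℤ) ≤ |(j : ℤ) - r * N| := by
    rcases le_or_gt r 0 with hr | hr
    · have : r * (N : ℤ) ≤ 0 := mul_nonpos_of_nonpos_of_nonneg hr (by positivity)
      rw [le_abs]; left; omega
    · have : (N : ℤ) ≤ r * N := le_mul_of_one_le_left (by positivity) hr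
      rw [le_abs]; right; omega
  exact_mod_cast h

/-- The numerator sin (Nz/2) is bounded because Im z has size at most 1/N. The denominator N |sin
(z/2)| is at least N |Re z|/π once z has been moved by 2πℤ to |Re z| ≤ π, and N |Re z| dominates the
distance of j from Nℤ. No constant depends on N, which makes every sum over a dual cell uniform in L
and n. -/
theorem norm_dirichletRatio_cell_le {N : ℕ} (hN : Odd N) {x : ℂ} (hre : |x.re| ≤ 5)
    (him : |x.im| ≤ 1) {j : ℕ} (hj : j < N) :
    ‖dirichletRatio N ((x + 2 * Real.pi * j) / N)‖ ≤ 14 * circWeight N j := by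
  have hN0 : (0 : ℝ) < N := by exact_mod_cast hN.pos
  have hNc : (N : ℂ) ≠ 0 := by exact_mod_cast hN.pos.ne'
  have he : Real.exp (1 / 2) ≤ 2 := by
    have := Real.exp_one_lt_d9
    have h2 : Real.exp (1 / 2) * Real.exp (1 / 2) = Real.exp 1 := by
      rw [← Real.exp_add]; norm_num
    nlinarith [Real.exp_pos (1 / 2)]
  rcases Nat.eq_zero_or_pos j with rfl | hj0
  · have h1 := norm_dirichletRatio_le hN ((x + 2 * Real.pi * (0 : ℕ)) / N)
    have h2 : ((x + 2 * Real.pi * (0 : ℕ)) / N).im = x.im / N := by simp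
    rw [h2, abs_div, abs_of_pos hN0, mul_div_cancel₀ _ hN0.ne'] at h1
    have h3 : Real.exp (|x.im| / 2) ≤ Real.exp (1 / 2) := Real.exp_le_exp.mpr (by linarith)
    simp only [circWeight, Nat.zero_min, Nat.cast_zero, add_zero, inv_one]
    linarith
  · set μ : ℝ := ((min j (N - j) : ℕ) : ℝ) with hμ
    have hμ1 : 1 ≤ μ := by
      have : 1 ≤ min j (N - j) := by omega
      rw [hμ]; exact_mod_cast this
    set y : ℂ := (x + 2 * Real.pi * j) / N with hy
    set r : ℤ := round (y.re / (2 * Real.pi)) with hr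
    set z : ℂ := y + 2 * Real.pi * ((-r : ℤ) : ℂ) with hz
    have hzr : dirichletRatio N z = dirichletRatio N y := dirichletRatio_add_two_pi N y (-r)
    have hyre : y.re = (x.re + 2 * Real.pi * j) / N := by
      have : y = ((x + ((2 * Real.pi * j : ℝ) : ℂ)) / ((N : ℝ) : ℂ)) := by rw [hy]; push_cast; rfl
      rw [this, Complex.div_ofReal_re, Complex.add_re, Complex.ofReal_re]
    have hyim : y.im = x.im / N := by
      have : y = ((x + ((2 * Real.pi * j : ℝ) : ℂ)) / ((N : ℝ) : ℂ)) := by rw [hy]; push_cast; rfl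
      rw [this, Complex.div_ofReal_im, Complex.add_im, Complex.ofReal_im, add_zero]
    have hzre : z.re = y.re - 2 * Real.pi * r := by
      have : z = y + ((-(2 * Real.pi * r) : ℝ) : ℂ) := by rw [hz]; push_cast; ring
      rw [this, Complex.add_re, Complex.ofReal_re]; ring
    have hzim : z.im = x.im / N := by
      have : z = y + ((-(2 * Real.pi * r) : ℝ) : ℂ) := by rw [hz]; push_cast; ring
      rw [this, Complex.add_im, Complex.ofReal_im, hyim, add_zero]
    have hpi := Real.pi_pos
    have hπ3 := Real.pi_gt_d2
    have hπ4 := Real.pi_lt_d2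
    have hzabs : |z.re| ≤ Real.pi := by
      have h1 := abs_sub_round (y.re / (2 * Real.pi))
      rw [← hr] at h1
      have h2 : z.re = (y.re / (2 * Real.pi) - r) * (2 * Real.pi) := by rw [hzre]; field_simp
      rw [h2, abs_mul, abs_of_pos (by positivity : 0 < 2 * Real.pi)]
      nlinarith
    -- N Re z = Re x + 2π(j - rN) with |j - rN| ≥ μ ≥ 1, so the bound follows from 2πμ - 5 ≥ μ. This
    -- is why |Re x| ≤ 5 is the admitted range: 5 < 2π - 1, and 5 > π + 1 leaves room around the
    -- fundamental cell.
    have hNz : μ ≤ N * |z.re| := by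
      have h1 : (N : ℝ) * z.re = x.re + 2 * Real.pi * (j - r * N) := by
        rw [hzre, hyre]; field_simp; ring
      have h2 : (N : ℝ) * |z.re| = |x.re + 2 * Real.pi * (j - r * N)| := by
        rw [← h1, abs_mul, abs_of_pos hN0]
      rw [h2]
      have h3 := min_le_abs_sub_mul hj r
      rw [← hμ] at h3
      have h4 : |2 * Real.pi * ((j : ℝ) - r * N)| = 2 * Real.pi * |(j : ℝ) - r * N| := by
        rw [abs_mul, abs_of_pos (by positivity : 0 < 2 * Real.pi)]
      have h5 := abs_sub_abs_le_abs_sub (2 * Real.pi * ((j : ℝ) - r * N)) (-x.re)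
      rw [abs_neg, sub_neg_eq_add, add_comm _ x.re] at h5
      nlinarith
    have hs : |z.re| / Real.pi ≤ ‖Complex.sin (z / 2)‖ := by
      have h0 := abs_sin_re_le_norm_sin (z / 2)
      have h1 : (z / 2).re = z.re / 2 := by
        rw [show (2 : ℂ) = ((2 : ℝ) : ℂ) by norm_num, Complex.div_ofReal_re]
      rw [h1] at h0
      have h2 := Real.mul_abs_le_abs_sin (x := z.re / 2) (by
        rw [abs_div, abs_of_pos (by norm_num : (0:ℝ) < 2)]; linarith)
      refine le_trans (le_of_eq ?_) (h2.trans h0)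
      rw [abs_div, abs_of_pos (by norm_num : (0:ℝ) < 2)]; field_simp
    have ht : ‖Complex.sin (N * z / 2)‖ ≤ 2 := by
      refine (norm_sin_le_exp _).trans (le_trans (Real.exp_le_exp.mpr ?_) he)
      have : ((N : ℂ) * z / 2).im = x.im / 2 := by
        rw [show (N : ℂ) * z / 2 = (((N : ℝ) / 2 : ℝ) : ℂ) * z by push_cast; ring,
          Complex.im_ofReal_mul, hzim]
        field_simp
      rw [this, abs_div, abs_of_pos (by norm_num : (0:ℝ) < 2)]
      linarith
    have hm := dirichletRatio_mul_sin hN z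
    rw [← hm, norm_mul, norm_mul, Complex.norm_natCast, hzr] at ht
    have hD : 0 ≤ ‖dirichletRatio N y‖ := norm_nonneg _
    have h6 : μ / Real.pi * ‖dirichletRatio N y‖ ≤ 2 := by
      refine le_trans ?_ ht
      rw [← mul_assoc]
      refine mul_le_mul_of_nonneg_right ?_ hD
      calc μ / Real.pi ≤ N * |z.re| / Real.pi := by gcongr
        _ = N * (|z.re| / Real.pi) := by ring
        _ ≤ _ := by gcongr
    have h7 : μ * ‖dirichletRatio N y‖ ≤ 7 := by
      have : μ / Real.pi * ‖dirichletRatio N y‖ = μ * ‖dirichletRatio N y‖ / Real.pi := by ring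
      rw [this, div_le_iff₀ hpi] at h6
      linarith
    rw [circWeight, ← hμ, ← div_eq_mul_inv, le_div_iff₀ (by linarith)]
    nlinarith

theorem sum_range_inv_sq_le (N : ℕ) : ∑ j ∈ Finset.range N, ((1 + (j : ℝ)) ^ 2)⁻¹ ≤ 2 := by
  -- The subtracted 1/N lets the induction close, by 1/(1+n)² ≤ 1/n - 1/(n+1).
  have h : ∑ j ∈ Finset.range N, ((1 + (j : ℝ)) ^ 2)⁻¹ ≤ 2 - (N : ℝ)⁻¹ := by
    induction N with
    | zero => norm_num
    | succ n ih =>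
      rw [Finset.sum_range_succ]
      rcases Nat.eq_zero_or_pos n with rfl | hn
      · norm_num
      have hn' : (0 : ℝ) < n := by exact_mod_cast hn
      have : ((1 + (n : ℝ)) ^ 2)⁻¹ ≤ (n : ℝ)⁻¹ - ((n + 1 : ℕ) : ℝ)⁻¹ := by
        push_cast
        rw [inv_sub_inv (by positivity) (by positivity), inv_eq_one_div,
          div_le_div_iff₀ (by positivity) (by positivity)]
        nlinarith
      linarith
  have : 0 ≤ (N : ℝ)⁻¹ := by positivity
  linarith

/-- The weight is dominated by two one-sided inverse squares, one counted from each end of the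
range. At the far end N - j is weakened to N - 1 - j so that the second sum is the reflection of the
first. -/
theorem sum_circWeight_pow_le (N : ℕ) {r : ℕ} (hr : 2 ≤ r) :
    ∑ j : Fin N, circWeight N j ^ r ≤ 4 := by
  have h1 : ∀ j : Fin N, circWeight N j ^ r
      ≤ ((1 + ((j : ℕ) : ℝ)) ^ 2)⁻¹ + ((1 + ((N - 1 - j : ℕ) : ℝ)) ^ 2)⁻¹ := by
    intro j
    refine (pow_le_pow_of_le_one (circWeight_pos N j).le (circWeight_le_one N j) hr).trans ?_
    rw [circWeight, inv_pow]
    rcases le_total (j : ℕ) (N - j) with h | h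
    · rw [min_eq_left h]
      have : 0 ≤ ((1 + ((N - 1 - j : ℕ) : ℝ)) ^ 2)⁻¹ := by positivity
      linarith
    · rw [min_eq_right h]
      have h2 : ((1 + ((N - j : ℕ) : ℝ)) ^ 2)⁻¹ ≤ ((1 + ((N - 1 - j : ℕ) : ℝ)) ^ 2)⁻¹ := by
        have : ((N - 1 - j : ℕ) : ℝ) ≤ ((N - j : ℕ) : ℝ) := by
          have : N - 1 - j ≤ N - (j : ℕ) := by omega
          exact_mod_cast this
        gcongr
      have : 0 ≤ ((1 + ((j : ℕ) : ℝ)) ^ 2)⁻¹ := by positivity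
      linarith
  refine (Finset.sum_le_sum fun j _ => h1 j).trans ?_
  rw [Finset.sum_add_distrib, Fin.sum_univ_eq_sum_range (fun j => ((1 + (j : ℝ)) ^ 2)⁻¹),
    Fin.sum_univ_eq_sum_range (fun j => ((1 + ((N - 1 - j : ℕ) : ℝ)) ^ 2)⁻¹),
    Finset.sum_range_reflect (fun j => ((1 + (j : ℝ)) ^ 2)⁻¹)]
  linarith [sum_range_inv_sq_le N]

/-- The decay weight of an element of the dual cell. -/
noncomputable def cellWeight {L n : ℕ} (l : DualCell L n) : ℝ :=
  ∏ ν, circWeight (scaleFactor L ν ^ n) (l ν)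

theorem sum_cellWeight_pow_le (L n : ℕ) {r : ℕ} (hr : 2 ≤ r) :
    ∑ l : DualCell L n, cellWeight l ^ r ≤ 256 := by
  simp_rw [cellWeight, ← Finset.prod_pow]
  rw [← Fintype.piFinset_univ, ← Finset.prod_univ_sum (fun _ => Finset.univ)
    (fun ν (j : Fin (scaleFactor L ν ^ n)) => circWeight (scaleFactor L ν ^ n) j ^ r)]
  calc _ ≤ ∏ _ν : Fin 4, (4 : ℝ) := Finset.prod_le_prod
        (fun ν _ => Finset.sum_nonneg fun j _ => (pow_pos (circWeight_pos _ _) _).le)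
        (fun ν _ => sum_circWeight_pow_le _ hr)
    _ = 256 := by simp; norm_num

theorem odd_scaleFactor {L : ℕ} (hL : Odd L) (ν : Fin 4) : Odd (scaleFactor L ν) := by
  unfold scaleFactor
  split_ifs
  exacts [hL.pow, hL]

theorem scaleFactor_pos {L : ℕ} (hL : 0 < L) (ν : Fin 4) : 0 < scaleFactor L ν := by
  unfold scaleFactor
  split_ifs
  exacts [pow_pos hL _, hL]

theorem norm_uN_cell_le {L : ℕ} (hL : Odd L) (n : ℕ) {p : Fin 4 → ℂ} (hre : ∀ ν, |(p ν).re| ≤ 5)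
    (him : ∀ ν, |(p ν).im| ≤ 1) (l : DualCell L n) :
    ‖uN L n (p + l.momentum)‖ ≤ 14 ^ 4 * cellWeight l := by
  rw [uN, norm_prod, cellWeight]
  calc _ ≤ ∏ ν : Fin 4, (14 * circWeight (scaleFactor L ν ^ n) (l ν)) := by
        refine Finset.prod_le_prod (fun _ _ => norm_nonneg _) fun ν _ => ?_
        have := norm_dirichletRatio_cell_le ((odd_scaleFactor hL ν).pow (n := n)) (hre ν) (him ν)
          (l ν).isLt
        push_cast at this
        simpa [DualCell.momentum] using this
    _ = _ := by rw [Finset.prod_mul_distrib]; simp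

/-! ### Shifts of momenta by `2πℤ⁴` -/

/-- The vector `2π r`. -/
noncomputable def latticeVec (r : Fin 4 → ℤ) : Fin 4 → ℂ := fun ν => 2 * Real.pi * (r ν : ℂ)

/-- Invariance under translations by `2π L_νⁿ ℤ` in the direction `ν`. -/
def LatticePeriodic {α : Type*} (L n : ℕ) (F : (Fin 4 → ℂ) → α) : Prop :=
  ∀ (p : Fin 4 → ℂ) (s : Fin 4 → ℤ),
    F (p + latticeVec fun ν => ((scaleFactor L ν ^ n : ℕ) : ℤ) * s ν) = F p

theorem exists_add_latticeVec_re_le (p : Fin 4 → ℂ) :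
    ∃ r : Fin 4 → ℤ, ∀ ν, |((p + latticeVec r) ν).re| ≤ Real.pi ∧
      ((p + latticeVec r) ν).im = (p ν).im := by
  refine ⟨fun ν => -round ((p ν).re / (2 * Real.pi)), fun ν => ?_⟩
  set t := round ((p ν).re / (2 * Real.pi)) with ht
  have hpi := Real.pi_pos
  have e : (p + latticeVec fun ν => -round ((p ν).re / (2 * Real.pi))) ν
      = p ν + ((-(2 * Real.pi * t) : ℝ) : ℂ) := by
    simp [latticeVec, ht]
  rw [e, Complex.add_re, Complex.add_im, Complex.ofReal_re, Complex.ofReal_im, add_zero]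
  refine ⟨?_, rfl⟩
  have h1 := abs_sub_round ((p ν).re / (2 * Real.pi))
  rw [← ht] at h1
  have h2 : (p ν).re + -(2 * Real.pi * t) = ((p ν).re / (2 * Real.pi) - t) * (2 * Real.pi) := by
    field_simp; ring
  rw [h2, abs_mul, abs_of_pos (by positivity : 0 < 2 * Real.pi)]
  nlinarith

/-- Adding r modulo the side lengths permutes the cell; s is the carry, which periodic functions do
not see. -/
theorem exists_dualCell_perm {L : ℕ} (hL : 0 < L) (n : ℕ) (r : Fin 4 → ℤ) :
    ∃ σ : Equiv.Perm (DualCell L n), ∀ l, ∃ s : Fin 4 → ℤ, ∀ ν,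
      ((l ν : ℕ) : ℤ) + r ν = (σ l ν : ℕ) + ((scaleFactor L ν ^ n : ℕ) : ℤ) * s ν := by
  have hN : ∀ ν, (0 : ℤ) < ((scaleFactor L ν ^ n : ℕ) : ℤ) := fun ν => by
    exact_mod_cast pow_pos (scaleFactor_pos hL ν) n
  have hlt : ∀ (l : DualCell L n) (ν : Fin 4),
      ((((l ν : ℕ) : ℤ) + r ν) % ((scaleFactor L ν ^ n : ℕ) : ℤ)).toNat
        < scaleFactor L ν ^ n := fun l ν => by
    have h1 := Int.emod_nonneg (((l ν : ℕ) : ℤ) + r ν) (hN ν).ne'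
    have h2 := Int.emod_lt_of_pos (((l ν : ℕ) : ℤ) + r ν) (hN ν)
    omega
  let g : DualCell L n → DualCell L n := fun l ν => ⟨_, hlt l ν⟩
  have hg : ∀ (l : DualCell L n) ν, ((g l ν : ℕ) : ℤ)
      = (((l ν : ℕ) : ℤ) + r ν) % ((scaleFactor L ν ^ n : ℕ) : ℤ) := fun l ν =>
    Int.toNat_of_nonneg (Int.emod_nonneg _ (hN ν).ne')
  have hinj : Function.Injective g := by
    intro l l' h
    funext ν
    have h1 := hg l ν
    rw [h, hg l' ν] at h1
    have h2 : (((l' ν : ℕ) : ℤ)) ≡ ((l ν : ℕ) : ℤ) [ZMOD ((scaleFactor L ν ^ n : ℕ) : ℤ)] :=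
      Int.ModEq.add_right_cancel' (r ν) h1
    have h3 : ((l' ν : ℕ)) ≡ (l ν : ℕ) [MOD (scaleFactor L ν ^ n)] :=
      (Int.natCast_modEq_iff).mp h2
    exact (Fin.ext (h3.eq_of_lt_of_lt (l' ν).isLt (l ν).isLt)).symm
  refine ⟨Equiv.ofBijective g (Finite.injective_iff_bijective.mp hinj), fun l =>
    ⟨fun ν => (((l ν : ℕ) : ℤ) + r ν) / ((scaleFactor L ν ^ n : ℕ) : ℤ), fun ν => ?_⟩⟩
  rw [Equiv.ofBijective_apply, hg]
  exact (Int.emod_add_mul_ediv _ _).symm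

/-- The permutation is chosen before the function, so expressions built from several periodic
symbols can be reindexed by one and the same σ. -/
theorem LatticePeriodic.exists_perm {L : ℕ} (hL : 0 < L) (n : ℕ) (r : Fin 4 → ℤ) :
    ∃ σ : Equiv.Perm (DualCell L n), ∀ (α : Type) (F : (Fin 4 → ℂ) → α), LatticePeriodic L n F →
      ∀ p (l : DualCell L n), F (p + latticeVec r + l.momentum) = F (p + (σ l).momentum) := by
  obtain ⟨σ, hσ⟩ := exists_dualCell_perm hL n r
  refine ⟨σ, fun α F hF p l => ?_⟩
  obtain ⟨s, hs⟩ := hσ l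
  rw [← hF (p + (σ l).momentum) s]
  congr 1
  funext ν
  have h : (((l ν : ℕ) : ℤ) + r ν : ℂ)
      = ((σ l ν : ℕ) : ℂ) + ((scaleFactor L ν ^ n : ℕ) : ℂ) * s ν := by exact_mod_cast hs ν
  simp only [Pi.add_apply, latticeVec, DualCell.momentum]
  push_cast at h ⊢
  linear_combination (2 * (Real.pi : ℂ)) * h

/-! ### The functions `u_n` -/

theorem uN_latticePeriodic {L : ℕ} (hL : 0 < L) (n : ℕ) : LatticePeriodic L n (uN L n) := by
  intro p s
  unfold uN
  refine Finset.prod_congr rfl fun ν _ => ?_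
  have hN : (scaleFactor L ν : ℂ) ≠ 0 := by exact_mod_cast (scaleFactor_pos hL ν).ne'
  rw [← dirichletRatio_add_two_pi _ (p ν / _) (s ν)]
  congr 1
  simp only [Pi.add_apply, latticeVec]
  push_cast
  field_simp

theorem uPlus_unscale (L : ℕ) (p : Fin 4 → ℂ) : uPlus L (unscale L p) = uN L 1 p := by
  simp [uPlus, uN, unscale]

/-- The sum over the whole cell is invariant under p ↦ p + 2πr, so p may be moved to the fundamental
cell, where the pointwise decay applies. The exponent must be at least 2 for the decay 1/(1+|j|) per
direction to be summable. -/
theorem sum_norm_uN_pow_le {L : ℕ} (hL : Odd L) (n : ℕ) {r : ℕ} (hr : 2 ≤ r) {p : Fin 4 → ℂ}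
    (him : ∀ ν, |(p ν).im| ≤ 1) :
    ∑ l : DualCell L n, ‖uN L n (p + l.momentum)‖ ^ r ≤ (14 ^ 4) ^ r * 256 := by
  obtain ⟨t, ht⟩ := exists_add_latticeVec_re_le p
  obtain ⟨σ, hσ⟩ := LatticePeriodic.exists_perm hL.pos n t
  have h1 := fun l => hσ _ _ (uN_latticePeriodic hL.pos n) p l
  rw [← Equiv.sum_comp σ]
  simp_rw [← h1]
  calc _ ≤ ∑ l : DualCell L n, (14 ^ 4 * cellWeight l) ^ r := by
        refine Finset.sum_le_sum fun l _ => pow_le_pow_left₀ (norm_nonneg _) ?_ r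
        refine norm_uN_cell_le hL n (fun ν => ?_) (fun ν => ?_) l
        · linarith [(ht ν).1, Real.pi_lt_d2]
        · rw [(ht ν).2]; exact him ν
    _ = (14 ^ 4) ^ r * ∑ l : DualCell L n, cellWeight l ^ r := by
        rw [Finset.mul_sum]; exact Finset.sum_congr rfl fun l _ => mul_pow _ _ _
    _ ≤ _ := by gcongr; exact sum_cellWeight_pow_le L n hr

theorem norm_uN_le {L : ℕ} (hL : Odd L) (n : ℕ) {p : Fin 4 → ℂ}
    (hre : ∀ ν, |(p ν).re| ≤ 5) (him : ∀ ν, |(p ν).im| ≤ 1) : ‖uN L n p‖ ≤ 14 ^ 4 := by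
  have hN : ∀ ν, 0 < scaleFactor L ν ^ n := fun ν => pow_pos (scaleFactor_pos hL.pos ν) n
  have h := norm_uN_cell_le hL n hre him (fun ν => ⟨0, hN ν⟩)
  have e : DualCell.momentum (fun ν => ⟨0, hN ν⟩ : DualCell L n) = 0 := by
    funext ν; simp [DualCell.momentum]
  rw [e, add_zero] at h
  refine h.trans (mul_le_of_le_one_right (by norm_num) ?_)
  exact Finset.prod_le_one (fun _ _ => (circWeight_pos _ _).le) fun _ _ => circWeight_le_one _ _

/-- A momentum is real. -/
def IsRealMomentum (p : Fin 4 → ℂ) : Prop := ∀ ν, (p ν).im = 0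

theorem IsRealMomentum.add_momentum {L n : ℕ} {p : Fin 4 → ℂ} (hp : IsRealMomentum p)
    (l : DualCell L n) : IsRealMomentum (p + l.momentum) := by
  intro ν
  simp [DualCell.momentum, hp ν]

theorem uN_eq_ofReal {L : ℕ} (hL : Odd L) (n : ℕ) {p : Fin 4 → ℂ} (hp : IsRealMomentum p) :
    uN L n p = ((uN L n p).re : ℂ) := by
  have h : ∀ ν, dirichletRatio (scaleFactor L ν ^ n) (p ν / (scaleFactor L ν : ℂ) ^ n)
      = ((dirichletRatio (scaleFactor L ν ^ n) (p ν / (scaleFactor L ν : ℂ) ^ n)).re : ℂ) := by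
    intro ν
    have e : p ν / (scaleFactor L ν : ℂ) ^ n = (((p ν).re / (scaleFactor L ν : ℝ) ^ n : ℝ) : ℂ) := by
      push_cast
      congr 1
      exact Complex.ext (by simp) (by simp [hp ν])
    rw [e]
    refine Complex.ext (by simp) ?_
    rw [dirichletRatio_ofReal_im ((odd_scaleFactor hL ν).pow), Complex.ofReal_im]
  have h2 : uN L n p = ((∏ ν, (dirichletRatio (scaleFactor L ν ^ n)
      (p ν / (scaleFactor L ν : ℂ) ^ n)).re : ℝ) : ℂ) := by
    rw [uN, Complex.ofReal_prod]
    exact Finset.prod_congr rfl fun ν _ => h ν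
  rw [h2, Complex.ofReal_re]

/-- |sin (x/2)| ≥ |x|/π against N |sin (x/2N)| ≤ |x|/2. Thus averaging does not destroy the mode ℓ =
0, uniformly in N. -/
theorem dirichletRatio_re_ge {N : ℕ} (hN : Odd N) {x : ℝ} (hx : |x| ≤ Real.pi) :
    2 / Real.pi ≤ ‖dirichletRatio N ((x : ℂ) / N)‖ := by
  have hpi := Real.pi_pos
  have hN0 : (0 : ℝ) < N := by exact_mod_cast hN.pos
  rcases eq_or_ne x 0 with rfl | hx0
  · rw [Complex.ofReal_zero, zero_div, dirichletRatio_zero hN, norm_one, div_le_one hpi]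
    linarith [Real.pi_gt_three]
  have hx1 : 0 < |x| := abs_pos.mpr hx0
  have h := congrArg norm (dirichletRatio_mul_sin hN ((x : ℂ) / N))
  have e1 : (N : ℂ) * (x / N) / 2 = ((x / 2 : ℝ) : ℂ) := by
    have : (N : ℂ) ≠ 0 := by exact_mod_cast hN.pos.ne'
    push_cast; field_simp
  have e2 : (x : ℂ) / N / 2 = ((x / N / 2 : ℝ) : ℂ) := by push_cast; rfl
  rw [e1, e2, norm_mul, norm_mul, Complex.norm_natCast, ← Complex.ofReal_sin, ← Complex.ofReal_sin,
    Complex.norm_real, Complex.norm_real, Real.norm_eq_abs, Real.norm_eq_abs] at h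
  have h1 : |x| / Real.pi ≤ |Real.sin (x / 2)| := by
    have := Real.mul_abs_le_abs_sin (x := x / 2) (by
      rw [abs_div, abs_of_pos (by norm_num : (0:ℝ) < 2)]; linarith)
    refine le_trans (le_of_eq ?_) this
    rw [abs_div, abs_of_pos (by norm_num : (0:ℝ) < 2)]; field_simp
  have h2 : |Real.sin (x / N / 2)| ≤ |x| / N / 2 := by
    refine (Real.abs_sin_le_abs).trans (le_of_eq ?_)
    rw [abs_div, abs_div, abs_of_pos hN0, abs_of_pos (by norm_num : (0:ℝ) < 2)]
  rw [← h] at h1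
  have h3 : |x| / Real.pi ≤ |x| / 2 * ‖dirichletRatio N ((x : ℂ) / N)‖ := by
    refine h1.trans ?_
    calc _ ≤ (N : ℝ) * (|x| / N / 2 * ‖dirichletRatio N ((x : ℂ) / N)‖) := by gcongr
      _ = _ := by field_simp
  have h4 : |x| / Real.pi = |x| / 2 * (2 / Real.pi) := by field_simp
  rw [h4] at h3
  exact le_of_mul_le_mul_left h3 (by positivity)

theorem norm_uN_ge {L : ℕ} (hL : Odd L) (n : ℕ) {p : Fin 4 → ℂ} (hp : IsRealMomentum p)
    (hre : ∀ ν, |(p ν).re| ≤ Real.pi) : (2 / Real.pi) ^ 4 ≤ ‖uN L n p‖ := by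
  have hpi := Real.pi_pos
  rw [uN, norm_prod]
  calc (2 / Real.pi) ^ 4 = ∏ _ν : Fin 4, (2 / Real.pi) := by
        rw [Finset.prod_const, Finset.card_univ, Fintype.card_fin]
    _ ≤ _ := by
      refine Finset.prod_le_prod (fun _ _ => by positivity) fun ν _ => ?_
      have := dirichletRatio_re_ge ((odd_scaleFactor hL ν).pow (n := n)) (hre ν)
      have e : ((p ν).re : ℂ) = p ν := Complex.ext (by simp) (by simp [hp ν])
      rw [e] at this
      push_cast at this
      exact this

/-! ### The symbol of the single particle operator -/

theorem hatH_add_two_pi (h : (Fin 3 → ℤ) → ℂ) (p : Fin 3 → ℂ) (r : Fin 3 → ℤ) :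
    hatH h (fun ν => p ν + 2 * Real.pi * (r ν : ℂ)) = hatH h p := by
  unfold hatH
  refine tsum_congr fun z => ?_
  congr 1
  rw [Complex.exp_eq_exp_iff_exists_int]
  refine ⟨-∑ ν, r ν * z ν, ?_⟩
  push_cast
  simp only [add_mul, Finset.sum_add_distrib, mul_add]
  have : ∑ ν, 2 * (Real.pi : ℂ) * (r ν : ℂ) * (z ν : ℂ) = 2 * Real.pi * ∑ ν, (r ν : ℂ) * (z ν : ℂ) := by
    rw [Finset.mul_sum]; exact Finset.sum_congr rfl fun _ _ => by ring
  rw [this]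
  ring

/-- The mean value inequality twice: f' vanishes at 0 and f'' is bounded on the ball, so |f'| is at
most C times the distance to 0, and this bound is integrated along the segment. -/
theorem exists_quadratic_lipschitz {E : Type*} [NormedAddCommGroup E] [NormedSpace ℂ E]
    [ProperSpace E] {f : E → ℂ} (hf : AnalyticOnNhd ℂ f Set.univ) (h0 : fderiv ℂ f 0 = 0) (R : ℝ) :
    ∃ C : ℝ, 0 ≤ C ∧ ∀ y y' : E, ‖y‖ ≤ R → ‖y'‖ ≤ R →
      ‖f y - f y'‖ ≤ C * max ‖y‖ ‖y'‖ * ‖y - y'‖ := by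
  have hf2 : AnalyticOnNhd ℂ (fderiv ℂ f) Set.univ := hf.fderiv
  have hf3 : AnalyticOnNhd ℂ (fderiv ℂ (fderiv ℂ f)) Set.univ := hf2.fderiv
  have hc : Continuous (fderiv ℂ (fderiv ℂ f)) := continuousOn_univ.mp hf3.continuousOn
  obtain ⟨C, hC⟩ := (isCompact_closedBall (0 : E) R).exists_bound_of_continuousOn
    (f := fderiv ℂ (fderiv ℂ f)) hc.continuousOn
  refine ⟨max C 0, le_max_right _ _, fun y y' hy hy' => ?_⟩
  have key : ∀ z : E, ‖z‖ ≤ R → ‖fderiv ℂ f z‖ ≤ max C 0 * ‖z‖ := by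
    intro z hz
    have h1 := (convex_closedBall (0 : E) ‖z‖).norm_image_sub_le_of_norm_fderiv_le (𝕜 := ℂ)
      (f := fderiv ℂ f) (C := max C 0) (x := 0) (y := z)
      (fun x _ => (hf2 x (Set.mem_univ x)).differentiableAt)
      (fun x hx => (hC x (by
        rw [mem_closedBall_zero_iff] at hx ⊢; exact hx.trans hz)).trans (le_max_left _ _))
      (by simp) (by simp)
    rwa [h0, sub_zero, sub_zero] at h1
  exact (convex_closedBall (0 : E) (max ‖y‖ ‖y'‖)).norm_image_sub_le_of_norm_fderiv_le (𝕜 := ℂ)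
    (f := f) (x := y') (y := y)
    (fun x _ => (hf x (Set.mem_univ x)).differentiableAt)
    (fun x hx => (key x (by
      rw [mem_closedBall_zero_iff] at hx; exact hx.trans (max_le hy hy'))).trans (by
        rw [mem_closedBall_zero_iff] at hx
        gcongr))
    (by simp) (by simp)

/-- A real vector as a complex one. -/
def cvec {ι : Type*} (y : ι → ℝ) : ι → ℂ := fun ν => (y ν : ℂ)

theorem norm_cvec {ι : Type*} [Fintype ι] (y : ι → ℝ) : ‖cvec y‖ = ‖y‖ := by
  simp [Pi.norm_def, cvec]

theorem continuous_cvec {ι : Type*} : Continuous (cvec : (ι → ℝ) → ι → ℂ) := by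
  unfold cvec; fun_prop

theorem cvec_eq_sum (y : Fin 3 → ℝ) :
    cvec y = ∑ μ, (y μ : ℂ) • (Pi.single μ 1 : Fin 3 → ℂ) := by
  funext ν
  simp [cvec, Pi.single_apply]

theorem IsHamiltonian.hess_apply {h : (Fin 3 → ℤ) → ℂ} (y : Fin 3 → ℝ) :
    (iteratedFDeriv ℂ 2 (hatH h) 0 fun _ => cvec y).re = y ⬝ᵥ (hessH h).mulVec y := by
  have e1 : (iteratedFDeriv ℂ 2 (hatH h) 0 fun _ => cvec y)
      = fderiv ℂ (fderiv ℂ (hatH h)) 0 (cvec y) (cvec y) := by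
    rw [iteratedFDeriv_two_apply]
  have e2 : ∀ μ ν, (iteratedFDeriv ℂ 2 (hatH h) 0 ![Pi.single μ 1, Pi.single ν 1])
      = fderiv ℂ (fderiv ℂ (hatH h)) 0 (Pi.single μ 1) (Pi.single ν 1) := by
    intro μ ν
    rw [iteratedFDeriv_two_apply]; rfl
  rw [e1, cvec_eq_sum]
  simp only [map_sum, map_smul, sum_apply, smul_apply,
    dotProduct, Matrix.mulVec, hessH, Matrix.of_apply, e2, Complex.re_sum, smul_eq_mul,
    Complex.re_ofReal_mul, Finset.mul_sum]
  rw [Finset.sum_comm]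
  refine Finset.sum_congr rfl fun μ _ => Finset.sum_congr rfl fun ν _ => by ring

/-- Near the origin the Taylor polynomial is half the positive definite Hessian form, and it absorbs
the cubic remainder. On the rest of the cube, compactness and strict positivity off 2πℤ³ give a
positive minimum. -/
theorem IsHamiltonian.exists_re_ge {h : (Fin 3 → ℤ) → ℂ} (hh : IsHamiltonian h) :
    ∃ c : ℝ, 0 < c ∧ ∀ y : Fin 3 → ℝ, ‖y‖ ≤ Real.pi → c * ‖y‖ ^ 2 ≤ (hatH h (cvec y)).re := by
  have hpi := Real.pi_pos
  have hcont : Continuous (hatH h) := continuousOn_univ.mp hh.entire.continuousOn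
  have hcr : Continuous fun y : Fin 3 → ℝ => (hatH h (cvec y)).re :=
    Complex.continuous_re.comp (hcont.comp continuous_cvec)
  obtain ⟨c0, hc0, hq⟩ : ∃ c0 : ℝ, 0 < c0 ∧
      ∀ y : Fin 3 → ℝ, c0 * ‖y‖ ^ 2 ≤ y ⬝ᵥ (hessH h).mulVec y := by
    have hqc : Continuous fun y : Fin 3 → ℝ => y ⬝ᵥ (hessH h).mulVec y := by fun_prop
    obtain ⟨y0, hy0, hmin⟩ := (isCompact_sphere (0 : Fin 3 → ℝ) 1).exists_isMinOn
      (NormedSpace.sphere_nonempty.mpr zero_le_one) hqc.continuousOn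
    have hy0' : y0 ≠ 0 := by
      rintro rfl
      simp at hy0
    have hpos : 0 < y0 ⬝ᵥ (hessH h).mulVec y0 := by
      have := hh.hess_posDef.dotProduct_mulVec_pos hy0'
      simpa using this
    refine ⟨_, hpos, fun y => ?_⟩
    rcases eq_or_ne y 0 with rfl | hy
    · simp
    have hn : 0 < ‖y‖ := norm_pos_iff.mpr hy
    have h1 := hmin (show ‖y‖⁻¹ • y ∈ Metric.sphere (0 : Fin 3 → ℝ) 1 by
      rw [mem_sphere_zero_iff_norm, norm_smul, norm_inv, norm_norm, inv_mul_cancel₀ hn.ne'])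
    simp only [Set.mem_ofPred_eq, Matrix.mulVec_smul, smul_dotProduct, dotProduct_smul,
      smul_eq_mul] at h1
    calc _ ≤ (‖y‖⁻¹ * (‖y‖⁻¹ * (y ⬝ᵥ (hessH h).mulVec y))) * ‖y‖ ^ 2 := by gcongr
      _ = _ := by field_simp
  obtain ⟨P, r, hP⟩ := hh.entire 0 (Set.mem_univ 0)
  have hO := (HasFPowerSeriesAt.isBigO_sub_partialSum_pow ⟨r, hP⟩ 3)
  obtain ⟨K, hK⟩ := hO.bound
  obtain ⟨ρ, hρ, hball⟩ := Metric.eventually_nhds_iff.mp hK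
  have hps : ∀ y : Fin 3 → ℝ, (P.partialSum 3 (cvec y)).re
      = (1 / 2) * (y ⬝ᵥ (hessH h).mulVec y) := by
    intro y
    have f0 := hP.factorial_smul (cvec y) 0
    have f1 := hP.factorial_smul (cvec y) 1
    have f2 := hP.factorial_smul (cvec y) 2
    rw [iteratedFDeriv_zero_apply, hh.map_zero, Nat.factorial_zero, one_smul] at f0
    rw [iteratedFDeriv_one_apply, hh.fderiv_zero, Nat.factorial_one, one_smul] at f1
    have f2' := congrArg Complex.re f2
    rw [IsHamiltonian.hess_apply, nsmul_eq_mul] at f2'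
    simp only [FormalMultilinearSeries.partialSum, Finset.sum_range_succ, Finset.sum_range_zero,
      f0, f1, zero_add, zero_apply]
    rw [← f2']
    simp
  -- Small enough that the remainder K‖y‖³ uses at most c0/4 of the coefficient c0/2 supplied by the
  -- Hessian.
  set ρ' : ℝ := min (ρ / 2) (c0 / (4 * (|K| + 1))) with hρ'
  have hρ'pos : 0 < ρ' := by positivity
  have near : ∀ y : Fin 3 → ℝ, ‖y‖ ≤ ρ' → c0 / 4 * ‖y‖ ^ 2 ≤ (hatH h (cvec y)).re := by
    intro y hy
    have h1 := hball (y := cvec y) (by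
      rw [dist_zero_right, norm_cvec]
      have : ρ' ≤ ρ / 2 := min_le_left _ _
      linarith)
    rw [zero_add, norm_pow, norm_norm, norm_cvec] at h1
    have h2 := (Complex.abs_re_le_norm _).trans h1
    rw [Complex.sub_re, hps] at h2
    have h3 := (abs_le.mp h2).1
    have h4 := hq y
    have h5 : ‖y‖ * (4 * (|K| + 1)) ≤ c0 := by
      rw [← le_div_iff₀ (by positivity)]
      exact hy.trans (min_le_right _ _)
    have h6 : K * ‖y‖ ^ 3 ≤ c0 / 4 * ‖y‖ ^ 2 := by
      have : K * ‖y‖ ≤ c0 / 4 := by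
        nlinarith [le_abs_self K, norm_nonneg y]
      calc K * ‖y‖ ^ 3 = K * ‖y‖ * ‖y‖ ^ 2 := by ring
        _ ≤ _ := by gcongr
    linarith
  set S : Set (Fin 3 → ℝ) := Metric.closedBall 0 Real.pi \ Metric.ball 0 ρ' with hS
  have hScomp : IsCompact S := (isCompact_closedBall _ _).diff Metric.isOpen_ball
  obtain ⟨c1, hc1, hfar⟩ : ∃ c1 : ℝ, 0 < c1 ∧ ∀ y ∈ S, c1 ≤ (hatH h (cvec y)).re := by
    rcases S.eq_empty_or_nonempty with hE | hne
    · exact ⟨1, one_pos, fun y hy => by simp [hE] at hy⟩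
    obtain ⟨y0, hy0, hmin⟩ := hScomp.exists_isMinOn hne hcr.continuousOn
    refine ⟨_, hh.pos y0 ?_, fun y hy => hmin hy⟩
    -- The norm is the sup norm, so the ball is a cube of half-side π. Its only point of 2πℤ³ is the
    -- origin, which has been removed.
    rintro ⟨z, hz⟩
    have h1 : ‖y0‖ ≤ Real.pi := by simpa using hy0.1
    have h2 : ρ' ≤ ‖y0‖ := by simpa using hy0.2
    have h3 : y0 = 0 := by
      funext ν
      have h4 : |y0 ν| ≤ Real.pi := (norm_le_pi_norm y0 ν).trans h1
      rw [hz ν] at h4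
      rw [abs_mul, abs_of_pos (by positivity : 0 < 2 * Real.pi)] at h4
      have h5 : |(z ν : ℝ)| < 1 := by nlinarith
      have h6 : |z ν| < 1 := by exact_mod_cast h5
      rw [hz ν, Int.abs_lt_one_iff.mp h6]; simp
    rw [h3, norm_zero] at h2
    linarith
  refine ⟨min (c0 / 4) (c1 / Real.pi ^ 2), by positivity, fun y hy => ?_⟩
  rcases le_or_gt ‖y‖ ρ' with hyρ | hyρ
  · exact le_trans (by gcongr; exact min_le_left _ _) (near y hyρ)
  · refine le_trans ?_ (hfar y ⟨by simpa using hy, by simpa using hyρ.le⟩)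
    calc _ ≤ c1 / Real.pi ^ 2 * Real.pi ^ 2 := by gcongr; exact min_le_right _ _
      _ = c1 := by field_simp

/-! ### The symbol of the heat operator -/

/-- The symbol `1 - e^{-ĥ(y) + iθ}` of `1 - e^{-h₀} - e^{-h₀} ∂₀` on the unit lattice. -/
noncomputable def heatSymbol (h : (Fin 3 → ℤ) → ℂ) (θ : ℂ) (y : Fin 3 → ℂ) : ℂ :=
  1 - Complex.exp (-hatH h y + Complex.I * θ)

theorem diffHat_eq (L : ℕ) (h : (Fin 3 → ℤ) → ℂ) (n : ℕ) (p : Fin 4 → ℂ) :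
    diffHat L h n p = (L : ℂ) ^ (2 * n)
      * heatSymbol h (p 0 / (L : ℂ) ^ (2 * n)) fun ν => p ν.succ / (L : ℂ) ^ n := by
  rw [diffHat, heatSymbol, Complex.exp_add]
  ring

theorem norm_exp_sub_exp_le {M : ℝ} {a b : ℂ} (ha : a.re ≤ M) (hb : b.re ≤ M) :
    ‖Complex.exp a - Complex.exp b‖ ≤ Real.exp M * ‖a - b‖ := by
  refine (convex_halfSpace_re_le M).norm_image_sub_le_of_norm_deriv_le (𝕜 := ℂ)
    (fun x _ => Complex.differentiable_exp x) (fun x hx => ?_) hb ha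
  rw [Complex.deriv_exp, Complex.norm_exp]
  exact Real.exp_le_exp.mpr hx

/-- The factor max ‖y‖ ‖y'‖ comes from the vanishing gradient of ĥ at 0. It makes the bound
homogeneous under parabolic scaling, hence independent of n after rescaling. -/
theorem IsHamiltonian.exists_heatSymbol_sub_le {h : (Fin 3 → ℤ) → ℂ} (hh : IsHamiltonian h) :
    ∃ C : ℝ, 0 < C ∧ ∀ (θ θ' : ℂ) (y y' : Fin 3 → ℂ), |θ.im| ≤ 1 → |θ'.im| ≤ 1 → ‖y‖ ≤ 6 →
      ‖y'‖ ≤ 6 → ‖heatSymbol h θ y - heatSymbol h θ' y'‖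
        ≤ C * (‖θ - θ'‖ + max ‖y‖ ‖y'‖ * ‖y - y'‖) := by
  obtain ⟨C, hC0, hC⟩ := exists_quadratic_lipschitz hh.entire hh.fderiv_zero 6
  have hb : ∀ y : Fin 3 → ℂ, ‖y‖ ≤ 6 → ‖hatH h y‖ ≤ C * 36 := by
    intro y hy
    have := hC y 0 hy (by simp)
    rw [hh.map_zero, sub_zero, sub_zero, norm_zero, max_eq_left (norm_nonneg _)] at this
    refine this.trans ?_
    nlinarith [norm_nonneg y, mul_le_mul hy hy (norm_nonneg y) (by norm_num)]
  have hre : ∀ (θ : ℂ) (y : Fin 3 → ℂ), |θ.im| ≤ 1 → ‖y‖ ≤ 6 →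
      (-hatH h y + Complex.I * θ).re ≤ C * 36 + 1 := by
    intro θ y hθ hy
    have h1 := (abs_le.mp (Complex.abs_re_le_norm (hatH h y))).1
    have h2 := (abs_le.mp hθ).1
    have e : (-hatH h y + Complex.I * θ).re = -(hatH h y).re - θ.im := by simp; ring
    rw [e]
    linarith [hb y hy]
  refine ⟨Real.exp (C * 36 + 1) * (C + 1), by positivity, fun θ θ' y y' hθ hθ' hy hy' => ?_⟩
  have h1 := norm_exp_sub_exp_le (hre θ' y' hθ' hy') (hre θ y hθ hy)
  have e : heatSymbol h θ y - heatSymbol h θ' y' = Complex.exp (-hatH h y' + Complex.I * θ')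
      - Complex.exp (-hatH h y + Complex.I * θ) := by unfold heatSymbol; ring
  rw [e, mul_assoc]
  refine h1.trans (mul_le_mul_of_nonneg_left ?_ (Real.exp_pos _).le)
  have e2 : (-hatH h y' + Complex.I * θ') - (-hatH h y + Complex.I * θ)
      = (hatH h y - hatH h y') - Complex.I * (θ - θ') := by ring
  rw [e2]
  refine (norm_sub_le _ _).trans ?_
  rw [norm_mul, Complex.norm_I, one_mul]
  have h2 := hC y y' hy hy'
  have h3 : 0 ≤ max ‖y‖ ‖y'‖ * ‖y - y'‖ := by positivity
  nlinarith [norm_nonneg (θ - θ')]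

theorem heatSymbol_zero {h : (Fin 3 → ℤ) → ℂ} (hh : IsHamiltonian h) : heatSymbol h 0 0 = 0 := by
  simp [heatSymbol, hh.map_zero]

theorem IsHamiltonian.hatH_cvec {h : (Fin 3 → ℤ) → ℂ} (hh : IsHamiltonian h) (y : Fin 3 → ℝ) :
    hatH h (cvec y) = ((hatH h (cvec y)).re : ℂ) :=
  Complex.ext (by simp) ((hh.real y).trans (Complex.ofReal_im _).symm)

theorem heatSymbol_real {h : (Fin 3 → ℤ) → ℂ} (hh : IsHamiltonian h) (θ : ℝ) (y : Fin 3 → ℝ) :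
    heatSymbol h θ (cvec y)
      = 1 - (Real.exp (-(hatH h (cvec y)).re) : ℂ) * Complex.exp (θ * Complex.I) := by
  rw [heatSymbol, hh.hatH_cvec, Complex.exp_add, mul_comm Complex.I]
  simp

theorem heatSymbol_re_nonneg {h : (Fin 3 → ℤ) → ℂ} (hh : IsHamiltonian h) (θ : ℝ) (y : Fin 3 → ℝ) :
    0 ≤ (heatSymbol h θ (cvec y)).re := by
  rw [heatSymbol_real hh, Complex.sub_re, Complex.re_ofReal_mul, Complex.exp_ofReal_mul_I_re,
    Complex.one_re]
  have h1 : Real.exp (-(hatH h (cvec y)).re) ≤ 1 := Real.exp_le_one_iff.mpr (by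
    have := hh.nonneg y
    unfold cvec; linarith)
  nlinarith [Real.exp_pos (-(hatH h (cvec y)).re), Real.cos_le_one θ, Real.neg_one_le_cos θ]

/-- If cos θ ≤ 0 the real part is already at least 1. Otherwise rotate by -θ, which turns the
imaginary part into ∓ sin θ, whatever the value of r. -/
theorem abs_div_pi_le_norm_one_sub {r θ : ℝ} (hr : 0 ≤ r) (hθ : |θ| ≤ Real.pi) :
    |θ| / Real.pi ≤ ‖1 - (r : ℂ) * Complex.exp (θ * Complex.I)‖ := by
  have hpi := Real.pi_pos
  rcases le_or_gt (Real.cos θ) 0 with hc | hc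
  · have h1 := (le_abs_self _).trans
      (Complex.abs_re_le_norm (1 - (r : ℂ) * Complex.exp (θ * Complex.I)))
    rw [Complex.sub_re, Complex.re_ofReal_mul, Complex.exp_ofReal_mul_I_re, Complex.one_re] at h1
    have h2 : |θ| / Real.pi ≤ 1 := (div_le_one hpi).mpr hθ
    nlinarith
  · have hθ2 : |θ| ≤ Real.pi / 2 := by
      by_contra hcon
      push Not at hcon
      have := Real.cos_nonpos_of_pi_div_two_le_of_le hcon.le (by linarith)
      rw [Real.cos_abs] at this
      linarith
    have h1 : 1 - (r : ℂ) * Complex.exp (θ * Complex.I)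
        = Complex.exp (θ * Complex.I) * (Complex.exp ((-θ : ℝ) * Complex.I) - r) := by
      rw [mul_sub, ← Complex.exp_add]
      push_cast
      rw [neg_mul, add_neg_cancel, Complex.exp_zero]
      ring
    rw [h1, norm_mul, Complex.norm_exp_ofReal_mul_I, one_mul]
    have h2 := Complex.abs_im_le_norm (Complex.exp ((-θ : ℝ) * Complex.I) - r)
    rw [Complex.sub_im, Complex.exp_ofReal_mul_I_im, Complex.ofReal_im, sub_zero, Real.sin_neg,
      abs_neg] at h2
    refine le_trans ?_ ((Real.mul_abs_le_abs_sin hθ2).trans h2)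
    rw [div_eq_mul_inv, mul_comm, div_mul_eq_mul_div, div_eq_mul_inv]
    nlinarith [abs_nonneg θ, inv_pos.mpr hpi, mul_nonneg (abs_nonneg θ) (inv_pos.mpr hpi).le]

/-- The norm is bounded below by a multiple of |θ| and, through 1 - e^{-t} ≥ t/(1+T) with t = ĥ(y) ≤
T, by a multiple of ‖y‖². Half of each bound is kept. -/
theorem IsHamiltonian.exists_heatSymbol_ge {h : (Fin 3 → ℤ) → ℂ} (hh : IsHamiltonian h) :
    ∃ c : ℝ, 0 < c ∧ ∀ (θ : ℝ) (y : Fin 3 → ℝ), |θ| ≤ Real.pi → ‖y‖ ≤ Real.pi →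
      c * (|θ| + ‖y‖ ^ 2) ≤ ‖heatSymbol h θ (cvec y)‖ := by
  have hpi := Real.pi_pos
  obtain ⟨c, hc, hcy⟩ := hh.exists_re_ge
  obtain ⟨C, hC0, hC⟩ := exists_quadratic_lipschitz hh.entire hh.fderiv_zero Real.pi
  set T : ℝ := C * Real.pi * Real.pi with hT
  have hT0 : 0 ≤ T := by positivity
  refine ⟨min (1 / (2 * Real.pi)) (c / (2 * (1 + T))), by positivity, fun θ y hθ hy => ?_⟩
  set t := (hatH h (cvec y)).re with ht
  have ht0 : 0 ≤ t := hh.nonneg y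
  have htT : t ≤ T := by
    have h1 := hC (cvec y) 0 (by rwa [norm_cvec]) (by simpa using hpi.le)
    rw [hh.map_zero, sub_zero, sub_zero, norm_zero, max_eq_left (norm_nonneg _), norm_cvec] at h1
    refine ((le_abs_self _).trans (Complex.abs_re_le_norm _)).trans (h1.trans ?_)
    rw [hT]; gcongr
  have hE := heatSymbol_real hh θ y
  rw [← ht] at hE
  have h1 : |θ| / Real.pi ≤ ‖heatSymbol h θ (cvec y)‖ := by
    rw [hE]; exact abs_div_pi_le_norm_one_sub (Real.exp_pos _).le hθ
  have h2 : c * ‖y‖ ^ 2 / (1 + T) ≤ ‖heatSymbol h θ (cvec y)‖ := by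
    have h3 : 1 - Real.exp (-t) ≤ ‖heatSymbol h θ (cvec y)‖ := by
      rw [hE]
      have := norm_sub_norm_le (1 : ℂ) ((Real.exp (-t) : ℂ) * Complex.exp (θ * Complex.I))
      rw [norm_mul, Complex.norm_exp_ofReal_mul_I, Complex.norm_real, norm_one, mul_one,
        Real.norm_eq_abs, abs_of_pos (Real.exp_pos _)] at this
      exact this
    have h4 : t / (1 + T) ≤ 1 - Real.exp (-t) := by
      have h5 : Real.exp (-t) ≤ 1 / (1 + t) := by
        rw [Real.exp_neg, inv_eq_one_div]
        exact one_div_le_one_div_of_le (by linarith) (by linarith [Real.add_one_le_exp t])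
      have h6 : t / (1 + T) ≤ t / (1 + t) := by gcongr
      have h7 : t / (1 + t) = 1 - 1 / (1 + t) := by field_simp; ring
      linarith
    refine le_trans ?_ (h4.trans h3)
    gcongr
    exact hcy y hy
  have h8 : min (1 / (2 * Real.pi)) (c / (2 * (1 + T))) * |θ| ≤ |θ| / Real.pi / 2 := by
    calc _ ≤ 1 / (2 * Real.pi) * |θ| := by gcongr; exact min_le_left _ _
      _ = _ := by field_simp
  have h9 : min (1 / (2 * Real.pi)) (c / (2 * (1 + T))) * ‖y‖ ^ 2 ≤ c * ‖y‖ ^ 2 / (1 + T) / 2 := by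
    calc _ ≤ c / (2 * (1 + T)) * ‖y‖ ^ 2 := by gcongr; exact min_le_right _ _
      _ = _ := by field_simp
  rw [mul_add]
  linarith

theorem heatSymbol_add_two_pi (h : (Fin 3 → ℤ) → ℂ) (θ : ℂ) (y : Fin 3 → ℂ) (s : ℤ)
    (r : Fin 3 → ℤ) : heatSymbol h (θ + 2 * Real.pi * s) (fun ν => y ν + 2 * Real.pi * (r ν : ℂ))
      = heatSymbol h θ y := by
  unfold heatSymbol
  rw [hatH_add_two_pi]
  congr 1
  rw [Complex.exp_eq_exp_iff_exists_int]
  exact ⟨s, by ring⟩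

/-! ### Analyticity of the symbols -/

theorem analyticAt_coord (ν : Fin 4) (p : Fin 4 → ℂ) : AnalyticAt ℂ (fun p : Fin 4 → ℂ => p ν) p :=
  (ContinuousLinearMap.proj (R := ℂ) (φ := fun _ : Fin 4 => ℂ) ν).analyticAt p

theorem analyticAt_uN (L n : ℕ) (p : Fin 4 → ℂ) : AnalyticAt ℂ (uN L n) p := by
  unfold uN
  refine Finset.analyticAt_fun_prod _ fun ν _ => ?_
  have h1 : AnalyticAt ℂ (dirichletRatio (scaleFactor L ν ^ n)) (p ν / (scaleFactor L ν : ℂ) ^ n) :=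
    (differentiable_dirichletRatio _).analyticAt _
  exact h1.fun_comp (f := fun p : Fin 4 → ℂ => p ν / (scaleFactor L ν : ℂ) ^ n)
    ((analyticAt_coord ν p).div_const)

theorem analyticAt_comp_add_const {F : (Fin 4 → ℂ) → ℂ} {p b : Fin 4 → ℂ}
    (hF : AnalyticAt ℂ F (p + b)) : AnalyticAt ℂ (fun p => F (p + b)) p :=
  hF.fun_comp (f := fun p => p + b) (analyticAt_id.add analyticAt_const)

theorem analyticAt_diffHat {h : (Fin 3 → ℤ) → ℂ} (hh : IsHamiltonian h) (L n : ℕ)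
    (p : Fin 4 → ℂ) : AnalyticAt ℂ (diffHat L h n) p := by
  have h1 : AnalyticAt ℂ (fun p : Fin 4 → ℂ => hatH h fun ν => p ν.succ / (L : ℂ) ^ n) p := by
    refine (hh.entire _ (Set.mem_univ _)).fun_comp
      (f := fun p : Fin 4 → ℂ => fun ν : Fin 3 => p ν.succ / (L : ℂ) ^ n) ?_
    rw [analyticAt_pi_iff]
    exact fun ν => (analyticAt_coord ν.succ p).div_const
  have h2 : AnalyticAt ℂ (fun p : Fin 4 → ℂ => Complex.exp (-(hatH h fun ν =>
      p ν.succ / (L : ℂ) ^ n))) p := h1.fun_neg.cexp'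
  have h3 : AnalyticAt ℂ (fun p : Fin 4 → ℂ =>
      Complex.exp (Complex.I * (p 0 / (L : ℂ) ^ (2 * n)))) p :=
    (analyticAt_const.fun_mul (analyticAt_coord 0 p).div_const).cexp'
  unfold diffHat
  exact analyticAt_const.fun_mul
    ((analyticAt_const.fun_sub h2).fun_sub (h2.fun_mul (h3.fun_sub analyticAt_const)))

/-! ### Perturbation of the imaginary part -/

/-- The real part of a momentum. -/
def rePart (p : Fin 4 → ℂ) : Fin 4 → ℂ := fun ν => ((p ν).re : ℂ)

theorem isReal_rePart (p : Fin 4 → ℂ) : IsRealMomentum (rePart p) := fun _ => Complex.ofReal_im _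

/-- The Schwarz lemma on the complex line τ ↦ Re p + iτ Im p: on |τ| < m/t the function F stays
bounded by C, so between τ = 0 and τ = 1 it moves by at most 2C t/m. Complex τ also displaces the
real parts, by at most m ≤ 1, hence the hypotheses on the larger range |Re p| ≤ 5. -/
theorem norm_sub_rePart_le {F : (Fin 4 → ℂ) → ℂ} {m C t : ℝ} (hm1 : m ≤ 1)
    (hF : ∀ p : Fin 4 → ℂ, (∀ ν, |(p ν).re| ≤ 5) → (∀ ν, |(p ν).im| ≤ m) →
      DifferentiableAt ℂ F p ∧ ‖F p‖ ≤ C)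
    {p : Fin 4 → ℂ} (hre : ∀ ν, |(p ν).re| ≤ Real.pi) (him : ∀ ν, |(p ν).im| ≤ t)
    (ht : 0 < t) (htm : t < m) : ‖F p - F (rePart p)‖ ≤ 2 * C / m * t := by
  have hm : 0 < m := ht.trans htm
  set γ : ℂ → Fin 4 → ℂ := fun τ ν => ((p ν).re : ℂ) + τ * ((p ν).im * Complex.I) with hγ
  have hγd : Differentiable ℂ γ := by
    rw [differentiable_pi]
    intro ν
    simp only [hγ]
    fun_prop
  have hγ1 : γ 1 = p := by
    funext ν
    simp only [hγ, one_mul, Complex.re_add_im]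
  have hγ0 : γ 0 = rePart p := by
    funext ν
    simp [hγ, rePart]
  have hmem : ∀ τ ∈ Metric.ball (0 : ℂ) (m / t), (∀ ν, |(γ τ ν).re| ≤ 5) ∧
      ∀ ν, |(γ τ ν).im| ≤ m := by
    intro τ hτ
    rw [mem_ball_zero_iff] at hτ
    have hτ' : ‖τ‖ * t ≤ m := by rw [lt_div_iff₀ ht] at hτ; exact hτ.le
    have hb : ∀ ν, ‖τ‖ * |(p ν).im| ≤ m := fun ν =>
      (mul_le_mul_of_nonneg_left (him ν) (norm_nonneg _)).trans hτ'
    constructor <;> intro ν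
    · have e : (γ τ ν).re = (p ν).re - τ.im * (p ν).im := by simp [hγ]; ring
      rw [e]
      have h1 : |τ.im * (p ν).im| ≤ m := by
        rw [abs_mul]
        exact (mul_le_mul_of_nonneg_right (Complex.abs_im_le_norm τ) (abs_nonneg _)).trans (hb ν)
      linarith [abs_sub ((p ν).re) (τ.im * (p ν).im), hre ν, Real.pi_lt_d2]
    · have e : (γ τ ν).im = τ.re * (p ν).im := by simp [hγ]
      rw [e, abs_mul]
      exact (mul_le_mul_of_nonneg_right (Complex.abs_re_le_norm τ) (abs_nonneg _)).trans (hb ν)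
  have hC : ∀ τ ∈ Metric.ball (0 : ℂ) (m / t), ‖F (γ τ)‖ ≤ C := fun τ hτ =>
    (hF _ (hmem τ hτ).1 (hmem τ hτ).2).2
  have h0 : (0 : ℂ) ∈ Metric.ball (0 : ℂ) (m / t) := by
    rw [mem_ball_zero_iff, norm_zero]; positivity
  have key := Complex.dist_le_div_mul_dist_of_mapsTo_ball (f := fun τ => F (γ τ)) (c := 0)
    (z := 1) (R₁ := m / t) (R₂ := 2 * C)
    (fun τ hτ => ((hF _ (hmem τ hτ).1 (hmem τ hτ).2).1.comp τ
      hγd.differentiableAt).differentiableWithinAt)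
    (fun τ hτ => by
      rw [mem_closedBall_iff_norm]
      refine (norm_sub_le _ _).trans ?_
      linarith [hC τ hτ, hC 0 h0])
    (by rw [mem_ball_zero_iff, norm_one, lt_div_iff₀ ht]; linarith)
  simp only [dist_eq_norm, hγ1, hγ0, sub_zero, norm_one, mul_one] at key
  refine key.trans (le_of_eq ?_)
  field_simp

/-! ### Estimates on the symbol of `D_n` -/

theorem scaleFactor_zero (L : ℕ) : scaleFactor L 0 = L ^ 2 := by simp [scaleFactor]

theorem scaleFactor_succ (L : ℕ) (ν : Fin 3) : scaleFactor L ν.succ = L := by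
  simp [scaleFactor, Fin.succ_ne_zero]

theorem diffHat_latticePeriodic {L : ℕ} (hL : 0 < L) (h : (Fin 3 → ℤ) → ℂ) (n : ℕ) :
    LatticePeriodic L n (diffHat L h n) := by
  intro p s
  have hL0 : (L : ℂ) ≠ 0 := by exact_mod_cast hL.ne'
  rw [diffHat_eq, diffHat_eq, ← heatSymbol_add_two_pi h (p 0 / (L : ℂ) ^ (2 * n)) _ (s 0)
    (fun ν => s ν.succ)]
  congr 2
  · simp only [Pi.add_apply, latticeVec, scaleFactor_zero]
    push_cast
    rw [← pow_mul]
    field_simp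
  · funext ν
    simp only [Pi.add_apply, latticeVec, scaleFactor_succ]
    push_cast
    field_simp

theorem norm_space_div {L : ℕ} (p : Fin 3 → ℂ) (n : ℕ) :
    ‖fun ν => p ν / (L : ℂ) ^ n‖ = ‖p‖ / (L : ℝ) ^ n := by
  have : (fun ν => p ν / (L : ℂ) ^ n) = ((L : ℂ) ^ n)⁻¹ • p := by
    funext ν; simp [div_eq_inv_mul]
  rw [this, norm_smul, norm_inv, norm_pow, Complex.norm_natCast, div_eq_inv_mul]

/-- The prefactor L²ⁿ is cancelled exactly by time momenta divided by L²ⁿ and by two factors of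
space momenta divided by Lⁿ, so C sees neither L nor n. -/
theorem IsHamiltonian.exists_diffHat_sub_le {h : (Fin 3 → ℤ) → ℂ} (hh : IsHamiltonian h) :
    ∃ C : ℝ, 0 < C ∧ ∀ L : ℕ, 0 < L → ∀ (n : ℕ) (p p' : Fin 4 → ℂ),
      |(p 0).im| ≤ 1 → |(p' 0).im| ≤ 1 → ‖Fin.tail p‖ ≤ 6 * (L : ℝ) ^ n →
      ‖Fin.tail p'‖ ≤ 6 * (L : ℝ) ^ n →
      ‖diffHat L h n p - diffHat L h n p'‖
        ≤ C * (‖p 0 - p' 0‖ + max ‖Fin.tail p‖ ‖Fin.tail p'‖ * ‖Fin.tail p - Fin.tail p'‖) := by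
  obtain ⟨C, hC0, hC⟩ := hh.exists_heatSymbol_sub_le
  refine ⟨C, hC0, fun L hL n p p' h1 h2 h3 h4 => ?_⟩
  have hL1 : (1 : ℝ) ≤ L := by exact_mod_cast hL
  have hP : (1 : ℝ) ≤ (L : ℝ) ^ (2 * n) := one_le_pow₀ hL1
  have hPn : (0 : ℝ) < (L : ℝ) ^ n := by positivity
  have him : ∀ z : ℂ, |z.im| ≤ 1 → |(z / (L : ℂ) ^ (2 * n)).im| ≤ 1 := by
    intro z hz
    have : (z / (L : ℂ) ^ (2 * n)).im = z.im / (L : ℝ) ^ (2 * n) := by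
      rw [← Complex.div_ofReal_im]; push_cast; rfl
    rw [this, abs_div, abs_of_pos (by positivity : (0 : ℝ) < (L : ℝ) ^ (2 * n))]
    exact (div_le_self (abs_nonneg _) hP).trans hz
  have key := hC (p 0 / (L : ℂ) ^ (2 * n)) (p' 0 / (L : ℂ) ^ (2 * n))
    (fun ν => Fin.tail p ν / (L : ℂ) ^ n) (fun ν => Fin.tail p' ν / (L : ℂ) ^ n)
    (him _ h1) (him _ h2)
    (by rw [norm_space_div, div_le_iff₀ hPn]; exact h3)
    (by rw [norm_space_div, div_le_iff₀ hPn]; exact h4)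
  have e1 : ((fun ν => Fin.tail p ν / (L : ℂ) ^ n) - fun ν => Fin.tail p' ν / (L : ℂ) ^ n)
      = fun ν => (Fin.tail p - Fin.tail p') ν / (L : ℂ) ^ n := by
    funext ν; simp [sub_div]
  rw [e1, norm_space_div, norm_space_div, norm_space_div, ← sub_div, norm_div, norm_pow,
    Complex.norm_natCast, max_div_div_right hPn.le] at key
  rw [diffHat_eq, diffHat_eq, ← mul_sub, norm_mul, norm_pow, Complex.norm_natCast]
  calc _ ≤ (L : ℝ) ^ (2 * n) * _ := mul_le_mul_of_nonneg_left key (by positivity)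
    _ = _ := by
      have : (L : ℝ) ^ (2 * n) = (L : ℝ) ^ n * (L : ℝ) ^ n := by rw [two_mul, pow_add]
      rw [this]
      field_simp

theorem IsHamiltonian.exists_diffHat_ge {h : (Fin 3 → ℤ) → ℂ} (hh : IsHamiltonian h) :
    ∃ c : ℝ, 0 < c ∧ ∀ L : ℕ, 0 < L → ∀ (n : ℕ) (p : Fin 4 → ℂ), IsRealMomentum p →
      (∀ ν, |(p ν).re| ≤ Real.pi * ((scaleFactor L ν ^ n : ℕ) : ℝ)) →
      c * (‖p 0‖ + ‖Fin.tail p‖ ^ 2) ≤ ‖diffHat L h n p‖ := by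
  obtain ⟨c, hc0, hc⟩ := hh.exists_heatSymbol_ge
  refine ⟨c, hc0, fun L hL n p hp hre => ?_⟩
  have hL1 : (0 : ℝ) < L := by exact_mod_cast hL
  have hre0 : |(p 0).re| ≤ Real.pi * (L : ℝ) ^ (2 * n) := by
    have := hre 0
    rw [scaleFactor_zero] at this
    push_cast at this
    rwa [← pow_mul] at this
  have hres : ∀ ν : Fin 3, |(p ν.succ).re| ≤ Real.pi * (L : ℝ) ^ n := by
    intro ν
    have := hre ν.succ
    rw [scaleFactor_succ] at this
    push_cast at this
    exact this
  have e0 : p 0 / (L : ℂ) ^ (2 * n) = (((p 0).re / (L : ℝ) ^ (2 * n) : ℝ) : ℂ) := by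
    have : p 0 = ((p 0).re : ℂ) := Complex.ext (by simp) (by simp [hp 0])
    rw [this]; push_cast; simp
  have e1 : (fun ν : Fin 3 => p ν.succ / (L : ℂ) ^ n)
      = cvec fun ν => (p ν.succ).re / (L : ℝ) ^ n := by
    funext ν
    have : p ν.succ = ((p ν.succ).re : ℂ) := Complex.ext (by simp) (by simp [hp ν.succ])
    rw [this]; simp [cvec]
  have e2 : ‖fun ν : Fin 3 => (p ν.succ).re / (L : ℝ) ^ n‖ = ‖Fin.tail p‖ / (L : ℝ) ^ n := by
    rw [← norm_cvec, ← e1]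
    exact norm_space_div (Fin.tail p) n
  have e3 : ‖p 0‖ = |(p 0).re| := by
    have : p 0 = ((p 0).re : ℂ) := Complex.ext (by simp) (by simp [hp 0])
    rw [this, Complex.norm_real, Complex.ofReal_re, Real.norm_eq_abs]
  have key := hc ((p 0).re / (L : ℝ) ^ (2 * n)) (fun ν => (p ν.succ).re / (L : ℝ) ^ n)
    (by rw [abs_div, abs_of_pos (by positivity : (0 : ℝ) < (L : ℝ) ^ (2 * n)),
      div_le_iff₀ (by positivity)]; exact hre0)
    (by
      rw [pi_norm_le_iff_of_nonneg Real.pi_pos.le]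
      intro ν
      rw [Real.norm_eq_abs, abs_div, abs_of_pos (by positivity : (0 : ℝ) < (L : ℝ) ^ n),
        div_le_iff₀ (by positivity)]
      exact hres ν)
  rw [e2, abs_div, abs_of_pos (by positivity : (0 : ℝ) < (L : ℝ) ^ (2 * n)), ← e3] at key
  rw [diffHat_eq, e0, e1, norm_mul, norm_pow, Complex.norm_natCast]
  calc _ = (L : ℝ) ^ (2 * n) * (c * (‖p 0‖ / (L : ℝ) ^ (2 * n)
        + (‖Fin.tail p‖ / (L : ℝ) ^ n) ^ 2)) := by
        rw [div_pow, ← pow_mul, mul_comm n 2]; field_simp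
    _ ≤ _ := mul_le_mul_of_nonneg_left key (by positivity)

theorem diffHat_re_nonneg {h : (Fin 3 → ℤ) → ℂ} (hh : IsHamiltonian h) (L n : ℕ)
    {p : Fin 4 → ℂ} (hp : IsRealMomentum p) : 0 ≤ (diffHat L h n p).re := by
  have e0 : p 0 / (L : ℂ) ^ (2 * n) = (((p 0).re / (L : ℝ) ^ (2 * n) : ℝ) : ℂ) := by
    have : p 0 = ((p 0).re : ℂ) := Complex.ext (by simp) (by simp [hp 0])
    rw [this]; push_cast; simp
  have e1 : (fun ν : Fin 3 => p ν.succ / (L : ℂ) ^ n)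
      = cvec fun ν => (p ν.succ).re / (L : ℝ) ^ n := by
    funext ν
    have : p ν.succ = ((p ν.succ).re : ℂ) := Complex.ext (by simp) (by simp [hp ν.succ])
    rw [this]; simp [cvec]
  rw [diffHat_eq, e0, e1, show (L : ℂ) ^ (2 * n) = (((L : ℝ) ^ (2 * n) : ℝ) : ℂ) by push_cast; rfl,
    Complex.re_ofReal_mul]
  exact mul_nonneg (by positivity) (heatSymbol_re_nonneg hh _ _)

theorem exists_center {L : ℕ} (hL : 0 < L) (n : ℕ) (p : Fin 4 → ℂ) :
    ∃ s : Fin 4 → ℤ, ∀ ν,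
      |((p + latticeVec fun ν => ((scaleFactor L ν ^ n : ℕ) : ℤ) * s ν) ν).re|
        ≤ Real.pi * ((scaleFactor L ν ^ n : ℕ) : ℝ) := by
  obtain ⟨s, hs⟩ := exists_add_latticeVec_re_le
    (fun ν => p ν / (((scaleFactor L ν ^ n : ℕ) : ℝ) : ℂ))
  refine ⟨s, fun ν => ?_⟩
  have hN : (0 : ℝ) < ((scaleFactor L ν ^ n : ℕ) : ℝ) := by
    exact_mod_cast pow_pos (scaleFactor_pos hL ν) n
  have h1 := (hs ν).1
  have e : (p + latticeVec fun ν => ((scaleFactor L ν ^ n : ℕ) : ℤ) * s ν) ν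
      = (((scaleFactor L ν ^ n : ℕ) : ℝ) : ℂ)
        * (((fun ν => p ν / (((scaleFactor L ν ^ n : ℕ) : ℝ) : ℂ)) + latticeVec s) ν) := by
    have hN' : (((scaleFactor L ν ^ n : ℕ) : ℝ) : ℂ) ≠ 0 := by exact_mod_cast hN.ne'
    simp only [Pi.add_apply, latticeVec]
    rw [mul_add, mul_div_cancel₀ _ hN']
    push_cast
    ring
  rw [e, Complex.re_ofReal_mul, abs_mul, abs_of_pos hN, mul_comm]
  gcongr

theorem latticeVec_im (r : Fin 4 → ℤ) (ν : Fin 4) : (latticeVec r ν).im = 0 := by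
  have : latticeVec r ν = ((2 * Real.pi * r ν : ℝ) : ℂ) := by simp [latticeVec]
  rw [this, Complex.ofReal_im]

theorem latticeVec_re (r : Fin 4 → ℤ) (ν : Fin 4) : (latticeVec r ν).re = 2 * Real.pi * r ν := by
  have : latticeVec r ν = ((2 * Real.pi * r ν : ℝ) : ℂ) := by simp [latticeVec]
  rw [this, Complex.ofReal_re]

theorem momentum_eq_latticeVec {L n : ℕ} (l : DualCell L n) :
    l.momentum = latticeVec fun ν => ((l ν : ℕ) : ℤ) := by
  funext ν; simp [DualCell.momentum, latticeVec]

theorem momentum_im {L n : ℕ} (l : DualCell L n) (ν : Fin 4) : (l.momentum ν).im = 0 := by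
  rw [momentum_eq_latticeVec, latticeVec_im]

/-- A nonzero index stays at distance at least 1 from every multiple of N, and 2π - 5 ≥ 1. So no
period brings the momentum p + ℓ, ℓ ≠ 0, close to the zero of D̂_n. -/
theorem one_le_abs_re_of_cell {N j : ℕ} (hj : j < N) (hj0 : j ≠ 0) {x : ℝ} (hx : |x| ≤ 5) (s : ℤ) :
    1 ≤ |x + 2 * Real.pi * j + 2 * Real.pi * (N * s)| := by
  have h1 := min_le_abs_sub_mul hj (-s)
  have h2 : (1 : ℝ) ≤ ((min j (N - j) : ℕ) : ℝ) := by
    have : 1 ≤ min j (N - j) := by omega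
    exact_mod_cast this
  have h3 := h2.trans h1
  have hpi := Real.pi_gt_d2
  have e : x + 2 * Real.pi * j + 2 * Real.pi * (N * s)
      = 2 * Real.pi * ((j : ℝ) - (-s : ℤ) * N) - (-x) := by push_cast; ring
  rw [e]
  have h5 := abs_sub_abs_le_abs_sub (2 * Real.pi * ((j : ℝ) - (-s : ℤ) * N)) (-x)
  rw [abs_neg, abs_mul, abs_of_pos (by positivity : 0 < 2 * Real.pi)] at h5
  nlinarith

theorem norm_tail_le {p : Fin 4 → ℂ} {R : ℝ} (hR : 0 ≤ R) (h : ∀ ν, ‖p ν‖ ≤ R) :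
    ‖Fin.tail p‖ ≤ R := by
  rw [pi_norm_le_iff_of_nonneg hR]
  exact fun ν => h ν.succ

theorem norm_sub_rePart_apply (p : Fin 4 → ℂ) (ν : Fin 4) : ‖p ν - rePart p ν‖ = |(p ν).im| := by
  have : p ν - rePart p ν = (p ν).im * Complex.I := by
    simp only [rePart]
    nth_rw 1 [← Complex.re_add_im (p ν)]
    ring
  rw [this, norm_mul, Complex.norm_I, mul_one, Complex.norm_real, Real.norm_eq_abs]

theorem IsHamiltonian.exists_diffHat_sub_rePart_le {h : (Fin 3 → ℤ) → ℂ} (hh : IsHamiltonian h) :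
    ∃ C : ℝ, 0 < C ∧ ∀ L : ℕ, 0 < L → ∀ (n : ℕ) (p : Fin 4 → ℂ) (t : ℝ), t ≤ 1 →
      |(p 0).im| ≤ 1 → (∀ ν : Fin 3, |(p ν.succ).im| ≤ t) →
      (∀ ν, |(p ν).re| ≤ Real.pi * ((scaleFactor L ν ^ n : ℕ) : ℝ)) →
      ‖diffHat L h n p - diffHat L h n (rePart p)‖
        ≤ C * (|(p 0).im| + (‖Fin.tail (rePart p)‖ + t) * t) := by
  obtain ⟨C, hC0, hC⟩ := hh.exists_diffHat_sub_le
  refine ⟨C, hC0, fun L hL n p t ht1 h0 hs hre => ?_⟩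
  have hL1 : (1 : ℝ) ≤ L := by exact_mod_cast hL
  have hP : (1 : ℝ) ≤ (L : ℝ) ^ n := one_le_pow₀ hL1
  have ht0 : 0 ≤ t := (abs_nonneg _).trans (hs 0)
  have hsub : ‖Fin.tail p - Fin.tail (rePart p)‖ ≤ t := by
    rw [pi_norm_le_iff_of_nonneg ht0]
    intro ν
    exact (norm_sub_rePart_apply p ν.succ).le.trans (hs ν)
  have hr : ‖Fin.tail (rePart p)‖ ≤ Real.pi * (L : ℝ) ^ n := by
    have := Real.pi_pos
    rw [pi_norm_le_iff_of_nonneg (by positivity)]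
    intro ν
    have := hre ν.succ
    rw [scaleFactor_succ] at this
    push_cast at this
    rw [Fin.tail, rePart, Complex.norm_real]
    exact this
  have hn : ‖Fin.tail p‖ ≤ ‖Fin.tail (rePart p)‖ + t := by
    have := norm_sub_norm_le (Fin.tail p) (Fin.tail (rePart p))
    linarith
  have hpi := Real.pi_lt_d2
  have key := hC L hL n p (rePart p) h0 (by simp [rePart]) (by nlinarith) (by nlinarith)
  refine key.trans (mul_le_mul_of_nonneg_left ?_ hC0.le)
  rw [norm_sub_rePart_apply]
  gcongr
  exact max_le hn (by linarith)

/-- After centring modulo the periods, some component of Re (p + ℓ) has size at least 1. The lower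
bound at the real part then grows quadratically in the spatial momentum, while the cost of the
imaginary part grows only linearly, so a small strip suffices for all ℓ ≠ 0, all n and all L. -/
theorem IsHamiltonian.exists_diffHat_cell_ge {h : (Fin 3 → ℤ) → ℂ} (hh : IsHamiltonian h) :
    ∃ m c : ℝ, 0 < m ∧ m ≤ 1 ∧ 0 < c ∧ ∀ L : ℕ, 0 < L → ∀ (n : ℕ) (p : Fin 4 → ℂ),
      (∀ ν, |(p ν).re| ≤ 5) → (∀ ν, |(p ν).im| ≤ m) → ∀ l : DualCell L n,
      (∃ ν, (l ν : ℕ) ≠ 0) → c ≤ ‖diffHat L h n (p + l.momentum)‖ := by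
  obtain ⟨c, hc0, hc⟩ := hh.exists_diffHat_ge
  obtain ⟨C, hC0, hC⟩ := hh.exists_diffHat_sub_rePart_le
  refine ⟨min 1 (c / (8 * C)), c / 4, by positivity, min_le_left _ _, by positivity,
    fun L hL n p hre him l hl => ?_⟩
  set m := min 1 (c / (8 * C)) with hm
  have hm0 : 0 < m := by positivity
  have hm1 : m ≤ 1 := min_le_left _ _
  have hmC : C * m ≤ c / 8 := by
    have : m ≤ c / (8 * C) := min_le_right _ _
    rw [le_div_iff₀ (by positivity)] at this
    linarith
  obtain ⟨s, hs⟩ := exists_center hL n (p + l.momentum)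
  rw [← diffHat_latticePeriodic hL h n (p + l.momentum) s]
  set q := p + l.momentum + latticeVec fun ν => ((scaleFactor L ν ^ n : ℕ) : ℤ) * s ν with hq
  have hqim : ∀ ν, (q ν).im = (p ν).im := by
    intro ν
    simp [hq, momentum_im, latticeVec_im]
  have hqim' : ∀ ν, |(q ν).im| ≤ m := fun ν => by rw [hqim]; exact him ν
  have hlow := hc L hL n (rePart q) (isReal_rePart q) (fun ν => by simpa [rePart] using hs ν)
  have hdiff := hC L hL n q m hm1 ((hqim' 0).trans hm1) (fun ν => hqim' ν.succ) hs
  set X := ‖rePart q 0‖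
  set Y := ‖Fin.tail (rePart q)‖
  have hX0 : 0 ≤ X := norm_nonneg _
  have hY0 : 0 ≤ Y := norm_nonneg _
  have hXY : 1 ≤ X ∨ 1 ≤ Y := by
    obtain ⟨ν, hν⟩ := hl
    have h1 := one_le_abs_re_of_cell (l ν).isLt hν (hre ν) (s ν)
    have e : (q ν).re = (p ν).re + 2 * Real.pi * ((l ν : ℕ) : ℝ)
        + 2 * Real.pi * (((scaleFactor L ν ^ n : ℕ) : ℝ) * s ν) := by
      simp [hq, momentum_eq_latticeVec, latticeVec_re]
    rw [← e] at h1
    have h2 : 1 ≤ ‖rePart q ν‖ := by simpa [rePart] using h1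
    rcases Fin.eq_zero_or_eq_succ ν with rfl | ⟨j, rfl⟩
    · exact Or.inl h2
    · exact Or.inr (h2.trans (norm_le_pi_norm (Fin.tail (rePart q)) j))
  -- The gain in the form in which it beats the error term, which is a small multiple of 2 + Y.
  have h1 : (2 + Y) / 4 ≤ X + Y ^ 2 := by
    rcases hXY with h | h <;> nlinarith [sq_nonneg (Y - 1 / 8)]
  have h2 : C * (|(q 0).im| + (Y + m) * m) ≤ c / 8 * (2 + Y) := by
    have h3 : |(q 0).im| + (Y + m) * m ≤ m * (2 + Y) := by
      have := hqim' 0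
      nlinarith
    calc _ ≤ C * (m * (2 + Y)) := by gcongr
      _ = C * m * (2 + Y) := by ring
      _ ≤ _ := by gcongr
  have h4 := norm_sub_norm_le (diffHat L h n (rePart q)) (diffHat L h n q)
  rw [norm_sub_rev] at h4
  nlinarith

theorem IsHamiltonian.exists_diffHat_le {h : (Fin 3 → ℤ) → ℂ} (hh : IsHamiltonian h) :
    ∃ C : ℝ, 0 < C ∧ ∀ L : ℕ, 0 < L → ∀ (n : ℕ) (p : Fin 4 → ℂ),
      (∀ ν, |(p ν).re| ≤ 5) → (∀ ν, |(p ν).im| ≤ 1) →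
      ‖diffHat L h n p‖ ≤ C * (‖p 0‖ + ‖Fin.tail p‖ ^ 2) := by
  obtain ⟨C, hC0, hC⟩ := hh.exists_diffHat_sub_le
  refine ⟨C, hC0, fun L hL n p hre him => ?_⟩
  have hL1 : (1 : ℝ) ≤ L := by exact_mod_cast hL
  have hP : (1 : ℝ) ≤ (L : ℝ) ^ n := one_le_pow₀ hL1
  have hn : ‖Fin.tail p‖ ≤ 6 := norm_tail_le (by norm_num) fun ν => by
    have := Complex.norm_le_abs_re_add_abs_im (p ν)
    linarith [hre ν, him ν]
  have e0 : Fin.tail (0 : Fin 4 → ℂ) = 0 := rfl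
  have key := hC L hL n p 0 (him 0) (by simp) (by nlinarith) (by rw [e0, norm_zero]; positivity)
  have hz : diffHat L h n 0 = 0 := by
    rw [diffHat_eq]
    have : (fun ν : Fin 3 => (0 : Fin 4 → ℂ) ν.succ / (L : ℂ) ^ n) = 0 := by funext ν; simp
    rw [this, Pi.zero_apply, zero_div, heatSymbol_zero hh, mul_zero]
  rw [hz, e0] at key
  simp only [sub_zero, Pi.zero_apply, norm_zero, max_eq_left (norm_nonneg _)] at key
  rw [pow_two]
  exact key

/-! ### The symbol of `𝔔_n` -/

/-- The denominator of the symbol of `𝔔_n`. -/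
noncomputable def frakDen (L 𝔮 n : ℕ) (k : Fin 4 → ℂ) : ℂ :=
  1 + ∑ j ∈ Finset.Icc 1 (n - 1), ∑ l : DualCell L j,
    ((L : ℂ) ^ (2 * j))⁻¹ * uN L j (k + l.momentum) ^ (2 * 𝔮)

theorem frakQHat_eq (L 𝔮 : ℕ) (a : ℝ) (n : ℕ) (k : Fin 4 → ℂ) :
    frakQHat L 𝔮 a n k = a * (frakDen L 𝔮 n k)⁻¹ := rfl

/-- The bound for `∑_ℓ |u_n(p + ℓ)|^r`. -/
noncomputable def cellBound (r : ℕ) : ℝ := (14 ^ 4) ^ r * 256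

theorem cellBound_pos (r : ℕ) : 0 < cellBound r := by unfold cellBound; positivity

theorem sum_Icc_inv_pow_le {L : ℕ} (hL : 1 < L) (m : ℕ) :
    ∑ j ∈ Finset.Icc 1 m, ((L : ℝ) ^ (2 * j))⁻¹ ≤ 2 * (L : ℝ)⁻¹ := by
  have hL2 : (2 : ℝ) ≤ L := by exact_mod_cast hL
  have h : ∑ j ∈ Finset.Icc 1 m, ((L : ℝ) ^ (2 * j))⁻¹ ≤ 2 * (L : ℝ)⁻¹ - 2 * ((L : ℝ) ^ (2 * m + 1))⁻¹ := by
    induction m with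
    | zero => simp
    | succ m ih =>
      rw [Finset.sum_Icc_succ_top (by omega)]
      have : ((L : ℝ) ^ (2 * (m + 1)))⁻¹ ≤ 2 * ((L : ℝ) ^ (2 * m + 1))⁻¹
          - 2 * ((L : ℝ) ^ (2 * (m + 1) + 1))⁻¹ := by
        have e1 : (L : ℝ) ^ (2 * (m + 1)) = (L : ℝ) ^ (2 * m + 1) * L := by ring
        have e2 : (L : ℝ) ^ (2 * (m + 1) + 1) = (L : ℝ) ^ (2 * m + 1) * (L * L) := by ring
        rw [e1, e2, mul_inv, mul_inv]
        have hX : 0 < ((L : ℝ) ^ (2 * m + 1))⁻¹ := by positivity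
        have hi : (L : ℝ)⁻¹ + 2 * (L * L : ℝ)⁻¹ ≤ 2 := by
          have h1 : (L : ℝ)⁻¹ ≤ 2⁻¹ := by gcongr
          have h2 : (L * L : ℝ)⁻¹ ≤ (2 * 2)⁻¹ := by gcongr
          linarith
        nlinarith
      linarith
  have : 0 ≤ ((L : ℝ) ^ (2 * m + 1))⁻¹ := by positivity
  linarith

theorem norm_frakDen_sub_one_le {L : ℕ} (hL : Odd L) (hL1 : 1 < L) {𝔮 : ℕ} (hq : 1 ≤ 𝔮) (n : ℕ)
    {k : Fin 4 → ℂ} (him : ∀ ν, |(k ν).im| ≤ 1) :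
    ‖frakDen L 𝔮 n k - 1‖ ≤ 2 * cellBound (2 * 𝔮) * (L : ℝ)⁻¹ := by
  rw [frakDen, add_sub_cancel_left]
  calc _ ≤ ∑ j ∈ Finset.Icc 1 (n - 1), ((L : ℝ) ^ (2 * j))⁻¹ * cellBound (2 * 𝔮) := by
        refine (norm_sum_le _ _).trans (Finset.sum_le_sum fun j _ => ?_)
        rw [← Finset.mul_sum, norm_mul, norm_inv, norm_pow, Complex.norm_natCast]
        gcongr
        refine (norm_sum_le _ _).trans ?_
        simp_rw [norm_pow]
        exact sum_norm_uN_pow_le hL j (by omega) him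
    _ = cellBound (2 * 𝔮) * ∑ j ∈ Finset.Icc 1 (n - 1), ((L : ℝ) ^ (2 * j))⁻¹ := by
        rw [Finset.mul_sum]; exact Finset.sum_congr rfl fun _ _ => mul_comm _ _
    _ ≤ cellBound (2 * 𝔮) * (2 * (L : ℝ)⁻¹) := by
        gcongr
        · exact (cellBound_pos _).le
        · exact sum_Icc_inv_pow_le hL1 _
    _ = _ := by ring

/-- Source of the threshold Γ₂: the weights L⁻²ʲ sum to at most 2/L, and each inner sum over ℓ is at
most `cellBound (2 * 𝔮)`. -/
theorem norm_frakDen_sub_one_le_half {L : ℕ} (hL : Odd L) (hL1 : 1 < L) {𝔮 : ℕ} (hq : 1 ≤ 𝔮)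
    (hΓ : 4 * cellBound (2 * 𝔮) < L) (n : ℕ) {k : Fin 4 → ℂ} (him : ∀ ν, |(k ν).im| ≤ 1) :
    ‖frakDen L 𝔮 n k - 1‖ ≤ 1 / 2 := by
  refine (norm_frakDen_sub_one_le hL hL1 hq n him).trans ?_
  have hL0 : (0 : ℝ) < L := by exact_mod_cast hL.pos
  rw [← div_eq_mul_inv, div_le_iff₀ hL0]
  linarith

theorem frakDen_bounds {L : ℕ} (hL : Odd L) (hL1 : 1 < L) {𝔮 : ℕ} (hq : 1 ≤ 𝔮)
    (hΓ : 4 * cellBound (2 * 𝔮) < L) (n : ℕ) {k : Fin 4 → ℂ} (him : ∀ ν, |(k ν).im| ≤ 1) :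
    1 / 2 ≤ ‖frakDen L 𝔮 n k‖ ∧ ‖frakDen L 𝔮 n k‖ ≤ 3 / 2 := by
  have h := norm_frakDen_sub_one_le_half hL hL1 hq hΓ n him
  have h1 := norm_sub_norm_le (frakDen L 𝔮 n k) 1
  have h2 := norm_sub_norm_le 1 (frakDen L 𝔮 n k)
  rw [norm_sub_rev] at h2
  rw [norm_one] at h1 h2
  constructor <;> linarith

theorem frakDen_real {L : ℕ} (hL : Odd L) (𝔮 n : ℕ) {k : Fin 4 → ℂ} (hk : IsRealMomentum k) :
    ∃ x : ℝ, 1 ≤ x ∧ frakDen L 𝔮 n k = x := by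
  refine ⟨1 + ∑ j ∈ Finset.Icc 1 (n - 1), ∑ l : DualCell L j,
    ((L : ℝ) ^ (2 * j))⁻¹ * (uN L j (k + l.momentum)).re ^ (2 * 𝔮), ?_, ?_⟩
  · have : 0 ≤ ∑ j ∈ Finset.Icc 1 (n - 1), ∑ l : DualCell L j,
        ((L : ℝ) ^ (2 * j))⁻¹ * (uN L j (k + l.momentum)).re ^ (2 * 𝔮) :=
      Finset.sum_nonneg fun j _ => Finset.sum_nonneg fun l _ =>
        mul_nonneg (by positivity) ((even_two_mul 𝔮).pow_nonneg _)
    linarith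
  · rw [frakDen]
    push_cast
    congr 1
    refine Finset.sum_congr rfl fun j _ => Finset.sum_congr rfl fun l _ => ?_
    rw [← uN_eq_ofReal hL j (hk.add_momentum l)]

theorem analyticAt_frakDen (L 𝔮 n : ℕ) (k : Fin 4 → ℂ) : AnalyticAt ℂ (frakDen L 𝔮 n) k := by
  unfold frakDen
  refine analyticAt_const.fun_add (Finset.analyticAt_fun_sum _ fun j _ =>
    Finset.analyticAt_fun_sum _ fun l _ => analyticAt_const.fun_mul ?_)
  exact (analyticAt_comp_add_const (analyticAt_uN L j _)).fun_pow _

theorem frakDen_latticePeriodic {L : ℕ} (hL : 0 < L) (𝔮 n : ℕ) :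
    LatticePeriodic L 0 (frakDen L 𝔮 n) := by
  intro p s
  simp only [pow_zero, Nat.cast_one, one_mul]
  rw [frakDen, frakDen]
  refine congrArg (fun z : ℂ => 1 + z) (Finset.sum_congr rfl fun j _ => ?_)
  obtain ⟨σ, hσ⟩ := LatticePeriodic.exists_perm hL j s
  rw [← Equiv.sum_comp σ (fun l : DualCell L j =>
    ((L : ℂ) ^ (2 * j))⁻¹ * uN L j (p + l.momentum) ^ (2 * 𝔮))]
  refine Finset.sum_congr rfl fun l _ => ?_
  rw [hσ _ _ (uN_latticePeriodic hL j) p l]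

/-! ### The symbol of `Δ⁽ⁿ⁾` -/

/-- The denominator of the symbol of `Δ⁽ⁿ⁾`. -/
noncomputable def deltaDen (L 𝔮 : ℕ) (a : ℝ) (h : (Fin 3 → ℤ) → ℂ) (n : ℕ) (k : Fin 4 → ℂ) : ℂ :=
  (∏ l : DualCell L n, diffHat L h n (k + l.momentum)) +
    frakQHat L 𝔮 a n k * ∑ l : DualCell L n, uN L n (k + l.momentum) ^ (2 * 𝔮) *
      ∏ l' ∈ Finset.univ.erase l, diffHat L h n (k + l'.momentum)

theorem deltaHat_eq {L 𝔮 : ℕ} {a : ℝ} {h : (Fin 3 → ℤ) → ℂ} {n : ℕ} (hn : n ≠ 0)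
    (k : Fin 4 → ℂ) : deltaHat L 𝔮 a h n k = frakQHat L 𝔮 a n k *
      (∏ l : DualCell L n, diffHat L h n (k + l.momentum)) / deltaDen L 𝔮 a h n k := by
  rw [deltaHat, if_neg hn, deltaDen]

theorem deltaDen_latticePeriodic {L : ℕ} (hL : 0 < L) (𝔮 : ℕ) (a : ℝ) (h : (Fin 3 → ℤ) → ℂ)
    (n : ℕ) : LatticePeriodic L 0 (deltaDen L 𝔮 a h n) := by
  intro p s
  have hf := frakDen_latticePeriodic hL 𝔮 n p s
  simp only [pow_zero, Nat.cast_one, one_mul] at hf ⊢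
  obtain ⟨σ, hσ⟩ := LatticePeriodic.exists_perm hL n s
  have hu := hσ _ _ (uN_latticePeriodic hL n) p
  have hd := hσ _ _ (diffHat_latticePeriodic hL h n) p
  rw [deltaDen, deltaDen, frakQHat_eq, frakQHat_eq, hf]
  refine congrArg₂ (fun z w : ℂ => z + w) ?_ ?_
  · rw [← Equiv.prod_comp σ (fun l : DualCell L n => diffHat L h n (p + l.momentum))]
    exact Finset.prod_congr rfl fun l _ => hd l
  · refine congrArg (fun z : ℂ => a * (frakDen L 𝔮 n p)⁻¹ * z) ?_
    rw [← Equiv.sum_comp σ (fun l : DualCell L n => uN L n (p + l.momentum) ^ (2 * 𝔮) *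
      ∏ l' ∈ Finset.univ.erase l, diffHat L h n (p + l'.momentum))]
    refine Finset.sum_congr rfl fun l _ => ?_
    rw [hu l]
    refine congrArg (fun z : ℂ => uN L n (p + (σ l).momentum) ^ (2 * 𝔮) * z) ?_
    refine Finset.prod_bij (fun l' _ => σ l') (fun l' hl' => ?_) (fun _ _ _ _ e => σ.injective e)
      (fun b hb => ⟨σ.symm b, ?_, σ.apply_symm_apply b⟩) (fun l' _ => hd l')
    · simpa using hl'
    · simp only [Finset.mem_erase, Finset.mem_univ, and_true] at hb ⊢
      rintro rfl
      simp at hb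

theorem deltaHat_latticePeriodic {L : ℕ} (hL : 0 < L) (𝔮 : ℕ) (a : ℝ) (h : (Fin 3 → ℤ) → ℂ)
    (n : ℕ) : LatticePeriodic L 0 (deltaHat L 𝔮 a h n) := by
  intro p s
  rcases eq_or_ne n 0 with rfl | hn
  · simp only [deltaHat, if_pos]
    exact diffHat_latticePeriodic hL h 0 p s
  rw [deltaHat_eq hn, deltaHat_eq hn, deltaDen_latticePeriodic hL, frakQHat_eq, frakQHat_eq,
    frakDen_latticePeriodic hL]
  congr 2
  obtain ⟨σ, hσ⟩ := LatticePeriodic.exists_perm hL n s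
  simp only [pow_zero, Nat.cast_one, one_mul]
  rw [← Equiv.prod_comp σ (fun l : DualCell L n => diffHat L h n (p + l.momentum))]
  exact Finset.prod_congr rfl fun l _ => hσ _ _ (diffHat_latticePeriodic hL h n) p l

theorem analyticAt_deltaDen {L : ℕ} {𝔮 : ℕ} (a : ℝ) {h : (Fin 3 → ℤ) → ℂ} (hh : IsHamiltonian h)
    (n : ℕ) {k : Fin 4 → ℂ} (hk : frakDen L 𝔮 n k ≠ 0) : AnalyticAt ℂ (deltaDen L 𝔮 a h n) k := by
  have hd : ∀ l : DualCell L n, AnalyticAt ℂ (fun k => diffHat L h n (k + l.momentum)) k :=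
    fun l => analyticAt_comp_add_const (analyticAt_diffHat hh L n _)
  have hQ : AnalyticAt ℂ (frakQHat L 𝔮 a n) k :=
    analyticAt_const.fun_mul ((analyticAt_frakDen L 𝔮 n k).fun_inv hk)
  unfold deltaDen
  refine (Finset.analyticAt_fun_prod _ fun l _ => hd l).fun_add (hQ.fun_mul
    (Finset.analyticAt_fun_sum _ fun l _ => AnalyticAt.fun_mul ?_
      (Finset.analyticAt_fun_prod _ fun l _ => hd l)))
  exact (analyticAt_comp_add_const (analyticAt_uN L n _)).fun_pow _

theorem analyticAt_deltaHat {L : ℕ} {𝔮 : ℕ} (a : ℝ) {h : (Fin 3 → ℤ) → ℂ} (hh : IsHamiltonian h)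
    {n : ℕ} (hn : n ≠ 0) {k : Fin 4 → ℂ} (hk : frakDen L 𝔮 n k ≠ 0)
    (hd : deltaDen L 𝔮 a h n k ≠ 0) : AnalyticAt ℂ (deltaHat L 𝔮 a h n) k := by
  have e : deltaHat L 𝔮 a h n = fun k => frakQHat L 𝔮 a n k *
      (∏ l : DualCell L n, diffHat L h n (k + l.momentum)) / deltaDen L 𝔮 a h n k :=
    funext fun k => deltaHat_eq hn k
  rw [e]
  have hQ : AnalyticAt ℂ (frakQHat L 𝔮 a n) k :=
    analyticAt_const.fun_mul ((analyticAt_frakDen L 𝔮 n k).fun_inv hk)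
  exact (hQ.fun_mul (Finset.analyticAt_fun_prod _ fun l _ =>
    analyticAt_comp_add_const (analyticAt_diffHat hh L n _))).fun_div
      (analyticAt_deltaDen a hh n hk) hd

/-- The origin of the dual cell. -/
def originCell (L n : ℕ) [NeZero L] : DualCell L n :=
  fun ν => ⟨0, pow_pos (scaleFactor_pos (NeZero.pos L) ν) n⟩

theorem originCell_momentum (L n : ℕ) [NeZero L] : (originCell L n).momentum = 0 := by
  funext ν; simp [DualCell.momentum, originCell]

theorem exists_ne_zero_of_ne_originCell {L n : ℕ} [NeZero L] {l : DualCell L n}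
    (hl : l ≠ originCell L n) : ∃ ν, (l ν : ℕ) ≠ 0 := by
  by_contra hcon
  push Not at hcon
  exact hl (funext fun ν => Fin.ext (hcon ν))

/-- `1/𝔔_n + ∑_{ℓ ≠ 0} u_n(k+ℓ)^{2𝔮} / D_n(k+ℓ)`. -/
noncomputable def regPart (L 𝔮 : ℕ) [NeZero L] (a : ℝ) (h : (Fin 3 → ℤ) → ℂ) (n : ℕ)
    (k : Fin 4 → ℂ) : ℂ :=
  frakDen L 𝔮 n k / a + ∑ l ∈ Finset.univ.erase (originCell L n),
    uN L n (k + l.momentum) ^ (2 * 𝔮) / diffHat L h n (k + l.momentum)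

/-- The quotient `D_n / Δ⁽ⁿ⁾` of symbols. -/
noncomputable def deltaRatio (L 𝔮 : ℕ) [NeZero L] (a : ℝ) (h : (Fin 3 → ℤ) → ℂ) (n : ℕ)
    (k : Fin 4 → ℂ) : ℂ :=
  diffHat L h n k * regPart L 𝔮 a h n k + uN L n k ^ (2 * 𝔮)

/-- In the fundamental cell only the factor with ℓ = 0 can vanish. All others are pulled out, and
what remains, `deltaRatio`, contains D̂_n(k) only in a numerator. -/
theorem deltaDen_eq {L 𝔮 : ℕ} [NeZero L] {a : ℝ} (ha : a ≠ 0) {h : (Fin 3 → ℤ) → ℂ} {n : ℕ}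
    {k : Fin 4 → ℂ} (hk : frakDen L 𝔮 n k ≠ 0)
    (hd : ∀ l : DualCell L n, l ≠ originCell L n → diffHat L h n (k + l.momentum) ≠ 0) :
    deltaDen L 𝔮 a h n k = frakQHat L 𝔮 a n k *
      (∏ l ∈ Finset.univ.erase (originCell L n), diffHat L h n (k + l.momentum)) *
        deltaRatio L 𝔮 a h n k := by
  set o := originCell L n with ho
  have ho0 : k + o.momentum = k := by rw [ho, originCell_momentum, add_zero]
  set P := ∏ l ∈ Finset.univ.erase o, diffHat L h n (k + l.momentum) with hP
  have h1 : ∏ l : DualCell L n, diffHat L h n (k + l.momentum) = diffHat L h n k * P := by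
    rw [← Finset.mul_prod_erase _ _ (Finset.mem_univ o), ho0]
  have h2 : ∑ l : DualCell L n, uN L n (k + l.momentum) ^ (2 * 𝔮) *
      ∏ l' ∈ Finset.univ.erase l, diffHat L h n (k + l'.momentum)
      = uN L n k ^ (2 * 𝔮) * P + ∑ l ∈ Finset.univ.erase o,
        diffHat L h n k * P * (uN L n (k + l.momentum) ^ (2 * 𝔮) / diffHat L h n (k + l.momentum)) := by
    rw [← Finset.add_sum_erase _ _ (Finset.mem_univ o), ho0]
    congr 1
    refine Finset.sum_congr rfl fun l hl => ?_
    have hl' : diffHat L h n (k + l.momentum) ≠ 0 := hd l (Finset.ne_of_mem_erase hl)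
    have h3 := Finset.mul_prod_erase Finset.univ (fun l : DualCell L n =>
      diffHat L h n (k + l.momentum)) (Finset.mem_univ l)
    rw [h1] at h3
    rw [← h3]
    field_simp
  have ha' : (a : ℂ) ≠ 0 := by exact_mod_cast ha
  rw [deltaDen, h1, h2, ← Finset.mul_sum, deltaRatio, regPart, frakQHat_eq]
  field_simp
  ring

theorem deltaHat_eq_div {L 𝔮 : ℕ} [NeZero L] {a : ℝ} (ha : a ≠ 0) {h : (Fin 3 → ℤ) → ℂ} {n : ℕ}
    (hn : n ≠ 0) {k : Fin 4 → ℂ} (hk : frakDen L 𝔮 n k ≠ 0)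
    (hd : ∀ l : DualCell L n, l ≠ originCell L n → diffHat L h n (k + l.momentum) ≠ 0) :
    deltaHat L 𝔮 a h n k = diffHat L h n k / deltaRatio L 𝔮 a h n k := by
  have ha' : (a : ℂ) ≠ 0 := by exact_mod_cast ha
  have hP : ∏ l ∈ Finset.univ.erase (originCell L n), diffHat L h n (k + l.momentum) ≠ 0 :=
    Finset.prod_ne_zero_iff.mpr fun l hl => hd l (Finset.ne_of_mem_erase hl)
  have hQ : frakQHat L 𝔮 a n k ≠ 0 := mul_ne_zero ha' (inv_ne_zero hk)
  rw [deltaHat_eq hn, deltaDen_eq ha hk hd,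
    ← Finset.mul_prod_erase _ _ (Finset.mem_univ (originCell L n)), originCell_momentum, add_zero,
    mul_left_comm, mul_comm (diffHat L h n k), mul_div_mul_left _ _ (mul_ne_zero hQ hP)]

theorem inv_re_nonneg {z : ℂ} (hz : 0 ≤ z.re) : 0 ≤ (z⁻¹).re := by
  rw [Complex.inv_re]; exact div_nonneg hz (Complex.normSq_nonneg z)

theorem uN_pow_even_real {L : ℕ} (hL : Odd L) (n 𝔮 : ℕ) {p : Fin 4 → ℂ} (hp : IsRealMomentum p) :
    uN L n p ^ (2 * 𝔮) = ((‖uN L n p‖ ^ (2 * 𝔮) : ℝ) : ℂ) := by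
  rw [uN_eq_ofReal hL n hp, Complex.norm_real, Real.norm_eq_abs, (even_two_mul 𝔮).pow_abs]
  push_cast
  rfl

/-- At real momenta the powers of u_n are nonnegative and Re (1/D̂_n) ≥ 0, so all terms with ℓ ≠ 0
help. A vanishing D̂_n would contribute 0 by the convention 0⁻¹ = 0, so no nonvanishing hypothesis
is needed. -/
theorem regPart_re_ge {L : ℕ} [NeZero L] (hL : Odd L) (𝔮 : ℕ) {a : ℝ} (ha : 0 < a)
    {h : (Fin 3 → ℤ) → ℂ} (hh : IsHamiltonian h) (n : ℕ) {k : Fin 4 → ℂ} (hk : IsRealMomentum k) :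
    1 / a ≤ (regPart L 𝔮 a h n k).re := by
  obtain ⟨x, hx1, hx⟩ := frakDen_real hL 𝔮 n hk
  rw [regPart, Complex.add_re, hx, ← Complex.ofReal_div, Complex.ofReal_re, Complex.re_sum]
  have h1 : 0 ≤ ∑ l ∈ Finset.univ.erase (originCell L n),
      (uN L n (k + l.momentum) ^ (2 * 𝔮) / diffHat L h n (k + l.momentum)).re := by
    refine Finset.sum_nonneg fun l _ => ?_
    rw [uN_pow_even_real hL n 𝔮 (hk.add_momentum l), div_eq_mul_inv, Complex.re_ofReal_mul]
    exact mul_nonneg (by positivity) (inv_re_nonneg (diffHat_re_nonneg hh L n (hk.add_momentum l)))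
  have h2 : 1 / a ≤ x / a := by gcongr
  linarith

/-- Write DB + u = B(D + u/B). Both D and u/B have nonnegative real part, and Re (u/B) = u Re
B/|B|². This positivity argument serves twice: for the denominator of Δ̂ and for the Schur
complement of the Floquet matrices. -/
theorem le_norm_mul_add {B D : ℂ} {u b C : ℝ} (hb : 0 < b) (hu : 0 ≤ u) (hB : b ≤ B.re)
    (hBC : ‖B‖ ≤ C) (hD : 0 ≤ D.re) : b * (u * b / C ^ 2) ≤ ‖D * B + u‖ := by
  have hB0 : 0 < ‖B‖ := by
    have := (le_abs_self _).trans (Complex.abs_re_le_norm B); linarith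
  have hBne : B ≠ 0 := norm_pos_iff.mp hB0
  have e : D * B + u = B * (D + u * B⁻¹) := by field_simp
  rw [e, norm_mul]
  have h1 : b ≤ ‖B‖ := hB.trans ((le_abs_self _).trans (Complex.abs_re_le_norm B))
  have h2 : u * b / C ^ 2 ≤ ‖D + u * B⁻¹‖ := by
    refine le_trans ?_ ((le_abs_self _).trans (Complex.abs_re_le_norm _))
    rw [Complex.add_re, Complex.re_ofReal_mul, Complex.inv_re, Complex.normSq_eq_norm_sq]
    have h3 : b / C ^ 2 ≤ B.re / ‖B‖ ^ 2 := by
      have : 0 ≤ B.re := by linarith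
      gcongr
    have h4 : u * b / C ^ 2 ≤ u * (B.re / ‖B‖ ^ 2) := by
      rw [mul_div_assoc]; gcongr
    linarith
  have h5 : 0 ≤ u * b / C ^ 2 := by positivity
  exact mul_le_mul h1 h2 h5 (norm_nonneg _)

/-- The symbol of `Δ⁽ⁿ⁾` is that of `D_n` times a function that is bounded, bounded below and
Lipschitz in the imaginary directions, uniformly in `n` and `L`. -/
theorem IsHamiltonian.exists_deltaHat_factor {h : (Fin 3 → ℤ) → ℂ} (hh : IsHamiltonian h) {𝔮 : ℕ}
    (hq : 1 ≤ 𝔮) {a : ℝ} (ha : 0 < a) :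
    ∃ m C : ℝ, 0 < m ∧ m ≤ 1 ∧ 0 < C ∧ ∀ L : ℕ, Odd L → 1 < L → 4 * cellBound (2 * 𝔮) < L →
      ∀ n : ℕ, ∃ G : (Fin 4 → ℂ) → ℂ,
        (∀ p : Fin 4 → ℂ, (∀ ν, |(p ν).re| ≤ Real.pi) → (∀ ν, |(p ν).im| ≤ m) →
          deltaHat L 𝔮 a h n p = diffHat L h n p * G p ∧ ‖G p‖ ≤ C ∧ C⁻¹ ≤ ‖G p‖) ∧
        (∀ p : Fin 4 → ℂ, (∀ ν, |(p ν).re| ≤ Real.pi) → ∀ t : ℝ, 0 < t → t ≤ m →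
          (∀ ν, |(p ν).im| ≤ t) → ‖G p - G (rePart p)‖ ≤ C * t) ∧
        (∀ p : Fin 4 → ℂ, (∀ ν, |(p ν).im| ≤ m) → AnalyticAt ℂ (deltaHat L 𝔮 a h n) p) ∧
        ∀ p : Fin 4 → ℂ, IsRealMomentum p → (∀ ν, |(p ν).re| ≤ Real.pi) →
          0 ≤ (deltaHat L 𝔮 a h n p).re := by
  obtain ⟨m0, c1, hm0, hm01, hc1, hcell⟩ := hh.exists_diffHat_cell_ge
  obtain ⟨C2, hC2, hD⟩ := hh.exists_diffHat_le
  set CB : ℝ := 3 / 2 / a + cellBound (2 * 𝔮) / c1 with hCB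
  have hCBpos : 0 < CB := by
    have := cellBound_pos (2 * 𝔮)
    positivity
  set CF : ℝ := C2 * 42 * CB + (14 ^ 4) ^ (2 * 𝔮) with hCF
  have hCFpos : 0 < CF := by positivity
  set κ : ℝ := ((2 / Real.pi) ^ 4) ^ (2 * 𝔮) with hκ
  have hκpos : 0 < κ := by have := Real.pi_pos; positivity
  set c4 : ℝ := 1 / a * (κ * (1 / a) / CB ^ 2) with hc4
  have hc4pos : 0 < c4 := by positivity
  -- The second entry makes the Schwarz error 2 CF m/m0 at most half of the lower bound c4 valid at
  -- real momenta.
  set m : ℝ := min (m0 / 2) (c4 * m0 / (4 * CF)) with hm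
  have hmpos : 0 < m := by positivity
  have hmm0 : m < m0 := lt_of_le_of_lt (min_le_left _ _) (by linarith)
  set C : ℝ := max (max 1 (max (2 / c4) CF)) (2 / c4 * (1 / c4) * (2 * CF / m0)) with hC
  have hC1 : 1 ≤ C := (le_max_left _ _).trans (le_max_left _ _)
  have hCc : 2 / c4 ≤ C := (le_max_left _ _).trans ((le_max_right _ _).trans (le_max_left _ _))
  have hCF' : CF ≤ C := (le_max_right _ _).trans ((le_max_right _ _).trans (le_max_left _ _))
  have hCL : 2 / c4 * (1 / c4) * (2 * CF / m0) ≤ C := le_max_right _ _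
  have hCpos : 0 < C := by linarith
  refine ⟨m, C, hmpos, by linarith, hCpos, fun L hL hL1 hΓ n => ?_⟩
  have hL0 : 0 < L := hL.pos
  have : NeZero L := ⟨hL0.ne'⟩
  rcases eq_or_ne n 0 with rfl | hn
  -- For n = 0 the symbol of Δ⁽⁰⁾ is D̂₀ itself, so the factor is constant.
  · refine ⟨fun _ => 1, fun p _ _ => ⟨by simp [deltaHat], by simpa using hC1, by
      simpa using inv_le_one_of_one_le₀ hC1⟩, fun p _ t ht _ _ => by simp; positivity, ?_, ?_⟩
    · intro p _
      have : deltaHat L 𝔮 a h 0 = diffHat L h 0 := by funext k; simp [deltaHat]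
      rw [this]
      exact analyticAt_diffHat hh L 0 p
    · intro p hp _
      simp only [deltaHat, if_pos]
      exact diffHat_re_nonneg hh L 0 hp
  have hden : ∀ p : Fin 4 → ℂ, (∀ ν, |(p ν).im| ≤ 1) → frakDen L 𝔮 n p ≠ 0 := by
    intro p hp h0
    have := (frakDen_bounds hL hL1 hq hΓ n hp).1
    rw [h0, norm_zero] at this
    norm_num at this
  have hcell' : ∀ p : Fin 4 → ℂ, (∀ ν, |(p ν).re| ≤ 5) → (∀ ν, |(p ν).im| ≤ m0) →
      ∀ l : DualCell L n, l ≠ originCell L n → c1 ≤ ‖diffHat L h n (p + l.momentum)‖ :=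
    fun p h1 h2 l hl => hcell L hL0 n p h1 h2 l (exists_ne_zero_of_ne_originCell hl)
  have hne : ∀ p : Fin 4 → ℂ, (∀ ν, |(p ν).re| ≤ 5) → (∀ ν, |(p ν).im| ≤ m0) →
      ∀ l : DualCell L n, l ≠ originCell L n → diffHat L h n (p + l.momentum) ≠ 0 :=
    fun p h1 h2 l hl => norm_pos_iff.mp (hc1.trans_le (hcell' p h1 h2 l hl))
  have hreg : ∀ p : Fin 4 → ℂ, (∀ ν, |(p ν).re| ≤ 5) → (∀ ν, |(p ν).im| ≤ m0) →
      ‖regPart L 𝔮 a h n p‖ ≤ CB := by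
    intro p h1 h2
    have h3 : ∀ ν, |(p ν).im| ≤ 1 := fun ν => (h2 ν).trans hm01
    refine (norm_add_le _ _).trans (add_le_add ?_ ?_)
    · rw [norm_div, Complex.norm_real, Real.norm_eq_abs, abs_of_pos ha]
      gcongr
      exact (frakDen_bounds hL hL1 hq hΓ n h3).2
    · calc _ ≤ ∑ l ∈ Finset.univ.erase (originCell L n),
            ‖uN L n (p + l.momentum)‖ ^ (2 * 𝔮) / c1 := by
            refine (norm_sum_le _ _).trans (Finset.sum_le_sum fun l hl => ?_)
            rw [norm_div, norm_pow]
            gcongr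
            exact hcell' p h1 h2 l (Finset.ne_of_mem_erase hl)
        _ ≤ ∑ l : DualCell L n, ‖uN L n (p + l.momentum)‖ ^ (2 * 𝔮) / c1 :=
            Finset.sum_le_sum_of_subset_of_nonneg (Finset.erase_subset _ _)
              fun _ _ _ => by positivity
        _ ≤ _ := by
            rw [← Finset.sum_div]
            gcongr
            exact sum_norm_uN_pow_le hL n (by omega) h3
  have hDb : ∀ p : Fin 4 → ℂ, (∀ ν, |(p ν).re| ≤ 5) → (∀ ν, |(p ν).im| ≤ 1) →
      ‖diffHat L h n p‖ ≤ C2 * 42 := by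
    intro p h1 h2
    have h6 : ∀ ν, ‖p ν‖ ≤ 6 := fun ν => by
      have := Complex.norm_le_abs_re_add_abs_im (p ν)
      linarith [h1 ν, h2 ν]
    refine (hD L hL0 n p h1 h2).trans ?_
    have h7 := norm_tail_le (by norm_num) h6
    have : ‖p 0‖ + ‖Fin.tail p‖ ^ 2 ≤ 42 := by nlinarith [h6 0, norm_nonneg (Fin.tail p)]
    gcongr
  have hFb : ∀ p : Fin 4 → ℂ, (∀ ν, |(p ν).re| ≤ 5) → (∀ ν, |(p ν).im| ≤ m0) →
      DifferentiableAt ℂ (deltaRatio L 𝔮 a h n) p ∧ ‖deltaRatio L 𝔮 a h n p‖ ≤ CF := by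
    intro p h1 h2
    have h3 : ∀ ν, |(p ν).im| ≤ 1 := fun ν => (h2 ν).trans hm01
    constructor
    · apply AnalyticAt.differentiableAt
      unfold deltaRatio regPart
      refine ((analyticAt_diffHat hh L n p).fun_mul (((analyticAt_frakDen L 𝔮 n p).fun_div
        analyticAt_const (by exact_mod_cast ha.ne')).fun_add
        (Finset.analyticAt_fun_sum _ fun l hl => AnalyticAt.fun_div ?_ ?_ ?_))).fun_add
        ((analyticAt_uN L n p).fun_pow _)
      · exact (analyticAt_comp_add_const (analyticAt_uN L n _)).fun_pow _
      · exact analyticAt_comp_add_const (analyticAt_diffHat hh L n _)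
      · exact hne p h1 h2 l (Finset.ne_of_mem_erase hl)
    · refine (norm_add_le _ _).trans (add_le_add ?_ ?_)
      · rw [norm_mul]
        exact mul_le_mul (hDb p h1 h3) (hreg p h1 h2) (norm_nonneg _) (by positivity)
      · rw [norm_pow]
        exact pow_le_pow_left₀ (norm_nonneg _) (norm_uN_le hL n h1 h3) _
  have hpi := Real.pi_lt_d2
  have hreal : ∀ p : Fin 4 → ℂ, IsRealMomentum p → (∀ ν, |(p ν).re| ≤ Real.pi) →
      c4 ≤ ‖deltaRatio L 𝔮 a h n p‖ := by
    intro p hp hre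
    have h1 : ∀ ν, |(p ν).re| ≤ 5 := fun ν => by linarith [hre ν]
    have h2 : ∀ ν, |(p ν).im| ≤ m0 := fun ν => by rw [hp ν, abs_zero]; exact hm0.le
    have key := le_norm_mul_add (B := regPart L 𝔮 a h n p) (D := diffHat L h n p)
      (u := ‖uN L n p‖ ^ (2 * 𝔮)) (by positivity : 0 < 1 / a) (by positivity)
      (regPart_re_ge hL 𝔮 ha hh n hp) (hreg p h1 h2) (diffHat_re_nonneg hh L n hp)
    rw [deltaRatio, uN_pow_even_real hL n 𝔮 hp]
    refine le_trans ?_ key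
    rw [hc4]
    gcongr
    have := Real.pi_pos
    exact pow_le_pow_left₀ (by positivity) (norm_uN_ge hL n hp hre) _
  have hpert : ∀ p : Fin 4 → ℂ, (∀ ν, |(p ν).re| ≤ Real.pi) → ∀ t : ℝ, 0 < t → t ≤ m →
      (∀ ν, |(p ν).im| ≤ t) →
      ‖deltaRatio L 𝔮 a h n p - deltaRatio L 𝔮 a h n (rePart p)‖ ≤ 2 * CF / m0 * t :=
    fun p h1 t ht htm h2 => norm_sub_rePart_le hm01 hFb h1 h2 ht (htm.trans_lt hmm0)
  have hreP : ∀ p : Fin 4 → ℂ, (∀ ν, |(p ν).re| ≤ Real.pi) →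
      ∀ ν, |(rePart p ν).re| ≤ Real.pi := fun p h1 ν => by simpa [rePart] using h1 ν
  have hlow : ∀ p : Fin 4 → ℂ, (∀ ν, |(p ν).re| ≤ Real.pi) → (∀ ν, |(p ν).im| ≤ m) →
      c4 / 2 ≤ ‖deltaRatio L 𝔮 a h n p‖ := by
    intro p h1 h2
    have h3 := hpert p h1 m hmpos le_rfl h2
    have h4 := hreal (rePart p) (isReal_rePart p) (hreP p h1)
    have h5 := norm_sub_norm_le (deltaRatio L 𝔮 a h n (rePart p)) (deltaRatio L 𝔮 a h n p)
    rw [norm_sub_rev] at h5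
    have h6 : 2 * CF / m0 * m ≤ c4 / 2 := by
      have : m ≤ c4 * m0 / (4 * CF) := min_le_right _ _
      calc _ ≤ 2 * CF / m0 * (c4 * m0 / (4 * CF)) := by gcongr
        _ = _ := by field_simp; norm_num
    linarith
  have h5m : ∀ p : Fin 4 → ℂ, (∀ ν, |(p ν).re| ≤ Real.pi) → ∀ ν, |(p ν).re| ≤ 5 :=
    fun p h ν => by linarith [h ν]
  have himm : ∀ p : Fin 4 → ℂ, (∀ ν, |(p ν).im| ≤ m) → ∀ ν, |(p ν).im| ≤ m0 :=
    fun p h ν => (h ν).trans hmm0.le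
  have him1 : ∀ p : Fin 4 → ℂ, (∀ ν, |(p ν).im| ≤ m) → ∀ ν, |(p ν).im| ≤ 1 :=
    fun p h ν => (himm p h ν).trans hm01
  refine ⟨fun p => (deltaRatio L 𝔮 a h n p)⁻¹, fun p h1 h2 => ⟨?_, ?_, ?_⟩,
    fun p h1 t ht htm h2 => ?_, fun p h2 => ?_, fun p hp h1 => ?_⟩
  · rw [deltaHat_eq_div ha.ne' hn (hden p (him1 p h2)) (hne p (h5m p h1) (himm p h2)),
      div_eq_mul_inv]
  · rw [norm_inv]
    refine le_trans ?_ hCc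
    rw [← inv_div]
    exact inv_anti₀ (by positivity) (hlow p h1 h2)
  · rw [norm_inv]
    have h3 := hlow p h1 h2
    exact inv_anti₀ (by linarith) ((hFb p (h5m p h1) (himm p h2)).2.trans hCF')
  · have h2m : ∀ ν, |(p ν).im| ≤ m := fun ν => (h2 ν).trans htm
    have l1 := hlow p h1 h2m
    have l2 := hreal (rePart p) (isReal_rePart p) (hreP p h1)
    have n1 : deltaRatio L 𝔮 a h n p ≠ 0 := norm_pos_iff.mp (by linarith)
    have n2 : deltaRatio L 𝔮 a h n (rePart p) ≠ 0 := norm_pos_iff.mp (by linarith)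
    have h3 := hpert p h1 t ht htm h2
    rw [inv_sub_inv n1 n2, norm_div, norm_mul, norm_sub_rev]
    calc _ ≤ 2 * CF / m0 * t / (c4 / 2 * c4) := by gcongr
      _ = 2 / c4 * (1 / c4) * (2 * CF / m0) * t := by field_simp
      _ ≤ _ := by gcongr
  · refine analyticAt_deltaHat a hh hn (hden p (him1 p h2)) ?_
    -- The factorisation of the denominator is available only in the fundamental cell, so its
    -- nonvanishing is transported there by periodicity.
    obtain ⟨r, hr⟩ := exists_add_latticeVec_re_le p
    have hper := deltaDen_latticePeriodic hL0 𝔮 a h n p r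
    simp only [pow_zero, Nat.cast_one, one_mul] at hper
    rw [← hper]
    set p' := p + latticeVec r
    have h1' : ∀ ν, |(p' ν).re| ≤ Real.pi := fun ν => (hr ν).1
    have h2' : ∀ ν, |(p' ν).im| ≤ m := fun ν => by rw [(hr ν).2]; exact h2 ν
    rw [deltaDen_eq ha.ne' (hden p' (him1 p' h2')) (hne p' (h5m p' h1') (himm p' h2'))]
    refine mul_ne_zero (mul_ne_zero ?_ ?_) ?_
    · exact mul_ne_zero (by exact_mod_cast ha.ne') (inv_ne_zero (hden p' (him1 p' h2')))
    · exact Finset.prod_ne_zero_iff.mpr fun l hl =>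
        hne p' (h5m p' h1') (himm p' h2') l (Finset.ne_of_mem_erase hl)
    · exact norm_pos_iff.mp (by linarith [hlow p' h1' h2'])
  · have h2 : ∀ ν, |(p ν).im| ≤ m := fun ν => by rw [hp ν, abs_zero]; exact hmpos.le
    rw [deltaHat_eq_div ha.ne' hn (hden p (him1 p h2)) (hne p (h5m p h1) (himm p h2))]
    -- Where D̂ vanishes so does Δ̂. Elsewhere 1/Δ̂ = R + u^{2𝔮}/D̂ has nonnegative real part, and
    -- so has its inverse.
    rcases eq_or_ne (diffHat L h n p) 0 with h0 | h0
    · simp [h0]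
    · rw [← inv_div]
      apply inv_re_nonneg
      have e : deltaRatio L 𝔮 a h n p / diffHat L h n p
          = regPart L 𝔮 a h n p + ((‖uN L n p‖ ^ (2 * 𝔮) : ℝ) : ℂ) * (diffHat L h n p)⁻¹ := by
        rw [deltaRatio, uN_pow_even_real hL n 𝔮 hp]; field_simp
      rw [e, Complex.add_re, Complex.re_ofReal_mul]
      have h3 := regPart_re_ge hL 𝔮 ha hh n hp
      have h4 := inv_re_nonneg (diffHat_re_nonneg hh L n hp)
      have : 0 < 1 / a := by positivity
      have h6 : 0 ≤ ‖uN L n p‖ ^ (2 * 𝔮) * ((diffHat L h n p)⁻¹).re := by positivity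
      linarith

/-! ### Resolvents of rank one perturbations of diagonal matrices -/

theorem norm_le_norm_ofReal_add {x : ℝ} (hx : 0 ≤ x) {d : ℂ} (hd : 0 ≤ d.re) :
    x ≤ ‖(x : ℂ) + d‖ ∧ ‖d‖ ≤ ‖(x : ℂ) + d‖ := by
  constructor
  · refine le_trans ?_ ((le_abs_self _).trans (Complex.abs_re_le_norm _))
    simp [hd]
  · rw [← sq_le_sq₀ (norm_nonneg _) (norm_nonneg _), ← Complex.normSq_eq_norm_sq,
      ← Complex.normSq_eq_norm_sq, Complex.normSq_apply, Complex.normSq_apply]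
    simp only [Complex.add_re, Complex.ofReal_re, Complex.add_im, Complex.ofReal_im, zero_add]
    nlinarith

/-- Uniform invertibility of `z - c v vᵀ - diag δ` for `z` near the negative axis, when `v` is close
to a real vector and `δ` to a vector with nonnegative real parts, all but one of whose entries are
bounded below. -/
theorem exists_rankOne_resolvent_bound {a V κ K : ℝ} (ha : 0 < a) (hV : 0 < V) (hκ : 0 < κ)
    (hK : 0 < K) :
    ∃ η C : ℝ, 0 < η ∧ 0 < C ∧ ∀ (ι : Type) [Fintype ι] [DecidableEq ι] (o : ι) (ε : ℝ)
      (v δ δ₀ : ι → ℂ) (v₀ : ι → ℝ) (z : ℂ) (x : ℝ), 0 < ε →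
      (∀ i, ‖v i‖ ≤ V) → ∑ i, ‖v i‖ ≤ V → ∑ i, ‖v i‖ ^ 2 ≤ V → ∑ i, v₀ i ^ 2 ≤ V →
      ∑ i, ‖v i ^ 2 - (v₀ i : ℂ) ^ 2‖ ≤ η → κ ≤ v₀ o ^ 2 →
      (∀ i, 0 ≤ (δ₀ i).re) → (∀ i, i ≠ o → κ * ε ≤ ‖δ₀ i‖) →
      (∀ i, i ≠ o → ‖δ i - δ₀ i‖ ≤ η * ‖δ₀ i‖) → ‖δ₀ o‖ ≤ K * ε → ‖δ o - δ₀ o‖ ≤ η * ε →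
      0 ≤ x → ‖z + x‖ ≤ η * ε →
      ∀ (w : ι → ℂ) (Y : ℝ),
        (∀ i, ‖(z - δ i) * w i - ((a * ε : ℝ) : ℂ) * v i * ∑ j, v j * w j‖ ≤ Y) →
        ∀ i, ‖w i‖ ≤ C / ε * Y := by
  set M : ℝ := 1 + 2 * a * V / κ with hM
  have hM0 : 0 < M := by positivity
  set e1 : ℝ := a * κ / (1 + a * V / κ) ^ 2 with he1
  have he10 : 0 < e1 := by positivity
  -- the total perturbation constant
  set B1 : ℝ := 1 / κ + 1 with hB1
  have hB10 : 0 < B1 := by positivity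
  set S : ℝ := 2 * (1 + V * B1) with hS
  have hS0 : 0 < S := by positivity
  set B2 : ℝ := 2 * M + a * (1 + K / κ) * S + a with hB2
  have hB20 : 0 < B2 := by positivity
  -- The three entries guarantee, in this order: |z - δᵢ| ≥ |sᵢ|/2 for i ≠ o; |W + w0| ≤ 1/2; and an
  -- error in the Schur complement E of at most half of its unperturbed lower bound e1 ε.
  set η : ℝ := min (min (1 / (2 * B1)) (κ / (2 * a * S))) (e1 / (2 * B2)) with hη
  have hη0 : 0 < η := by positivity
  have hη1 : η * B1 ≤ 1 / 2 := by
    have : η ≤ 1 / (2 * B1) := (min_le_left _ _).trans (min_le_left _ _)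
    calc _ ≤ 1 / (2 * B1) * B1 := by gcongr
      _ = _ := by field_simp
  have hη2 : a * η * S / κ ≤ 1 / 2 := by
    have : η ≤ κ / (2 * a * S) := (min_le_left _ _).trans (min_le_right _ _)
    calc _ ≤ a * (κ / (2 * a * S)) * S / κ := by gcongr
      _ = _ := by field_simp
  have hη3 : η * B2 ≤ e1 / 2 := by
    have : η ≤ e1 / (2 * B2) := min_le_right _ _
    calc _ ≤ e1 / (2 * B2) * B2 := by gcongr
      _ = _ := by field_simp
  set C1 : ℝ := (M + a * V * (2 * V / κ)) * (2 / e1) with hC1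
  have hC10 : 0 < C1 := by positivity
  set C2 : ℝ := 2 * (V * C1 + 2 * V / κ) with hC2
  have hC20 : 0 < C2 := by positivity
  set C3 : ℝ := 2 / κ * (1 + a * V * C2) with hC3
  have hC30 : 0 < C3 := by positivity
  refine ⟨η, max C1 C3, hη0, by positivity, ?_⟩
  intro ι _ _ o ε v δ δ₀ v₀ z x hε hv hv1 hv2 hv0 hvd hvo hδ0 hδlow hδd hδo hδod hx hz w Y hw
  set c : ℝ := a * ε with hc
  have hc0 : 0 < c := by positivity
  have hY : 0 ≤ Y := (norm_nonneg _).trans (hw o)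
  -- Since z is close to -x and δ to δ₀, the entry z - δᵢ is close to -sᵢ. Because x ≥ 0 and Re δ₀ᵢ
  -- ≥ 0, the two parts of sᵢ cannot cancel.
  set s : ι → ℂ := fun i => (x : ℂ) + δ₀ i with hs
  have hsx : ∀ i, x ≤ ‖s i‖ := fun i => (norm_le_norm_ofReal_add hx (hδ0 i)).1
  have hsδ : ∀ i, ‖δ₀ i‖ ≤ ‖s i‖ := fun i => (norm_le_norm_ofReal_add hx (hδ0 i)).2
  have hsre : ∀ i, 0 ≤ (s i).re := fun i => by simp [hs]; linarith [hδ0 i]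
  have hslow : ∀ i, i ≠ o → κ * ε ≤ ‖s i‖ := fun i hi => (hδlow i hi).trans (hsδ i)
  have hspos : ∀ i, i ≠ o → 0 < ‖s i‖ := fun i hi => lt_of_lt_of_le (by positivity) (hslow i hi)
  set R : ι → ℂ := fun i => (z - δ i)⁻¹ with hR
  have hr : ∀ i, i ≠ o → ‖(z - δ i) + s i‖ ≤ η * B1 * ‖s i‖ := by
    intro i hi
    have e : (z - δ i) + s i = (z + x) - (δ i - δ₀ i) := by simp only [hs]; ring
    rw [e]
    refine (norm_sub_le _ _).trans ?_
    have h1 : ε ≤ ‖s i‖ / κ := by rw [le_div_iff₀ hκ]; linarith [hslow i hi]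
    calc _ ≤ η * ε + η * ‖δ₀ i‖ := add_le_add hz (hδd i hi)
      _ ≤ η * (‖s i‖ / κ) + η * ‖s i‖ := by gcongr; exact hsδ i
      _ = _ := by rw [hB1]; ring
  have hzlow : ∀ i, i ≠ o → ‖s i‖ / 2 ≤ ‖z - δ i‖ := by
    intro i hi
    have h1 := hr i hi
    have h2 := norm_sub_norm_le (s i) (-(z - δ i))
    rw [norm_neg, sub_neg_eq_add, add_comm (s i)] at h2
    have h3 : η * B1 * ‖s i‖ ≤ 1 / 2 * ‖s i‖ := by gcongr
    linarith
  have hzpos : ∀ i, i ≠ o → z - δ i ≠ 0 := fun i hi =>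
    norm_pos_iff.mp (lt_of_lt_of_le (by have := hspos i hi; positivity) (hzlow i hi))
  have hRb : ∀ i, i ≠ o → ‖R i‖ ≤ 2 / ‖s i‖ := by
    intro i hi
    simp only [hR]
    rw [norm_inv, ← inv_div]
    exact inv_anti₀ (by have := hspos i hi; positivity) (hzlow i hi)
  have hRb' : ∀ i, i ≠ o → ‖R i‖ ≤ 2 / (κ * ε) := fun i hi =>
    (hRb i hi).trans (div_le_div_of_nonneg_left (by norm_num) (by positivity) (hslow i hi))
  have hRd : ∀ i, i ≠ o → ‖R i + (s i)⁻¹‖ ≤ 2 * (η * B1) / ‖s i‖ := by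
    intro i hi
    have hsne : s i ≠ 0 := norm_pos_iff.mp (hspos i hi)
    have e : R i + (s i)⁻¹ = R i * ((z - δ i) + s i) * (s i)⁻¹ := by
      simp only [hR]
      have := hzpos i hi
      field_simp
      ring
    rw [e, norm_mul, norm_mul, norm_inv (s i)]
    have h0 := hspos i hi
    calc _ ≤ 2 / ‖s i‖ * (η * B1 * ‖s i‖) * ‖s i‖⁻¹ := by
          gcongr
          exacts [hRb i hi, hr i hi]
      _ = _ := by field_simp
  set I : Finset ι := Finset.univ.erase o with hI
  have hIo : ∀ i ∈ I, i ≠ o := fun i hi => Finset.ne_of_mem_erase hi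
  have hsumI : ∀ f : ι → ℝ, (∀ i, 0 ≤ f i) → ∑ i ∈ I, f i ≤ ∑ i, f i := fun f hf =>
    Finset.sum_le_sum_of_subset_of_nonneg (Finset.erase_subset _ _) fun i _ _ => hf i
  set W : ℂ := (c : ℂ) * ∑ i ∈ I, v i ^ 2 * R i with hW
  set w0 : ℂ := (c : ℂ) * ∑ i ∈ I, (v₀ i : ℂ) ^ 2 * (s i)⁻¹ with hw0
  have hw0re : 0 ≤ w0.re := by
    rw [hw0, Complex.re_ofReal_mul, Complex.re_sum]
    refine mul_nonneg hc0.le (Finset.sum_nonneg fun i _ => ?_)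
    rw [← Complex.ofReal_pow, Complex.re_ofReal_mul]
    exact mul_nonneg (sq_nonneg _) (inv_re_nonneg (hsre i))
  have hw0b : ‖w0‖ ≤ a * V / κ := by
    rw [hw0, norm_mul, Complex.norm_real, Real.norm_eq_abs, abs_of_pos hc0]
    calc _ ≤ c * ∑ i ∈ I, v₀ i ^ 2 * (1 / (κ * ε)) := by
          gcongr
          refine (norm_sum_le _ _).trans (Finset.sum_le_sum fun i hi => ?_)
          rw [norm_mul, norm_inv, norm_pow, Complex.norm_real, Real.norm_eq_abs, sq_abs, inv_eq_one_div]
          gcongr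
          exact hslow i (hIo i hi)
      _ ≤ c * (V * (1 / (κ * ε))) := by
          rw [← Finset.sum_mul]
          gcongr
          exact (hsumI _ fun i => sq_nonneg _).trans hv0
      _ = _ := by rw [hc]; field_simp
  have hWb : ‖W‖ ≤ 2 * a * V / κ := by
    rw [hW, norm_mul, Complex.norm_real, Real.norm_eq_abs, abs_of_pos hc0]
    calc _ ≤ c * ∑ i ∈ I, ‖v i‖ ^ 2 * (2 / (κ * ε)) := by
          gcongr
          refine (norm_sum_le _ _).trans (Finset.sum_le_sum fun i hi => ?_)
          rw [norm_mul, norm_pow]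
          gcongr
          exact hRb' i (hIo i hi)
      _ ≤ c * (V * (2 / (κ * ε))) := by
          rw [← Finset.sum_mul]
          gcongr
          exact (hsumI _ fun i => by positivity).trans hv2
      _ = _ := by rw [hc]; field_simp
  -- `W + w0` is small, also relative to a weight below all `‖s i‖`, `i ≠ o`
  have hWd : ∀ T : ℝ, 0 ≤ T → (∀ i, i ≠ o → T ≤ ‖s i‖) → T * ‖W + w0‖ ≤ c * (η * S) := by
    intro T hT hTs
    have e : W + w0 = (c : ℂ) * ∑ i ∈ I, ((v i ^ 2 - (v₀ i : ℂ) ^ 2) * R i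
        + (v₀ i : ℂ) ^ 2 * (R i + (s i)⁻¹)) := by
      rw [hW, hw0, ← mul_add, ← Finset.sum_add_distrib]
      congr 1
      exact Finset.sum_congr rfl fun i _ => by ring
    rw [e, norm_mul, Complex.norm_real, Real.norm_eq_abs, abs_of_pos hc0, mul_left_comm]
    refine mul_le_mul_of_nonneg_left ?_ hc0.le
    have hb : ∀ i ∈ I, T * ‖(v i ^ 2 - (v₀ i : ℂ) ^ 2) * R i
        + (v₀ i : ℂ) ^ 2 * (R i + (s i)⁻¹)‖
        ≤ 2 * ‖v i ^ 2 - (v₀ i : ℂ) ^ 2‖ + 2 * (η * B1) * v₀ i ^ 2 := by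
      intro i hi
      have hi' := hIo i hi
      have h0 := hspos i hi'
      have hTs' : T / ‖s i‖ ≤ 1 := (div_le_one h0).mpr (hTs i hi')
      calc _ ≤ T * (‖v i ^ 2 - (v₀ i : ℂ) ^ 2‖ * (2 / ‖s i‖)
            + v₀ i ^ 2 * (2 * (η * B1) / ‖s i‖)) := by
            gcongr
            refine (norm_add_le _ _).trans ?_
            rw [norm_mul, norm_mul, norm_pow, Complex.norm_real, Real.norm_eq_abs, sq_abs]
            gcongr
            exacts [hRb i hi', hRd i hi']
        _ = (T / ‖s i‖) * (2 * ‖v i ^ 2 - (v₀ i : ℂ) ^ 2‖ + 2 * (η * B1) * v₀ i ^ 2) := by ring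
        _ ≤ 1 * (2 * ‖v i ^ 2 - (v₀ i : ℂ) ^ 2‖ + 2 * (η * B1) * v₀ i ^ 2) := by gcongr
        _ = _ := one_mul _
    calc _ ≤ T * ∑ i ∈ I, ‖(v i ^ 2 - (v₀ i : ℂ) ^ 2) * R i
            + (v₀ i : ℂ) ^ 2 * (R i + (s i)⁻¹)‖ := by gcongr; exact norm_sum_le _ _
      _ ≤ ∑ i ∈ I, (2 * ‖v i ^ 2 - (v₀ i : ℂ) ^ 2‖ + 2 * (η * B1) * v₀ i ^ 2) := by
          rw [Finset.mul_sum]; exact Finset.sum_le_sum hb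
      _ = 2 * ∑ i ∈ I, ‖v i ^ 2 - (v₀ i : ℂ) ^ 2‖ + 2 * (η * B1) * ∑ i ∈ I, v₀ i ^ 2 := by
          rw [Finset.sum_add_distrib, Finset.mul_sum, Finset.mul_sum]
      _ ≤ 2 * η + 2 * (η * B1) * V := by
          gcongr
          · exact (hsumI _ fun i => norm_nonneg _).trans hvd
          · exact (hsumI _ fun i => sq_nonneg _).trans hv0
      _ = _ := by rw [hS]; ring
  have hWd1 : ‖W + w0‖ ≤ 1 / 2 := by
    have h1 := hWd (κ * ε) (by positivity) hslow
    have h2 : ‖W + w0‖ ≤ a * η * S / κ := by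
      rw [le_div_iff₀ hκ]
      have : ε * (‖W + w0‖ * κ) ≤ ε * (a * η * S) := by rw [hc] at h1; linarith
      exact le_of_mul_le_mul_left this hε
    linarith
  have h1W : 1 / 2 ≤ ‖1 - W‖ := by
    have h1 : 1 ≤ ‖1 + w0‖ := by
      refine le_trans ?_ ((le_abs_self _).trans (Complex.abs_re_le_norm _))
      simp [hw0re]
    have h2 := norm_sub_norm_le (1 + w0) (1 - W)
    have e : (1 + w0) - (1 - W) = W + w0 := by ring
    rw [e] at h2
    linarith
  have h1Wb : ‖1 - W‖ ≤ M := by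
    refine (norm_sub_le _ _).trans ?_
    rw [norm_one]; linarith
  -- The Schur complement, multiplied by 1 - W, that remains at o after solving for the components i
  -- ≠ o. Its unperturbed value is -(s_o (1 + w0) + c v₀(o)²), which `le_norm_mul_add` bounds below:
  -- the rank one term acts exactly where s_o may vanish.
  set E : ℂ := (z - δ o) * (1 - W) - c * v o ^ 2 with hE
  have hElow : e1 / 2 * ε ≤ ‖E‖ := by
    have hlow := le_norm_mul_add (B := 1 + w0) (D := s o) (u := c * v₀ o ^ 2) (b := 1)
      (C := 1 + a * V / κ) one_pos (by positivity) (by simpa using hw0re)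
      ((norm_add_le _ _).trans (by rw [norm_one]; linarith)) (hsre o)
    have hlow' : e1 * ε ≤ ‖s o * (1 + w0) + ((c * v₀ o ^ 2 : ℝ) : ℂ)‖ := by
      refine le_trans ?_ hlow
      rw [one_mul, mul_one, he1, hc]
      calc _ = a * ε * κ / (1 + a * V / κ) ^ 2 := by ring
        _ ≤ _ := by gcongr
    have hdiff : ‖E + (s o * (1 + w0) + ((c * v₀ o ^ 2 : ℝ) : ℂ))‖ ≤ η * B2 * ε := by
      have e : E + (s o * (1 + w0) + ((c * v₀ o ^ 2 : ℝ) : ℂ))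
          = ((z + x) - (δ o - δ₀ o)) * (1 - W) + s o * (W + w0)
            - (c : ℂ) * (v o ^ 2 - (v₀ o : ℂ) ^ 2) := by
        simp only [hE, hs]; push_cast; ring
      rw [e]
      have t1 : ‖((z + x) - (δ o - δ₀ o)) * (1 - W)‖ ≤ η * (2 * M) * ε := by
        rw [norm_mul]
        calc _ ≤ (η * ε + η * ε) * M := by
              gcongr
              exact (norm_sub_le _ _).trans (add_le_add hz hδod)
          _ = _ := by ring
      have t2 : ‖s o * (W + w0)‖ ≤ η * (a * (1 + K / κ) * S) * ε := by
        rw [norm_mul]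
        have hso : ‖s o‖ ≤ x + K * ε := by
          refine (norm_add_le _ _).trans ?_
          rw [Complex.norm_real, Real.norm_eq_abs, abs_of_nonneg hx]
          linarith
        -- There is no upper bound on x, so the product x ‖W + w0‖ is estimated as a whole, using
        -- that every |sᵢ| is at least x.
        have h1 := hWd x hx fun i _ => hsx i
        have h2 := hWd (κ * ε) (by positivity) hslow
        calc _ ≤ (x + K * ε) * ‖W + w0‖ := by gcongr
          _ = x * ‖W + w0‖ + K / κ * (κ * ε * ‖W + w0‖) := by field_simp
          _ ≤ c * (η * S) + K / κ * (c * (η * S)) := by gcongr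
          _ = _ := by rw [hc]; ring
      have t3 : ‖(c : ℂ) * (v o ^ 2 - (v₀ o : ℂ) ^ 2)‖ ≤ η * a * ε := by
        rw [norm_mul, Complex.norm_real, Real.norm_eq_abs, abs_of_pos hc0]
        have : ‖v o ^ 2 - (v₀ o : ℂ) ^ 2‖ ≤ η :=
          (Finset.single_le_sum (f := fun i => ‖v i ^ 2 - (v₀ i : ℂ) ^ 2‖)
            (fun i _ => norm_nonneg _) (Finset.mem_univ o)).trans hvd
        calc _ ≤ c * η := by gcongr
          _ = _ := by rw [hc]; ring
      refine (norm_sub_le _ _).trans ?_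
      have := norm_add_le (((z + x) - (δ o - δ₀ o)) * (1 - W)) (s o * (W + w0))
      calc _ ≤ η * (2 * M) * ε + η * (a * (1 + K / κ) * S) * ε + η * a * ε := by linarith
        _ = _ := by rw [hB2]; ring
    have h3 := norm_sub_norm_le (s o * (1 + w0) + ((c * v₀ o ^ 2 : ℝ) : ℂ)) (-E)
    rw [norm_neg, sub_neg_eq_add, add_comm _ E] at h3
    have h4 : η * B2 * ε ≤ e1 / 2 * ε := by gcongr
    linarith
  have hEpos : 0 < ‖E‖ := lt_of_lt_of_le (by positivity) hElow
  -- solve the equations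
  set y : ι → ℂ := fun i => (z - δ i) * w i - (c : ℂ) * v i * ∑ j, v j * w j with hy
  have hyY : ∀ i, ‖y i‖ ≤ Y := hw
  set σ : ℂ := ∑ j, v j * w j with hσ
  clear_value σ
  set T : ℂ := ∑ i ∈ I, v i * (R i * y i) with hT
  have hTb : ‖T‖ ≤ 2 * V / κ / ε * Y := by
    calc ‖T‖ ≤ ∑ i ∈ I, ‖v i‖ * (2 / (κ * ε) * Y) := by
          refine (norm_sum_le _ _).trans (Finset.sum_le_sum fun i hi => ?_)
          rw [norm_mul, norm_mul]
          gcongr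
          exacts [hRb' i (hIo i hi), hyY i]
      _ ≤ V * (2 / (κ * ε) * Y) := by
          rw [← Finset.sum_mul]
          gcongr
          exact (hsumI _ fun i => norm_nonneg _).trans hv1
      _ = _ := by field_simp
  have hwi : ∀ i, i ≠ o → w i = R i * y i + (c : ℂ) * v i * R i * σ := by
    intro i hi
    have := hzpos i hi
    simp only [hR, hy]
    field_simp
    ring
  have hσ1 : σ * (1 - W) = v o * w o + T := by
    have h1 : σ = v o * w o + ∑ i ∈ I, v i * w i :=
      hσ.trans (Finset.add_sum_erase _ (fun i => v i * w i) (Finset.mem_univ o)).symm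
    have h2 : ∑ i ∈ I, v i * w i = T + W * σ := by
      rw [hT, hW, Finset.mul_sum, Finset.sum_mul, ← Finset.sum_add_distrib]
      refine Finset.sum_congr rfl fun i hi => ?_
      rw [hwi i (hIo i hi)]; ring
    rw [h2] at h1
    linear_combination h1
  have hwo : E * w o = (1 - W) * y o + c * v o * T := by
    simp only [hE, hy]
    linear_combination ((c : ℂ) * v o) * hσ1
  have hwob : ‖w o‖ ≤ C1 / ε * Y := by
    have h1 : ‖E‖ * ‖w o‖ ≤ (M + a * V * (2 * V / κ)) * Y := by
      rw [← norm_mul, hwo]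
      refine (norm_add_le _ _).trans ?_
      rw [norm_mul, norm_mul, norm_mul, Complex.norm_real, Real.norm_eq_abs, abs_of_pos hc0]
      calc _ ≤ M * Y + c * V * (2 * V / κ / ε * Y) := by
            gcongr
            exacts [hyY o, hv o]
        _ = _ := by rw [hc]; field_simp
    have h2 : e1 / 2 * ε * ‖w o‖ ≤ (M + a * V * (2 * V / κ)) * Y :=
      (mul_le_mul_of_nonneg_right hElow (norm_nonneg _)).trans h1
    have h3 : ‖w o‖ ≤ (M + a * V * (2 * V / κ)) * Y / (e1 / 2 * ε) := by
      rw [le_div_iff₀ (by positivity)]; linarith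
    refine h3.trans (le_of_eq ?_)
    rw [hC1]; field_simp
  have hσb : ‖σ‖ ≤ C2 / ε * Y := by
    have h1 : ‖σ‖ * (1 / 2) ≤ V * (C1 / ε * Y) + 2 * V / κ / ε * Y := by
      calc _ ≤ ‖σ‖ * ‖1 - W‖ := by gcongr
        _ = ‖v o * w o + T‖ := by rw [← norm_mul, hσ1]
        _ ≤ ‖v o‖ * ‖w o‖ + ‖T‖ := (norm_add_le _ _).trans (by rw [norm_mul])
        _ ≤ _ := by gcongr; exact hv o
    calc ‖σ‖ ≤ 2 * (V * (C1 / ε * Y) + 2 * V / κ / ε * Y) := by linarith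
      _ = _ := by rw [hC2]; field_simp
  intro i
  have hYε : 0 ≤ Y / ε := by positivity
  rcases eq_or_ne i o with rfl | hi
  · refine hwob.trans ?_
    gcongr
    exact le_max_left _ _
  · rw [hwi i hi]
    calc _ ≤ 2 / (κ * ε) * Y + c * V * (2 / (κ * ε)) * (C2 / ε * Y) := by
          refine (norm_add_le _ _).trans ?_
          rw [norm_mul, norm_mul, norm_mul, norm_mul, Complex.norm_real, Real.norm_eq_abs,
            abs_of_pos hc0]
          gcongr
          exacts [hRb' i hi, hyY i, hv i, hRb' i hi]
      _ = C3 / ε * Y := by rw [hC3, hc]; field_simp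
      _ ≤ _ := by gcongr; exact le_max_right _ _

/-! ### Inverses of symmetric matrices from a priori bounds in the sup norm -/

theorem matNorm_le_of_symm {ι : Type} [Fintype ι] {M : Matrix ι ι ℂ} {C : ℝ} (hC : 0 ≤ C)
    (hM : ∀ i j, M i j = M j i) (h : ∀ i, ∑ j, ‖M i j‖ ≤ C) : matNorm M ≤ C := by
  refine max_le (Real.iSup_le h hC) (Real.iSup_le (fun j => ?_) hC)
  simp_rw [hM _ j]
  exact h j

/-- The a priori bound gives injectivity, hence invertibility. Applied to the vector of phases of a
row of the inverse it gives the ℓ¹ norm of that row, and symmetry turns row sums into column sums.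
-/
theorem isUnit_and_matNorm_inv_le {ι : Type} [Fintype ι] [DecidableEq ι] {M : Matrix ι ι ℂ} {C : ℝ}
    (hC : 0 ≤ C) (hM : ∀ i j, M i j = M j i)
    (h : ∀ (w : ι → ℂ) (Y : ℝ), (∀ i, ‖M.mulVec w i‖ ≤ Y) → ∀ i, ‖w i‖ ≤ C * Y) :
    IsUnit M ∧ matNorm M⁻¹ ≤ C := by
  have hu : IsUnit M := by
    rw [← Matrix.mulVec_injective_iff_isUnit]
    intro w w' hww
    have h1 : ∀ i, ‖M.mulVec (w - w') i‖ ≤ 0 := by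
      intro i
      have hww' : M.mulVec w = M.mulVec w' := hww
      rw [Matrix.mulVec_sub, hww', sub_self, Pi.zero_apply, norm_zero]
    have h2 := h (w - w') 0 h1
    funext i
    have h3 := h2 i
    rw [mul_zero] at h3
    exact sub_eq_zero.mp (norm_le_zero_iff.mp h3)
  have hdet : IsUnit M.det := (Matrix.isUnit_iff_isUnit_det M).mp hu
  have hMt : M.transpose = M := by ext i j; exact hM j i
  refine ⟨hu, matNorm_le_of_symm hC (fun i j => ?_) fun i => ?_⟩
  · have : (M⁻¹).transpose = M⁻¹ := by rw [Matrix.transpose_nonsing_inv, hMt]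
    exact (congrFun (congrFun this i) j).symm
  -- Conjugate phases of row i. Vanishing entries give 0/0 = 0, so the sup norm of y is at most 1
  -- and the i-th component of M⁻¹ y is the row sum.
  · set y : ι → ℂ := fun j => (starRingEnd ℂ) (M⁻¹ i j) / ‖M⁻¹ i j‖ with hy
    have h1 := h (M⁻¹.mulVec y) 1 (fun j => by
      rw [Matrix.mulVec_mulVec, Matrix.mul_nonsing_inv _ hdet, Matrix.one_mulVec]
      simp only [hy]
      rw [norm_div, RCLike.norm_conj, Complex.norm_real, norm_norm]
      exact div_self_le_one _) i
    rw [mul_one] at h1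
    have h2 : M⁻¹.mulVec y i = ((∑ j, ‖M⁻¹ i j‖ : ℝ) : ℂ) := by
      rw [Matrix.mulVec, dotProduct, Complex.ofReal_sum]
      refine Finset.sum_congr rfl fun j _ => ?_
      simp only [hy]
      rw [← mul_div_assoc, Complex.mul_conj, Complex.normSq_eq_norm_sq]
      rcases eq_or_ne ‖M⁻¹ i j‖ 0 with h0 | h0
      · simp [h0]
      · have : ((‖M⁻¹ i j‖ : ℝ) : ℂ) ≠ 0 := by exact_mod_cast h0
        push_cast
        field_simp
    rw [h2, Complex.norm_real, Real.norm_eq_abs] at h1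
    exact (le_abs_self _).trans h1

/-! ### Size and perturbation of Δ̂ in parabolic variables -/

theorem one_le_scaleFactor_pow {L : ℕ} (hL : 0 < L) (ν : Fin 4) (n : ℕ) :
    (1 : ℝ) ≤ ((scaleFactor L ν ^ n : ℕ) : ℝ) := by
  exact_mod_cast Nat.one_le_pow _ _ (scaleFactor_pos hL ν)

theorem norm_rePart_apply (p : Fin 4 → ℂ) (ν : Fin 4) : ‖rePart p ν‖ = |(p ν).re| := by
  rw [rePart, Complex.norm_real, Real.norm_eq_abs]

/-- The parabolic size `|Re p₀| + |Re 𝐩|²` of a momentum. -/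
noncomputable def parSize (p : Fin 4 → ℂ) : ℝ := ‖rePart p 0‖ + ‖Fin.tail (rePart p)‖ ^ 2

theorem parSize_nonneg (p : Fin 4 → ℂ) : 0 ≤ parSize p := by unfold parSize; positivity

/-- Size and perturbation of the symbol of `Δ⁽ⁿ⁾` in the strips belonging to the block size `L`. -/
theorem IsHamiltonian.exists_deltaHat_bounds {h : (Fin 3 → ℤ) → ℂ} (hh : IsHamiltonian h) {𝔮 : ℕ}
    (hq : 1 ≤ 𝔮) {a : ℝ} (ha : 0 < a) :
    ∃ m C κ : ℝ, 0 < m ∧ m ≤ 1 ∧ 0 < C ∧ 0 < κ ∧ ∀ L : ℕ, Odd L → 1 < L →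
      4 * cellBound (2 * 𝔮) < L → ∀ n : ℕ,
        (∀ p : Fin 4 → ℂ, (∀ ν, |(p ν).im| ≤ m) → AnalyticAt ℂ (deltaHat L 𝔮 a h n) p) ∧
        ∀ (p : Fin 4 → ℂ) (t : ℝ), 0 < t → t ≤ m → (∀ ν, |(p ν).re| ≤ Real.pi) →
          |(p 0).im| ≤ t / (L : ℝ) ^ 2 → (∀ ν : Fin 3, |(p ν.succ).im| ≤ t / L) →
          ‖deltaHat L 𝔮 a h n p‖ ≤ C ∧
          ‖deltaHat L 𝔮 a h n p - deltaHat L 𝔮 a h n (rePart p)‖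
            ≤ C * t * (1 / (L : ℝ) ^ 2 + parSize p) ∧
          κ * parSize p ≤ ‖deltaHat L 𝔮 a h n (rePart p)‖ ∧
          ‖deltaHat L 𝔮 a h n (rePart p)‖ ≤ C * parSize p ∧
          0 ≤ (deltaHat L 𝔮 a h n (rePart p)).re := by
  obtain ⟨m, CG, hm, hm1, hCG, hG⟩ := hh.exists_deltaHat_factor hq ha
  obtain ⟨CU, hCU, hU⟩ := hh.exists_diffHat_le
  obtain ⟨cl, hcl, hlow⟩ := hh.exists_diffHat_ge
  obtain ⟨CD, hCD, hD⟩ := hh.exists_diffHat_sub_rePart_le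
  refine ⟨m, max (42 * CU * CG) (max (3 * CD * CG + CU * CG) (CU * CG)), cl / CG, hm, hm1,
    by positivity, by positivity, fun L hL hL1 hΓ n => ?_⟩
  obtain ⟨G, hG1, hG2, hG3, hG4⟩ := hG L hL hL1 hΓ n
  refine ⟨hG3, fun p t ht htm hre him0 hims => ?_⟩
  have hLpos : 0 < L := hL.pos
  have hL1' : (1 : ℝ) ≤ L := by exact_mod_cast hLpos
  have hL0' : (0 : ℝ) < L := by linarith
  have htL : t / L ≤ t := div_le_self ht.le hL1'
  have htL2 : t / (L : ℝ) ^ 2 ≤ t := div_le_self ht.le (one_le_pow₀ hL1')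
  have him : ∀ ν, |(p ν).im| ≤ t := by
    intro ν
    rcases Fin.eq_zero_or_eq_succ ν with rfl | ⟨j, rfl⟩
    · exact him0.trans htL2
    · exact (hims j).trans htL
  have himm : ∀ ν, |(p ν).im| ≤ m := fun ν => (him ν).trans htm
  have him1 : ∀ ν, |(p ν).im| ≤ 1 := fun ν => (himm ν).trans hm1
  have hπ := Real.pi_lt_d2
  have h5 : ∀ ν, |(p ν).re| ≤ 5 := fun ν => by linarith [hre ν]
  have hrR : ∀ ν, |(rePart p ν).re| ≤ Real.pi := fun ν => by simpa [rePart] using hre ν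
  have hrI : ∀ ν, |(rePart p ν).im| ≤ m := fun ν => by simp [rePart, hm.le]
  have hrR5 : ∀ ν, |(rePart p ν).re| ≤ 5 := fun ν => by linarith [hrR ν]
  have hrI1 : ∀ ν, |(rePart p ν).im| ≤ 1 := fun ν => (hrI ν).trans hm1
  have hcent : ∀ q : Fin 4 → ℂ, (∀ ν, |(q ν).re| ≤ Real.pi) → ∀ ν,
      |(q ν).re| ≤ Real.pi * ((scaleFactor L ν ^ n : ℕ) : ℝ) := fun q hq ν => by
    have := one_le_scaleFactor_pow hLpos ν n
    nlinarith [hq ν, Real.pi_pos]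
  obtain ⟨e1, g1, g2⟩ := hG1 p hre himm
  obtain ⟨e2, g3, g4⟩ := hG1 (rePart p) hrR hrI
  have g5 := hG2 p hre t ht htm him
  set D := diffHat L h n p
  set D0 := diffHat L h n (rePart p)
  have hA := parSize_nonneg p
  have d1 : ‖D0‖ ≤ CU * parSize p := hU L hLpos n (rePart p) hrR5 hrI1
  have d2 : cl * parSize p ≤ ‖D0‖ := hlow L hLpos n (rePart p) (isReal_rePart p) (hcent _ hrR)
  have d3 : ‖D - D0‖ ≤ 3 * CD * t * (1 / (L : ℝ) ^ 2 + parSize p) := by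
    have h1 := hD L hLpos n p (t / L) (htL.trans (htm.trans hm1)) (him1 0) hims (hcent _ hre)
    refine h1.trans ?_
    -- With imaginary parts t/L² in time and t/L in space, every term is of order t (L⁻² + `parSize
    -- p`). The mixed term Y/L is split as Y² + L⁻².
    have h2 : |(p 0).im| + (‖Fin.tail (rePart p)‖ + t / L) * (t / L)
        ≤ 3 * t * (1 / (L : ℝ) ^ 2 + parSize p) := by
      set Y := ‖Fin.tail (rePart p)‖ with hY
      have hY0 : 0 ≤ Y := norm_nonneg _
      have hp : Y ^ 2 ≤ parSize p := by
        unfold parSize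
        have := norm_nonneg (rePart p 0)
        linarith
      set e := (L : ℝ)⁻¹ with he
      have he0 : 0 < e := by positivity
      have e3 : 1 / (L : ℝ) ^ 2 = e ^ 2 := by rw [he, inv_pow, one_div]
      rw [div_eq_mul_inv, ← inv_pow, ← he] at him0
      rw [e3, div_eq_mul_inv, ← he]
      have t1 : t ≤ 1 := htm.trans hm1
      have k1 : Y * e ≤ Y ^ 2 + e ^ 2 := by nlinarith [sq_nonneg (Y - e)]
      have k2 : (Y + t * e) * (t * e) ≤ t * (Y ^ 2 + e ^ 2) + t * e ^ 2 := by
        have : t * (t * e ^ 2) ≤ t * (1 * e ^ 2) := by gcongr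
        have k3 : t * (Y * e) ≤ t * (Y ^ 2 + e ^ 2) := by gcongr
        nlinarith
      have k4 : t * Y ^ 2 ≤ t * parSize p := by gcongr
      have k5 : 0 ≤ t * parSize p := by positivity
      nlinarith
    calc _ ≤ CD * (3 * t * (1 / (L : ℝ) ^ 2 + parSize p)) := by gcongr
      _ = _ := by ring
  have hS : 0 ≤ 1 / (L : ℝ) ^ 2 := by positivity
  refine ⟨?_, ?_, ?_, ?_, hG4 _ (isReal_rePart p) hrR⟩
  · refine le_trans ?_ (le_max_left _ _)
    rw [e1, norm_mul]
    have h6 : ∀ ν, ‖p ν‖ ≤ 6 := fun ν => by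
      have := Complex.norm_le_abs_re_add_abs_im (p ν)
      linarith [h5 ν, him1 ν]
    have h7 := norm_tail_le (by norm_num) h6
    have h8 : ‖p 0‖ + ‖Fin.tail p‖ ^ 2 ≤ 42 := by nlinarith [h6 0, norm_nonneg (Fin.tail p)]
    have h9 : ‖D‖ ≤ CU * 42 := (hU L hLpos n p h5 him1).trans (by gcongr)
    calc _ ≤ CU * 42 * CG := by gcongr
      _ = _ := by ring
  · rw [e1, e2]
    have e : D * G p - D0 * G (rePart p) = (D - D0) * G p + D0 * (G p - G (rePart p)) := by ring
    rw [e]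
    calc _ ≤ 3 * CD * t * (1 / (L : ℝ) ^ 2 + parSize p) * CG
          + CU * parSize p * (CG * t) := by
          refine (norm_add_le _ _).trans ?_
          rw [norm_mul, norm_mul]
          gcongr
      _ ≤ 3 * CD * t * (1 / (L : ℝ) ^ 2 + parSize p) * CG
          + CU * (1 / (L : ℝ) ^ 2 + parSize p) * (CG * t) := by
          gcongr; linarith
      _ = (3 * CD * CG + CU * CG) * t * (1 / (L : ℝ) ^ 2 + parSize p) := by ring
      _ ≤ _ := by
          gcongr
          exact (le_max_left _ _).trans (le_max_right _ _)
  · rw [e2, norm_mul]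
    calc _ = cl * parSize p * CG⁻¹ := by ring
      _ ≤ _ := by gcongr
  · rw [e2, norm_mul]
    calc _ ≤ CU * parSize p * CG := by gcongr
      _ = CU * CG * parSize p := by ring
      _ ≤ _ := by
          gcongr
          exact (le_max_right _ _).trans (le_max_right _ _)

/-! ### Floquet matrices -/

theorem unscale_add (L : ℕ) (p p' : Fin 4 → ℂ) : unscale L (p + p') = unscale L p + unscale L p' := by
  funext ν; simp [unscale, add_div]

theorem unscale_latticeVec {L : ℕ} (hL : 0 < L) (s : Fin 4 → ℤ) :
    unscale L (latticeVec fun ν => ((scaleFactor L ν ^ 1 : ℕ) : ℤ) * s ν) = latticeVec s := by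
  funext ν
  have : (scaleFactor L ν : ℂ) ≠ 0 := by exact_mod_cast (scaleFactor_pos hL ν).ne'
  simp only [unscale, latticeVec]
  push_cast
  field_simp

theorem deltaHat_unscale_latticePeriodic {L : ℕ} (hL : 0 < L) (𝔮 : ℕ) (a : ℝ)
    (h : (Fin 3 → ℤ) → ℂ) (n : ℕ) :
    LatticePeriodic L 1 fun p => deltaHat L 𝔮 a h n (unscale L p) := by
  intro p s
  have := deltaHat_latticePeriodic hL 𝔮 a h n (unscale L p) s
  simp only [pow_zero, Nat.cast_one, one_mul] at this
  simp only [unscale_add, unscale_latticeVec hL, this]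

theorem floquet_apply (L 𝔮 : ℕ) (a : ℝ) (h : (Fin 3 → ℤ) → ℂ) (n : ℕ) (k : Fin 4 → ℂ)
    (l l' : DualCell L 1) : floquet L 𝔮 a h n k l l' =
      (a : ℂ) / (L : ℂ) ^ 2 * uN L 1 (k + l.momentum) ^ 𝔮 * uN L 1 (k + l'.momentum) ^ 𝔮
        + if l = l' then deltaHat L 𝔮 a h n (unscale L (k + l.momentum)) else 0 := by
  simp only [floquet, Matrix.of_apply, uPlus_unscale]

theorem floquet_symm (L 𝔮 : ℕ) (a : ℝ) (h : (Fin 3 → ℤ) → ℂ) (n : ℕ) (k : Fin 4 → ℂ)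
    (l l' : DualCell L 1) : floquet L 𝔮 a h n k l l' = floquet L 𝔮 a h n k l' l := by
  rw [floquet_apply, floquet_apply]
  rcases eq_or_ne l l' with rfl | hne
  · rfl
  · rw [if_neg hne, if_neg hne.symm]; ring

/-- Translating the momentum by `2πℤ⁴` permutes the indices of the Floquet matrices. -/
theorem exists_perm_floquet {L : ℕ} (hL : 0 < L) (r : Fin 4 → ℤ) :
    ∃ σ : Equiv.Perm (DualCell L 1),
      (∀ (α : Type) (F : (Fin 4 → ℂ) → α), LatticePeriodic L 1 F →
        ∀ p (l : DualCell L 1), F (p + latticeVec r + l.momentum) = F (p + (σ l).momentum)) ∧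
      ∀ 𝔮 a h n k, floquet L 𝔮 a h n (k + latticeVec r) = (floquet L 𝔮 a h n k).submatrix σ σ := by
  obtain ⟨σ, hσ⟩ := LatticePeriodic.exists_perm hL 1 r
  refine ⟨σ, hσ, fun 𝔮 a h n k => ?_⟩
  ext l l'
  rw [Matrix.submatrix_apply, floquet_apply, floquet_apply,
    hσ _ _ (uN_latticePeriodic hL 1) k l, hσ _ _ (uN_latticePeriodic hL 1) k l',
    hσ _ _ (deltaHat_unscale_latticePeriodic hL 𝔮 a h n) k l]
  simp only [σ.injective.eq_iff]

theorem matNorm_submatrix {ι : Type} [Fintype ι] (M : Matrix ι ι ℂ) (σ : Equiv.Perm ι) :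
    matNorm (M.submatrix σ σ) = matNorm M := by
  unfold matNorm
  simp only [Matrix.submatrix_apply]
  congr 1
  · rw [← σ.iSup_comp (g := fun i => ∑ j, ‖M i j‖)]
    exact iSup_congr fun i => Equiv.sum_comp σ fun j => ‖M (σ i) j‖
  · rw [← σ.iSup_comp (g := fun j => ∑ i, ‖M i j‖)]
    exact iSup_congr fun j => Equiv.sum_comp σ fun i => ‖M i (σ j)‖

theorem abs_im_le_of_mem_strip {m : ℝ} {k : Fin 4 → ℂ} (hk : k ∈ strip m) (ν : Fin 4) :
    |(k ν).im| ≤ m := by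
  have hk' : Real.sqrt (∑ ν, (k ν).im ^ 2) < m := hk
  refine le_trans ?_ hk'.le
  rw [← Real.sqrt_sq_eq_abs]
  exact Real.sqrt_le_sqrt (Finset.single_le_sum (f := fun ν => (k ν).im ^ 2)
    (fun _ _ => sq_nonneg _) (Finset.mem_univ ν))

theorem unscale_apply_re (L : ℕ) (p : Fin 4 → ℂ) (ν : Fin 4) :
    (unscale L p ν).re = (p ν).re / scaleFactor L ν := by
  rw [unscale, show (scaleFactor L ν : ℂ) = ((scaleFactor L ν : ℝ) : ℂ) by simp,
    Complex.div_ofReal_re]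

theorem unscale_apply_im (L : ℕ) (p : Fin 4 → ℂ) (ν : Fin 4) :
    (unscale L p ν).im = (p ν).im / scaleFactor L ν := by
  rw [unscale, show (scaleFactor L ν : ℂ) = ((scaleFactor L ν : ℝ) : ℂ) by simp,
    Complex.div_ofReal_im]

theorem exists_nonneg_norm_add_le {z : ℂ} {r : ℝ} (hz : Metric.infDist z negAxis < r) :
    ∃ x : ℝ, 0 ≤ x ∧ ‖z + x‖ ≤ r := by
  have hne : negAxis.Nonempty := ⟨0, by simp [negAxis]⟩
  obtain ⟨y, ⟨hy1, hy2⟩, hyz⟩ := (Metric.infDist_lt_iff hne).mp hz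
  refine ⟨-y.re, by linarith, ?_⟩
  have : y = (y.re : ℂ) := Complex.ext (by simp) (by simp [hy1])
  rw [dist_eq_norm, this] at hyz
  push_cast
  rw [← sub_eq_add_neg]
  exact hyz.le

/-- The Schwarz estimate is applied to each entry with its own decaying bound, so the perturbation
is summable over ℓ and not merely bounded entry by entry. -/
theorem sum_norm_uN_sq_sub_le {L : ℕ} (hL : Odd L) {𝔮 : ℕ} (hq : 1 ≤ 𝔮) {k : Fin 4 → ℂ}
    (hre : ∀ ν, |(k ν).re| ≤ Real.pi) {t : ℝ} (ht : 0 < t) (ht1 : t < 1)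
    (him : ∀ ν, |(k ν).im| ≤ t) :
    ∑ l : DualCell L 1, ‖(uN L 1 (k + l.momentum) ^ 𝔮) ^ 2
      - (uN L 1 (rePart k + l.momentum) ^ 𝔮) ^ 2‖ ≤ 2 * cellBound (2 * 𝔮) * t := by
  calc _ ≤ ∑ l : DualCell L 1, 2 * (14 ^ 4 * cellWeight l) ^ (2 * 𝔮) / 1 * t := by
        refine Finset.sum_le_sum fun l _ => ?_
        refine norm_sub_rePart_le (F := fun k => (uN L 1 (k + l.momentum) ^ 𝔮) ^ 2) le_rfl
          (fun p h1 h2 => ⟨?_, ?_⟩) hre him ht ht1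
        · exact (((analyticAt_comp_add_const (analyticAt_uN L 1 _)).fun_pow _).fun_pow _).differentiableAt
        · rw [← pow_mul, norm_pow, mul_comm 𝔮]
          exact pow_le_pow_left₀ (norm_nonneg _) (norm_uN_cell_le hL 1 h1 h2 l) _
    _ = 2 * ((14 ^ 4) ^ (2 * 𝔮) * ∑ l : DualCell L 1, cellWeight l ^ (2 * 𝔮)) * t := by
        rw [Finset.mul_sum, Finset.mul_sum, Finset.sum_mul]
        exact Finset.sum_congr rfl fun l _ => by rw [mul_pow]; ring
    _ ≤ _ := by
        unfold cellBound
        gcongr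
        exact sum_cellWeight_pow_le L 1 (by omega)

theorem latticePeriodic_zero {α : Type*} {L : ℕ} {F : (Fin 4 → ℂ) → α} (hF : LatticePeriodic L 0 F)
    (p : Fin 4 → ℂ) (s : Fin 4 → ℤ) : F (p + latticeVec s) = F p := by
  simpa using hF p s

/-- The rank one lemma with ε = L⁻², distinguished index ℓ = 0, and comparison data taken at real
momenta. Translation by 2πℤ⁴ only permutes the indices, so it is enough to treat k in the
fundamental cell. -/
theorem IsHamiltonian.exists_floquetConstants {h : (Fin 3 → ℤ) → ℂ} (hh : IsHamiltonian h) {𝔮 : ℕ}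
    (hq : 2 ≤ 𝔮) {a : ℝ} (ha : 0 < a) :
    ∃ m₂ lam₀ Γ₈ : ℝ, FloquetConstants 𝔮 a h (4 * cellBound (2 * 𝔮)) m₂ lam₀ Γ₈ := by
  obtain ⟨m, C, κ', hm, hm1, hC, hκ', hb⟩ := hh.exists_deltaHat_bounds (by omega : 1 ≤ 𝔮) ha
  have hπ := Real.pi_pos
  set V : ℝ := max ((14 ^ 4) ^ 𝔮) (max (cellBound 𝔮) (cellBound (2 * 𝔮))) with hV
  have hV1 : (14 ^ 4 : ℝ) ^ 𝔮 ≤ V := le_max_left _ _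
  have hV2 : cellBound 𝔮 ≤ V := (le_max_left _ _).trans (le_max_right _ _)
  have hV3 : cellBound (2 * 𝔮) ≤ V := (le_max_right _ _).trans (le_max_right _ _)
  have hV0 : 0 < V := (cellBound_pos 𝔮).trans_le hV2
  set κ : ℝ := min κ' (((2 / Real.pi) ^ 4) ^ (2 * 𝔮)) with hκ
  have hκ0 : 0 < κ := by positivity
  set P : ℝ := Real.pi + Real.pi ^ 2 with hP
  have hP0 : 0 < P := by positivity
  obtain ⟨η, CR, hη, hCR, hres⟩ := exists_rankOne_resolvent_bound ha hV0 hκ0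
    (by positivity : 0 < C * P)
  set D : ℝ := 2 * C / κ' + C * (1 + P) + 2 * cellBound (2 * 𝔮) with hD
  have hcb := cellBound_pos (2 * 𝔮)
  have hD0 : 0 < D := by positivity
  -- D dominates each of the three perturbation constants: the relative one for ℓ ≠ 0, the one at ℓ
  -- = 0, and that of v.
  set t : ℝ := min (m / 2) (η / D) with ht
  have ht0 : 0 < t := by positivity
  have htm : t ≤ m := (min_le_left _ _).trans (by linarith)
  have ht1 : t < 1 := (min_le_left _ _).trans_lt (by linarith)
  have htD : t * D ≤ η := by
    have : t ≤ η / D := min_le_right _ _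
    rwa [le_div_iff₀ hD0] at this
  have htη1 : 2 * C / κ' * t ≤ η := by
    have : t * (2 * C / κ') ≤ t * D := by
      gcongr
      have : 0 ≤ C * (1 + P) := by positivity
      linarith
    linarith
  have htη2 : C * t * (1 + P) ≤ η := by
    have : t * (C * (1 + P)) ≤ t * D := by
      gcongr
      have : 0 ≤ 2 * C / κ' := by positivity
      linarith
    linarith
  have htη3 : 2 * cellBound (2 * 𝔮) * t ≤ η := by
    have : t * (2 * cellBound (2 * 𝔮)) ≤ t * D := by
      gcongr
      have : 0 ≤ 2 * C / κ' + C * (1 + P) := by positivity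
      linarith
    linarith
  -- the estimates for momenta in the fundamental cell
  have main : ∀ L : ℕ, Odd L → 1 < L → 4 * cellBound (2 * 𝔮) < L → ∀ (n : ℕ) (k : Fin 4 → ℂ),
      (∀ ν, |(k ν).re| ≤ Real.pi) → (∀ ν, |(k ν).im| ≤ t) →
      matNorm (floquet L 𝔮 a h n k) ≤ a * V * V + C ∧
      ∀ z : ℂ, Metric.infDist z negAxis ≤ η / 2 / (L : ℝ) ^ 2 →
        IsUnit (z • 1 - floquet L 𝔮 a h n k) ∧
        matNorm (z • 1 - floquet L 𝔮 a h n k)⁻¹ ≤ CR * (L : ℝ) ^ 2 := by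
    intro L hL hL1 hΓ n k hre him
    have hLpos : 0 < L := hL.pos
    have : NeZero L := ⟨hLpos.ne'⟩
    have hL0' : (0 : ℝ) < L := by exact_mod_cast hLpos
    have hL1' : (1 : ℝ) ≤ L := by exact_mod_cast hLpos
    obtain ⟨-, hb⟩ := hb L hL hL1 hΓ n
    have him1 : ∀ ν, |(k ν).im| ≤ 1 := fun ν => (him ν).trans ht1.le
    have hre5 : ∀ ν, |(k ν).re| ≤ 5 := fun ν => by linarith [hre ν, Real.pi_lt_d2]
    set o := originCell L 1 with ho
    set ε : ℝ := 1 / (L : ℝ) ^ 2 with hε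
    have hε0 : 0 < ε := by positivity
    have hε1 : ε ≤ 1 := by
      rw [hε, div_le_one (by positivity)]; exact one_le_pow₀ hL1'
    set v : DualCell L 1 → ℂ := fun l => uN L 1 (k + l.momentum) ^ 𝔮 with hv
    set v₀ : DualCell L 1 → ℝ := fun l => (uN L 1 (rePart k + l.momentum)).re ^ 𝔮 with hv₀
    set δ : DualCell L 1 → ℂ := fun l => deltaHat L 𝔮 a h n (unscale L (k + l.momentum)) with hδ
    have hv₀c : ∀ l, (v₀ l : ℂ) = uN L 1 (rePart k + l.momentum) ^ 𝔮 := by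
      intro l
      rw [hv₀, uN_eq_ofReal hL 1 ((isReal_rePart k).add_momentum l)]
      push_cast
      rfl
    have hrim : ∀ ν, |(rePart k ν).im| ≤ 1 := fun ν => by simp [rePart]
    -- centered representatives
    have hcent : ∀ l : DualCell L 1, ∃ q : Fin 4 → ℂ, (∀ ν, |(q ν).re| ≤ Real.pi) ∧
        |(q 0).im| ≤ t / (L : ℝ) ^ 2 ∧ (∀ ν : Fin 3, |(q ν.succ).im| ≤ t / L) ∧
        δ l = deltaHat L 𝔮 a h n q ∧ (l ≠ o → ε ≤ parSize q) ∧ (l = o → parSize q ≤ P * ε) := by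
      intro l
      have hreal : ∀ (q : Fin 4 → ℂ), (∀ ν, (q ν).im = (unscale L (k + l.momentum) ν).im) →
          |(q 0).im| ≤ t / (L : ℝ) ^ 2 ∧ ∀ ν : Fin 3, |(q ν.succ).im| ≤ t / L := by
        intro q hq
        constructor
        · rw [hq, unscale_apply_im, scaleFactor_zero, Pi.add_apply, Complex.add_im, momentum_im,
            add_zero, abs_div, Nat.cast_pow, abs_of_pos (by positivity : (0 : ℝ) < (L : ℝ) ^ 2)]
          gcongr
          exact him 0
        · intro ν
          rw [hq, unscale_apply_im, scaleFactor_succ, Pi.add_apply, Complex.add_im, momentum_im,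
            add_zero, abs_div, abs_of_pos hL0']
          gcongr
          exact him ν.succ
      by_cases hlo : l = o
      · refine ⟨unscale L k, fun ν => ?_, ?_⟩
        · rw [unscale_apply_re, abs_div]
          have : (1 : ℝ) ≤ |(scaleFactor L ν : ℝ)| := by
            rw [abs_of_nonneg (by positivity)]; exact_mod_cast scaleFactor_pos hLpos ν
          exact (div_le_self (abs_nonneg _) this).trans (hre ν)
        · have hk : k + l.momentum = k := by rw [hlo, ho, originCell_momentum, add_zero]
          obtain ⟨h1, h2⟩ := hreal (unscale L k) (fun ν => by rw [hk])
          refine ⟨h1, h2, by simp only [hδ, hk], fun hne => absurd hlo hne, fun _ => ?_⟩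
          have n0 : ‖rePart (unscale L k) 0‖ ≤ Real.pi * ε := by
            rw [norm_rePart_apply, unscale_apply_re, scaleFactor_zero, abs_div, Nat.cast_pow,
              abs_of_pos (by positivity : (0 : ℝ) < (L : ℝ) ^ 2), hε, mul_one_div]
            gcongr
            exact hre 0
          have n1 : ‖Fin.tail (rePart (unscale L k))‖ ≤ Real.pi / L := by
            rw [pi_norm_le_iff_of_nonneg (by positivity)]
            intro ν
            rw [Fin.tail, norm_rePart_apply, unscale_apply_re, scaleFactor_succ, abs_div,
              abs_of_pos hL0']
            gcongr
            exact hre ν.succ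
          -- In the fundamental cell |k₀|/L² and |𝐤|²/L² are at most π ε and π² ε, whence P = π +
          -- π².
          calc parSize (unscale L k) ≤ Real.pi * ε + (Real.pi / L) ^ 2 := by
                unfold parSize; gcongr
            _ = P * ε := by rw [hP, hε]; field_simp
      · obtain ⟨s, hs⟩ := exists_add_latticeVec_re_le (unscale L (k + l.momentum))
        obtain ⟨h1, h2⟩ := hreal _ (fun ν => (hs ν).2)
        refine ⟨_, fun ν => (hs ν).1, h1, h2,
          (latticePeriodic_zero (deltaHat_latticePeriodic hLpos 𝔮 a h n) _ s).symm,
          fun _ => ?_, fun he => absurd he hlo⟩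
        set q := unscale L (k + l.momentum) + latticeVec s with hq
        obtain ⟨ν, hν⟩ := exists_ne_zero_of_ne_originCell hlo
        have hN : (0 : ℝ) < scaleFactor L ν := by exact_mod_cast scaleFactor_pos hLpos ν
        have key := one_le_abs_re_of_cell (l ν).isLt hν (hre5 ν) (s ν)
        have e : (k ν).re + 2 * Real.pi * ((l ν : ℕ) : ℝ)
            + 2 * Real.pi * (((scaleFactor L ν ^ 1 : ℕ) : ℝ) * s ν) = scaleFactor L ν * (q ν).re := by
          rw [hq, Pi.add_apply, Complex.add_re, unscale_apply_re, latticeVec_re, Pi.add_apply,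
            Complex.add_re, momentum_eq_latticeVec, latticeVec_re]
          push_cast
          field_simp
        rw [e, abs_mul, abs_of_pos hN, ← norm_rePart_apply] at key
        rcases Fin.eq_zero_or_eq_succ ν with rfl | ⟨j, rfl⟩
        · rw [scaleFactor_zero] at key
          push_cast at key
          have : ε ≤ ‖rePart q 0‖ := by rw [hε, div_le_iff₀ (by positivity)]; linarith
          unfold parSize
          have := sq_nonneg ‖Fin.tail (rePart q)‖
          linarith
        · rw [scaleFactor_succ] at key
          have h3 : 1 / (L : ℝ) ≤ ‖Fin.tail (rePart q)‖ := by
            rw [div_le_iff₀ hL0', mul_comm]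
            refine key.trans ?_
            gcongr
            exact norm_le_pi_norm (Fin.tail (rePart q)) j
          have h4 : ε ≤ ‖Fin.tail (rePart q)‖ ^ 2 := by
            rw [hε, ← one_div_pow]; gcongr
          unfold parSize
          have := norm_nonneg (rePart q 0)
          linarith
    choose q hqre hq0 hqs hqδ hqne hqo using hcent
    have hbq := fun l => hb (q l) t ht0 htm (hqre l) (hq0 l) (hqs l)
    set δ₀ : DualCell L 1 → ℂ := fun l => deltaHat L 𝔮 a h n (rePart (q l)) with hδ₀
    have hvb : ∀ l, ‖v l‖ ≤ V := by
      intro l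
      simp only [hv, norm_pow]
      refine le_trans (pow_le_pow_left₀ (norm_nonneg _)
        ((norm_uN_cell_le hL 1 hre5 him1 l).trans ?_) 𝔮) hV1
      exact mul_le_of_le_one_right (by norm_num)
        (Finset.prod_le_one (fun _ _ => (circWeight_pos _ _).le) fun _ _ => circWeight_le_one _ _)
    -- The ℓ¹ bound on v itself, with exponent 𝔮 in place of 2𝔮, is what needs 𝔮 ≥ 2.
    have hvs : ∑ l, ‖v l‖ ≤ V := by
      simp only [hv, norm_pow]
      exact (sum_norm_uN_pow_le hL 1 hq him1).trans hV2
    have hvs2 : ∑ l, ‖v l‖ ^ 2 ≤ V := by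
      simp only [hv, norm_pow, ← pow_mul, mul_comm 𝔮 2]
      exact (sum_norm_uN_pow_le hL 1 (by omega) him1).trans hV3
    have hv0s : ∑ l, v₀ l ^ 2 ≤ V := by
      have : ∀ l, v₀ l ^ 2 = ‖uN L 1 (rePart k + l.momentum)‖ ^ (2 * 𝔮) := by
        intro l
        have h1 : ‖(v₀ l : ℂ)‖ ^ 2 = v₀ l ^ 2 := by
          rw [Complex.norm_real, Real.norm_eq_abs, sq_abs]
        rw [← h1, hv₀c, norm_pow, ← pow_mul, mul_comm 𝔮]
      simp_rw [this]
      exact (sum_norm_uN_pow_le hL 1 (by omega) hrim).trans hV3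
    have hvd : ∑ l, ‖v l ^ 2 - (v₀ l : ℂ) ^ 2‖ ≤ η := by
      simp_rw [hv₀c]
      exact (sum_norm_uN_sq_sub_le hL (by omega) hre ht0 ht1 him).trans htη3
    have hvo : κ ≤ v₀ o ^ 2 := by
      have h1 : ‖(v₀ o : ℂ)‖ ^ 2 = v₀ o ^ 2 := by
        rw [Complex.norm_real, Real.norm_eq_abs, sq_abs]
      rw [← h1, hv₀c, norm_pow, ← pow_mul, mul_comm 𝔮, ho, originCell_momentum, add_zero]
      refine (min_le_right _ _).trans (pow_le_pow_left₀ (by positivity)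
        (norm_uN_ge hL 1 (isReal_rePart k) fun ν => by simpa [rePart] using hre ν) _)
    have hfl : ∀ l l', floquet L 𝔮 a h n k l l'
        = ((a * ε : ℝ) : ℂ) * v l * v l' + if l = l' then δ l else 0 := by
      intro l l'
      rw [floquet_apply, hε]
      push_cast
      rw [mul_one_div]
    constructor
    · refine matNorm_le_of_symm (by positivity) (floquet_symm L 𝔮 a h n k) fun l => ?_
      calc _ ≤ ∑ l', (a * V * ‖v l'‖ + if l = l' then C else 0) := by
            refine Finset.sum_le_sum fun l' _ => ?_
            rw [hfl]
            refine (norm_add_le _ _).trans (add_le_add ?_ ?_)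
            · rw [norm_mul, norm_mul, Complex.norm_real, Real.norm_eq_abs,
                abs_of_pos (by positivity)]
              have h1 : a * ε ≤ a := mul_le_of_le_one_right ha.le hε1
              gcongr
              exact hvb l
            · split_ifs
              · rw [hqδ]; exact (hbq l).1
              · simp
        _ ≤ _ := by
            rw [Finset.sum_add_distrib, ← Finset.mul_sum, Finset.sum_ite_eq,
              if_pos (Finset.mem_univ _)]
            gcongr
    · intro z hz
      have hz' : Metric.infDist z negAxis < η * ε := by
        refine hz.trans_lt ?_
        rw [hε, mul_one_div]
        gcongr
        linarith
      obtain ⟨x, hx0, hx⟩ := exists_nonneg_norm_add_le hz'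
      refine isUnit_and_matNorm_inv_le (by positivity) (fun l l' => ?_) fun w Y hw => ?_
      · rw [Matrix.sub_apply, Matrix.sub_apply, floquet_symm, Matrix.smul_apply, Matrix.smul_apply,
          Matrix.one_apply, Matrix.one_apply]
        simp only [eq_comm]
      · have e1 : CR * (L : ℝ) ^ 2 = CR / ε := by rw [hε]; field_simp
        rw [e1]
        refine hres (DualCell L 1) o ε v δ δ₀ v₀ z x hε0 hvb hvs hvs2 hv0s hvd hvo
          (fun l => (hbq l).2.2.2.2) (fun l hl => ?_) (fun l hl => ?_) ?_ ?_ hx0 hx w Y fun l => ?_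
        · refine le_trans ?_ (hbq l).2.2.1
          have h1 := hqne l hl
          have h2 : κ ≤ κ' := min_le_left _ _
          gcongr
        · rw [hqδ]
          refine (hbq l).2.1.trans ?_
          have h1 := hqne l hl
          have h2 := (hbq l).2.2.1
          -- For ℓ ≠ 0 the term L⁻² is absorbed by `parSize`, which turns the error into one
          -- relative to |δ₀|.
          calc _ ≤ C * t * (parSize (q l) + parSize (q l)) := by gcongr
            _ = 2 * C / κ' * t * (κ' * parSize (q l)) := by field_simp; ring
            _ ≤ 2 * C / κ' * t * ‖δ₀ l‖ := by gcongr
            _ ≤ _ := by gcongr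
        · refine (hbq o).2.2.2.1.trans ?_
          rw [mul_assoc]
          gcongr
          exact hqo o rfl
        · rw [hqδ]
          refine (hbq o).2.1.trans ?_
          have h1 := hqo o rfl
          calc _ ≤ C * t * (ε + P * ε) := by gcongr
            _ = C * t * (1 + P) * ε := by ring
            _ ≤ _ := by gcongr
        · refine le_trans (le_of_eq (congrArg norm ?_)) (hw l)
          rw [Matrix.sub_mulVec, Matrix.smul_mulVec, Matrix.one_mulVec]
          simp only [Pi.sub_apply, Pi.smul_apply, smul_eq_mul, Matrix.mulVec, dotProduct, hfl,
            add_mul, Finset.sum_add_distrib, ite_mul, zero_mul, Finset.sum_ite_eq,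
            Finset.mem_univ, if_true]
          rw [Finset.mul_sum]
          have : ∑ i, ((a * ε : ℝ) : ℂ) * v l * (v i * w i)
              = ∑ i, ((a * ε : ℝ) : ℂ) * v l * v i * w i :=
            Finset.sum_congr rfl fun _ _ => by ring
          rw [this]
          ring
  -- The strip has width 3 m₂, hence t/3. Taking η/2 instead of η makes the distance to the negative
  -- axis strictly less than η ε, so that a nearby point -x of the axis exists.
  refine ⟨t / 3, η / 2, max (a * V * V + C) CR, by positivity, by positivity, by positivity,
    ?_, ?_, ?_⟩
  · intro L hL hL1 hΓ n l l' k hk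
    have hLpos : 0 < L := hL.pos
    obtain ⟨han, -⟩ := hb L hL hL1 hΓ n
    rw [mul_div_cancel₀ _ (by norm_num : (3 : ℝ) ≠ 0)] at hk
    have him := abs_im_le_of_mem_strip hk
    have hu : AnalyticAt ℂ (unscale L) k := by
      rw [show unscale L = fun k => fun ν => k ν / (scaleFactor L ν : ℂ) from rfl, analyticAt_pi_iff]
      exact fun ν => (analyticAt_coord ν k).div_const
    have hδ : AnalyticAt ℂ (fun k => deltaHat L 𝔮 a h n (unscale L (k + l.momentum))) k := by
      have e : (fun k => deltaHat L 𝔮 a h n (unscale L (k + l.momentum)))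
          = fun k => deltaHat L 𝔮 a h n (unscale L k + unscale L l.momentum) := by
        funext k; rw [unscale_add]
      rw [e]
      refine AnalyticAt.fun_comp (g := deltaHat L 𝔮 a h n)
        (f := fun k => unscale L k + unscale L l.momentum) (han _ fun ν => ?_)
        (hu.fun_add analyticAt_const)
      rw [← unscale_add, unscale_apply_im, Pi.add_apply, Complex.add_im, momentum_im, add_zero,
        abs_div]
      have : (1 : ℝ) ≤ |(scaleFactor L ν : ℝ)| := by
        rw [abs_of_nonneg (by positivity)]; exact_mod_cast scaleFactor_pos hLpos ν
      exact (div_le_self (abs_nonneg _) this).trans ((him ν).trans htm)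
    have e : (fun k => floquet L 𝔮 a h n k l l') = fun k => (a : ℂ) / (L : ℂ) ^ 2
        * uN L 1 (k + l.momentum) ^ 𝔮 * uN L 1 (k + l'.momentum) ^ 𝔮
        + if l = l' then deltaHat L 𝔮 a h n (unscale L (k + l.momentum)) else 0 :=
      funext fun k => floquet_apply L 𝔮 a h n k l l'
    rw [e]
    refine ((analyticAt_const.fun_mul ((analyticAt_comp_add_const (analyticAt_uN L 1 _)).fun_pow
      _)).fun_mul ((analyticAt_comp_add_const (analyticAt_uN L 1 _)).fun_pow _)).fun_add ?_
    split_ifs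
    · exact hδ
    · exact analyticAt_const
  · intro L hL hL1 hΓ n k hk
    rw [mul_div_cancel₀ _ (by norm_num : (3 : ℝ) ≠ 0)] at hk
    obtain ⟨r, hr⟩ := exists_add_latticeVec_re_le k
    obtain ⟨σ, -, hσ⟩ := exists_perm_floquet hL.pos r
    rw [← matNorm_submatrix _ σ, ← hσ]
    refine ((main L hL hL1 hΓ n _ (fun ν => (hr ν).1) fun ν => ?_).1).trans (le_max_left _ _)
    rw [(hr ν).2]
    exact abs_im_le_of_mem_strip hk ν
  · intro L hL hL1 hΓ n k hk z hz
    rw [mul_div_cancel₀ _ (by norm_num : (3 : ℝ) ≠ 0)] at hk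
    obtain ⟨r, hr⟩ := exists_add_latticeVec_re_le k
    obtain ⟨σ, -, hσ⟩ := exists_perm_floquet hL.pos r
    have key := (main L hL hL1 hΓ n _ (fun ν => (hr ν).1) fun ν => by
      rw [(hr ν).2]; exact abs_im_le_of_mem_strip hk ν).2 z hz
    have e : z • (1 : Matrix (DualCell L 1) (DualCell L 1) ℂ) - floquet L 𝔮 a h n (k + latticeVec r)
        = (z • 1 - floquet L 𝔮 a h n k).submatrix σ σ := by
      rw [hσ]
      ext i j
      simp [Matrix.one_apply, σ.injective.eq_iff]
    rw [e, Matrix.isUnit_submatrix_equiv, Matrix.inv_submatrix_equiv, matNorm_submatrix] at key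
    refine ⟨key.1, key.2.trans ?_⟩
    gcongr
    exact le_max_right _ _

/-! ### Characters of the tori -/

/-- The character of the torus with dual index `p`. -/
noncomputable def chi {L s t : ℕ} [NeZero L] (p x : Torus L s t) : ℂ :=
  ZMod.stdAddChar (p.1 * x.1) * ∏ ν, ZMod.stdAddChar (p.2 ν * x.2 ν)

/-- The momentum with dual index `p`. -/
noncomputable def mom {L s t : ℕ} (p : Torus L s t) : Fin 4 → ℂ :=
  Fin.cons (2 * Real.pi * p.1.val / (L : ℂ) ^ s) fun ν => 2 * Real.pi * (p.2 ν).val / (L : ℂ) ^ t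

theorem stdAddChar_mul_intCast {N : ℕ} [NeZero N] (p : ZMod N) (z : ℤ) :
    ZMod.stdAddChar (p * (z : ZMod N)) = Complex.exp (Complex.I * (2 * Real.pi * p.val / N * z)) := by
  have : p * (z : ZMod N) = (((p.val : ℤ) * z : ℤ) : ZMod N) := by
    push_cast
    rw [ZMod.natCast_zmod_val]
  rw [this, ZMod.stdAddChar_coe]
  congr 1
  push_cast
  ring

theorem chi_toTorus {L s t : ℕ} [NeZero L] (p : Torus L s t) (z : ℤ × (Fin 3 → ℤ)) :
    chi p (toTorus L s t z) = Complex.exp (Complex.I * (mom p 0 * z.1 + ∑ ν : Fin 3,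
      mom p ν.succ * z.2 ν)) := by
  rw [chi, toTorus]
  simp only
  rw [stdAddChar_mul_intCast]
  simp_rw [stdAddChar_mul_intCast]
  rw [← Complex.exp_sum, ← Complex.exp_add, mul_add, Finset.mul_sum]
  simp [mom]

theorem chi_add {L s t : ℕ} [NeZero L] (p x y : Torus L s t) :
    chi p (x + y) = chi p x * chi p y := by
  unfold chi
  simp only [Prod.fst_add, Prod.snd_add, Pi.add_apply, mul_add, AddChar.map_add_eq_mul,
    Finset.prod_mul_distrib]
  ring

theorem chi_comm {L s t : ℕ} [NeZero L] (p x : Torus L s t) : chi p x = chi x p := by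
  unfold chi
  simp only [mul_comm]

theorem chi_zero_right {L s t : ℕ} [NeZero L] (p : Torus L s t) : chi p 0 = 1 := by
  simp [chi]

theorem chi_add_left {L s t : ℕ} [NeZero L] (p q x : Torus L s t) :
    chi (p + q) x = chi p x * chi q x := by
  rw [chi_comm, chi_add, chi_comm x, chi_comm x]

theorem chi_neg_right {L s t : ℕ} [NeZero L] (p x : Torus L s t) : chi p (-x) = chi (-p) x := by
  simp [chi]

theorem sum_stdAddChar {N : ℕ} [NeZero N] (x : ZMod N) :
    ∑ p : ZMod N, ZMod.stdAddChar (p * x) = if x = 0 then (N : ℂ) else 0 := by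
  rw [AddChar.sum_mulShift x (ZMod.isPrimitive_stdAddChar N), ZMod.card]
  split_ifs <;> simp

/-- The number of points of a torus. -/
noncomputable def torusCard (L s t : ℕ) : ℂ := (L : ℂ) ^ s * ((L : ℂ) ^ t) ^ 3

theorem torusCard_ne_zero (L s t : ℕ) [NeZero L] : torusCard L s t ≠ 0 := by
  have : (L : ℂ) ≠ 0 := by exact_mod_cast NeZero.ne L
  unfold torusCard
  exact mul_ne_zero (pow_ne_zero _ this) (pow_ne_zero _ (pow_ne_zero _ this))

theorem sum_chi {L s t : ℕ} [NeZero L] (x : Torus L s t) :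
    ∑ p : Torus L s t, chi p x = if x = 0 then torusCard L s t else 0 := by
  rw [Fintype.sum_prod_type]
  simp only [chi]
  simp_rw [← Finset.mul_sum]
  rw [← Finset.sum_mul, sum_stdAddChar]
  have h := Finset.prod_univ_sum (fun _ : Fin 3 => (Finset.univ : Finset (ZMod (L ^ t))))
    (fun ν p => ZMod.stdAddChar (p * x.2 ν))
  rw [Fintype.piFinset_univ] at h
  rw [← h]
  simp_rw [sum_stdAddChar]
  by_cases hx : x = 0
  · subst hx
    simp [torusCard]
  · rw [if_neg hx]
    by_cases h1 : x.1 = 0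
    · have h2 : ∃ ν, x.2 ν ≠ 0 := by
        by_contra hcon
        push Not at hcon
        exact hx (Prod.ext h1 (funext hcon))
      obtain ⟨ν, hν⟩ := h2
      rw [Finset.prod_eq_zero (Finset.mem_univ ν) (if_neg hν), mul_zero]
    · rw [if_neg h1, zero_mul]

theorem sum_chi_right {L s t : ℕ} [NeZero L] (p : Torus L s t) :
    ∑ x : Torus L s t, chi p x = if p = 0 then torusCard L s t else 0 := by
  simp_rw [chi_comm p]
  exact sum_chi p

/-! ### Translation invariant operators -/

/-- The operator with symbol `f`. -/
noncomputable def ofSymbol {L s t : ℕ} [NeZero L] (f : Torus L s t → ℂ) :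
    Matrix (Torus L s t) (Torus L s t) ℂ :=
  Matrix.of fun x y => (torusCard L s t)⁻¹ * ∑ p, f p * (chi p x * chi p (-y))

theorem fourier_inversion {L s t : ℕ} [NeZero L] (v : Torus L s t → ℂ) (x : Torus L s t) :
    v x = (torusCard L s t)⁻¹ * ∑ p, (∑ y, chi p (-y) * v y) * chi p x := by
  simp_rw [Finset.sum_mul]
  rw [Finset.sum_comm]
  have : ∀ y, ∑ p : Torus L s t, chi p (-y) * v y * chi p x
      = if y = x then torusCard L s t * v y else 0 := by
    intro y
    have h1 : ∀ p : Torus L s t, chi p (-y) * v y * chi p x = v y * chi p (-y + x) := by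
      intro p; rw [chi_add]; ring
    simp_rw [h1, ← Finset.mul_sum, sum_chi]
    by_cases hxy : y = x
    · subst hxy; simp [mul_comm]
    · rw [if_neg hxy, if_neg, mul_zero]
      rw [neg_add_eq_zero]; exact hxy
  simp_rw [this]
  rw [Finset.sum_ite_eq' Finset.univ x, if_pos (Finset.mem_univ _),
    inv_mul_cancel_left₀ (torusCard_ne_zero L s t)]

/-- An operator is determined by its action on the characters. -/
theorem eq_of_mulVec_chi {L s t : ℕ} [NeZero L] {m : Type*} {M M' : Matrix m (Torus L s t) ℂ}
    (h : ∀ p, M.mulVec (chi p) = M'.mulVec (chi p)) : M = M' := by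
  have h1 : ∀ (v : Torus L s t → ℂ), v = ∑ p,
      ((torusCard L s t)⁻¹ * ∑ y, chi p (-y) * v y) • (chi p : Torus L s t → ℂ) := by
    intro v
    funext x
    rw [fourier_inversion v x, Finset.sum_apply, Finset.mul_sum]
    exact Finset.sum_congr rfl fun p _ => by rw [Pi.smul_apply, smul_eq_mul, mul_assoc]
  have h2 : ∀ v, M.mulVec v = M'.mulVec v := by
    intro v
    rw [h1 v, Matrix.mulVec_sum, Matrix.mulVec_sum]
    refine Finset.sum_congr rfl fun p _ => ?_
    rw [Matrix.mulVec_smul, Matrix.mulVec_smul, h p]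
  exact Matrix.ext_of_mulVec_single fun i => h2 _

/-- The operator `M` is diagonal in the basis of characters, with symbol `f`. -/
def HasSymbol {L s t : ℕ} [NeZero L] (M : Matrix (Torus L s t) (Torus L s t) ℂ)
    (f : Torus L s t → ℂ) : Prop :=
  ∀ p, M.mulVec (chi p) = f p • (chi p : Torus L s t → ℂ)

section
variable {L s t : ℕ} [NeZero L] {M M' : Matrix (Torus L s t) (Torus L s t) ℂ}
  {f f' : Torus L s t → ℂ}

theorem HasSymbol.unique (h : HasSymbol M f) (h' : HasSymbol M' f) : M = M' :=
  eq_of_mulVec_chi fun p => (h p).trans (h' p).symm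

theorem HasSymbol.add (h : HasSymbol M f) (h' : HasSymbol M' f') :
    HasSymbol (M + M') fun p => f p + f' p := fun p => by
  rw [Matrix.add_mulVec, h p, h' p, add_smul]

theorem HasSymbol.sub (h : HasSymbol M f) (h' : HasSymbol M' f') :
    HasSymbol (M - M') fun p => f p - f' p := fun p => by
  rw [Matrix.sub_mulVec, h p, h' p, sub_smul]

theorem HasSymbol.mul (h : HasSymbol M f) (h' : HasSymbol M' f') :
    HasSymbol (M * M') fun p => f p * f' p := fun p => by
  rw [← Matrix.mulVec_mulVec, h' p, Matrix.mulVec_smul, h p, smul_smul, mul_comm]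

theorem HasSymbol.smul (c : ℂ) (h : HasSymbol M f) : HasSymbol (c • M) fun p => c * f p :=
  fun p => by rw [Matrix.smul_mulVec, h p, smul_smul]

theorem HasSymbol.neg (h : HasSymbol M f) : HasSymbol (-M) fun p => -f p :=
  fun p => by rw [Matrix.neg_mulVec, h p, neg_smul]

theorem hasSymbol_one : HasSymbol (1 : Matrix (Torus L s t) (Torus L s t) ℂ) fun _ => 1 :=
  fun p => by rw [Matrix.one_mulVec, one_smul]

theorem HasSymbol.sum {ι : Type*} (I : Finset ι) {N : ι → Matrix (Torus L s t) (Torus L s t) ℂ}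
    {g : ι → Torus L s t → ℂ} (h : ∀ i ∈ I, HasSymbol (N i) (g i)) :
    HasSymbol (∑ i ∈ I, N i) fun p => ∑ i ∈ I, g i p := fun p => by
  rw [Matrix.sum_mulVec, Finset.sum_smul]
  exact Finset.sum_congr rfl fun i hi => h i hi p

theorem hasSymbol_ofSymbol (f : Torus L s t → ℂ) : HasSymbol (ofSymbol f) f := by
  intro q
  funext x
  have h1 : ∀ p, ∑ y : Torus L s t, chi p (-y) * chi q y = if q = p then torusCard L s t else 0 := by
    intro p
    have : ∀ y : Torus L s t, chi p (-y) * chi q y = chi (q - p) y := by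
      intro y; rw [chi_neg_right, ← chi_add_left, neg_add_eq_sub]
    simp_rw [this, sum_chi_right, sub_eq_zero]
  simp only [Matrix.mulVec, dotProduct, ofSymbol, Matrix.of_apply, Pi.smul_apply, smul_eq_mul]
  simp_rw [mul_assoc, Finset.sum_mul, ← Finset.mul_sum]
  rw [Finset.sum_comm]
  simp_rw [mul_assoc, ← Finset.mul_sum, h1]
  simp only [mul_ite, mul_zero, Finset.sum_ite_eq, Finset.mem_univ, if_true]
  field_simp [torusCard_ne_zero L s t]

theorem HasSymbol.eq_ofSymbol (h : HasSymbol M f) : M = ofSymbol f := h.unique (hasSymbol_ofSymbol f)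

theorem HasSymbol.congr (h : HasSymbol M f) (hf : ∀ p, f p = f' p) : HasSymbol M f' :=
  fun p => by rw [← hf p]; exact h p

theorem HasSymbol.inv (h : HasSymbol M f) (hf : ∀ p, f p ≠ 0) :
    HasSymbol M⁻¹ fun p => (f p)⁻¹ := by
  have h1 : M * ofSymbol (fun p => (f p)⁻¹) = 1 :=
    (h.mul (hasSymbol_ofSymbol _)).unique
      (hasSymbol_one.congr fun p => (mul_inv_cancel₀ (hf p)).symm)
  rw [Matrix.inv_eq_right_inv h1]
  exact hasSymbol_ofSymbol _

/-- The matrix of characters conjugates M to a diagonal matrix, and the exponential commutes with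
conjugation. -/
theorem HasSymbol.exp (h : HasSymbol M f) :
    HasSymbol (NormedSpace.exp M) fun p => Complex.exp (f p) := by
  set F : Matrix (Torus L s t) (Torus L s t) ℂ := Matrix.of fun x p => chi p x with hF
  set F' : Matrix (Torus L s t) (Torus L s t) ℂ :=
    Matrix.of fun p y => (torusCard L s t)⁻¹ * chi p (-y) with hF'
  have hdiag : ∀ g : Torus L s t → ℂ, ofSymbol g = F * Matrix.diagonal g * F' := by
    intro g
    ext x y
    rw [Matrix.mul_apply]
    simp only [ofSymbol, Matrix.of_apply, Matrix.mul_diagonal, hF, hF', Finset.mul_sum]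
    exact Finset.sum_congr rfl fun p _ => by ring
  have hFF : F * F' = 1 := by
    have h1 := hdiag fun _ => 1
    have h2 := (hasSymbol_ofSymbol (L := L) (s := s) (t := t) fun _ => 1).unique hasSymbol_one
    rw [h2] at h1
    rw [h1, show Matrix.diagonal (fun _ : Torus L s t => (1 : ℂ)) = 1 from Matrix.diagonal_one,
      Matrix.mul_one]
  have hinv : F⁻¹ = F' := Matrix.inv_eq_right_inv hFF
  have hu : IsUnit F := IsUnit.of_mul_eq_one F' hFF
  have e : NormedSpace.exp M = ofSymbol fun p => Complex.exp (f p) := by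
    rw [h.eq_ofSymbol, hdiag, hdiag, ← hinv, Matrix.exp_conj _ _ hu, Matrix.exp_diagonal]
    congr 3
    funext p
    rw [Pi.coe_exp]
    exact (congrFun Complex.exp_eq_exp_ℂ (f p)).symm
  rw [e]
  exact hasSymbol_ofSymbol _

theorem tendsto_ofSymbol {α : Type*} {l : Filter α} {g : α → Torus L s t → ℂ}
    (h : ∀ p, Tendsto (fun a => g a p) l (𝓝 (f p))) :
    Tendsto (fun a => ofSymbol (g a)) l (𝓝 (ofSymbol f)) := by
  refine tendsto_pi_nhds.mpr fun x => tendsto_pi_nhds.mpr fun y => ?_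
  simp only [ofSymbol, Matrix.of_apply]
  exact (tendsto_finsetSum _ fun p _ => (h p).mul_const _).const_mul _

end

/-! ### Symbols of the single particle operators -/

/-- Unfolds a periodized kernel: applied to a function on the torus it acts like the original kernel
on the pullback. The same lemma serves for h₀ and for the averaging profile. -/
theorem sum_tsum_fiber_mul {X Z : Type*} [Fintype X] [DecidableEq X] (φ : Z → X) {F : Z → ℂ}
    (hF : Summable fun z => ‖F z‖) (G : X → ℂ) :
    ∑ x, (∑' z, if φ z = x then F z else 0) * G x = ∑' z, F z * G (φ z) := by
  have h1 : ∀ x, Summable fun z => (if φ z = x then F z else 0) * G x := by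
    intro x
    refine Summable.mul_right _ (Summable.of_norm_bounded hF fun z => ?_)
    split_ifs
    · exact le_rfl
    · rw [norm_zero]; exact norm_nonneg _
  simp_rw [← tsum_mul_right]
  rw [← Summable.tsum_finsetSum fun x _ => h1 x]
  refine tsum_congr fun z => ?_
  rw [Finset.sum_eq_single (φ z)]
  · rw [if_pos rfl]
  · intro x _ hx
    rw [if_neg (Ne.symm hx), zero_mul]
  · intro hx
    exact absurd (Finset.mem_univ _) hx

section
variable {L s t : ℕ} [NeZero L]

/-- With x' = x - z the character contributes e^{-ip·z}, the sign convention of `hatH`. -/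
theorem hasSymbol_hOp {h : (Fin 3 → ℤ) → ℂ} (hh : IsHamiltonian h) :
    HasSymbol (hOp L h s t) fun p => hatH h fun ν => mom p ν.succ := by
  classical
  intro p
  funext x
  have hsum : Summable fun z => ‖h z‖ := by
    simpa using (hh.summable 0).norm
  have h1 : ∀ x' : Torus L s t, hOp L h s t x x'
      = ∑' z : Fin 3 → ℤ, if x + toTorus L s t (0, -z) = x' then h z else 0 := by
    intro x'
    simp only [hOp, Matrix.of_apply]
    have key : ∀ z : Fin 3 → ℤ, x + toTorus L s t (0, -z) = x' ↔
        x.1 = x'.1 ∧ (fun ν => (z ν : ZMod (L ^ t))) = x.2 - x'.2 := by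
      intro z
      rw [Prod.ext_iff]
      refine and_congr (by simp [toTorus]) ?_
      rw [funext_iff, funext_iff]
      refine forall_congr' fun ν => ?_
      simp only [toTorus, Prod.snd_add, Pi.add_apply, Pi.neg_apply, Int.cast_neg, Pi.sub_apply]
      constructor <;> intro e
      · rw [← e]; ring
      · rw [e]; ring
    simp_rw [key]
    by_cases hx : x.1 = x'.1
    · simp [hx]
    · simp [hx]
  simp only [Matrix.mulVec, dotProduct, h1]
  rw [sum_tsum_fiber_mul _ hsum, Pi.smul_apply, smul_eq_mul, hatH, ← tsum_mul_right]
  refine tsum_congr fun z => ?_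
  rw [chi_add, chi_toTorus, mul_assoc, mul_comm (chi p x)]
  congr 3
  simp only [Int.cast_zero, mul_zero, zero_add, Pi.neg_apply, Int.cast_neg, mul_neg,
    Finset.sum_neg_distrib, neg_mul]

theorem hasSymbol_timeDeriv :
    HasSymbol (timeDeriv L s t) fun p => Complex.exp (Complex.I * mom p 0) - 1 := by
  intro p
  funext x
  have h1 : chi p ((1, 0) : Torus L s t) = Complex.exp (Complex.I * mom p 0) := by
    have := chi_toTorus p (1, 0)
    simpa [toTorus, Pi.zero_def] using this
  simp only [Matrix.mulVec, dotProduct, timeDeriv, Matrix.of_apply, sub_mul, ite_mul, one_mul,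
    zero_mul, Finset.sum_sub_distrib, Finset.sum_ite_eq', Finset.mem_univ, if_true, Pi.smul_apply,
    smul_eq_mul]
  rw [chi_add, h1]
  ring

end

/-- The scaling of momenta by `L_νⁿ`. -/
noncomputable def scaleMom (L n : ℕ) (q : Fin 4 → ℂ) : Fin 4 → ℂ :=
  fun ν => (scaleFactor L ν : ℂ) ^ n * q ν

theorem uN_scaleMom {L : ℕ} (hL : 0 < L) (n : ℕ) (q : Fin 4 → ℂ) :
    uN L n (scaleMom L n q) = ∏ ν, dirichletRatio (scaleFactor L ν ^ n) (q ν) := by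
  refine Finset.prod_congr rfl fun ν _ => ?_
  have : (scaleFactor L ν : ℂ) ≠ 0 := by exact_mod_cast (scaleFactor_pos hL ν).ne'
  rw [scaleMom, mul_div_cancel_left₀ _ (pow_ne_zero _ this)]

theorem uN_scaleMom_succ {L : ℕ} (hL : Odd L) (n : ℕ) (q : Fin 4 → ℂ) :
    uN L (n + 1) (scaleMom L (n + 1) q) = uPlus L q * uN L n (scaleMom L (n + 1) q) := by
  have e : scaleMom L (n + 1) q = scaleMom L n (scaleMom L 1 q) := by
    funext ν; simp only [scaleMom]; ring
  rw [uN_scaleMom hL.pos, e, uN_scaleMom hL.pos, uPlus, ← Finset.prod_mul_distrib]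
  refine Finset.prod_congr rfl fun ν _ => ?_
  rw [pow_succ', dirichletRatio_mul (odd_scaleFactor hL ν) ((odd_scaleFactor hL ν).pow)]
  simp [scaleMom]

theorem dirichletRatio_neg {N : ℕ} (hN : Odd N) (x : ℂ) :
    dirichletRatio N (-x) = dirichletRatio N x := by
  obtain ⟨m, rfl⟩ := hN
  rw [dirichletRatio_eq_cos, dirichletRatio_eq_cos]
  simp only [mul_neg, Complex.cos_neg]

theorem uN_neg {L : ℕ} (hL : Odd L) (n : ℕ) (p : Fin 4 → ℂ) : uN L n (-p) = uN L n p := by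
  refine Finset.prod_congr rfl fun ν _ => ?_
  rw [Pi.neg_apply, neg_div, dirichletRatio_neg (odd_scaleFactor hL ν).pow]

section
variable {L s t : ℕ} [NeZero L]

theorem hasSymbol_diffOp {h : (Fin 3 → ℤ) → ℂ} (hh : IsHamiltonian h) (n : ℕ) :
    HasSymbol (diffOp L h n s t) fun p => diffHat L h n (scaleMom L n (mom p)) := by
  have h0 := (hasSymbol_hOp (L := L) (s := s) (t := t) hh).neg.exp
  refine (((hasSymbol_one.sub h0).sub (h0.mul hasSymbol_timeDeriv)).smul _).congr fun p => ?_
  have hL : (L : ℂ) ≠ 0 := by exact_mod_cast NeZero.ne L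
  have e1 : (fun ν : Fin 3 => scaleMom L n (mom p) ν.succ / (L : ℂ) ^ n)
      = fun ν => mom p ν.succ := by
    funext ν
    rw [scaleMom, scaleFactor_succ, mul_div_cancel_left₀ _ (pow_ne_zero _ hL)]
  have e2 : scaleMom L n (mom p) 0 / (L : ℂ) ^ (2 * n) = mom p 0 := by
    rw [scaleMom, scaleFactor_zero, Nat.cast_pow, ← pow_mul,
      mul_div_cancel_left₀ _ (pow_ne_zero _ hL)]
  rw [diffHat, e1, e2]

/-! ### Symbols of the averaging operators -/

theorem finite_support_profile (L r : ℕ) : (Function.support (profile L r)).Finite := by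
  induction r with
  | zero =>
    refine (Set.finite_singleton 0).subset fun x hx => ?_
    by_contra hne
    exact hx (if_neg hne)
  | succ r ih =>
    refine ((block L).finite_toSet.biUnion fun y _ => ih.image fun x => x + y).subset fun x hx => ?_
    obtain ⟨y, hy, hxy⟩ := Finset.exists_ne_zero_of_sum_ne_zero
      (right_ne_zero_of_mul (Function.mem_support.mp hx))
    exact Set.mem_biUnion (Finset.mem_coe.mpr hy) ⟨x - y, hxy, sub_add_cancel x y⟩

/-- A multiplicative function turns convolution into multiplication, so the transform of the 𝔮-fold
convolution is the 𝔮-th power of that of one block. -/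
theorem hasSum_profile_mul (L r : ℕ) {g : ℤ × (Fin 3 → ℤ) → ℂ} (h0 : g 0 = 1)
    (hg : ∀ x y, g (x + y) = g x * g y) :
    HasSum (fun z => (profile L r z : ℂ) * g z) ((((L : ℂ) ^ 5)⁻¹ * ∑ y ∈ block L, g y) ^ r) := by
  induction r with
  | zero =>
    rw [pow_zero]
    convert hasSum_ite_eq (0 : ℤ × (Fin 3 → ℤ)) (1 : ℂ) using 2 with z
    by_cases hz : z = 0
    · simp [profile, hz, h0]
    · simp [profile, hz]
  | succ r ih =>
    have h1 : ∀ y ∈ block L, HasSum (fun z => (profile L r (z - y) : ℂ) * g (z - y) * g y)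
        ((((L : ℂ) ^ 5)⁻¹ * ∑ y ∈ block L, g y) ^ r * g y) := fun y _ =>
      ((Equiv.subRight y).hasSum_iff.mpr ih).mul_right (g y)
    have h2 := (hasSum_sum h1).mul_left (((L : ℂ) ^ 5)⁻¹)
    rw [← Finset.mul_sum, mul_left_comm, ← pow_succ] at h2
    have e : (fun z => (profile L (r + 1) z : ℂ) * g z) = fun z => ((L : ℂ) ^ 5)⁻¹ *
        ∑ y ∈ block L, (profile L r (z - y) : ℂ) * g (z - y) * g y := by
      funext z
      simp only [profile]
      push_cast
      rw [mul_assoc, Finset.sum_mul]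
      congr 1
      refine Finset.sum_congr rfl fun y _ => ?_
      rw [mul_assoc, ← hg, sub_add_cancel]
    rw [e]
    exact h2

theorem avg_apply (L 𝔮 s t : ℕ) (y : Torus L s t) (x' : Torus L (s + 2) (t + 1)) :
    avg L 𝔮 s t y x' = ∑' z : ℤ × (Fin 3 → ℤ),
      if coarseToFine L s t y + toTorus L (s + 2) (t + 1) z = x' then (profile L 𝔮 z : ℂ) else 0 := by
  classical
  simp only [avg, Matrix.of_apply]
  rw [tsum_eq_finsum]
  refine (finite_support_profile L 𝔮).subset fun z hz h0 => hz ?_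
  simp [h0]

theorem block_sum_exp {L : ℕ} (hL : Odd L) (q : Fin 4 → ℂ) :
    ((L : ℂ) ^ 5)⁻¹ * ∑ y ∈ block L,
      Complex.exp (Complex.I * (q 0 * y.1 + ∑ ν : Fin 3, q ν.succ * y.2 ν)) = uPlus L q := by
  have h1 : uPlus L q = uPlus L (-q) := by
    refine Finset.prod_congr rfl fun ν _ => ?_
    rw [Pi.neg_apply, dirichletRatio_neg (odd_scaleFactor hL ν)]
  have h2 := Finset.prod_univ_sum
    (fun _ : Fin 3 => Finset.Icc (-(((L : ℤ) - 1) / 2)) (((L : ℤ) - 1) / 2))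
    (fun ν j => Complex.exp (Complex.I * (q ν.succ * j)))
  rw [h1, uPlus, Fin.prod_univ_succ]
  simp only [dirichletRatio, scaleFactor_zero, scaleFactor_succ, Finset.prod_mul_distrib,
    Pi.neg_apply]
  have e3 : ∀ (z : ℂ) (j : ℤ), Complex.exp (-Complex.I * (j : ℂ) * -z)
      = Complex.exp (Complex.I * (z * j)) := by
    intro z j; congr 1; ring
  simp_rw [e3]
  rw [h2, block, Finset.sum_product, Finset.prod_const, Finset.card_univ, Fintype.card_fin]
  rw [mul_mul_mul_comm, Finset.sum_mul_sum]
  push_cast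
  congr 1
  · rw [inv_pow, ← mul_inv, ← pow_add]
  · refine Finset.sum_congr rfl fun y _ => Finset.sum_congr rfl fun z _ => ?_
    rw [mul_add, Complex.exp_add, Finset.mul_sum, Complex.exp_sum]

/-- The reduction of the dual index of a torus to that of a coarser one. -/
def red (L s t : ℕ) {s' t' : ℕ} (p : Torus L s' t') : Torus L s t :=
  ((p.1.val : ZMod (L ^ s)), fun ν => ((p.2 ν).val : ZMod (L ^ t)))

theorem natCast_val_neg {N M : ℕ} [NeZero N] (hNM : M ∣ N) (x : ZMod N) :
    ((-x).val : ZMod M) = -(x.val : ZMod M) := by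
  rw [ZMod.natCast_val, ZMod.natCast_val, ZMod.cast_neg hNM]

theorem red_neg {s' t' : ℕ} (hs : s ≤ s') (ht : t ≤ t') (p : Torus L s' t') :
    red L s t (-p) = -red L s t p :=
  Prod.ext (natCast_val_neg (pow_dvd_pow L hs) _)
    (funext fun _ => natCast_val_neg (pow_dvd_pow L ht) _)

theorem natCast_val_natCast_val {N M K : ℕ} [NeZero N] [NeZero M] (hKM : K ∣ M) (x : ZMod N) :
    (((x.val : ZMod M).val : ℕ) : ZMod K) = (x.val : ZMod K) := by
  rw [ZMod.val_natCast, ZMod.natCast_eq_natCast_iff]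
  exact (Nat.mod_modEq _ _).of_dvd hKM

theorem red_red {s' t' s'' t'' : ℕ} (hs : s ≤ s') (ht : t ≤ t') (p : Torus L s'' t'') :
    red L s t (red L s' t' p) = red L s t p :=
  Prod.ext (natCast_val_natCast_val (pow_dvd_pow L hs) _)
    (funext fun _ => natCast_val_natCast_val (pow_dvd_pow L ht) _)

theorem exists_mom_red (j : ℕ) (p : Torus L (s + 2 * j) (t + j)) :
    ∃ r : Fin 4 → ℤ, scaleMom L j (mom p) = mom (red L s t p) + latticeVec r := by
  have hL : (L : ℂ) ≠ 0 := by exact_mod_cast NeZero.ne L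
  have key : ∀ (e i : ℕ) (x : ZMod (L ^ (e + i))), ∃ r : ℤ, (L : ℂ) ^ i *
      (2 * Real.pi * x.val / (L : ℂ) ^ (e + i)) =
      2 * Real.pi * ((x.val : ZMod (L ^ e)).val : ℂ) / (L : ℂ) ^ e + 2 * Real.pi * (r : ℂ) := by
    intro e i x
    refine ⟨(x.val / L ^ e : ℕ), ?_⟩
    have h1 : (x.val : ℂ) = ((x.val % L ^ e : ℕ) : ℂ) + (L : ℂ) ^ e * ((x.val / L ^ e : ℕ) : ℂ) := by
      exact_mod_cast (Nat.mod_add_div x.val (L ^ e)).symm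
    rw [ZMod.val_natCast, Int.cast_natCast, h1]
    generalize ((x.val % L ^ e : ℕ) : ℂ) = A
    generalize ((x.val / L ^ e : ℕ) : ℂ) = B
    rw [pow_add]
    field_simp
  obtain ⟨r0, h0⟩ := key s (2 * j) p.1
  choose r1 h1 using fun ν => key t j (p.2 ν)
  refine ⟨Fin.cons r0 r1, funext fun ν => ?_⟩
  refine Fin.cases ?_ (fun ν => ?_) ν
  · rw [Pi.add_apply, scaleMom, scaleFactor_zero, Nat.cast_pow, ← pow_mul]
    exact h0
  · rw [Pi.add_apply, scaleMom, scaleFactor_succ]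
    exact h1 ν

/-- Aliasing: restricted to the coarse sublattice, a character remembers its momentum only modulo
the dual of the coarse torus. -/
theorem exp_mom_coarse (p : Torus L (s + 2) (t + 1)) (y : Torus L s t) :
    chi p (coarseToFine L s t y) = chi (red L s t p) y := by
  have e1 : coarseToFine L s t y
      = toTorus L (s + 2) (t + 1) ((L : ℤ) ^ 2 * y.1.val, fun ν => (L : ℤ) * (y.2 ν).val) := by
    refine Prod.ext ?_ (funext fun ν => ?_) <;> simp [coarseToFine, toTorus]
  have e2 : y = toTorus L s t ((y.1.val : ℤ), fun ν => ((y.2 ν).val : ℤ)) := by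
    refine Prod.ext ?_ (funext fun ν => ?_) <;> simp [toTorus]
  obtain ⟨r, hr⟩ := exists_mom_red 1 (s := s) (t := t) p
  have hr0 : (L : ℂ) ^ 2 * mom p 0 = mom (red L s t p) 0 + 2 * Real.pi * r 0 := by
    have := congrFun hr 0
    rwa [scaleMom, scaleFactor_zero, pow_one, Nat.cast_pow] at this
  have hr1 : ∀ ν : Fin 3, (L : ℂ) * mom p ν.succ
      = mom (red L s t p) ν.succ + 2 * Real.pi * r ν.succ := by
    intro ν
    have := congrFun hr ν.succ
    rwa [scaleMom, scaleFactor_succ, pow_one] at this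
  conv_rhs => rw [e2]
  rw [e1, chi_toTorus, chi_toTorus, Complex.exp_eq_exp_iff_exists_int]
  refine ⟨r 0 * y.1.val + ∑ ν : Fin 3, r ν.succ * (y.2 ν).val, ?_⟩
  push_cast
  have hs : ∀ ν : Fin 3, mom p ν.succ * ((L : ℂ) * (y.2 ν).val)
      = mom (red L s t p) ν.succ * (y.2 ν).val + 2 * Real.pi * (r ν.succ * (y.2 ν).val) := by
    intro ν; rw [← mul_assoc, mul_comm (mom p _), hr1]; ring
  simp_rw [hs, Finset.sum_add_distrib, ← Finset.mul_sum]
  rw [← mul_assoc (mom p 0), mul_comm (mom p 0), hr0]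
  ring

theorem avg_mulVec_chi (hL : Odd L) (𝔮 : ℕ) (p : Torus L (s + 2) (t + 1)) :
    (avg L 𝔮 s t).mulVec (chi p) = uPlus L (mom p) ^ 𝔮 • (chi (red L s t p) : Torus L s t → ℂ) := by
  classical
  funext y
  have hsum : Summable fun z => ‖(profile L 𝔮 z : ℂ)‖ :=
    summable_of_hasFiniteSupport ((finite_support_profile L 𝔮).subset fun z hz h0 => hz (by simp [h0]))
  simp only [Matrix.mulVec, dotProduct, avg_apply]
  rw [sum_tsum_fiber_mul _ hsum, Pi.smul_apply, smul_eq_mul]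
  have h1 := hasSum_profile_mul L 𝔮 (g := fun z => chi p (toTorus L (s + 2) (t + 1) z))
    (by simp [toTorus, ← Prod.zero_eq_mk, ← Pi.zero_def, chi_zero_right]) (fun x y => by
      rw [← chi_add]; congr 1
      refine Prod.ext ?_ (funext fun ν => ?_) <;> simp [toTorus])
  simp_rw [chi_toTorus, block_sum_exp hL, ← chi_toTorus] at h1
  rw [← h1.tsum_eq, ← tsum_mul_right]
  refine tsum_congr fun z => ?_
  rw [chi_add, exp_mom_coarse]
  ring

/-- Each averaging step contributes a factor u_+, and `uN_scaleMom_succ` merges it with the u_j of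
the remaining steps. Periodicity of u_j hides the momentum lost in the reduction. -/
theorem avgIter_mulVec_chi (hL : Odd L) (𝔮 : ℕ) (j : ℕ) (p : Torus L (s + 2 * j) (t + j)) :
    (avgIter L 𝔮 s t j).mulVec (chi p)
      = uN L j (scaleMom L j (mom p)) ^ 𝔮 • (chi (red L s t p) : Torus L s t → ℂ) := by
  induction j with
  | zero =>
    have h1 : uN L 0 (scaleMom L 0 (mom p)) = 1 := by
      rw [uN_scaleMom hL.pos]
      simp [dirichletRatio]
    have h2 : red L s t p = p := by
      refine Prod.ext ?_ (funext fun ν => ?_) <;> simp [red]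
    rw [h1, one_pow, one_smul, h2, avgIter]
    exact Matrix.one_mulVec _
  | succ j ih =>
    rw [avgIter, ← Matrix.mulVec_mulVec]
    have h1 := avg_mulVec_chi (s := s + 2 * j) (t := t + j) hL 𝔮 p
    have h2 := ih (red L (s + 2 * j) (t + j) p)
    obtain ⟨r, hr⟩ := exists_mom_red 1 (s := s + 2 * j) (t := t + j) p
    have h3 : uN L j (scaleMom L j (mom (red L (s + 2 * j) (t + j) p)))
        = uN L j (scaleMom L (j + 1) (mom p)) := by
      have e : scaleMom L (j + 1) (mom p) = scaleMom L j (mom (red L (s + 2 * j) (t + j) p))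
          + latticeVec fun ν => ((scaleFactor L ν ^ j : ℕ) : ℤ) * r ν := by
        have e1 : scaleMom L (j + 1) (mom p) = scaleMom L j (scaleMom L 1 (mom p)) := by
          funext ν; simp only [scaleMom]; ring
        rw [e1, hr]
        funext ν
        simp only [scaleMom, Pi.add_apply, latticeVec]
        push_cast
        ring
      rw [e, uN_latticePeriodic hL.pos]
    rw [red_red (by omega) (by omega), h3] at h2
    refine (congrArg _ h1).trans ?_
    rw [Matrix.mulVec_smul, h2, smul_smul, ← mul_pow]
    congr 2
    exact (uN_scaleMom_succ hL j _).symm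

end

theorem add_mul_lt_pow {L e i k l : ℕ} (hk : k < L ^ e) (hl : l < L ^ i) :
    k + L ^ e * l < L ^ (e + i) := by
  calc k + L ^ e * l < L ^ e + L ^ e * l := by omega
    _ = L ^ e * (l + 1) := by ring
    _ ≤ L ^ e * L ^ i := Nat.mul_le_mul_left _ hl
    _ = _ := (pow_add _ _ _).symm

theorem torusCard_add (L s t j : ℕ) :
    torusCard L (s + 2 * j) (t + j) = (L : ℂ) ^ (5 * j) * torusCard L s t := by
  unfold torusCard
  ring

section
variable {L s t : ℕ} [NeZero L]

/-! ### Adjoints of the averaging operators -/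

/-- The dual index of the finer torus with momentum `𝕃⁻ʲ(k + ℓ)`. -/
def joinMom {L s t j : ℕ} (k : Torus L s t) (l : DualCell L j) : Torus L (s + 2 * j) (t + j) :=
  (((k.1.val + L ^ s * (l 0 : ℕ) : ℕ) : ZMod _),
    fun ν => (((k.2 ν).val + L ^ t * (l ν.succ : ℕ) : ℕ) : ZMod _))

theorem joinMom_fst_val {j : ℕ} (k : Torus L s t) (l : DualCell L j) :
    (joinMom k l).1.val = k.1.val + L ^ s * (l 0 : ℕ) := by
  refine ZMod.val_natCast_of_lt (add_mul_lt_pow (ZMod.val_lt _) ?_)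
  exact (l 0).2.trans_eq (by rw [scaleFactor_zero, ← pow_mul])

theorem joinMom_snd_val {j : ℕ} (k : Torus L s t) (l : DualCell L j) (ν : Fin 3) :
    ((joinMom k l).2 ν).val = (k.2 ν).val + L ^ t * (l ν.succ : ℕ) := by
  refine ZMod.val_natCast_of_lt (add_mul_lt_pow (ZMod.val_lt _) ?_)
  exact (l ν.succ).2.trans_eq (by rw [scaleFactor_succ])

theorem scaleMom_joinMom {j : ℕ} (k : Torus L s t) (l : DualCell L j) :
    scaleMom L j (mom (joinMom k l)) = mom k + l.momentum := by
  have hL : (L : ℂ) ≠ 0 := by exact_mod_cast NeZero.ne L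
  have key : ∀ (e i a b : ℕ), (L : ℂ) ^ i * (2 * Real.pi * ((a + L ^ e * b : ℕ) : ℂ) / (L : ℂ) ^ (e + i))
      = 2 * Real.pi * (a : ℂ) / (L : ℂ) ^ e + 2 * Real.pi * (b : ℂ) := by
    intro e i a b
    push_cast
    rw [pow_add]
    field_simp
  funext ν
  refine Fin.cases ?_ (fun ν => ?_) ν
  · have := key s (2 * j) k.1.val (l 0)
    rw [← joinMom_fst_val] at this
    rw [Pi.add_apply, scaleMom, scaleFactor_zero, Nat.cast_pow, ← pow_mul]
    exact this
  · have := key t j (k.2 ν).val (l ν.succ)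
    rw [← joinMom_snd_val] at this
    rw [Pi.add_apply, scaleMom, scaleFactor_succ]
    exact this

theorem red_joinMom {j : ℕ} (k : Torus L s t) (l : DualCell L j) : red L s t (joinMom k l) = k := by
  have key : ∀ e a b : ℕ, ((a + L ^ e * b : ℕ) : ZMod (L ^ e)) = (a : ZMod (L ^ e)) := by
    intro e a b
    rw [Nat.cast_add, Nat.cast_mul, ZMod.natCast_self, zero_mul, add_zero]
  refine Prod.ext ?_ (funext fun ν => ?_)
  · simp only [red]
    rw [joinMom_fst_val, key, ZMod.natCast_zmod_val]
  · simp only [red]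
    rw [joinMom_snd_val, key, ZMod.natCast_zmod_val]

theorem joinMom_injective {j : ℕ} (k : Torus L s t) :
    Function.Injective (joinMom (j := j) k) := by
  intro l l' h
  have hL : 0 < L := Nat.pos_of_ne_zero (NeZero.ne L)
  funext ν
  refine Fin.cases ?_ (fun ν => ?_) ν
  · have := congrArg (fun p => p.1.val) h
    simp only [joinMom_fst_val] at this
    exact Fin.ext (Nat.eq_of_mul_eq_mul_left (pow_pos hL s) (by omega))
  · have := congrArg (fun p => (p.2 ν).val) h
    simp only [joinMom_snd_val] at this
    exact Fin.ext (Nat.eq_of_mul_eq_mul_left (pow_pos hL t) (by omega))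

theorem exists_joinMom_eq {j : ℕ} (p : Torus L (s + 2 * j) (t + j)) :
    ∃ l : DualCell L j, joinMom (red L s t p) l = p := by
  have key : ∀ (e i : ℕ) (x : ZMod (L ^ (e + i))), x.val / L ^ e < L ^ i := fun e i x =>
    Nat.div_lt_of_lt_mul (by rw [← pow_add]; exact ZMod.val_lt x)
  refine ⟨Fin.cons ⟨p.1.val / L ^ s, by
    rw [scaleFactor_zero, ← pow_mul]; exact key s (2 * j) p.1⟩ fun ν => ⟨(p.2 ν).val / L ^ t, by
    rw [scaleFactor_succ]; exact key t j (p.2 ν)⟩, ?_⟩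
  refine Prod.ext ?_ (funext fun ν => ?_)
  · refine ZMod.val_injective _ ?_
    rw [joinMom_fst_val]
    simp only [red, Fin.cons_zero, ZMod.val_natCast]
    exact Nat.mod_add_div _ _
  · refine ZMod.val_injective _ ?_
    rw [joinMom_snd_val]
    simp only [red, Fin.cons_succ, ZMod.val_natCast]
    exact Nat.mod_add_div _ _

theorem sum_red_eq {j : ℕ} (k : Torus L s t) {V : Type*} [AddCommMonoid V]
    (F : Torus L (s + 2 * j) (t + j) → V) :
    ∑ p, (if red L s t p = k then F p else 0) = ∑ l : DualCell L j, F (joinMom k l) := by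
  rw [← Finset.sum_filter]
  symm
  refine Finset.sum_bij (fun l _ => joinMom k l) (fun l _ => ?_) (fun l _ l' _ h => joinMom_injective k h)
    (fun p hp => ?_) fun _ _ => rfl
  · rw [Finset.mem_filter]
    exact ⟨Finset.mem_univ _, red_joinMom k l⟩
  · rw [Finset.mem_filter] at hp
    obtain ⟨l, hl⟩ := exists_joinMom_eq (s := s) (t := t) p
    rw [hp.2] at hl
    exact ⟨l, Finset.mem_univ _, hl⟩

/-- Pairing Mᵀχ_k with χ₋ₚ amounts to applying M to χ₋ₚ, and orthogonality leaves only the p that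
reduce to k. Evenness of g removes the sign, and the prefactor L⁵ʲ is exactly the ratio of the
numbers of sites. -/
theorem transpose_mulVec_chi {j : ℕ} {M : Matrix (Torus L s t) (Torus L (s + 2 * j) (t + j)) ℂ}
    {g : Torus L (s + 2 * j) (t + j) → ℂ}
    (hM : ∀ p, M.mulVec (chi p) = g p • (chi (red L s t p) : Torus L s t → ℂ))
    (hg : ∀ p, g (-p) = g p) (k : Torus L s t) :
    (((L : ℂ) ^ (5 * j)) • M.transpose).mulVec (chi k)
      = ∑ l : DualCell L j, g (joinMom k l) • (chi (joinMom k l) : Torus L _ _ → ℂ) := by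
  funext x
  have hL : (L : ℂ) ≠ 0 := by exact_mod_cast NeZero.ne L
  have h1 : ∀ p : Torus L (s + 2 * j) (t + j), ∑ y, chi p (-y) * (M.transpose.mulVec (chi k)) y
      = if red L s t p = k then torusCard L s t * g p else 0 := by
    intro p
    simp only [Matrix.mulVec, dotProduct, Matrix.transpose_apply, Finset.mul_sum]
    rw [Finset.sum_comm]
    have h2 : ∀ z : Torus L s t, ∑ y, chi p (-y) * (M z y * chi k z)
        = chi k z * (g p * chi (-red L s t p) z) := by
      intro z
      have := congrFun (hM (-p)) z
      rw [Pi.smul_apply, smul_eq_mul, hg, red_neg (by omega) (by omega)] at this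
      rw [← this]
      simp only [Matrix.mulVec, dotProduct, Finset.mul_sum]
      refine Finset.sum_congr rfl fun y _ => ?_
      rw [chi_neg_right]; ring
    have h3 : ∀ z : Torus L s t, chi k z * (g p * chi (-red L s t p) z)
        = g p * chi (k - red L s t p) z := by
      intro z
      rw [sub_eq_add_neg, chi_add_left]; ring
    simp_rw [h2, h3]
    rw [← Finset.mul_sum, sum_chi_right]
    by_cases hk : red L s t p = k
    · rw [if_pos (sub_eq_zero.mpr hk.symm), if_pos hk, mul_comm]
    · rw [if_neg fun e => hk (sub_eq_zero.mp e).symm, if_neg hk, mul_zero]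
  rw [Matrix.smul_mulVec, Pi.smul_apply, fourier_inversion (M.transpose.mulVec (chi k)) x]
  simp_rw [h1, ite_mul, zero_mul]
  rw [sum_red_eq k fun p => torusCard L s t * g p * chi p x, Finset.sum_apply, smul_eq_mul,
    torusCard_add L s t j, Finset.mul_sum, Finset.mul_sum]
  refine Finset.sum_congr rfl fun l _ => ?_
  rw [Pi.smul_apply, smul_eq_mul]
  have := torusCard_ne_zero L s t
  field_simp

theorem exists_mom_neg (p : Torus L s t) : ∃ r : Fin 4 → ℤ, mom (-p) = -mom p + latticeVec r := by
  have hL : (L : ℂ) ≠ 0 := by exact_mod_cast NeZero.ne L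
  have key : ∀ (e : ℕ) (x : ZMod (L ^ e)), ∃ r : ℤ, 2 * Real.pi * ((-x).val : ℂ) / (L : ℂ) ^ e
      = -(2 * Real.pi * (x.val : ℂ) / (L : ℂ) ^ e) + 2 * Real.pi * (r : ℂ) := by
    intro e x
    have h1 : (((-x).val + x.val : ℕ) : ZMod (L ^ e)) = 0 := by
      rw [Nat.cast_add, ZMod.natCast_zmod_val, ZMod.natCast_zmod_val, neg_add_cancel]
    obtain ⟨c, hc⟩ := (ZMod.natCast_eq_zero_iff _ _).mp h1
    refine ⟨c, ?_⟩
    have h2 : ((-x).val : ℂ) = (L : ℂ) ^ e * c - x.val := by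
      rw [eq_sub_iff_add_eq]; exact_mod_cast hc
    rw [h2, Int.cast_natCast]
    field_simp
    ring
  obtain ⟨r0, h0⟩ := key s p.1
  choose r1 h1 using fun ν => key t (p.2 ν)
  refine ⟨Fin.cons r0 r1, funext fun ν => ?_⟩
  refine Fin.cases ?_ (fun ν => ?_) ν
  · exact h0
  · exact h1 ν

theorem uN_scaleMom_mom_neg (hL : Odd L) (j : ℕ) (p : Torus L s t) :
    uN L j (scaleMom L j (mom (-p))) = uN L j (scaleMom L j (mom p)) := by
  obtain ⟨r, hr⟩ := exists_mom_neg p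
  have e : scaleMom L j (mom (-p)) = -scaleMom L j (mom p)
      + latticeVec fun ν => ((scaleFactor L ν ^ j : ℕ) : ℤ) * r ν := by
    rw [hr]
    funext ν
    simp only [scaleMom, Pi.add_apply, Pi.neg_apply, latticeVec]
    push_cast
    ring
  rw [e, uN_latticePeriodic hL.pos, uN_neg hL]

theorem avgIterAdj_mulVec_chi (hL : Odd L) (𝔮 j : ℕ) (k : Torus L s t) :
    (avgIterAdj L 𝔮 s t j).mulVec (chi k) = ∑ l : DualCell L j,
      uN L j (mom k + l.momentum) ^ 𝔮 • (chi (joinMom k l) : Torus L _ _ → ℂ) := by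
  rw [avgIterAdj, transpose_mulVec_chi (avgIter_mulVec_chi hL 𝔮 j)
    (fun p => by rw [uN_scaleMom_mom_neg hL])]
  simp_rw [scaleMom_joinMom]

/-- The adjoint spreads χ_k over its aliases with momenta 𝕃⁻ʲ(k + ℓ), and averaging sends each of
them back to χ_k. The composition is thus diagonal, with the sum over ℓ as its symbol. -/
theorem HasSymbol.avgIter_conj (hL : Odd L) (𝔮 j : ℕ)
    {M : Matrix (Torus L (s + 2 * j) (t + j)) (Torus L (s + 2 * j) (t + j)) ℂ}
    {d : Torus L (s + 2 * j) (t + j) → ℂ} (hM : HasSymbol M d) :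
    HasSymbol (avgIter L 𝔮 s t j * M * avgIterAdj L 𝔮 s t j) fun k =>
      ∑ l : DualCell L j, uN L j (mom k + l.momentum) ^ (2 * 𝔮) * d (joinMom k l) := by
  intro k
  rw [← Matrix.mulVec_mulVec, ← Matrix.mulVec_mulVec, avgIterAdj_mulVec_chi hL, Matrix.mulVec_sum,
    Matrix.mulVec_sum, Finset.sum_smul]
  refine Finset.sum_congr rfl fun l _ => ?_
  rw [Matrix.mulVec_smul, Matrix.mulVec_smul, hM, Matrix.mulVec_smul, avgIter_mulVec_chi hL,
    scaleMom_joinMom, red_joinMom, smul_smul, smul_smul]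
  congr 1
  ring

theorem isRealMomentum_mom (p : Torus L s t) : IsRealMomentum (mom p) := by
  have key : ∀ (e i : ℕ), (2 * Real.pi * (i : ℂ) / (L : ℂ) ^ e).im = 0 := by
    intro e i
    have : 2 * Real.pi * (i : ℂ) / (L : ℂ) ^ e = ((2 * Real.pi * i / (L : ℝ) ^ e : ℝ) : ℂ) := by
      push_cast; rfl
    rw [this, Complex.ofReal_im]
  intro ν
  refine Fin.cases (key s _) (fun ν => key t _) ν

theorem frakDen_ne_zero (hL : Odd L) (𝔮 n : ℕ) {k : Fin 4 → ℂ} (hk : IsRealMomentum k) :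
    frakDen L 𝔮 n k ≠ 0 := by
  obtain ⟨x, hx, e⟩ := frakDen_real hL 𝔮 n hk
  rw [e]
  exact Complex.ofReal_ne_zero.mpr (by linarith)

theorem hasSymbol_frakQ (hL : Odd L) (𝔮 : ℕ) (a : ℝ) (n : ℕ) :
    HasSymbol (frakQ L 𝔮 a n s t) fun k => frakQHat L 𝔮 a n (mom k) := by
  have h1 : ∀ j ∈ Finset.Icc 1 (n - 1), HasSymbol
      (((L : ℂ) ^ (2 * j))⁻¹ • (avgIter L 𝔮 s t j * avgIterAdj L 𝔮 s t j)) fun k =>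
      ((L : ℂ) ^ (2 * j))⁻¹ * ∑ l : DualCell L j, uN L j (mom k + l.momentum) ^ (2 * 𝔮) := by
    intro j _
    have := (hasSymbol_one (L := L) (s := s + 2 * j) (t := t + j)).avgIter_conj hL 𝔮 j
    rw [Matrix.mul_one] at this
    exact (this.congr fun k => by simp_rw [mul_one]).smul _
  have h2 := (hasSymbol_one.add (HasSymbol.sum _ h1)).congr (f' := fun k => frakDen L 𝔮 n (mom k))
    fun k => by
      unfold frakDen
      simp_rw [Finset.mul_sum]
  exact (h2.inv fun k => frakDen_ne_zero hL 𝔮 n (isRealMomentum_mom k)).smul _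

end

theorem unscale_scaleMom {L : ℕ} (hL : 0 < L) (q : Fin 4 → ℂ) : unscale L (scaleMom L 1 q) = q := by
  funext ν
  have : (scaleFactor L ν : ℂ) ≠ 0 := by exact_mod_cast (scaleFactor_pos hL ν).ne'
  rw [unscale, scaleMom, pow_one, mul_div_cancel_left₀ _ this]

section
variable {L s t : ℕ} [NeZero L]

/-! ### The symbol of `Δ⁽ⁿ⁾` -/

theorem LatticePeriodic.add_latticeVec {L : ℕ} {F : (Fin 4 → ℂ) → ℂ} (hF : LatticePeriodic L 0 F)
    (p : Fin 4 → ℂ) (r : Fin 4 → ℤ) : F (p + latticeVec r) = F p := by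
  have := hF p r
  simpa using this

/-- At real momenta positivity alone excludes zeros; no lower bound on L enters. -/
theorem deltaDen_ne_zero (hL : Odd L) (𝔮 : ℕ) {a : ℝ} (ha : 0 < a) {h : (Fin 3 → ℤ) → ℂ}
    (hh : IsHamiltonian h) (n : ℕ) {k : Fin 4 → ℂ} (hk : IsRealMomentum k) :
    deltaDen L 𝔮 a h n k ≠ 0 := by
  obtain ⟨r, hr⟩ := exists_add_latticeVec_re_le k
  rw [← (deltaDen_latticePeriodic hL.pos 𝔮 a h n).add_latticeVec k r]
  set p := k + latticeVec r with hp
  have hp' : IsRealMomentum p := fun ν => ((hr ν).2).trans (hk ν)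
  obtain ⟨m, c, hm, -, hc, H⟩ := hh.exists_diffHat_cell_ge
  have hd : ∀ l : DualCell L n, l ≠ originCell L n → diffHat L h n (p + l.momentum) ≠ 0 := by
    intro l hl
    have := H L hL.pos n p (fun ν => (hr ν).1.trans (by linarith [Real.pi_lt_four]))
      (fun ν => by rw [hp' ν, abs_zero]; exact hm.le) l (exists_ne_zero_of_ne_originCell hl)
    exact norm_pos_iff.mp (hc.trans_le this)
  have hf := frakDen_ne_zero hL 𝔮 n hp'
  rw [deltaDen_eq ha.ne' hf hd]
  refine mul_ne_zero (mul_ne_zero ?_ (Finset.prod_ne_zero_iff.mpr fun l hl =>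
    hd l (Finset.ne_of_mem_erase hl))) ?_
  · rw [frakQHat_eq]
    exact mul_ne_zero (Complex.ofReal_ne_zero.mpr ha.ne') (inv_ne_zero hf)
  · have h1 := regPart_re_ge hL 𝔮 ha hh n hp'
    have hu : 0 < ‖uN L n p‖ ^ (2 * 𝔮) :=
      pow_pos ((by positivity : (0 : ℝ) < (2 / Real.pi) ^ 4).trans_le
        (norm_uN_ge hL n hp' fun ν => (hr ν).1)) _
    have hb : 0 < 1 / a := by positivity
    have h2 := le_norm_mul_add hb hu.le h1 le_rfl (diffHat_re_nonneg hh L n hp')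
    rw [deltaRatio, uN_pow_even_real hL n 𝔮 hp']
    have h3 : 0 < ‖regPart L 𝔮 a h n p‖ :=
      (hb.trans_le h1).trans_le ((le_abs_self _).trans (Complex.abs_re_le_norm _))
    exact norm_pos_iff.mp (lt_of_lt_of_le (by positivity) h2)

/-- The symbol of `(1 + 𝔔_n Q_n (D_n + μ)⁻¹ Q_n*)⁻¹ 𝔔_n`. -/
noncomputable def deltaRegHat (L 𝔮 : ℕ) (a : ℝ) (h : (Fin 3 → ℤ) → ℂ) (n : ℕ) (μ : ℝ)
    (k : Fin 4 → ℂ) : ℂ :=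
  (1 + frakQHat L 𝔮 a n k * ∑ l : DualCell L n, uN L n (k + l.momentum) ^ (2 * 𝔮) *
    (diffHat L h n (k + l.momentum) + μ)⁻¹)⁻¹ * frakQHat L 𝔮 a n k

theorem diffHat_add_re_pos {h : (Fin 3 → ℤ) → ℂ} (hh : IsHamiltonian h) (L n : ℕ) {μ : ℝ}
    (hμ : 0 < μ) {p : Fin 4 → ℂ} (hp : IsRealMomentum p) : 0 < (diffHat L h n p + μ).re := by
  rw [Complex.add_re, Complex.ofReal_re]
  linarith [diffHat_re_nonneg hh L n hp]

theorem ne_zero_of_re_pos {z : ℂ} (hz : 0 < z.re) : z ≠ 0 := by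
  rintro rfl
  simp at hz

theorem deltaRegHat_den_ne_zero {L : ℕ} (hL : Odd L) (𝔮 : ℕ) {a : ℝ} (ha : 0 < a)
    {h : (Fin 3 → ℤ) → ℂ} (hh : IsHamiltonian h) (n : ℕ) {μ : ℝ} (hμ : 0 < μ) {k : Fin 4 → ℂ}
    (hk : IsRealMomentum k) :
    1 + frakQHat L 𝔮 a n k * ∑ l : DualCell L n, uN L n (k + l.momentum) ^ (2 * 𝔮) *
      (diffHat L h n (k + l.momentum) + μ)⁻¹ ≠ 0 := by
  obtain ⟨x, hx1, hx⟩ := frakDen_real hL 𝔮 n hk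
  refine ne_zero_of_re_pos ?_
  have e : frakQHat L 𝔮 a n k = ((a * x⁻¹ : ℝ) : ℂ) := by
    rw [frakQHat_eq, hx]; push_cast; rfl
  rw [e, Complex.add_re, Complex.re_ofReal_mul, Complex.re_sum, Complex.one_re]
  have h1 : 0 ≤ ∑ l : DualCell L n, (uN L n (k + l.momentum) ^ (2 * 𝔮) *
      (diffHat L h n (k + l.momentum) + μ)⁻¹).re := by
    refine Finset.sum_nonneg fun l _ => ?_
    rw [uN_pow_even_real hL n 𝔮 (hk.add_momentum l), Complex.re_ofReal_mul]
    exact mul_nonneg (by positivity)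
      (inv_re_nonneg (diffHat_add_re_pos hh L n hμ (hk.add_momentum l)).le)
  have h2 : 0 ≤ a * x⁻¹ := mul_nonneg ha.le (inv_nonneg.mpr (by linarith))
  linarith [mul_nonneg h2 h1]

theorem hasSymbol_deltaReg (hL : Odd L) (𝔮 : ℕ) {a : ℝ} (ha : 0 < a) {h : (Fin 3 → ℤ) → ℂ}
    (hh : IsHamiltonian h) (n : ℕ) {μ : ℝ} (hμ : 0 < μ) :
    HasSymbol (deltaReg L 𝔮 a h n s t μ) fun k => deltaRegHat L 𝔮 a h n μ (mom k) := by
  have h1 : HasSymbol (diffOp L h n (s + 2 * n) (t + n) + (μ : ℂ) • 1)⁻¹ fun p =>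
      (diffHat L h n (scaleMom L n (mom p)) + μ)⁻¹ := by
    refine HasSymbol.inv (((hasSymbol_diffOp hh n).add (hasSymbol_one.smul (μ : ℂ))).congr
      fun p => by rw [mul_one]) fun p => ne_zero_of_re_pos (diffHat_add_re_pos hh L n hμ ?_)
    intro ν
    have := isRealMomentum_mom p ν
    rw [scaleMom, Complex.mul_im, this, mul_zero, zero_add, ← Nat.cast_pow, Complex.natCast_im,
      zero_mul]
  have h2 := ((hasSymbol_frakQ (s := s) (t := t) hL 𝔮 a n).mul (h1.avgIter_conj hL 𝔮 n)).congr
    (f' := fun k => frakQHat L 𝔮 a n (mom k) * ∑ l : DualCell L n,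
      uN L n (mom k + l.momentum) ^ (2 * 𝔮) * (diffHat L h n (mom k + l.momentum) + μ)⁻¹)
    fun k => by simp_rw [scaleMom_joinMom]
  have h3 := ((hasSymbol_one.add h2).inv fun k =>
    deltaRegHat_den_ne_zero hL 𝔮 ha hh n hμ (isRealMomentum_mom k)).mul (hasSymbol_frakQ hL 𝔮 a n)
  have e : deltaReg L 𝔮 a h n s t μ = (1 + frakQ L 𝔮 a n s t * (avgIter L 𝔮 s t n
      * (diffOp L h n (s + 2 * n) (t + n) + (μ : ℂ) • 1)⁻¹ * avgIterAdj L 𝔮 s t n))⁻¹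
      * frakQ L 𝔮 a n s t := by
    simp only [deltaReg, Matrix.mul_assoc]
  rw [e]
  exact h3

/-- Clearing the factors D̂_n + μ, which are nonzero for μ > 0, gives an expression in which μ can
be set to 0 even where some D̂_n vanishes. -/
theorem deltaRegHat_eq {L : ℕ} (hL : Odd L) (𝔮 : ℕ) {a : ℝ} (ha : 0 < a)
    {h : (Fin 3 → ℤ) → ℂ} (hh : IsHamiltonian h) (n : ℕ) {μ : ℝ} (hμ : 0 < μ) {k : Fin 4 → ℂ}
    (hk : IsRealMomentum k) : deltaRegHat L 𝔮 a h n μ k =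
      frakQHat L 𝔮 a n k * (∏ l : DualCell L n, (diffHat L h n (k + l.momentum) + μ)) /
      ((∏ l : DualCell L n, (diffHat L h n (k + l.momentum) + μ)) +
        frakQHat L 𝔮 a n k * ∑ l : DualCell L n, uN L n (k + l.momentum) ^ (2 * 𝔮) *
          ∏ l' ∈ Finset.univ.erase l, (diffHat L h n (k + l'.momentum) + μ)) := by
  have hne : ∀ l : DualCell L n, diffHat L h n (k + l.momentum) + μ ≠ 0 := fun l =>
    ne_zero_of_re_pos (diffHat_add_re_pos hh L n hμ (hk.add_momentum l))
  have hP : (∏ l : DualCell L n, (diffHat L h n (k + l.momentum) + μ)) ≠ 0 :=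
    Finset.prod_ne_zero_iff.mpr fun l _ => hne l
  have e1 : ∀ l : DualCell L n, ∏ l' ∈ Finset.univ.erase l, (diffHat L h n (k + l'.momentum) + μ)
      = (∏ l : DualCell L n, (diffHat L h n (k + l.momentum) + μ)) *
        (diffHat L h n (k + l.momentum) + μ)⁻¹ := by
    intro l
    rw [eq_mul_inv_iff_mul_eq₀ (hne l)]
    exact Finset.prod_erase_mul _ _ (Finset.mem_univ l)
  have hD := deltaRegHat_den_ne_zero hL 𝔮 ha hh n hμ hk
  simp_rw [e1, mul_left_comm _ (∏ l : DualCell L n, (diffHat L h n (k + l.momentum) + (μ : ℂ)))]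
  rw [← Finset.mul_sum]
  rw [deltaRegHat]
  generalize (∏ l : DualCell L n, (diffHat L h n (k + l.momentum) + μ)) = P at *
  generalize (∑ l : DualCell L n, uN L n (k + l.momentum) ^ (2 * 𝔮) *
      (diffHat L h n (k + l.momentum) + μ)⁻¹) = S at *
  generalize frakQHat L 𝔮 a n k = q at *
  have e2 : P + q * (P * S) = P * (1 + q * S) := by ring
  rw [e2]
  field_simp

theorem tendsto_deltaRegHat (hL : Odd L) (𝔮 : ℕ) {a : ℝ} (ha : 0 < a)
    {h : (Fin 3 → ℤ) → ℂ} (hh : IsHamiltonian h) {n : ℕ} (hn : n ≠ 0) {k : Fin 4 → ℂ}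
    (hk : IsRealMomentum k) : Tendsto (fun μ => deltaRegHat L 𝔮 a h n μ k) (𝓝[>] 0)
      (𝓝 (deltaHat L 𝔮 a h n k)) := by
  have h0 : Tendsto (fun μ : ℝ => (μ : ℂ)) (𝓝[>] 0) (𝓝 0) := by
    have : Tendsto (fun μ : ℝ => (μ : ℂ)) (𝓝 0) (𝓝 ((0 : ℝ) : ℂ)) :=
      Complex.continuous_ofReal.tendsto 0
    rw [Complex.ofReal_zero] at this
    exact this.mono_left nhdsWithin_le_nhds
  have h1 : ∀ l : DualCell L n, Tendsto (fun μ : ℝ => diffHat L h n (k + l.momentum) + (μ : ℂ))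
      (𝓝[>] 0) (𝓝 (diffHat L h n (k + l.momentum))) := fun l => by
    have := h0.const_add (diffHat L h n (k + l.momentum))
    rwa [add_zero] at this
  rw [deltaHat_eq hn]
  have hP := tendsto_finsetProd (Finset.univ : Finset (DualCell L n)) fun l _ => h1 l
  have hS := (tendsto_finsetSum (Finset.univ : Finset (DualCell L n)) fun l _ =>
    (tendsto_finsetProd (Finset.univ.erase l) fun l' _ => h1 l').const_mul
      (uN L n (k + l.momentum) ^ (2 * 𝔮))).const_mul (frakQHat L 𝔮 a n k)
  refine ((hP.const_mul (frakQHat L 𝔮 a n k)).div (hP.add hS)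
    (deltaDen_ne_zero hL 𝔮 ha hh n hk)).congr' ?_
  filter_upwards [self_mem_nhdsWithin] with μ hμ
  exact (deltaRegHat_eq hL 𝔮 ha hh n hμ hk).symm

theorem tendsto_deltaReg_ofSymbol (hL : Odd L) (𝔮 : ℕ) {a : ℝ} (ha : 0 < a)
    {h : (Fin 3 → ℤ) → ℂ} (hh : IsHamiltonian h) {n : ℕ} (hn : n ≠ 0) :
    Tendsto (fun μ : ℝ => deltaReg L 𝔮 a h n s t μ) (𝓝[>] 0)
      (𝓝 (ofSymbol fun k => deltaHat L 𝔮 a h n (mom k))) := by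
  refine (tendsto_ofSymbol fun k =>
    tendsto_deltaRegHat hL 𝔮 ha hh hn (isRealMomentum_mom k)).congr' ?_
  filter_upwards [self_mem_nhdsWithin] with μ hμ
  exact (hasSymbol_deltaReg hL 𝔮 ha hh n hμ).eq_ofSymbol.symm

/-- `delta` is defined by `limUnder`, which means what it should only once convergence is known; the
explicit limit supplies this. -/
theorem tendsto_deltaReg (hL : Odd L) (𝔮 : ℕ) {a : ℝ} (ha : 0 < a)
    {h : (Fin 3 → ℤ) → ℂ} (hh : IsHamiltonian h) {n : ℕ} (hn : n ≠ 0) :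
    Tendsto (fun μ : ℝ => deltaReg L 𝔮 a h n s t μ) (𝓝[>] 0) (𝓝 (delta L 𝔮 a h n s t)) := by
  have h1 := tendsto_deltaReg_ofSymbol (s := s) (t := t) hL 𝔮 ha hh hn
  rw [delta, if_neg hn, h1.limUnder_eq]
  exact h1

theorem hasSymbol_delta (hL : Odd L) (𝔮 : ℕ) {a : ℝ} (ha : 0 < a)
    {h : (Fin 3 → ℤ) → ℂ} (hh : IsHamiltonian h) (n : ℕ) :
    HasSymbol (delta L 𝔮 a h n s t) fun k => deltaHat L 𝔮 a h n (mom k) := by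
  by_cases hn : n = 0
  · subst hn
    rw [delta, if_pos rfl]
    refine (hasSymbol_diffOp hh 0).congr fun k => ?_
    rw [deltaHat, if_pos rfl]
    congr 1
    funext ν
    rw [scaleMom, pow_zero, one_mul]
  · rw [tendsto_nhds_unique (tendsto_deltaReg hL 𝔮 ha hh hn)
      (tendsto_deltaReg_ofSymbol hL 𝔮 ha hh hn)]
    exact hasSymbol_ofSymbol _

/-! ### The Floquet decomposition -/

theorem avgAdj_mulVec_chi (hL : Odd L) (𝔮 : ℕ) (k : Torus L s t) :
    (avgAdj L 𝔮 s t).mulVec (chi k) = ∑ l : DualCell L 1,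
      uN L 1 (mom k + l.momentum) ^ 𝔮 •
        (chi (joinMom k l : Torus L (s + 2) (t + 1)) : Torus L (s + 2) (t + 1) → ℂ) := by
  have e1 : ∀ p : Torus L (s + 2) (t + 1), uPlus L (mom p) = uN L 1 (scaleMom L 1 (mom p)) := by
    intro p
    rw [uN_scaleMom hL.pos, uPlus]
    simp_rw [pow_one]
  have h1 : ∀ p : Torus L (s + 2 * 1) (t + 1), (avg L 𝔮 s t).mulVec (chi p)
      = uN L 1 (scaleMom L 1 (mom p)) ^ 𝔮 • (chi (red L s t p) : Torus L s t → ℂ) := fun p => by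
    rw [← e1]; exact avg_mulVec_chi hL 𝔮 p
  have := transpose_mulVec_chi (j := 1) h1 (fun p => by rw [uN_scaleMom_mom_neg hL]) k
  simp_rw [scaleMom_joinMom] at this
  exact this

/-- Q*Q sends each alias of k to the same combination of aliases, up to a factor, which is the rank
one part. Δ⁽ⁿ⁾ is diagonal in the characters and gives the diagonal part. -/
theorem scaledOp_mulVec_chi (hL : Odd L) (𝔮 : ℕ) {a : ℝ} (ha : 0 < a) {h : (Fin 3 → ℤ) → ℂ}
    (hh : IsHamiltonian h) (n : ℕ) (k : Torus L s t) (l' : DualCell L 1) :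
    (scaledOp L 𝔮 a h n s t).mulVec (chi (joinMom k l' : Torus L (s + 2) (t + 1)))
      = ∑ l : DualCell L 1, floquet L 𝔮 a h n (mom k) l l' •
        (chi (joinMom k l : Torus L (s + 2) (t + 1)) : Torus L (s + 2) (t + 1) → ℂ) := by
  have hs : scaleMom L 1 (mom (joinMom k l' : Torus L (s + 2) (t + 1)))
      = mom k + l'.momentum := scaleMom_joinMom k l'
  have hm : mom (joinMom k l' : Torus L (s + 2) (t + 1)) = unscale L (mom k + l'.momentum) := by
    rw [← hs, unscale_scaleMom hL.pos]
  have h1 := avg_mulVec_chi hL 𝔮 (joinMom k l' : Torus L (s + 2) (t + 1))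
  rw [hm, uPlus_unscale, show red L s t (joinMom k l' : Torus L (s + 2) (t + 1)) = k from
    red_joinMom k l'] at h1
  have h2 := hasSymbol_delta (s := s + 2) (t := t + 1) hL 𝔮 ha hh n (joinMom k l')
  beta_reduce at h2
  rw [hm] at h2
  rw [scaledOp, Matrix.add_mulVec, h2, Matrix.smul_mulVec, ← Matrix.mulVec_mulVec, h1,
    Matrix.mulVec_smul, avgAdj_mulVec_chi hL]
  simp_rw [floquet_apply, add_smul, Finset.sum_add_distrib, ite_smul, zero_smul]
  rw [Finset.sum_ite_eq' Finset.univ l', if_pos (Finset.mem_univ _), Finset.smul_sum,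
    Finset.smul_sum]
  congr 1
  refine Finset.sum_congr rfl fun l _ => ?_
  rw [smul_smul, smul_smul]
  congr 1
  ring

end

section
variable {L s t : ℕ} [NeZero L]

/-! ### Operators commuting with coarse translations -/

/-- The operator `M` maps the character with momentum `𝕃⁻¹(k + ℓ')` to the combination of those with
momenta `𝕃⁻¹(k + ℓ)` given by the matrix `D k`. -/
def HasFloquet (M : Matrix (Torus L (s + 2) (t + 1)) (Torus L (s + 2) (t + 1)) ℂ)
    (D : Torus L s t → Matrix (DualCell L 1) (DualCell L 1) ℂ) : Prop :=
  ∀ (k : Torus L s t) (l' : DualCell L 1),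
    M.mulVec (chi (joinMom k l' : Torus L (s + 2) (t + 1))) = ∑ l, D k l l' •
      (chi (joinMom k l : Torus L (s + 2) (t + 1)) : Torus L (s + 2) (t + 1) → ℂ)

/-- The operator with the given Floquet matrices. -/
noncomputable def ofFloquet (D : Torus L s t → Matrix (DualCell L 1) (DualCell L 1) ℂ) :
    Matrix (Torus L (s + 2) (t + 1)) (Torus L (s + 2) (t + 1)) ℂ :=
  Matrix.of fun x x' => (torusCard L (s + 2) (t + 1))⁻¹ * ∑ k, ∑ l, ∑ l', D k l l' *
    (chi (joinMom k l : Torus L (s + 2) (t + 1)) x *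
      chi (joinMom k l' : Torus L (s + 2) (t + 1)) (-x'))

variable {M M' : Matrix (Torus L (s + 2) (t + 1)) (Torus L (s + 2) (t + 1)) ℂ}
  {D D' : Torus L s t → Matrix (DualCell L 1) (DualCell L 1) ℂ}

theorem HasFloquet.unique (h : HasFloquet M D) (h' : HasFloquet M' D) : M = M' := by
  refine eq_of_mulVec_chi fun p => ?_
  obtain ⟨l, hl⟩ := exists_joinMom_eq (s := s) (t := t) (j := 1) p
  have := (h (red L s t p) l).trans (h' (red L s t p) l).symm
  rwa [show (joinMom (red L s t p) l : Torus L (s + 2) (t + 1)) = p from hl] at this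

theorem hasFloquet_one :
    HasFloquet (1 : Matrix (Torus L (s + 2) (t + 1)) (Torus L (s + 2) (t + 1)) ℂ)
      fun _ : Torus L s t => 1 := by
  intro k l'
  rw [Matrix.one_mulVec]
  simp [Matrix.one_apply]

theorem HasFloquet.sub (h : HasFloquet M D) (h' : HasFloquet M' D') :
    HasFloquet (M - M') fun k => D k - D' k := by
  intro k l'
  rw [Matrix.sub_mulVec, h, h', ← Finset.sum_sub_distrib]
  exact Finset.sum_congr rfl fun l _ => (sub_smul _ _ _).symm

theorem HasFloquet.smul (c : ℂ) (h : HasFloquet M D) : HasFloquet (c • M) fun k => c • D k := by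
  intro k l'
  rw [Matrix.smul_mulVec, h, Finset.smul_sum]
  exact Finset.sum_congr rfl fun l _ => smul_smul _ _ _

theorem HasFloquet.mul (h : HasFloquet M D) (h' : HasFloquet M' D') :
    HasFloquet (M * M') fun k => D k * D' k := by
  intro k l'
  rw [← Matrix.mulVec_mulVec, h', Matrix.mulVec_sum]
  simp_rw [Matrix.mulVec_smul, h k, Finset.smul_sum, smul_smul]
  rw [Finset.sum_comm]
  refine Finset.sum_congr rfl fun l _ => ?_
  rw [← Finset.sum_smul, Matrix.mul_apply]
  congr 1
  exact Finset.sum_congr rfl fun m _ => mul_comm _ _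

/-- The pairs (k, ℓ) enumerate the fine characters without repetition, so orthogonality selects k₀
and ℓ₀. -/
theorem hasFloquet_ofFloquet (D : Torus L s t → Matrix (DualCell L 1) (DualCell L 1) ℂ) :
    HasFloquet (ofFloquet D) D := by
  classical
  intro k₀ l₀
  funext x
  have h1 : ∀ (k : Torus L s t) (l' : DualCell L 1), ∑ x' : Torus L (s + 2) (t + 1),
      chi (joinMom k l' : Torus L (s + 2) (t + 1)) (-x') *
        chi (joinMom k₀ l₀ : Torus L (s + 2) (t + 1)) x'
      = if k = k₀ then if l' = l₀ then torusCard L (s + 2) (t + 1) else 0 else 0 := by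
    intro k l'
    have : ∀ y : Torus L (s + 2) (t + 1), chi (joinMom k l' : Torus L (s + 2) (t + 1)) (-y) *
        chi (joinMom k₀ l₀ : Torus L (s + 2) (t + 1)) y
        = chi ((joinMom k₀ l₀ : Torus L (s + 2) (t + 1)) - joinMom k l') y := by
      intro y; rw [chi_neg_right, ← chi_add_left, neg_add_eq_sub]
    simp_rw [this]
    rw [sum_chi_right]
    by_cases hk : k = k₀
    · subst hk
      rw [if_pos rfl]
      by_cases hl : l' = l₀
      · subst hl
        rw [if_pos rfl, if_pos (sub_self _)]
      · rw [if_neg hl, if_neg fun e => hl (joinMom_injective k (sub_eq_zero.mp e).symm)]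
    · rw [if_neg hk, if_neg fun e => hk ?_]
      have := congrArg (red L s t) (sub_eq_zero.mp e)
      rw [show red L s t (joinMom k₀ l₀ : Torus L (s + 2) (t + 1)) = k₀ from red_joinMom k₀ l₀,
        show red L s t (joinMom k l' : Torus L (s + 2) (t + 1)) = k from red_joinMom k l'] at this
      exact this.symm
  have h2 : ∀ x' : Torus L (s + 2) (t + 1), ofFloquet D x x' *
      chi (joinMom k₀ l₀ : Torus L (s + 2) (t + 1)) x' = (torusCard L (s + 2) (t + 1))⁻¹ *
      ∑ k, ∑ l, ∑ l', D k l l' * chi (joinMom k l : Torus L (s + 2) (t + 1)) x *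
        (chi (joinMom k l' : Torus L (s + 2) (t + 1)) (-x') *
          chi (joinMom k₀ l₀ : Torus L (s + 2) (t + 1)) x') := by
    intro x'
    simp only [ofFloquet, Matrix.of_apply, mul_assoc, Finset.sum_mul]
  simp only [Matrix.mulVec, dotProduct]
  simp_rw [h2, ← Finset.mul_sum]
  rw [Finset.sum_comm]
  have h3 : ∀ k : Torus L s t, ∑ x' : Torus L (s + 2) (t + 1), ∑ l, ∑ l',
      D k l l' * chi (joinMom k l : Torus L (s + 2) (t + 1)) x *
        (chi (joinMom k l' : Torus L (s + 2) (t + 1)) (-x') *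
          chi (joinMom k₀ l₀ : Torus L (s + 2) (t + 1)) x')
      = if k = k₀ then ∑ l, D k l l₀ * chi (joinMom k l : Torus L (s + 2) (t + 1)) x
        * torusCard L (s + 2) (t + 1) else 0 := by
    intro k
    rw [Finset.sum_comm]
    have : ∀ l, ∑ x' : Torus L (s + 2) (t + 1), ∑ l',
        D k l l' * chi (joinMom k l : Torus L (s + 2) (t + 1)) x *
        (chi (joinMom k l' : Torus L (s + 2) (t + 1)) (-x') *
          chi (joinMom k₀ l₀ : Torus L (s + 2) (t + 1)) x')
        = if k = k₀ then D k l l₀ * chi (joinMom k l : Torus L (s + 2) (t + 1)) x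
        * torusCard L (s + 2) (t + 1) else 0 := by
      intro l
      rw [Finset.sum_comm]
      simp_rw [← Finset.mul_sum, h1]
      by_cases hk : k = k₀
      · simp only [hk, if_true, mul_ite, mul_zero, Finset.sum_ite_eq', Finset.mem_univ]
      · simp only [hk, if_false, mul_zero, Finset.sum_const_zero]
    simp_rw [this]
    by_cases hk : k = k₀ <;> simp [hk]
  simp_rw [h3]
  rw [Finset.sum_ite_eq' Finset.univ k₀, if_pos (Finset.mem_univ _), Finset.sum_apply,
    Finset.mul_sum]
  refine Finset.sum_congr rfl fun l _ => ?_
  rw [Pi.smul_apply, smul_eq_mul]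
  have := torusCard_ne_zero L (s + 2) (t + 1)
  field_simp

theorem HasFloquet.isUnit_and_inv_eq (h : HasFloquet M D) (hD : ∀ k, IsUnit (D k)) :
    IsUnit M ∧ M⁻¹ = ofFloquet fun k => (D k)⁻¹ := by
  have h1 : M * ofFloquet (fun k => (D k)⁻¹) = 1 := by
    refine (h.mul (hasFloquet_ofFloquet _)).unique ?_
    have : (fun k => D k * (D k)⁻¹) = fun _ : Torus L s t => 1 := funext fun k =>
      Matrix.mul_nonsing_inv _ ((Matrix.isUnit_iff_isUnit_det _).mp (hD k))
    rw [this]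
    exact hasFloquet_one
  exact ⟨IsUnit.of_mul_eq_one _ h1, Matrix.inv_eq_right_inv h1⟩

theorem hasFloquet_scaledOp (hL : Odd L) (𝔮 : ℕ) {a : ℝ} (ha : 0 < a) {h : (Fin 3 → ℤ) → ℂ}
    (hh : IsHamiltonian h) (n : ℕ) :
    HasFloquet (scaledOp L 𝔮 a h n s t) fun k => floquet L 𝔮 a h n (mom k) :=
  fun k l' => scaledOp_mulVec_chi hL 𝔮 ha hh n k l'

theorem isUnit_smul_sub_scaledOp (hL : Odd L) (𝔮 : ℕ) {a : ℝ} (ha : 0 < a) {h : (Fin 3 → ℤ) → ℂ}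
    (hh : IsHamiltonian h) (n : ℕ) {z : ℂ}
    (hz : ∀ k : Torus L s t, IsUnit (z • 1 - floquet L 𝔮 a h n (mom k))) :
    IsUnit (z • 1 - scaledOp L 𝔮 a h n s t) ∧ (z • 1 - scaledOp L 𝔮 a h n s t)⁻¹
      = ofFloquet fun k => (z • 1 - floquet L 𝔮 a h n (mom k))⁻¹ :=
  ((hasFloquet_one.smul z).sub (hasFloquet_scaledOp hL 𝔮 ha hh n)).isUnit_and_inv_eq hz

end

/-! ### Resolvents of the Floquet matrices off the slit disc -/

theorem sum_norm_le_matNorm {ι : Type} [Fintype ι] (M : Matrix ι ι ℂ) (i : ι) :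
    ∑ j, ‖M i j‖ ≤ matNorm M :=
  (le_ciSup (f := fun i => ∑ j, ‖M i j‖) (Set.finite_range _).bddAbove i).trans (le_max_left _ _)

/-- At the component m where |w| is largest, the equation gives |w_m| (|z| - Γ) ≤ Y, and |z| - Γ ≥
1. -/
theorem isUnit_smul_one_sub_of_matNorm_le {ι : Type} [Fintype ι] [DecidableEq ι]
    {M : Matrix ι ι ℂ} (hM : ∀ i j, M i j = M j i) {Γ : ℝ} (hΓ : matNorm M ≤ Γ) {z : ℂ}
    (hz : Γ + 1 ≤ ‖z‖) : IsUnit (z • 1 - M) ∧ matNorm (z • 1 - M)⁻¹ ≤ 1 := by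
  refine isUnit_and_matNorm_inv_le zero_le_one (fun i j => ?_) fun w Y hY i => ?_
  · rw [Matrix.sub_apply, Matrix.sub_apply, hM i j, Matrix.smul_apply, Matrix.smul_apply,
      Matrix.one_apply, Matrix.one_apply]
    simp only [eq_comm]
  · have : Nonempty ι := ⟨i⟩
    obtain ⟨m, hm⟩ := Finite.exists_max fun i => ‖w i‖
    have e : (z • 1 - M).mulVec w m = z * w m - ∑ j, M m j * w j := by
      rw [Matrix.sub_mulVec, Matrix.smul_mulVec, Matrix.one_mulVec]
      rfl
    have h1 := hY m
    rw [e] at h1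
    have h2 : ‖∑ j, M m j * w j‖ ≤ Γ * ‖w m‖ := by
      refine (norm_sum_le _ _).trans ?_
      calc ∑ j, ‖M m j * w j‖ ≤ ∑ j, ‖M m j‖ * ‖w m‖ := by
            refine Finset.sum_le_sum fun j _ => ?_
            rw [norm_mul]
            exact mul_le_mul_of_nonneg_left (hm j) (norm_nonneg _)
        _ = (∑ j, ‖M m j‖) * ‖w m‖ := (Finset.sum_mul _ _ _).symm
        _ ≤ _ := mul_le_mul_of_nonneg_right ((sum_norm_le_matNorm M m).trans hΓ) (norm_nonneg _)
    have h3 := norm_sub_norm_le (z * w m) (∑ j, M m j * w j)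
    rw [norm_mul] at h3
    have h4 := mul_le_mul_of_nonneg_right hz (norm_nonneg (w m))
    have := hm i
    linarith

section
variable {𝔮 : ℕ} {a : ℝ} {h : (Fin 3 → ℤ) → ℂ} {Γ₂ m₂ lam₀ Γ₈ : ℝ}

/-- A point off the disc is either large, where the bound Γ₈ on the matrix suffices, or close to the
negative axis, where the resolvent hypothesis applies. The sum of the two bounds covers both cases.
-/
theorem FloquetConstants.resolvent_bound (H : FloquetConstants 𝔮 a h Γ₂ m₂ lam₀ Γ₈) {L : ℕ}
    (hL : Odd L) (hL1 : 1 < L) (hL2 : Γ₂ < L) (n : ℕ) {k : Fin 4 → ℂ} (hk : k ∈ strip (3 * m₂))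
    {z : ℂ} (hz : z ∉ slitDisc (lam₀ / (2 * (L : ℝ) ^ 2)) (Γ₈ + 1)) :
    IsUnit (z • 1 - floquet L 𝔮 a h n k) ∧
      matNorm (z • 1 - floquet L 𝔮 a h n k)⁻¹ ≤ Γ₈ * (L : ℝ) ^ 2 + 1 := by
  have hL0 : (0 : ℝ) < L := by exact_mod_cast hL.pos
  have hΓ := H.Γ₈_pos
  by_cases h1 : Γ₈ + 1 ≤ ‖z‖
  · obtain ⟨h2, h3⟩ := isUnit_smul_one_sub_of_matNorm_le (floquet_symm L 𝔮 a h n k)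
      (H.bound L hL hL1 hL2 n k hk) h1
    exact ⟨h2, h3.trans (by have : 0 ≤ Γ₈ * (L : ℝ) ^ 2 := by positivity
                            linarith)⟩
  · have h2 : Metric.infDist z negAxis ≤ lam₀ / (L : ℝ) ^ 2 := by
      by_contra hcon
      refine hz ⟨?_, not_le.mp h1⟩
      refine lt_of_le_of_lt ?_ (not_le.mp hcon)
      have := H.lam₀_pos
      gcongr
      nlinarith [sq_nonneg (L : ℝ)]
    obtain ⟨h3, h4⟩ := H.resolvent L hL hL1 hL2 n k hk z h2
    exact ⟨h3, h4.trans (by linarith)⟩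

theorem IsRealMomentum.mem_strip {k : Fin 4 → ℂ} (hk : IsRealMomentum k) {m : ℝ} (hm : 0 < m) :
    k ∈ strip m := by
  have : ∑ ν, (k ν).im ^ 2 = 0 := Finset.sum_eq_zero fun ν _ => by rw [hk ν]; simp
  rw [strip, Set.mem_ofPred_eq, this, Real.sqrt_zero]
  exact hm

theorem FloquetConstants.spectrum_subset (H : FloquetConstants 𝔮 a h Γ₂ m₂ lam₀ Γ₈) (ha : 0 < a)
    (hh : IsHamiltonian h) {L : ℕ} [NeZero L] (hL : Odd L) (hL1 : 1 < L) (hL2 : Γ₂ < L)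
    (n s t : ℕ) : spectrum ℂ (scaledOp L 𝔮 a h n s t)
      ⊆ slitDisc (lam₀ / (2 * (L : ℝ) ^ 2)) (Γ₈ + 1) := by
  intro z hz
  by_contra hcon
  have h1 := (isUnit_smul_sub_scaledOp (s := s) (t := t) hL 𝔮 ha hh n fun k =>
    (H.resolvent_bound hL hL1 hL2 n
      ((isRealMomentum_mom k).mem_strip (by linarith [H.m₂_pos])) hcon).1).1
  rw [spectrum.mem_iff, Algebra.algebraMap_eq_smul_one] at hz
  exact hz h1

/-- A Floquet matrix has an eigenvalue, which must lie in the slit disc. The disc is therefore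
nonempty, and since 0 belongs to the negative axis its points satisfy δ < |z| < R. The
parametrisation of the contour needs this. -/
theorem FloquetConstants.lt_radius (H : FloquetConstants 𝔮 a h Γ₂ m₂ lam₀ Γ₈) {L : ℕ}
    (hL : Odd L) (hL1 : 1 < L) (hL2 : Γ₂ < L) : lam₀ / (2 * (L : ℝ) ^ 2) < Γ₈ + 1 := by
  by_contra hcon
  push Not at hcon
  have : NeZero L := ⟨hL.pos.ne'⟩
  have : Nonempty (DualCell L 1) := ⟨originCell L 1⟩
  obtain ⟨z, hz⟩ := spectrum.nonempty_of_isAlgClosed_of_finiteDimensional ℂ (floquet L 𝔮 a h 0 0)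
  rw [spectrum.mem_iff, Algebra.algebraMap_eq_smul_one] at hz
  refine hz (H.resolvent_bound hL hL1 hL2 0 (IsRealMomentum.mem_strip (fun ν => by simp)
    (by linarith [H.m₂_pos])) ?_).1
  rintro ⟨h1, h2⟩
  have h3 : Metric.infDist z negAxis ≤ dist z 0 :=
    Metric.infDist_le_dist_of_mem ⟨rfl, le_rfl⟩
  rw [dist_zero_right] at h3
  linarith

end

/-! ### Decay of discrete Fourier sums of analytic periodic functions -/

/-- Cauchy's theorem on a rectangle of width 2π; periodicity cancels the vertical sides. -/
theorem integral_add_mul_I_eq {F : ℂ → ℂ} {b η : ℝ} (hη : |η| < b)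
    (hF : ∀ z : ℂ, |z.im| < b → DifferentiableAt ℂ F z)
    (hper : ∀ z, F (z + 2 * Real.pi) = F z) :
    ∫ x in (0 : ℝ)..2 * Real.pi, F x = ∫ x in (0 : ℝ)..2 * Real.pi, F (x + η * Complex.I) := by
  have h1 := Complex.integral_boundary_rect_eq_zero_of_differentiableOn F 0
    (2 * Real.pi + η * Complex.I) (fun z hz => (hF z ?_).differentiableWithinAt)
  · have e1 : (2 * (Real.pi : ℂ) + η * Complex.I).re = 2 * Real.pi := by simp
    have e2 : (2 * (Real.pi : ℂ) + η * Complex.I).im = η := by simp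
    have e3 : ∀ y : ℝ, F (((2 * Real.pi : ℝ) : ℂ) + y * Complex.I) = F (((0 : ℝ) : ℂ) + y * Complex.I) := by
      intro y
      rw [← hper (((0 : ℝ) : ℂ) + y * Complex.I)]
      congr 1; push_cast; ring
    rw [e1, e2, Complex.zero_re, Complex.zero_im] at h1
    simp_rw [e3] at h1
    simp only [Complex.ofReal_zero, zero_mul, add_zero] at h1
    rw [add_sub_cancel_right] at h1
    exact sub_eq_zero.mp h1
  · have h2 := hz.2
    simp only [Set.mem_preimage, Complex.zero_im, Complex.add_im, Complex.mul_im,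
      Complex.ofReal_im, Complex.ofReal_re, Complex.I_im, Complex.I_re, Complex.re_ofNat,
      Complex.im_ofNat] at h2
    have h3 : z.im ∈ Set.uIcc 0 η := by simpa using h2
    refine lt_of_le_of_lt ?_ hη
    have := Set.abs_sub_left_of_mem_uIcc h3
    simpa using this

/-- The sum of `e^{-γ |m| / 2}` over the integers. -/
noncomputable def expSum (γ : ℝ) : ℝ := ∑' m : ℤ, Real.exp (-γ * (|(m : ℝ)| / 2))

theorem summable_exp_neg_abs {γ : ℝ} (hγ : 0 < γ) :
    Summable fun m : ℤ => Real.exp (-γ * (|(m : ℝ)| / 2)) := by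
  have h1 : Summable fun n : ℕ => Real.exp (-(γ / 2)) ^ n :=
    summable_geometric_of_lt_one (Real.exp_pos _).le (by rw [Real.exp_lt_one_iff]; linarith)
  have h2 : ∀ n : ℕ, Real.exp (-(γ / 2)) ^ n = Real.exp (-γ * ((n : ℝ) / 2)) := by
    intro n; rw [← Real.exp_nat_mul]; congr 1; ring
  simp_rw [h2] at h1
  refine Summable.of_nat_of_neg ?_ ?_ <;> simpa using h1

theorem expSum_pos {γ : ℝ} (hγ : 0 < γ) : 0 < expSum γ :=
  (summable_exp_neg_abs hγ).tsum_pos (fun _ => (Real.exp_pos _).le) 0 (Real.exp_pos _)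

/-- Recentre at the integer nearest to r/N: then |r - Ny| is at least half the distance of y from
it. The bound involves neither r nor N, hence the independence of the volume. -/
theorem sum_exp_neg_abs_le {γ : ℝ} (hγ : 0 < γ) (r : ℝ) {N : ℝ} (hN : 1 ≤ N) :
    Summable (fun y : ℤ => Real.exp (-γ * |r - N * y|)) ∧
      ∑' y : ℤ, Real.exp (-γ * |r - N * y|) ≤ expSum γ := by
  set y₀ : ℤ := round (r / N) with hy
  have hN0 : 0 < N := by linarith
  have key : ∀ y : ℤ, |((y - y₀ : ℤ) : ℝ)| / 2 ≤ |r - N * y| := by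
    intro y
    have h1 : |r / N - y₀| ≤ 1 / 2 := abs_sub_round _
    have h2 : |((y - y₀ : ℤ) : ℝ)| / 2 ≤ |r / N - y| := by
      by_cases hyy : y = y₀
      · rw [hyy, sub_self]; simp
      · have h3 : (1 : ℝ) ≤ |((y - y₀ : ℤ) : ℝ)| := by
          exact_mod_cast Int.one_le_abs (sub_ne_zero.mpr hyy)
        have h4 : |((y - y₀ : ℤ) : ℝ)| ≤ |r / N - y₀| + |r / N - y| := by
          have := abs_sub (r / N - y₀) (r / N - y)
          refine le_trans (le_of_eq ?_) this
          push_cast; congr 1; ring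
        linarith
    have h5 : |r - N * y| = N * |r / N - y| := by
      rw [← abs_of_pos hN0, ← abs_mul, abs_of_pos hN0]
      congr 1; field_simp
    rw [h5]
    nlinarith [abs_nonneg (r / N - y)]
  have h1 : Summable fun y : ℤ => Real.exp (-γ * (|((y - y₀ : ℤ) : ℝ)| / 2)) :=
    (Equiv.subRight y₀).summable_iff.mpr (summable_exp_neg_abs hγ)
  have h2 : ∀ y : ℤ, Real.exp (-γ * |r - N * y|) ≤ Real.exp (-γ * (|((y - y₀ : ℤ) : ℝ)| / 2)) := by
    intro y
    rw [Real.exp_le_exp]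
    nlinarith [key y]
  have h3 := Summable.of_nonneg_of_le (fun y => (Real.exp_pos _).le) h2 h1
  refine ⟨h3, (h3.tsum_le_tsum h2 h1).trans_eq ?_⟩
  exact (Equiv.subRight y₀).tsum_eq fun m : ℤ => Real.exp (-γ * (|(m : ℝ)| / 2))

/-- Averaging over the N points 2πj/N keeps exactly the Fourier coefficients with index in Nℤ, the
windings of the torus. Shifting the contour makes the coefficient m decay at rate β + γ in |w - m|.
The part β is spent on the shortest distance D, the part γ on summing over windings. -/
theorem norm_average_le {φ : ℂ → ℂ} {b β B w D : ℝ} (hβ : 0 < β) (hβb : β < b)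
    (hφ : ∀ z : ℂ, |z.im| < b → DifferentiableAt ℂ φ z)
    (hper : ∀ z, φ (z + 2 * Real.pi) = φ z)
    (hB : ∀ z : ℂ, |z.im| < b → ‖φ z‖ ≤ B * Real.exp (-(z.im * w)))
    {N : ℕ} [NeZero N] (hD : ∀ y : ℤ, D ≤ |w + N * y|) :
    ‖(N : ℂ)⁻¹ * ∑ j : ZMod N, φ (2 * Real.pi * j.val / N)‖
      ≤ B * expSum ((b - β) / 2) * Real.exp (-β * D) := by
  set γ := (b - β) / 2 with hγ
  have hγ0 : 0 < γ := by rw [hγ]; linarith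
  have hB0 : 0 ≤ B := by
    have := (norm_nonneg _).trans (hB 0 (by simpa using hβ.trans hβb))
    simpa using this
  have hT : Fact (0 < 2 * Real.pi) := ⟨Real.two_pi_pos⟩
  have hper' : Function.Periodic (fun x : ℝ => φ x) (2 * Real.pi) := by
    intro x
    have := hper x
    simpa using this
  have hcont : Continuous fun x : ℝ => φ x := by
    rw [continuous_iff_continuousAt]
    intro x
    have h1 : ContinuousAt φ (x : ℂ) := (hφ x (by simpa using hβ.trans hβb)).continuousAt
    exact h1.comp Complex.continuous_ofReal.continuousAt
  let f : C(AddCircle (2 * Real.pi), ℂ) := ⟨hper'.lift, continuous_coinduced_dom.mpr hcont⟩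
  have hfc : ∀ x : ℝ, f (x : AddCircle (2 * Real.pi)) = φ x := fun x => rfl
  have hcoef : ∀ m : ℤ, ‖fourierCoeff f m‖ ≤ B * Real.exp (-(β + γ) * |w - m|) := by
    intro m
    -- The shift goes in the direction in which e^{-η(w - m)} decays.
    set η : ℝ := if 0 ≤ w - m then β + γ else -(β + γ) with hη
    have hηw : η * (w - m) = (β + γ) * |w - m| := by
      rw [hη]; split_ifs with h
      · rw [abs_of_nonneg h]
      · rw [abs_of_neg (not_le.mp h)]; ring
    have hηb : |η| < b := by
      have : |η| = β + γ := by
        rw [hη]; split_ifs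
        · exact abs_of_pos (by linarith)
        · rw [abs_neg]; exact abs_of_pos (by linarith)
      rw [this, hγ]; linarith
    set F : ℂ → ℂ := fun z => Complex.exp (-(m : ℂ) * Complex.I * z) * φ z with hF
    have h1 : fourierCoeff f m = ((1 / (2 * Real.pi) : ℝ) : ℂ) *
        ∫ x in (0 : ℝ)..2 * Real.pi, F (x + η * Complex.I) := by
      rw [fourierCoeff_eq_intervalIntegral f m 0, zero_add, Complex.real_smul,
        ← integral_add_mul_I_eq hηb (F := F)]
      · congr 1
        refine intervalIntegral.integral_congr fun x _ => ?_
        simp only [fourier_coe_apply, hfc, smul_eq_mul, hF]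
        congr 2
        push_cast
        field_simp
      · intro z hz
        exact ((differentiableAt_id.const_mul _).cexp).mul (hφ z hz)
      · intro z
        simp only [hF, hper]
        congr 1
        rw [Complex.exp_eq_exp_iff_exists_int]
        exact ⟨-m, by push_cast; ring⟩
    have h2 : ∀ x : ℝ, ‖F (x + η * Complex.I)‖ ≤ B * Real.exp (-(β + γ) * |w - m|) := by
      intro x
      have hz : (x + η * Complex.I : ℂ).im = η := by simp
      rw [hF, norm_mul, Complex.norm_exp]
      have e1 : (-(m : ℂ) * Complex.I * (x + η * Complex.I)).re = m * η := by
        simp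
      rw [e1]
      have := hB (x + η * Complex.I) (by rw [hz]; exact hηb)
      rw [hz] at this
      calc Real.exp (m * η) * ‖φ (x + η * Complex.I)‖
          ≤ Real.exp (m * η) * (B * Real.exp (-(η * w))) := by gcongr
        _ = B * (Real.exp (m * η) * Real.exp (-(η * w))) := by ring
        _ = _ := by
          rw [← Real.exp_add]
          congr 2
          rw [neg_mul, ← hηw]; ring
    rw [h1, norm_mul, Complex.norm_real, Real.norm_eq_abs, abs_of_pos (by positivity)]
    have h3 := intervalIntegral.norm_integral_le_of_norm_le_const
      (a := 0) (b := 2 * Real.pi) (f := fun x : ℝ => F (x + η * Complex.I)) fun x _ => h2 x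
    rw [sub_zero, abs_of_pos Real.two_pi_pos] at h3
    calc 1 / (2 * Real.pi) * ‖∫ x in (0 : ℝ)..2 * Real.pi, F (x + η * Complex.I)‖
        ≤ 1 / (2 * Real.pi) * (B * Real.exp (-(β + γ) * |w - m|) * (2 * Real.pi)) := by gcongr
      _ = _ := by have := Real.pi_ne_zero; field_simp
  have hsumm : Summable (fourierCoeff f) := by
    refine Summable.of_norm_bounded (g := fun m : ℤ => B * Real.exp (-(β + γ) * |w - m|)) ?_ hcoef
    refine Summable.mul_left _ ?_
    have := (sum_exp_neg_abs_le (γ := β + γ) (by linarith) w (N := 1) le_rfl).1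
    simpa using this
  have hN0 : (N : ℂ) ≠ 0 := by exact_mod_cast NeZero.ne N
  have hfour : ∀ (m : ℤ) (j : ZMod N), fourier m (((2 * Real.pi * j.val / N : ℝ) : ℝ) :
      AddCircle (2 * Real.pi)) = ZMod.stdAddChar (j * (m : ZMod N)) := by
    intro m j
    rw [fourier_coe_apply, stdAddChar_mul_intCast]
    congr 1
    push_cast
    have := Real.pi_ne_zero
    have : (Real.pi : ℂ) ≠ 0 := by exact_mod_cast this
    field_simp
  have hsum : HasSum (fun m : ℤ => fourierCoeff f m * if (m : ZMod N) = 0 then 1 else 0)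
      ((N : ℂ)⁻¹ * ∑ j : ZMod N, φ (2 * Real.pi * j.val / N)) := by
    have h1 : ∀ j : ZMod N, HasSum (fun m : ℤ => fourierCoeff f m * ZMod.stdAddChar (j * (m : ZMod N)))
        (φ (2 * Real.pi * j.val / N)) := by
      intro j
      have := has_pointwise_sum_fourier_series_of_summable hsumm
        ((2 * Real.pi * j.val / N : ℝ) : AddCircle (2 * Real.pi))
      simp_rw [hfour, smul_eq_mul] at this
      rw [hfc] at this
      push_cast at this
      exact this
    have h2 := (hasSum_sum fun j (_ : j ∈ Finset.univ) => h1 j).mul_left ((N : ℂ)⁻¹)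
    have e : (fun m : ℤ => fourierCoeff f m * if (m : ZMod N) = 0 then (1 : ℂ) else 0)
        = fun m : ℤ => (N : ℂ)⁻¹ *
          ∑ j : ZMod N, fourierCoeff f m * ZMod.stdAddChar (j * (m : ZMod N)) := by
      funext m
      rw [← Finset.mul_sum, sum_stdAddChar]
      split_ifs
      · field_simp
      · simp
    rw [e]
    exact h2
  have hinj : Function.Injective fun y : ℤ => (N : ℤ) * y := fun y y' h =>
    mul_left_cancel₀ (by exact_mod_cast NeZero.ne N) h
  have hsum' : HasSum (fun y : ℤ => fourierCoeff f (N * y))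
      ((N : ℂ)⁻¹ * ∑ j : ZMod N, φ (2 * Real.pi * j.val / N)) := by
    have h0 : ∀ m ∉ Set.range fun y : ℤ => (N : ℤ) * y,
        (fourierCoeff f m * if (m : ZMod N) = 0 then (1 : ℂ) else 0) = 0 := by
      intro m hm
      rw [if_neg, mul_zero]
      intro h
      obtain ⟨y, hy⟩ := (ZMod.intCast_zmod_eq_zero_iff_dvd m N).mp h
      exact hm ⟨y, hy.symm⟩
    have := (hinj.hasSum_iff h0).mpr hsum
    have e : (fun y : ℤ => fourierCoeff f (N * y)) = (fun m : ℤ => fourierCoeff f m *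
        if (m : ZMod N) = 0 then (1 : ℂ) else 0) ∘ fun y : ℤ => (N : ℤ) * y := by
      funext y
      simp
    rw [e]
    exact this
  have hbound : ∀ y : ℤ, ‖fourierCoeff f (N * y)‖
      ≤ B * Real.exp (-β * D) * Real.exp (-γ * |w - N * y|) := by
    intro y
    refine (hcoef _).trans ?_
    rw [mul_assoc, ← Real.exp_add]
    refine mul_le_mul_of_nonneg_left (Real.exp_le_exp.mpr ?_) hB0
    have := hD (-y)
    push_cast at this ⊢
    rw [mul_neg, ← sub_eq_add_neg] at this
    nlinarith
  obtain ⟨h5, h6⟩ := sum_exp_neg_abs_le hγ0 w (N := N) (by exact_mod_cast NeZero.one_le)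
  rw [← hsum'.tsum_eq]
  refine (tsum_of_norm_bounded (h5.mul_left _).hasSum hbound).trans ?_
  rw [tsum_mul_left, mul_right_comm]
  gcongr

/-- `G` is analytic on the box `|Im q_ν| < b`, periodic, and bounded there by `B e^{-Im q · w}`. -/
structure StripDecay {d : ℕ} (b B : ℝ) (w : Fin d → ℝ) (G : (Fin d → ℂ) → ℂ) : Prop where
  diff : ∀ q : Fin d → ℂ, (∀ ν, |(q ν).im| < b) → DifferentiableAt ℂ G q
  periodic : ∀ (q : Fin d → ℂ) (r : Fin d → ℤ), G (fun ν => q ν + 2 * Real.pi * r ν) = G q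
  bound : ∀ q : Fin d → ℂ, (∀ ν, |(q ν).im| < b) →
    ‖G q‖ ≤ B * Real.exp (-∑ ν, (q ν).im * w ν)

theorem differentiable_cons {d : ℕ} (c : ℂ) :
    Differentiable ℂ fun q : Fin d → ℂ => (Fin.cons c q : Fin (d + 1) → ℂ) := by
  rw [differentiable_pi]
  intro ν
  refine Fin.cases ?_ (fun ν => ?_) ν
  · simp
  · simpa using differentiable_apply ν

theorem differentiable_cons_left {d : ℕ} (q : Fin d → ℂ) :
    Differentiable ℂ fun c : ℂ => (Fin.cons c q : Fin (d + 1) → ℂ) := by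
  rw [differentiable_pi]
  intro ν
  refine Fin.cases ?_ (fun ν => ?_) ν
  · simp
  · simp

/-- Averaging over one variable reproduces the hypotheses in the others with a new constant, so
directions can be treated one by one, with different periods N. -/
theorem StripDecay.average {d : ℕ} {b β B D : ℝ} {w : Fin (d + 1) → ℝ} {G : (Fin (d + 1) → ℂ) → ℂ}
    (hG : StripDecay b B w G) (hβ : 0 < β) (hβb : β < b) {N : ℕ} [NeZero N]
    (hD : ∀ y : ℤ, D ≤ |w 0 + N * y|) :
    StripDecay b (B * expSum ((b - β) / 2) * Real.exp (-β * D)) (fun ν => w ν.succ)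
      fun q => (N : ℂ)⁻¹ * ∑ j : ZMod N, G (Fin.cons (2 * Real.pi * j.val / N) q) := by
  have hb : 0 < b := hβ.trans hβb
  have him : ∀ j : ZMod N, (2 * Real.pi * j.val / N : ℂ).im = 0 := by
    intro j
    have : (2 * Real.pi * j.val / N : ℂ) = ((2 * Real.pi * j.val / N : ℝ) : ℂ) := by push_cast; rfl
    rw [this, Complex.ofReal_im]
  have hcons : ∀ (z : ℂ) (q : Fin d → ℂ), |z.im| < b → (∀ ν, |(q ν).im| < b) →
      ∀ ν, |((Fin.cons z q : Fin (d + 1) → ℂ) ν).im| < b := fun z q hz hq ν =>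
    Fin.cases hz hq ν
  refine ⟨fun q hq => ?_, fun q r => ?_, fun q hq => ?_⟩
  · refine (DifferentiableAt.fun_sum fun j _ => ?_).const_mul _
    exact (hG.diff _ (hcons _ q (by rw [him, abs_zero]; exact hb) hq)).comp q
      (differentiable_cons _ q)
  · congr 1
    refine Finset.sum_congr rfl fun j _ => ?_
    rw [← hG.periodic (Fin.cons (2 * Real.pi * j.val / N) q) (Fin.cons 0 r)]
    congr 1
    funext ν
    refine Fin.cases ?_ (fun ν => ?_) ν <;> simp
  · have h1 := norm_average_le (φ := fun z => G (Fin.cons z q)) (w := w 0) (D := D)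
      (B := B * Real.exp (-∑ ν : Fin d, (q ν).im * w ν.succ)) hβ hβb (N := N)
      (fun z hz => (hG.diff _ (hcons z q hz hq)).comp z (differentiable_cons_left q z))
      (fun z => ?_) (fun z hz => ?_) hD
    · refine h1.trans (le_of_eq ?_)
      ring
    · rw [← hG.periodic (Fin.cons z q) (Fin.cons 1 0)]
      congr 1
      funext ν
      refine Fin.cases ?_ (fun ν => ?_) ν <;> simp
    · refine (hG.bound _ (hcons z q hz hq)).trans (le_of_eq ?_)
      rw [Fin.sum_univ_succ, mul_assoc, ← Real.exp_add]
      simp only [Fin.cons_zero, Fin.cons_succ]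
      congr 2
      ring

theorem StripDecay.norm_average_le {d : ℕ} {b β B : ℝ} {w : Fin d → ℝ} {G : (Fin d → ℂ) → ℂ}
    (hG : StripDecay b B w G) (hβ : 0 < β) (hβb : β < b) {N : ℕ} [NeZero N] {D : Fin d → ℝ}
    (hD : ∀ ν, ∀ y : ℤ, D ν ≤ |w ν + N * y|) :
    ‖((N : ℂ) ^ d)⁻¹ * ∑ j : Fin d → ZMod N, G fun ν => 2 * Real.pi * (j ν).val / N‖
      ≤ B * expSum ((b - β) / 2) ^ d * Real.exp (-β * ∑ ν, D ν) := by
  induction d generalizing B with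
  | zero =>
    have := hG.bound (fun ν => 2 * Real.pi * ((0 : ZMod N).val : ℂ) / N) (fun ν => ν.elim0)
    simp only [Finset.univ_eq_empty, Finset.sum_empty, neg_zero, Real.exp_zero, mul_one] at this
    simp only [pow_zero, inv_one, one_mul, Finset.univ_eq_empty, Finset.sum_empty, mul_zero,
      Real.exp_zero, mul_one, Fintype.sum_unique]
    convert this using 3
  | succ d ih =>
    have h1 := ih (hG.average hβ hβb (N := N) (hD 0)) fun ν => hD ν.succ
    refine (le_of_eq ?_).trans (h1.trans (le_of_eq ?_))
    · congr 1
      rw [← (Fin.consEquiv fun _ : Fin (d + 1) => ZMod N).sum_comp, Fintype.sum_prod_type,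
        Finset.sum_comm, ← Finset.mul_sum, ← mul_assoc, ← mul_inv, ← pow_succ]
      congr 1
      refine Finset.sum_congr rfl fun j _ => Finset.sum_congr rfl fun j0 _ => ?_
      congr 1
      funext ν
      refine Fin.cases ?_ (fun ν => ?_) ν <;> simp [Fin.consEquiv]
    · rw [Fin.sum_univ_succ, mul_add, Real.exp_add]
      ring

/-! ### The kernel of the resolvent -/

theorem differentiableAt_finsetProd {E ι : Type*} [NormedAddCommGroup E] [NormedSpace ℂ E]
    (I : Finset ι) {f : ι → E → ℂ} {q : E} (hf : ∀ i, DifferentiableAt ℂ (f i) q) :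
    DifferentiableAt ℂ (fun q => ∏ i ∈ I, f i q) q := by
  classical
  induction I using Finset.induction_on with
  | empty => simp
  | insert i I hi ih =>
    simp_rw [Finset.prod_insert hi]
    exact (hf i).fun_mul ih

theorem differentiableAt_det {E ι : Type*} [NormedAddCommGroup E] [NormedSpace ℂ E] [Fintype ι]
    [DecidableEq ι] {M : E → Matrix ι ι ℂ} {q : E}
    (hM : ∀ i j, DifferentiableAt ℂ (fun q => M q i j) q) :
    DifferentiableAt ℂ (fun q => (M q).det) q := by
  simp_rw [Matrix.det_apply']
  exact DifferentiableAt.fun_sum fun σ _ =>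
    (differentiableAt_finsetProd _ fun i => hM (σ i) i).const_mul _

/-- By Cramer's rule the entries of the inverse are quotients of determinants. -/
theorem differentiableAt_inv_apply {E ι : Type*} [NormedAddCommGroup E] [NormedSpace ℂ E]
    [Fintype ι] [DecidableEq ι] {M : E → Matrix ι ι ℂ} {q : E}
    (hM : ∀ i j, DifferentiableAt ℂ (fun q => M q i j) q) (hu : IsUnit (M q)) (i j : ι) :
    DifferentiableAt ℂ (fun q => (M q)⁻¹ i j) q := by
  have hd : (M q).det ≠ 0 := ((Matrix.isUnit_iff_isUnit_det _).mp hu).ne_zero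
  simp_rw [Matrix.inv_def, Ring.inverse_eq_inv', Matrix.smul_apply, smul_eq_mul,
    Matrix.adjugate_apply]
  refine (DifferentiableAt.fun_inv (differentiableAt_det hM) hd).fun_mul (differentiableAt_det fun i' j' => ?_)
  simp only [Matrix.updateRow_apply]
  split_ifs
  · exact differentiableAt_const _
  · exact hM i' j'

/-- The plane wave `e^{i (𝕃⁻¹ p) · X}`. -/
noncomputable def planeWave (L : ℕ) (X : Fin 4 → ℤ) (p : Fin 4 → ℂ) : ℂ :=
  Complex.exp (Complex.I * ∑ ν, unscale L p ν * X ν)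

theorem planeWave_latticePeriodic {L : ℕ} (hL : 0 < L) (X : Fin 4 → ℤ) :
    LatticePeriodic L 1 (planeWave L X) := by
  intro p r
  rw [planeWave, planeWave, unscale_add, unscale_latticeVec hL, Complex.exp_eq_exp_iff_exists_int]
  refine ⟨∑ ν, r ν * X ν, ?_⟩
  push_cast
  simp only [Pi.add_apply, add_mul, Finset.sum_add_distrib, mul_add, latticeVec]
  congr 1
  rw [Finset.sum_mul, Finset.mul_sum]
  exact Finset.sum_congr rfl fun ν _ => by ring

theorem norm_planeWave (L : ℕ) (X : Fin 4 → ℤ) (q : Fin 4 → ℂ) (l : DualCell L 1) :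
    ‖planeWave L X (q + l.momentum)‖ = Real.exp (-∑ ν, (q ν).im * (X ν / scaleFactor L ν)) := by
  rw [planeWave, Complex.norm_exp]
  congr 1
  rw [Complex.I_mul_re, Complex.im_sum]
  congr 1
  refine Finset.sum_congr rfl fun ν _ => ?_
  rw [Complex.mul_im, unscale_apply_im, Complex.intCast_im, Complex.intCast_re, mul_zero, zero_add,
    Pi.add_apply, Complex.add_im, momentum_im, add_zero]
  ring

theorem differentiable_planeWave (L : ℕ) (X : Fin 4 → ℤ) (c : Fin 4 → ℂ) :
    Differentiable ℂ fun q => planeWave L X (q + c) := by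
  refine ((Differentiable.fun_sum fun ν _ => Differentiable.mul_const ?_ _).const_mul _).cexp
  have h1 : Differentiable ℂ fun q : Fin 4 → ℂ => q ν := differentiable_apply ν
  have h2 : (fun q : Fin 4 → ℂ => unscale L (q + c) ν)
      = fun q => (q ν + c ν) * (scaleFactor L ν : ℂ)⁻¹ := by
    funext q
    rw [unscale, div_eq_mul_inv, Pi.add_apply]
  rw [h2]
  exact (h1.add_const (c ν)).mul_const _

theorem card_dualCell_one (L : ℕ) : Fintype.card (DualCell L 1) = L ^ 5 := by
  rw [Fintype.card_pi, Fin.prod_univ_succ]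
  simp only [Fintype.card_fin, scaleFactor_zero, scaleFactor_succ, Finset.prod_const,
    Finset.card_univ]
  ring

/-- The integrand of the Fourier representation of the kernel of the resolvent. -/
noncomputable def resolventSymbol (L 𝔮 : ℕ) (a : ℝ) (h : (Fin 3 → ℤ) → ℂ) (n : ℕ) (z : ℂ)
    (X X' : Fin 4 → ℤ) (q : Fin 4 → ℂ) : ℂ :=
  ∑ l : DualCell L 1, ∑ l' : DualCell L 1, (z • 1 - floquet L 𝔮 a h n q)⁻¹ l l' *
    (planeWave L X (q + l.momentum) * planeWave L (-X') (q + l'.momentum))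

section
variable {𝔮 : ℕ} {a : ℝ} {h : (Fin 3 → ℤ) → ℂ} {Γ₂ m₂ lam₀ Γ₈ : ℝ}

/-- In four dimensions the box of half-width m/2 lies in the Euclidean strip of width m. -/
theorem mem_strip_of_abs_im_lt {m : ℝ} {q : Fin 4 → ℂ} (hq : ∀ ν, |(q ν).im| < m / 2) :
    q ∈ strip m := by
  have hm : 0 < m := by linarith [(abs_nonneg _).trans_lt (hq 0)]
  rw [strip, Set.mem_ofPred_eq, Real.sqrt_lt' hm]
  have h1 : ∀ ν, (q ν).im ^ 2 < (m / 2) ^ 2 := fun ν => sq_lt_sq' (abs_lt.mp (hq ν)).1 (abs_lt.mp (hq ν)).2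
  rw [Fin.sum_univ_four]
  linarith [h1 0, h1 1, h1 2, h1 3]

/-- Translation by 2πr permutes the indices of the resolvent and of both plane waves simultaneously,
so the full sum is periodic although its terms are not. All products of plane waves have the same
modulus, which leaves L⁵ rows, each with ℓ¹ norm at most Γ₈L² + 1. -/
theorem FloquetConstants.stripDecay (H : FloquetConstants 𝔮 a h Γ₂ m₂ lam₀ Γ₈) {L : ℕ}
    (hL : Odd L) (hL1 : 1 < L) (hL2 : Γ₂ < L) (n : ℕ) {z : ℂ}
    (hz : z ∉ slitDisc (lam₀ / (2 * (L : ℝ) ^ 2)) (Γ₈ + 1)) (X X' : Fin 4 → ℤ) :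
    StripDecay (3 * m₂ / 2) ((L : ℝ) ^ 5 * (Γ₈ * (L : ℝ) ^ 2 + 1))
      (fun ν => ((X ν - X' ν : ℤ) : ℝ) / scaleFactor L ν)
      (resolventSymbol L 𝔮 a h n z X X') := by
  refine ⟨fun q hq => ?_, fun q r => ?_, fun q hq => ?_⟩
  · have hs := mem_strip_of_abs_im_lt hq
    refine DifferentiableAt.fun_sum fun l _ => DifferentiableAt.fun_sum fun l' _ =>
      DifferentiableAt.fun_mul (differentiableAt_inv_apply
        (M := fun q => z • 1 - floquet L 𝔮 a h n q) (fun i j => ?_)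
        (H.resolvent_bound hL hL1 hL2 n hs hz).1 l l')
      (DifferentiableAt.fun_mul (differentiable_planeWave L X _ q)
        (differentiable_planeWave L (-X') _ q))
    simp only [Matrix.sub_apply]
    exact (differentiableAt_const ((z • (1 : Matrix _ _ ℂ)) i j)).fun_sub (H.analytic L hL hL1 hL2 n i j q hs).differentiableAt
  · obtain ⟨σ, h1, h2⟩ := exists_perm_floquet hL.pos r
    have e : (fun ν => q ν + 2 * Real.pi * (r ν : ℂ)) = q + latticeVec r := rfl
    have e2 : (z • 1 - floquet L 𝔮 a h n (q + latticeVec r))⁻¹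
        = ((z • 1 - floquet L 𝔮 a h n q)⁻¹).submatrix σ σ := by
      rw [h2, ← Matrix.inv_submatrix_equiv, Matrix.submatrix_sub, Matrix.submatrix_smul]
      simp only [Pi.sub_apply, Pi.smul_apply, Matrix.submatrix_one_equiv]
    rw [e, resolventSymbol, resolventSymbol, e2]
    simp_rw [h1 ℂ _ (planeWave_latticePeriodic hL.pos X),
      h1 ℂ _ (planeWave_latticePeriodic hL.pos (-X')), Matrix.submatrix_apply]
    refine (Finset.sum_congr rfl fun l _ => Equiv.sum_comp σ fun l' =>
      (z • 1 - floquet L 𝔮 a h n q)⁻¹ (σ l) l' * (planeWave L X (q + (σ l).momentum)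
        * planeWave L (-X') (q + l'.momentum))).trans ?_
    exact Equiv.sum_comp σ fun l => ∑ l', (z • 1 - floquet L 𝔮 a h n q)⁻¹ l l' *
      (planeWave L X (q + l.momentum) * planeWave L (-X') (q + l'.momentum))
  · have hs := mem_strip_of_abs_im_lt hq
    have hR := (H.resolvent_bound hL hL1 hL2 n hs hz).2
    have e : ∀ l l' : DualCell L 1, ‖planeWave L X (q + l.momentum)
        * planeWave L (-X') (q + l'.momentum)‖
        = Real.exp (-∑ ν, (q ν).im * (((X ν - X' ν : ℤ) : ℝ) / scaleFactor L ν)) := by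
      intro l l'
      rw [norm_mul, norm_planeWave, norm_planeWave, ← Real.exp_add, ← neg_add,
        ← Finset.sum_add_distrib]
      congr 2
      refine Finset.sum_congr rfl fun ν _ => ?_
      push_cast [Pi.neg_apply]
      ring
    rw [resolventSymbol]
    refine (norm_sum_le _ _).trans ?_
    calc ∑ l, ‖∑ l', (z • 1 - floquet L 𝔮 a h n q)⁻¹ l l' *
          (planeWave L X (q + l.momentum) * planeWave L (-X') (q + l'.momentum))‖
        ≤ ∑ l : DualCell L 1, (Γ₈ * (L : ℝ) ^ 2 + 1) *
          Real.exp (-∑ ν, (q ν).im * (((X ν - X' ν : ℤ) : ℝ) / scaleFactor L ν)) := by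
          refine Finset.sum_le_sum fun l _ => (norm_sum_le _ _).trans ?_
          simp_rw [norm_mul _ (planeWave L X _ * _), e]
          rw [← Finset.sum_mul]
          exact mul_le_mul_of_nonneg_right ((sum_norm_le_matNorm _ l).trans hR)
            (Real.exp_pos _).le
      _ = _ := by
          rw [Finset.sum_const, Finset.card_univ, card_dualCell_one, nsmul_eq_mul]
          push_cast
          ring

end

/-! ### Decay of the resolvent kernel in position space -/

section
variable {L s t : ℕ} [NeZero L]

/-- The integer coordinates of a site. -/
def siteLift (x : Torus L s t) : Fin 4 → ℤ := Fin.cons x.1.val fun ν => (x.2 ν).val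

theorem chi_joinMom_eq (hL : 0 < L) (k : Torus L s t) (l : DualCell L 1)
    {x : Torus L (s + 2) (t + 1)} {X : Fin 4 → ℤ}
    (hx : x = toTorus L (s + 2) (t + 1) (X 0, fun ν => X ν.succ)) :
    chi (joinMom k l : Torus L (s + 2) (t + 1)) x = planeWave L X (mom k + l.momentum) := by
  have hs : scaleMom L 1 (mom (joinMom k l : Torus L (s + 2) (t + 1)))
      = mom k + l.momentum := scaleMom_joinMom k l
  rw [hx, chi_toTorus, planeWave, ← hs, unscale_scaleMom hL,
    Fin.sum_univ_succ (n := 3) fun ν => mom (joinMom k l : Torus L (s + 2) (t + 1)) ν * (X ν : ℂ)]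

theorem toTorus_siteLift (x : Torus L s t) :
    x = toTorus L s t (siteLift x 0, fun ν => siteLift x ν.succ) := by
  refine Prod.ext ?_ (funext fun ν => ?_) <;> simp [toTorus, siteLift]

theorem ofFloquet_resolvent_apply (hL : 0 < L) (𝔮 : ℕ) (a : ℝ) (h : (Fin 3 → ℤ) → ℂ) (n : ℕ) (z : ℂ)
    (x x' : Torus L (s + 2) (t + 1)) :
    ofFloquet (fun k : Torus L s t => (z • 1 - floquet L 𝔮 a h n (mom k))⁻¹) x x'
      = (torusCard L (s + 2) (t + 1))⁻¹ * ∑ k : Torus L s t,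
        resolventSymbol L 𝔮 a h n z (siteLift x) (siteLift x') (mom k) := by
  simp only [ofFloquet, Matrix.of_apply, resolventSymbol]
  congr 1
  refine Finset.sum_congr rfl fun k _ => Finset.sum_congr rfl fun l _ =>
    Finset.sum_congr rfl fun l' _ => ?_
  rw [chi_joinMom_eq hL k l (toTorus_siteLift x), chi_joinMom_eq hL k l' (X := -siteLift x')]
  conv_lhs => rw [toTorus_siteLift x']
  refine Prod.ext ?_ (funext fun ν => ?_) <;> simp [toTorus]

/-- The distance of two sites with respect to the `ℓ¹` norm, for the spacing `L⁻²` in time and `L⁻¹`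
in space. -/
noncomputable def oneDist (x x' : Torus L s t) : ℝ :=
  |((x.1 - x'.1).valMinAbs : ℝ)| / (L : ℝ) ^ 2 + ∑ ν, |((x.2 ν - x'.2 ν).valMinAbs : ℝ)| / (L : ℝ)

/-- The centred representative minimises the absolute value in its class. Hence the torus distance
bounds the displacement of every winding from below. -/
theorem abs_valMinAbs_intCast_le {N : ℕ} [NeZero N] (z : ℤ) : |((z : ZMod N).valMinAbs : ℝ)| ≤ |(z : ℝ)| := by
  have : |(z : ZMod N).valMinAbs| ≤ |z| := by
    obtain ⟨h1, h2⟩ := (z : ZMod N).valMinAbs_mem_Ioc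
    obtain ⟨c, hc⟩ := (ZMod.intCast_eq_intCast_iff_dvd_sub _ _ N).mp (z : ZMod N).coe_valMinAbs
    set v := (z : ZMod N).valMinAbs
    by_cases hc0 : c = 0
    · rw [hc0, mul_zero, sub_eq_zero] at hc
      rw [hc]
    · have hN : (0 : ℤ) < N := by exact_mod_cast NeZero.pos N
      have h3 : (N : ℤ) ≤ |z - v| := by
        rw [hc, abs_mul, abs_of_pos hN]
        nlinarith [Int.one_le_abs hc0]
      have h4 := abs_sub z v
      have h5 : |v| * 2 ≤ N := by
        rw [← abs_two (α := ℤ), ← abs_mul, abs_le]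
        exact ⟨h1.le, h2⟩
      linarith
  exact_mod_cast this

/-- The time direction is averaged first, with period Lˢ, then the three space directions with
period Lᵗ; the four decays multiply to the ℓ¹ distance. -/
theorem norm_average_resolventSymbol_le {b β B : ℝ} (hβ : 0 < β) (hβb : β < b)
    {x x' : Torus L (s + 2) (t + 1)} {G : (Fin 4 → ℂ) → ℂ}
    (hG : StripDecay b B (fun ν => ((siteLift x ν - siteLift x' ν : ℤ) : ℝ) / scaleFactor L ν) G) :
    ‖(torusCard L s t)⁻¹ * ∑ k : Torus L s t, G (mom k)‖
      ≤ B * expSum ((b - β) / 2) ^ 4 * Real.exp (-β * oneDist x x') := by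
  have hL0 : (0 : ℝ) < L := by exact_mod_cast Nat.pos_of_ne_zero (NeZero.ne L)
  have key : ∀ (e i : ℕ) (y y' : ZMod (L ^ (e + i))) (c : ℤ),
      |((y - y').valMinAbs : ℝ)| / (L : ℝ) ^ i
        ≤ |((((y.val : ℤ) - (y'.val : ℤ) : ℤ) : ℝ)) / (L : ℝ) ^ i + ((L ^ e : ℕ) : ℝ) * c| := by
    intro e i y y' c
    have h1 : ((((y.val : ℤ) - y'.val + (L ^ (e + i) : ℕ) * c : ℤ) : ℤ) : ZMod (L ^ (e + i))) = y - y' := by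
      push_cast
      rw [← Nat.cast_pow, ZMod.natCast_self, zero_mul, add_zero, ZMod.natCast_zmod_val,
        ZMod.natCast_zmod_val]
    have h2 := abs_valMinAbs_intCast_le (N := L ^ (e + i)) ((y.val : ℤ) - y'.val + (L ^ (e + i) : ℕ) * c)
    rw [h1] at h2
    have h3 : ((((y.val : ℤ) - (y'.val : ℤ) : ℤ) : ℝ)) / (L : ℝ) ^ i + ((L ^ e : ℕ) : ℝ) * c
        = (((y.val : ℤ) - y'.val + (L ^ (e + i) : ℕ) * c : ℤ) : ℝ) / (L : ℝ) ^ i := by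
      push_cast
      generalize (y.val : ℝ) - (y'.val : ℝ) = u
      rw [pow_add]
      field_simp
    rw [h3, abs_div, abs_of_pos (pow_pos hL0 i)]
    gcongr
  have h1 := hG.average hβ hβb (N := L ^ s) (D := |((x.1 - x'.1).valMinAbs : ℝ)| / (L : ℝ) ^ 2)
    (fun c => by
      simpa [siteLift, scaleFactor_zero] using key s 2 x.1 x'.1 c)
  have h2 := h1.norm_average_le hβ hβb (N := L ^ t)
    (D := fun ν => |((x.2 ν - x'.2 ν).valMinAbs : ℝ)| / (L : ℝ)) (fun ν c => by
      simpa [siteLift, scaleFactor_succ] using key t 1 (x.2 ν) (x'.2 ν) c)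
  refine (le_of_eq ?_).trans (h2.trans (le_of_eq ?_))
  · congr 1
    rw [← Finset.mul_sum, ← mul_assoc, Fintype.sum_prod_type, Finset.sum_comm]
    congr 1
    · rw [torusCard, mul_inv, mul_comm]
      push_cast
      rfl
    · refine Finset.sum_congr rfl fun j _ => Finset.sum_congr rfl fun j0 _ => ?_
      congr 1
      rw [mom]
      push_cast
      rfl
  · rw [oneDist, mul_add, Real.exp_add]
    ring

/-- The fine torus has L⁵ times as many momenta as the coarse one, which cancels the L⁵ of the strip
bound. The rate 5m₂/4 lies between the weight m₂ and the width 3m₂/2 of the box. -/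
theorem FloquetConstants.norm_resolvent_apply_le {𝔮 : ℕ} {a : ℝ} {h : (Fin 3 → ℤ) → ℂ}
    {Γ₂ m₂ lam₀ Γ₈ : ℝ} (H : FloquetConstants 𝔮 a h Γ₂ m₂ lam₀ Γ₈) (ha : 0 < a)
    (hh : IsHamiltonian h) (hL : Odd L) (hL1 : 1 < L) (hL2 : Γ₂ < L) (n : ℕ) {z : ℂ}
    (hz : z ∉ slitDisc (lam₀ / (2 * (L : ℝ) ^ 2)) (Γ₈ + 1)) (x x' : Torus L (s + 2) (t + 1)) :
    ‖(z • 1 - scaledOp L 𝔮 a h n s t)⁻¹ x x'‖ ≤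
      (Γ₈ * (L : ℝ) ^ 2 + 1) * expSum (m₂ / 8) ^ 4 * Real.exp (-(5 * m₂ / 4) * oneDist x x') := by
  have hm := H.m₂_pos
  have hL0 : (0 : ℝ) < L := by exact_mod_cast hL.pos
  rw [(isUnit_smul_sub_scaledOp (s := s) (t := t) hL 𝔮 ha hh n fun k =>
    (H.resolvent_bound hL hL1 hL2 n
      ((isRealMomentum_mom k).mem_strip (by linarith)) hz).1).2,
    ofFloquet_resolvent_apply hL.pos]
  have h1 := norm_average_resolventSymbol_le (s := s) (t := t) (β := 5 * m₂ / 4) (by linarith)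
    (by linarith) (H.stripDecay hL hL1 hL2 n hz (siteLift x) (siteLift x'))
  rw [show (3 * m₂ / 2 - 5 * m₂ / 4) / 2 = m₂ / 8 by ring] at h1
  rw [show torusCard L (s + 2) (t + 1) = (L : ℂ) ^ 5 * torusCard L s t from torusCard_add L s t 1,
    mul_inv, mul_assoc, norm_mul, norm_inv, norm_pow, Complex.norm_natCast]
  refine (mul_le_mul_of_nonneg_left h1 (by positivity)).trans (le_of_eq ?_)
  field_simp

end

/-! ### The contour -/

theorem negAxis_nonempty : negAxis.Nonempty := ⟨0, rfl, le_rfl⟩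

theorem infDist_negAxis_of_re_nonpos {z : ℂ} (hz : z.re ≤ 0) :
    Metric.infDist z negAxis = |z.im| := by
  refine le_antisymm ?_ ((Metric.le_infDist negAxis_nonempty).mpr fun y hy => ?_)
  · have h1 : ((z.re : ℝ) : ℂ) ∈ negAxis := ⟨Complex.ofReal_im _, by simpa using hz⟩
    refine (Metric.infDist_le_dist_of_mem h1).trans (le_of_eq ?_)
    rw [Complex.dist_eq]
    have : z - ((z.re : ℝ) : ℂ) = (z.im : ℂ) * Complex.I := by
      apply Complex.ext <;> simp
    rw [this, norm_mul, Complex.norm_I, mul_one, Complex.norm_real, Real.norm_eq_abs]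
  · rw [Complex.dist_eq]
    refine le_trans (le_of_eq ?_) (Complex.abs_im_le_norm _)
    rw [Complex.sub_im, hy.1, sub_zero]

theorem infDist_negAxis_of_re_nonneg {z : ℂ} (hz : 0 ≤ z.re) :
    Metric.infDist z negAxis = ‖z‖ := by
  refine le_antisymm ?_ ((Metric.le_infDist negAxis_nonempty).mpr fun y hy => ?_)
  · rw [← dist_zero_right]
    exact Metric.infDist_le_dist_of_mem ⟨rfl, le_rfl⟩
  · rw [Complex.dist_eq]
    refine le_of_sq_le_sq ?_ (norm_nonneg _)
    rw [Complex.sq_norm, Complex.sq_norm, Complex.normSq_apply, Complex.normSq_apply,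
      Complex.sub_re, Complex.sub_im, hy.1]
    nlinarith [hy.2, mul_nonneg hz (neg_nonneg.mpr hy.2)]

theorem isOpen_slitDisc (δ R : ℝ) : IsOpen (slitDisc δ R) :=
  (isOpen_lt continuous_const (Metric.continuous_infDist_pt _)).inter
    (isOpen_lt continuous_norm continuous_const)

theorem closure_slitDisc_subset (δ R : ℝ) :
    closure (slitDisc δ R) ⊆ {z | δ ≤ Metric.infDist z negAxis ∧ ‖z‖ ≤ R} := by
  refine closure_minimal (fun z hz => ⟨hz.1.le, hz.2.le⟩) ?_
  exact (isClosed_le continuous_const (Metric.continuous_infDist_pt _)).inter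
    (isClosed_le continuous_norm continuous_const)

theorem notMem_slitDisc_of_mem_frontier {δ R : ℝ} {z : ℂ} (hz : z ∈ frontier (slitDisc δ R)) :
    z ∉ slitDisc δ R := by
  rw [(isOpen_slitDisc δ R).frontier_eq] at hz
  exact hz.2

/-- Boundary points are recognised as endpoints of curves that enter the disc: radial ones for the
circular pieces, vertical ones for the segments. -/
theorem mem_frontier_slitDisc {δ R : ℝ} {z : ℂ} (hz : z ∉ slitDisc δ R) {γ : ℝ → ℂ}
    (hγ : ContinuousAt γ 0) (h0 : γ 0 = z) (h : ∀ᶠ ε in 𝓝[>] (0 : ℝ), γ ε ∈ slitDisc δ R) :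
    z ∈ frontier (slitDisc δ R) := by
  rw [(isOpen_slitDisc δ R).frontier_eq]
  refine ⟨mem_closure_of_tendsto (h0 ▸ hγ.tendsto.mono_left nhdsWithin_le_nhds) h, hz⟩

theorem arc_mem_frontier {δ R : ℝ} (hδ : 0 < δ) (hδR : δ < R) {θ : ℝ}
    (hθ : |θ| < Real.pi - Real.arcsin (δ / R)) :
    (R * Complex.exp (θ * Complex.I) : ℂ) ∈ frontier (slitDisc δ R) := by
  have hR : 0 < R := hδ.trans hδR
  set z : ℂ := R * Complex.exp (θ * Complex.I) with hz
  have hnorm : ‖z‖ = R := by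
    rw [hz, norm_mul, Complex.norm_exp_ofReal_mul_I, mul_one, Complex.norm_real, Real.norm_eq_abs,
      abs_of_pos hR]
  have hre : z.re = R * Real.cos θ := by
    rw [hz, Complex.re_ofReal_mul, Complex.exp_ofReal_mul_I_re]
  have him : z.im = R * Real.sin θ := by
    rw [hz, Complex.im_ofReal_mul, Complex.exp_ofReal_mul_I_im]
  have hdist : δ < Metric.infDist z negAxis := by
    by_cases h : 0 ≤ z.re
    · rw [infDist_negAxis_of_re_nonneg h, hnorm]; exact hδR
    · push Not at h
      rw [infDist_negAxis_of_re_nonpos h.le, him, abs_mul, abs_of_pos hR]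
      have hcos : Real.cos |θ| < 0 := by
        rw [Real.cos_abs]
        rw [hre] at h
        by_contra hcon
        push Not at hcon
        exact absurd h (not_lt.mpr (mul_nonneg hR.le hcon))
      have has : 0 ≤ Real.arcsin (δ / R) := Real.arcsin_nonneg.mpr (by positivity)
      have hpi : Real.pi / 2 < |θ| := by
        by_contra hcon
        push Not at hcon
        exact absurd hcos (not_lt.mpr (Real.cos_nonneg_of_neg_pi_div_two_le_of_le
          (by linarith [abs_nonneg θ, Real.pi_pos]) hcon))
      have hsin : δ / R < Real.sin (Real.pi - |θ|) := by
        have h1 : δ / R = Real.sin (Real.arcsin (δ / R)) :=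
          (Real.sin_arcsin (by linarith [div_pos hδ hR]) ((div_le_one hR).mpr hδR.le)).symm
        rw [h1]
        exact Real.sin_lt_sin_of_lt_of_le_pi_div_two (by linarith [Real.pi_pos]) (by linarith)
          (by linarith)
      rw [Real.sin_pi_sub] at hsin
      have h2 : Real.sin |θ| ≤ |Real.sin θ| := by
        rcases abs_choice θ with e | e <;> rw [e]
        · exact le_abs_self _
        · rw [Real.sin_neg]; exact neg_le_abs _
      rw [div_lt_iff₀ hR] at hsin
      nlinarith
  refine mem_frontier_slitDisc (fun h => absurd h.2 (by rw [hnorm]; exact lt_irrefl _))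
    (γ := fun ε : ℝ => ((1 - ε : ℝ) : ℂ) * z) (by fun_prop) (by simp) ?_
  have h1 : Tendsto (fun ε : ℝ => Metric.infDist (((1 - ε : ℝ) : ℂ) * z) negAxis) (𝓝[>] 0)
      (𝓝 (Metric.infDist z negAxis)) := by
    have : ContinuousAt (fun ε : ℝ => Metric.infDist (((1 - ε : ℝ) : ℂ) * z) negAxis) 0 :=
      ((Metric.continuous_infDist_pt negAxis).comp (by fun_prop :
        Continuous fun ε : ℝ => ((1 - ε : ℝ) : ℂ) * z)).continuousAt
    have h2 := this.tendsto
    simp only [sub_zero, Complex.ofReal_one, one_mul] at h2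
    exact h2.mono_left nhdsWithin_le_nhds
  filter_upwards [h1.eventually (lt_mem_nhds hdist), Ioo_mem_nhdsGT (zero_lt_one' ℝ)] with ε hε hε1
  refine ⟨hε, ?_⟩
  rw [norm_mul, hnorm, Complex.norm_real, Real.norm_eq_abs, abs_of_pos (by linarith [hε1.2])]
  nlinarith [hε1.1]

theorem segment_mem_frontier {δ R : ℝ} (hδ : 0 < δ) (hδR : δ < R) {x σ : ℝ} (hσ : |σ| = 1)
    (hx : -Real.sqrt (R ^ 2 - δ ^ 2) < x) (hx0 : x ≤ 0) :
    (x + (σ * δ : ℝ) * Complex.I : ℂ) ∈ frontier (slitDisc δ R) := by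
  have hR : 0 < R := hδ.trans hδR
  have hσ2 : σ ^ 2 = 1 := by rw [← sq_abs, hσ, one_pow]
  have hre : ∀ y : ℝ, (x + (σ * y : ℝ) * Complex.I : ℂ).re = x := fun y => by simp
  have him : ∀ y : ℝ, (x + (σ * y : ℝ) * Complex.I : ℂ).im = σ * y := fun y => by simp
  have hdist : ∀ y : ℝ, 0 < y → Metric.infDist (x + (σ * y : ℝ) * Complex.I : ℂ) negAxis = y := by
    intro y hy
    rw [infDist_negAxis_of_re_nonpos (by rw [hre]; exact hx0), him, abs_mul, hσ, one_mul,
      abs_of_pos hy]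
  have hnorm : ‖(x + (σ * δ : ℝ) * Complex.I : ℂ)‖ < R := by
    refine lt_of_pow_lt_pow_left₀ 2 hR.le ?_
    rw [Complex.sq_norm, Complex.normSq_apply, hre, him]
    have h1 : x ^ 2 < R ^ 2 - δ ^ 2 := by
      have h2 : (-x) < Real.sqrt (R ^ 2 - δ ^ 2) := by linarith
      rw [Real.lt_sqrt (by linarith)] at h2
      linarith
    nlinarith
  refine mem_frontier_slitDisc (fun h => absurd h.1 (by rw [hdist δ hδ]; exact lt_irrefl _))
    (γ := fun ε : ℝ => (x + (σ * (δ + ε) : ℝ) * Complex.I : ℂ)) (by fun_prop) (by simp) ?_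
  have h1 : Tendsto (fun ε : ℝ => ‖(x + (σ * (δ + ε) : ℝ) * Complex.I : ℂ)‖) (𝓝[>] 0)
      (𝓝 ‖(x + (σ * δ : ℝ) * Complex.I : ℂ)‖) := by
    have : ContinuousAt (fun ε : ℝ => ‖(x + (σ * (δ + ε) : ℝ) * Complex.I : ℂ)‖) 0 := by fun_prop
    have h2 := this.tendsto
    simp only [add_zero] at h2
    exact h2.mono_left nhdsWithin_le_nhds
  filter_upwards [h1.eventually (gt_mem_nhds hnorm), self_mem_nhdsWithin] with ε hε hε0
  refine ⟨?_, hε⟩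
  have : (0 : ℝ) < ε := hε0
  rw [hdist _ (by linarith)]
  linarith

theorem halfCircle_mem_frontier {δ R : ℝ} (hδ : 0 < δ) (hδR : δ < R) {θ : ℝ}
    (hθ : |θ| ≤ Real.pi / 2) :
    (δ * Complex.exp (θ * Complex.I) : ℂ) ∈ frontier (slitDisc δ R) := by
  have hre : ∀ y : ℝ, 0 ≤ y → 0 ≤ (y * Complex.exp (θ * Complex.I) : ℂ).re := by
    intro y hy
    rw [Complex.re_ofReal_mul, Complex.exp_ofReal_mul_I_re]
    exact mul_nonneg hy (Real.cos_nonneg_of_neg_pi_div_two_le_of_le (abs_le.mp hθ).1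
      (abs_le.mp hθ).2)
  have hnorm : ∀ y : ℝ, 0 ≤ y → ‖(y * Complex.exp (θ * Complex.I) : ℂ)‖ = y := by
    intro y hy
    rw [norm_mul, Complex.norm_exp_ofReal_mul_I, mul_one, Complex.norm_real, Real.norm_eq_abs,
      abs_of_nonneg hy]
  refine mem_frontier_slitDisc (fun h => absurd h.1 (by
      rw [infDist_negAxis_of_re_nonneg (hre δ hδ.le), hnorm δ hδ.le]; exact lt_irrefl _))
    (γ := fun ε : ℝ => ((δ + ε : ℝ) : ℂ) * Complex.exp (θ * Complex.I)) (by fun_prop) (by simp) ?_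
  filter_upwards [Ioo_mem_nhdsGT (sub_pos.mpr hδR)] with ε hε
  have h1 : 0 ≤ δ + ε := by linarith [hε.1]
  refine ⟨?_, ?_⟩
  · rw [infDist_negAxis_of_re_nonneg (hre _ h1), hnorm _ h1]; linarith [hε.1]
  · rw [hnorm _ h1]; linarith [hε.2]

/-- The four pieces have total length at most 2πR + πδ + 2R, and δ < R, so 12R suffices. -/
theorem norm_slitDiscIntegral_le {δ R : ℝ} (hδ : 0 < δ) (hδR : δ < R) {g : ℂ → ℂ} {Y : ℝ}
    (hY : 0 ≤ Y) (hg : ∀ z ∈ frontier (slitDisc δ R), ‖g z‖ ≤ Y) :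
    ‖slitDiscIntegral δ R g‖ ≤ 12 * R * Y := by
  have hR : 0 < R := hδ.trans hδR
  have has : 0 ≤ Real.arcsin (δ / R) := Real.arcsin_nonneg.mpr (by positivity)
  have has2 : Real.arcsin (δ / R) ≤ Real.pi / 2 := Real.arcsin_le_pi_div_two _
  have hpi := Real.pi_pos
  set α := Real.pi - Real.arcsin (δ / R) with hα
  set ρ := Real.sqrt (R ^ 2 - δ ^ 2) with hρ
  have hρ0 : 0 ≤ ρ := Real.sqrt_nonneg _
  have hρR : ρ ≤ R := by
    rw [hρ, Real.sqrt_le_left hR.le]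
    nlinarith [sq_nonneg δ]
  have e : ∀ y : ℝ, 0 < y → ∀ θ : ℝ, ‖Complex.I * (y * Complex.exp (θ * Complex.I))‖ = y := by
    intro y hy θ
    rw [norm_mul, Complex.norm_I, one_mul, norm_mul, Complex.norm_exp_ofReal_mul_I, mul_one,
      Complex.norm_real, Real.norm_eq_abs, abs_of_pos hy]
  have h1 : ‖∫ θ in (-α)..α, g (R * Complex.exp (θ * Complex.I)) *
      (Complex.I * (R * Complex.exp (θ * Complex.I)))‖ ≤ (Y * R) * |α - -α| := by
    -- The arc is known to lie in the frontier only for angles strictly inside the range; the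
    -- endpoint is a null set.
    refine intervalIntegral.norm_integral_le_of_norm_le_const_ae ?_
    filter_upwards [MeasureTheory.compl_mem_ae_iff.mpr (MeasureTheory.measure_singleton α)]
      with θ hne hθ
    rw [Set.uIoc_of_le (by linarith)] at hθ
    rw [norm_mul, e R hR]
    refine mul_le_mul_of_nonneg_right (hg _ (arc_mem_frontier hδ hδR ?_)) hR.le
    exact abs_lt.mpr ⟨hθ.1, lt_of_le_of_ne hθ.2 hne⟩
  have h2 : ‖∫ x in (-ρ)..0, g (x + δ * Complex.I)‖ ≤ Y * |0 - -ρ| := by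
    refine intervalIntegral.norm_integral_le_of_norm_le_const fun x hx => ?_
    rw [Set.uIoc_of_le (by linarith)] at hx
    have := segment_mem_frontier hδ hδR (σ := 1) (by simp) hx.1 hx.2
    rw [one_mul] at this
    exact hg _ this
  have h3 : ‖∫ θ in (Real.pi / 2)..(-(Real.pi / 2)), g (δ * Complex.exp (θ * Complex.I)) *
      (Complex.I * (δ * Complex.exp (θ * Complex.I)))‖ ≤ (Y * δ) * |-(Real.pi / 2) - Real.pi / 2| := by
    refine intervalIntegral.norm_integral_le_of_norm_le_const fun θ hθ => ?_
    rw [Set.uIoc_of_ge (by linarith)] at hθ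
    rw [norm_mul, e δ hδ]
    exact mul_le_mul_of_nonneg_right (hg _ (halfCircle_mem_frontier hδ hδR
      (abs_le.mpr ⟨hθ.1.le, hθ.2⟩))) hδ.le
  have h4 : ‖∫ x in (0 : ℝ)..(-ρ), g (x - δ * Complex.I)‖ ≤ Y * |-ρ - 0| := by
    refine intervalIntegral.norm_integral_le_of_norm_le_const fun x hx => ?_
    rw [Set.uIoc_of_ge (by linarith)] at hx
    have := segment_mem_frontier hδ hδR (σ := -1) (by simp) hx.1 hx.2
    rw [neg_one_mul, Complex.ofReal_neg, neg_mul, ← sub_eq_add_neg] at this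
    exact hg _ this
  rw [show α - -α = 2 * α by ring, abs_of_nonneg (by linarith)] at h1
  rw [show (0 : ℝ) - -ρ = ρ by ring, abs_of_nonneg hρ0] at h2
  rw [show -(Real.pi / 2) - Real.pi / 2 = -Real.pi by ring, abs_neg, abs_of_pos hpi] at h3
  rw [sub_zero, abs_neg, abs_of_nonneg hρ0] at h4
  have h5 : ‖slitDiscIntegral δ R g‖ ≤ Y * R * (2 * α) + Y * ρ + Y * δ * Real.pi + Y * ρ :=
    (norm_add_le _ _).trans (add_le_add ((norm_add_le _ _).trans (add_le_add
      ((norm_add_le _ _).trans (add_le_add h1 h2)) h3)) h4)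
  refine h5.trans ?_
  have hπ : Real.pi < 3.15 := Real.pi_lt_d2
  have hYR : 0 ≤ Y * R := mul_nonneg hY hR.le
  have b1 : Y * R * (2 * α) ≤ Y * R * 6.3 :=
    mul_le_mul_of_nonneg_left (by linarith) hYR
  have b2 : Y * ρ ≤ Y * R := mul_le_mul_of_nonneg_left hρR hY
  have b3 : Y * δ * Real.pi ≤ Y * R * 3.15 :=
    mul_le_mul (mul_le_mul_of_nonneg_left hδR.le hY) hπ.le hpi.le hYR
  linarith

theorem norm_funCalc_apply_le {ι : Type} [Fintype ι] [DecidableEq ι] {δ R : ℝ} (hδ : 0 < δ)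
    (hδR : δ < R) {f : ℂ → ℂ} {A : Matrix ι ι ℂ} {u u' : ι} {S K : ℝ} (hK : 0 ≤ K)
    (hf : ∀ z ∈ frontier (slitDisc δ R), ‖f z‖ ≤ S) (hS : 0 ≤ S)
    (hA : ∀ z ∈ frontier (slitDisc δ R), ‖(z • 1 - A)⁻¹ u u'‖ ≤ K) :
    ‖funCalc δ R f A u u'‖ ≤ 2 * R * S * K := by
  have h1 := norm_slitDiscIntegral_le hδ hδR (g := fun ζ => f ζ * (ζ • 1 - A)⁻¹ u u')
    (Y := S * K) (mul_nonneg hS hK) fun z hz => by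
      rw [norm_mul]; exact mul_le_mul (hf z hz) (hA z hz) (norm_nonneg _) hS
  have hR : 0 < R := hδ.trans hδR
  rw [funCalc, Matrix.of_apply, norm_mul, norm_inv, norm_mul, norm_mul, Complex.norm_I, mul_one,
    Complex.norm_real, Real.norm_eq_abs, abs_of_pos Real.pi_pos, Complex.norm_ofNat]
  have h2 : (2 * Real.pi)⁻¹ ≤ 6⁻¹ := by
    gcongr
    linarith [Real.pi_gt_three]
  calc (2 * Real.pi)⁻¹ * ‖slitDiscIntegral δ R fun ζ => f ζ * (ζ • 1 - A)⁻¹ u u'‖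
      ≤ 6⁻¹ * (12 * R * (S * K)) := by gcongr
    _ = _ := by ring

/-- The frontier is compact and lies in the larger disc, where f is continuous. Without boundedness
the `sSup` in the conclusion would not control f. -/
theorem bddAbove_norm_image_frontier {δ δ' R R' : ℝ} (hδ : δ' < δ) (hR : R < R') {f : ℂ → ℂ}
    (hf : DifferentiableOn ℂ f (slitDisc δ' R')) :
    BddAbove ((fun ζ => ‖f ζ‖) '' frontier (slitDisc δ R)) := by
  have h1 : frontier (slitDisc δ R) ⊆ slitDisc δ' R' := fun z hz => by
    obtain ⟨h2, h3⟩ := closure_slitDisc_subset δ R (frontier_subset_closure hz)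
    exact ⟨hδ.trans_le h2, h3.trans_lt hR⟩
  have h2 : IsCompact (frontier (slitDisc δ R)) :=
    Metric.isCompact_of_isClosed_isBounded isClosed_frontier
      ((Metric.isBounded_closedBall (x := (0 : ℂ)) (r := R)).subset fun z hz => by
        rw [mem_closedBall_zero_iff]
        exact (closure_slitDisc_subset δ R (frontier_subset_closure hz)).2)
  exact h2.bddAbove_image (hf.continuousOn.mono h1).norm

/-! ### The weighted norm -/

/-- Centred representatives are distinct integers, so the sum is part of a two-sided geometric
series; ℓ ≥ 1 absorbs the additive constant. -/
theorem sum_exp_valMinAbs_le {N : ℕ} [NeZero N] {γ ℓ : ℝ} (hγ : 0 < γ) (hℓ : 1 ≤ ℓ) :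
    ∑ v : ZMod N, Real.exp (-γ * (|(v.valMinAbs : ℝ)| / ℓ)) ≤ (2 + 2 / γ) * ℓ := by
  have hℓ0 : 0 < ℓ := by linarith
  set c := γ / ℓ with hc
  have hc0 : 0 < c := by positivity
  set r := Real.exp (-c) with hr
  have hr0 : 0 < r := Real.exp_pos _
  have hr1 : r < 1 := by rw [hr, Real.exp_lt_one_iff]; linarith
  have e : ∀ m : ℤ, Real.exp (-γ * (|(m : ℝ)| / ℓ)) = r ^ m.natAbs := by
    intro m
    rw [hr, ← Real.exp_nat_mul, Nat.cast_natAbs, Int.cast_abs, hc]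
    congr 1; field_simp
  have h1 : HasSum (fun m : ℤ => r ^ m.natAbs) ((1 - r)⁻¹ + (1 - r)⁻¹ * r) := by
    refine HasSum.of_nat_of_neg_add_one ?_ ?_
    · simpa using hasSum_geometric_of_lt_one hr0.le hr1
    · have := (hasSum_geometric_of_lt_one hr0.le hr1).mul_right r
      simp_rw [← pow_succ] at this
      have e2 : ∀ n : ℕ, (-((n : ℤ) + 1)).natAbs = n + 1 := fun n => by omega
      simp_rw [e2]
      exact this
  simp_rw [e]
  rw [← Finset.sum_image (f := fun m : ℤ => r ^ m.natAbs) (g := ZMod.valMinAbs)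
    fun v _ v' _ h => ZMod.injective_valMinAbs h]
  refine (sum_le_hasSum _ (fun m _ => by positivity) h1).trans ?_
  have h2 : r ≤ (1 + c)⁻¹ := by
    rw [hr, Real.exp_neg]
    gcongr
    linarith [Real.add_one_le_exp c]
  have h3 : c / (1 + c) ≤ 1 - r := by
    have : c / (1 + c) = 1 - (1 + c)⁻¹ := by field_simp; ring
    linarith
  have h4 : (1 - r)⁻¹ ≤ (1 + c) / c := by
    rw [← inv_div]
    gcongr
  calc (1 - r)⁻¹ + (1 - r)⁻¹ * r ≤ (1 + c) / c + (1 + c) / c * 1 := by gcongr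
    _ = 2 + 2 / γ * ℓ := by rw [hc]; field_simp; ring
    _ ≤ _ := by nlinarith [div_pos two_pos hγ]

section
variable {L s t : ℕ} [NeZero L]

/-- The exponential of the ℓ¹ distance factorises over directions: the time direction costs L², each
space direction L. This is the factor L⁵, independent of the volume. -/
theorem sum_exp_oneDist_le {γ : ℝ} (hγ : 0 < γ) :
    ∑ v : Torus L s t, Real.exp (-γ * oneDist v 0) ≤ (2 + 2 / γ) ^ 4 * (L : ℝ) ^ 5 := by
  have hL1 : (1 : ℝ) ≤ L := by exact_mod_cast NeZero.one_le
  have e : ∀ v : Torus L s t, Real.exp (-γ * oneDist v 0)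
      = Real.exp (-γ * (|(v.1.valMinAbs : ℝ)| / (L : ℝ) ^ 2)) *
        ∏ ν, Real.exp (-γ * (|((v.2 ν).valMinAbs : ℝ)| / (L : ℝ))) := by
    intro v
    rw [← Real.exp_sum, ← Real.exp_add, ← Finset.mul_sum, ← mul_add, oneDist]
    simp
  simp_rw [e]
  rw [Fintype.sum_prod_type]
  simp only
  simp_rw [← Finset.mul_sum]
  rw [← Finset.sum_mul]
  have h := Finset.prod_univ_sum (fun _ : Fin 3 => (Finset.univ : Finset (ZMod (L ^ t))))
    (fun _ v => Real.exp (-γ * (|(v.valMinAbs : ℝ)| / (L : ℝ))))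
  rw [Fintype.piFinset_univ] at h
  rw [← h, Finset.prod_const, Finset.card_univ, Fintype.card_fin]
  calc _ ≤ ((2 + 2 / γ) * (L : ℝ) ^ 2) * ((2 + 2 / γ) * (L : ℝ)) ^ 3 := by
        gcongr
        · exact sum_exp_valMinAbs_le hγ (one_le_pow₀ hL1)
        · exact sum_exp_valMinAbs_le hγ hL1
    _ = _ := by ring

theorem torusDist_le_oneDist (x x' : Torus L s t) : torusDist L s t 1 x x' ≤ oneDist x x' := by
  have hL0 : (0 : ℝ) < L := by exact_mod_cast Nat.pos_of_ne_zero (NeZero.ne L)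
  have key : ∀ y : Fin 3 → ℝ, ∀ z : ℝ, z ^ 2 + ∑ ν, y ν ^ 2 ≤ (|z| + ∑ ν, |y ν|) ^ 2 := by
    intro y z
    rw [← sq_abs z]
    simp_rw [← sq_abs (y _)]
    rw [Fin.sum_univ_three, Fin.sum_univ_three]
    have := abs_nonneg z
    have := abs_nonneg (y 0)
    have := abs_nonneg (y 1)
    have := abs_nonneg (y 2)
    generalize |z| = A at *
    generalize |y 0| = B at *
    generalize |y 1| = C at *
    generalize |y 2| = D at *
    have : 0 ≤ A * (B + C + D) + B * (C + D) + C * D := by positivity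
    nlinarith
  rw [torusDist]
  refine Real.sqrt_le_iff.mpr ⟨?_, ?_⟩
  · rw [oneDist]; positivity
  · refine (key _ _).trans (le_of_eq ?_)
    rw [oneDist]
    simp only [abs_div, mul_one, pow_one, abs_of_pos hL0, abs_of_pos (pow_pos hL0 2)]

/-- The cell volume cancels against the normalisation of the kernel. Of the decay 5m/4 the weight
consumes m, and m/4 is left for the sum over sites, hence 2 + 8/m. -/
theorem weightedNorm_le_of_decay {m B : ℝ} (hm : 0 < m) (hB : 0 ≤ B)
    {M : Matrix (Torus L s t) (Torus L s t) ℂ}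
    (hM : ∀ x x', ‖M x x'‖ ≤ B * Real.exp (-(5 * m / 4) * oneDist x x')) :
    weightedNorm L s t 1 m M ≤ B * ((2 + 8 / m) ^ 4 * (L : ℝ) ^ 5) := by
  have hL0 : (0 : ℝ) < L := by exact_mod_cast Nat.pos_of_ne_zero (NeZero.ne L)
  have hc : 0 < cellVolume L 1 := by unfold cellVolume; positivity
  have h1 : ∀ x x' : Torus L s t, Real.exp (m * torusDist L s t 1 x x')
      * ‖((cellVolume L 1)⁻¹ : ℂ) * M x x'‖
      ≤ (cellVolume L 1)⁻¹ * (B * Real.exp (-(m / 4) * oneDist (x - x') 0)) := by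
    intro x x'
    have e : oneDist (x - x') 0 = oneDist x x' := by simp [oneDist]
    rw [e, norm_mul, norm_inv, Complex.norm_real, Real.norm_eq_abs, abs_of_pos hc, mul_left_comm]
    refine mul_le_mul_of_nonneg_left ?_ (inv_nonneg.mpr hc.le)
    calc Real.exp (m * torusDist L s t 1 x x') * ‖M x x'‖
        ≤ Real.exp (m * oneDist x x') * (B * Real.exp (-(5 * m / 4) * oneDist x x')) := by
          gcongr
          · exact torusDist_le_oneDist x x'
          · exact hM x x'
      _ = B * (Real.exp (m * oneDist x x') * Real.exp (-(5 * m / 4) * oneDist x x')) := by ring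
      _ = _ := by
          rw [← Real.exp_add]
          congr 2
          ring
  have h2 : ∑ v : Torus L s t, Real.exp (-(m / 4) * oneDist v 0) ≤ (2 + 8 / m) ^ 4 * (L : ℝ) ^ 5 := by
    have := sum_exp_oneDist_le (L := L) (s := s) (t := t) (γ := m / 4) (by linarith)
    rwa [show (2 : ℝ) / (m / 4) = 8 / m by field_simp; norm_num] at this
  refine max_le (ciSup_le fun u => ?_) (ciSup_le fun u' => ?_)
  · refine (mul_le_mul_of_nonneg_left (Finset.sum_le_sum fun u' _ => h1 u u') hc.le).trans ?_
    rw [← Finset.mul_sum, ← Finset.mul_sum, mul_inv_cancel_left₀ hc.ne']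
    exact mul_le_mul_of_nonneg_left ((Equiv.sum_comp (Equiv.subLeft u) fun v =>
      Real.exp (-(m / 4) * oneDist v 0)).trans_le h2) hB
  · refine (mul_le_mul_of_nonneg_left (Finset.sum_le_sum fun u _ => h1 u u') hc.le).trans ?_
    rw [← Finset.mul_sum, ← Finset.mul_sum, mul_inv_cancel_left₀ hc.ne']
    exact mul_le_mul_of_nonneg_left ((Equiv.sum_comp (Equiv.subRight u') fun v =>
      Real.exp (-(m / 4) * oneDist v 0)).trans_le h2) hB

/-- L² comes from the resolvent on the contour and L⁵ from the sum over sites; the length of the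
contour contributes only a multiple of Γ₈ + 1. -/
theorem FloquetConstants.weightedNorm_funCalc_le {𝔮 : ℕ} {a : ℝ} {h : (Fin 3 → ℤ) → ℂ}
    {Γ₂ m₂ lam₀ Γ₈ : ℝ} (H : FloquetConstants 𝔮 a h Γ₂ m₂ lam₀ Γ₈) (ha : 0 < a)
    (hh : IsHamiltonian h) (hL : Odd L) (hL1 : 1 < L) (hL2 : Γ₂ < L) (n : ℕ) {f : ℂ → ℂ}
    (hf : DifferentiableOn ℂ f (slitDisc (lam₀ / (3 * (L : ℝ) ^ 2)) (Γ₈ + 2))) :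
    weightedNorm L (s + 2) (t + 1) 1 m₂ (funCalc (lam₀ / (2 * (L : ℝ) ^ 2)) (Γ₈ + 1) f
        (scaledOp L 𝔮 a h n s t)) ≤
      2 * (Γ₈ + 1) ^ 2 * expSum (m₂ / 8) ^ 4 * (2 + 8 / m₂) ^ 4 * (L : ℝ) ^ 7 *
        sSup ((fun ζ => ‖f ζ‖) '' frontier (slitDisc (lam₀ / (2 * (L : ℝ) ^ 2)) (Γ₈ + 1))) := by
  have hL1' : (1 : ℝ) ≤ L := by exact_mod_cast hL1.le
  have hL0 : (0 : ℝ) < L := by linarith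
  have hm := H.m₂_pos
  have hlam := H.lam₀_pos
  have hΓ := H.Γ₈_pos
  have hδ : 0 < lam₀ / (2 * (L : ℝ) ^ 2) := by positivity
  have hδ' : lam₀ / (3 * (L : ℝ) ^ 2) < lam₀ / (2 * (L : ℝ) ^ 2) := by
    gcongr
    norm_num
  have hE := expSum_pos (γ := m₂ / 8) (by linarith)
  set S := sSup ((fun ζ => ‖f ζ‖) '' frontier (slitDisc (lam₀ / (2 * (L : ℝ) ^ 2)) (Γ₈ + 1)))
    with hSdef
  have hS : 0 ≤ S := Real.sSup_nonneg (by rintro _ ⟨z, -, rfl⟩; exact norm_nonneg _)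
  have hbdd := bddAbove_norm_image_frontier hδ' (by linarith : Γ₈ + 1 < Γ₈ + 2) hf
  have h1 : ∀ x x' : Torus L (s + 2) (t + 1), ‖funCalc (lam₀ / (2 * (L : ℝ) ^ 2)) (Γ₈ + 1) f
      (scaledOp L 𝔮 a h n s t) x x'‖ ≤ (2 * (Γ₈ + 1) * S *
        ((Γ₈ * (L : ℝ) ^ 2 + 1) * expSum (m₂ / 8) ^ 4)) *
          Real.exp (-(5 * m₂ / 4) * oneDist x x') := by
    intro x x'
    refine (norm_funCalc_apply_le hδ (H.lt_radius hL hL1 hL2) (S := S) (by positivity)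
      (fun z hz => le_csSup hbdd ⟨z, hz, rfl⟩) hS fun z hz =>
        H.norm_resolvent_apply_le ha hh hL hL1 hL2 n
          (notMem_slitDisc_of_mem_frontier hz) x x').trans (le_of_eq ?_)
    ring
  refine (weightedNorm_le_of_decay hm (by positivity) h1).trans ?_
  have h2 : Γ₈ * (L : ℝ) ^ 2 + 1 ≤ (Γ₈ + 1) * (L : ℝ) ^ 2 := by
    nlinarith [one_le_pow₀ hL1' (n := 2)]
  calc _ ≤ 2 * (Γ₈ + 1) * S * (((Γ₈ + 1) * (L : ℝ) ^ 2) * expSum (m₂ / 8) ^ 4) *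
        ((2 + 8 / m₂) ^ 4 * (L : ℝ) ^ 5) := by gcongr
    _ = _ := by ring

end

end BlockSpin

/-! ### Assembly -/

theorem mainTheorem4 (𝔮 : ℕ) (hq4 : 4 ≤ 𝔮) (hqe : Even 𝔮) :
    ∃ Γ₂ : ℝ, ∀ (a : ℝ), 0 < a → ∀ h : (Fin 3 → ℤ) → ℂ, BlockSpin.IsHamiltonian h →
      (∃ m₂ lam₀ Γ₈ : ℝ, BlockSpin.FloquetConstants 𝔮 a h Γ₂ m₂ lam₀ Γ₈) ∧
      ∀ m₂ lam₀ Γ₈ : ℝ, BlockSpin.FloquetConstants 𝔮 a h Γ₂ m₂ lam₀ Γ₈ →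
        ∃ Γ₉ : ℝ, ∀ (L : ℕ) [NeZero L], Odd L → 1 < L → Γ₂ < L → ∀ n s t : ℕ,
          (1 ≤ n → Filter.Tendsto
            (fun μ : ℝ => BlockSpin.deltaReg L 𝔮 a h n (s + 2) (t + 1) μ)
            (nhdsWithin 0 (Set.Ioi 0)) (nhds (BlockSpin.delta L 𝔮 a h n (s + 2) (t + 1)))) ∧
          spectrum ℂ (BlockSpin.scaledOp L 𝔮 a h n s t) ⊆
            BlockSpin.slitDisc (lam₀ / (2 * (L : ℝ) ^ 2)) (Γ₈ + 1) ∧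
          ∀ f : ℂ → ℂ,
            DifferentiableOn ℂ f (BlockSpin.slitDisc (lam₀ / (3 * (L : ℝ) ^ 2)) (Γ₈ + 2)) →
            BlockSpin.weightedNorm L (s + 2) (t + 1) 1 m₂
                (BlockSpin.funCalc (lam₀ / (2 * (L : ℝ) ^ 2)) (Γ₈ + 1) f
                  (BlockSpin.scaledOp L 𝔮 a h n s t)) ≤
              Γ₉ * (L : ℝ) ^ 7 *
                sSup ((fun ζ => ‖f ζ‖) ''
                  frontier (BlockSpin.slitDisc (lam₀ / (2 * (L : ℝ) ^ 2)) (Γ₈ + 1))) := by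
  refine ⟨4 * BlockSpin.cellBound (2 * 𝔮), fun a ha h hh =>
    ⟨hh.exists_floquetConstants (by omega) ha, fun m₂ lam₀ Γ₈ H =>
      ⟨2 * (Γ₈ + 1) ^ 2 * BlockSpin.expSum (m₂ / 8) ^ 4 * (2 + 8 / m₂) ^ 4,
        fun L _ hL hL1 hL2 n s t => ⟨fun hn => ?_, ?_, fun f hf => ?_⟩⟩⟩⟩
  · exact BlockSpin.tendsto_deltaReg hL 𝔮 ha hh (by omega)
  · exact H.spectrum_subset ha hh hL hL1 hL2 n s t
  · exact H.weightedNorm_funCalc_le ha hh hL hL1 hL2 n hf
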